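/- Let $n\ge 0$, $k\ge 2$, $m\ge 0$ be integers and let $\mathcal N\subseteq\mathbb R^m$ be a nonempty, compact, smooth manifold without boundary that is $(k-2)$-connected (that is, $\pi_0(\mathcal N)=\dots=\pi_{k-2}(\mathcal N)=0$); in case $k=2$, assume also that $\pi_1(\mathcal N)$ is Abelian. Then free homotopy classes of maps $\mathbb S^{k-1}\to\mathcal N$ are identified with elements of the Abelian group $\pi_{k-1}(\mathcal N)$. A polyhedral set of dimension $n$ in $\mathbb R^{n+k}$ is a nonempty finite union of convex, compact, $n$-dimensional polyhedra. Let $D\subseteq\mathbb R^{n+k}$ be a bounded domain and $M\subseteq D$ a polyhedral set of dimension $n$. A map $u\colon D\to\mathcal N$ has a nice singularity at $M$ if it is locally Lipschitz on $\overline D\setminus M$ and there is a constant $C$ such that $|\nabla u(x)|\le C\,\mathrm{dist}^{-1}(x,M)$ for a.e. $x\in D\setminus M$. For such a map, $\mathbf S(u)$ denotes the polyhedral $n$-chain with coefficients in $\pi_{k-1}(\mathcal N)$ that is carried by $M$ and whose multiplicity on each oriented $n$-face of $M$ is the homotopy class of $u$ on small $(k-1)$-spheres around that face, contained in the $k$-planes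 orthogonal to the face and oriented so that the orientation of the face followed by that of the orthogonal $k$-plane is the orientation of $\mathbb R^{n+k}$. Proposition. Let $D\subseteq\mathbb R^{n+k}$ be a bounded domain, $\Sigma\subseteq D$ a polyhedral set of dimension $n$, and $u\in W^{1,k-1}(D,\mathcal N)$ a map with nice singularity at $\Sigma$. Let $T\subset\subset D$ be an oriented simplex of dimension $n+1$ and let $\sigma\in\pi_{k-1}(\mathcal N)$. Then $\mathbf S(u)$ is well defined (it exists and is unique), and there exist a polyhedral set $\tilde\Sigma\subseteq D$ of dimension $n$ and a map $\tilde u\in W^{1,k-1}(D,\mathcal N)$ with nice singularity at $\tilde\Sigma$ such that $\tilde u=u$ in a neighbourhood of $\partial D$, $\mathbf S(\tilde u)$ is well defined and $$\mathbf S(\tilde u)=\mathbf S(u)+\sigma\,\partial[\![T]\!]$$ as polyhedral $n$-chains with coefficients in $\pi_{k-1}(\mathcal N)$. -/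

import Mathlib

open MeasureTheory Topology Set Filter
open scoped ContDiff unitInterval Topology.Homotopy

/-! ### Targets -/

section Target

variable {m : ℕ}

/-- `N` is an embedded smooth submanifold (without boundary) of `ℝ^m`: near each of its points,
some smooth local diffeomorphism of `ℝ^m` straightens `N` to a linear subspace. -/
def IsSmoothSubmanifold (N : Set (EuclideanSpace ℝ (Fin m))) : Prop :=
  ∀ p ∈ N, ∃ Φ : OpenPartialHomeomorph (EuclideanSpace ℝ (Fin m)) (EuclideanSpace ℝ (Fin m)),
    ∃ W : Submodule ℝ (EuclideanSpace ℝ (Fin m)),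
      p ∈ Φ.source ∧ ContDiffOn ℝ ∞ Φ Φ.source ∧ ContDiffOn ℝ ∞ Φ.symm Φ.target ∧
        ∀ y ∈ Φ.source, y ∈ N ↔ Φ y ∈ W

instance instNonemptyFinPredOfAtLeastTwo (k : ℕ) [hk : k.AtLeastTwo] : Nonempty (Fin (k - 1)) :=
  ⟨⟨0, by have := hk.prop; omega⟩⟩

/-- The standing assumptions on the target: `N ⊆ ℝ^m` is a nonempty, compact, smooth manifold
without boundary, it is `(k-2)`-connected, and `π₁(N)` is Abelian in case `k = 2`. -/
class IsAdmissibleTarget (k : ℕ) [k.AtLeastTwo] (N : Set (EuclideanSpace ℝ (Fin m))) : Prop where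
  nonempty : N.Nonempty
  isCompact : IsCompact N
  isSmoothSubmanifold : IsSmoothSubmanifold N
  connected : ∀ j : ℕ, j + 2 ≤ k → ∀ p : N, Subsingleton (HomotopyGroup (Fin j) N p)
  abelian : k = 2 → ∀ (p : N) (a b : HomotopyGroup (Fin (k - 1)) N p), a * b = b * a

/-- The coefficient group `π_{k-1}(N)` (with base point `p`), written additively. -/
def CoeffGroup (k : ℕ) (N : Set (EuclideanSpace ℝ (Fin m))) (p : N) : Type :=
  Additive (HomotopyGroup (Fin (k - 1)) N p)

theorem homotopyGroup_mul_comm (k : ℕ) [hk : k.AtLeastTwo] (N : Set (EuclideanSpace ℝ (Fin m)))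
    [hN : IsAdmissibleTarget k N] (p : N) (a b : HomotopyGroup (Fin (k - 1)) N p) :
    a * b = b * a := by
  by_cases h2 : k = 2
  · exact hN.abelian h2 p a b
  · have : Nontrivial (Fin (k - 1)) :=
      Fin.nontrivial_iff_two_le.2 (by have := hk.prop; omega)
    have h : ∀ a b : HomotopyGroup (Fin (k - 1)) N p,
        HomotopyGroup.commGroup.toGroup.mul a b = HomotopyGroup.commGroup.toGroup.mul b a :=
      fun a b => HomotopyGroup.commGroup.mul_comm a b
    exact h a b

noncomputable instance CoeffGroup.instAddCommGroup (k : ℕ) [k.AtLeastTwo]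
    (N : Set (EuclideanSpace ℝ (Fin m))) [IsAdmissibleTarget k N] (p : N) :
    AddCommGroup (CoeffGroup k N p) :=
  { (inferInstance : AddGroup (Additive (HomotopyGroup (Fin (k - 1)) N p))) with
    add_comm := fun a b => congrArg Additive.ofMul
      (homotopyGroup_mul_comm k N p a.toMul b.toMul) }

/-- The continuous map `I^{k-1} → S^{k-1} ⊆ ℝ^k` that collapses the boundary of the cube to the
north pole and is a homeomorphism from the open cube onto the rest of the sphere: with
`c = 2t - 1 ∈ [-1,1]^{k-1}` and `β = ∏ (1 - cᵢ²)`, it is the inverse stereographic projection of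
`c / β`. -/
noncomputable def cubeToSphere (k : ℕ) (t : Fin (k - 1) → I) : EuclideanSpace ℝ (Fin k) :=
  let c : Fin (k - 1) → ℝ := fun i => 2 * (t i : ℝ) - 1
  let β : ℝ := ∏ i, (1 - c i ^ 2)
  let s : ℝ := ∑ i, c i ^ 2
  WithLp.toLp 2 fun j =>
    if h : (j : ℕ) < k - 1 then 2 * β * c ⟨j, h⟩ / (s + β ^ 2) else (s - β ^ 2) / (s + β ^ 2)

/-- The restriction of `φ` to the unit sphere `S^{k-1} ⊆ ℝ^k` is continuous and its free homotopy
class is `g ∈ π_{k-1}(N)`: up to a homotopy of maps `S^{k-1} → N` (that is, of maps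
`I^{k-1} → N` that are constant on `∂I^{k-1}` at each time), it is given by a loop in `g`. -/
def HasHomotopyClass (k : ℕ) (N : Set (EuclideanSpace ℝ (Fin m))) (p : N)
    (φ : EuclideanSpace ℝ (Fin k) → N) (g : CoeffGroup k N p) : Prop :=
  ∃ (γ : Ω^ (Fin (k - 1)) N p) (H : C(I × (Fin (k - 1) → I), N)),
    g = Additive.ofMul (Quotient.mk (GenLoop.Homotopic.setoid (Fin (k - 1)) p) γ) ∧
    (∀ t, H (0, t) = φ (cubeToSphere k t)) ∧
    (∀ t, H (1, t) = γ t) ∧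
    ∀ s, ∀ t ∈ Cube.boundary (Fin (k - 1)), ∀ t' ∈ Cube.boundary (Fin (k - 1)),
      H (s, t) = H (s, t')

end Target

/-! ### Polyhedral sets and polyhedral chains in `ℝ^d` -/

section Chains

variable {d : ℕ}

/-- `K` is a convex, compact polyhedron of dimension `q`. -/
def IsConvexPolyhedron (q : ℕ) (K : Set (EuclideanSpace ℝ (Fin d))) : Prop :=
  ∃ F : Finset (EuclideanSpace ℝ (Fin d)), F.Nonempty ∧ K = convexHull ℝ (F : Set _) ∧
    Module.finrank ℝ (vectorSpan ℝ (F : Set (EuclideanSpace ℝ (Fin d)))) = q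

/-- `M` is a polyhedral set of dimension `q`: a (nonempty) finite union of convex, compact,
`q`-dimensional polyhedra. -/
def IsPolyhedralSet (q : ℕ) (M : Set (EuclideanSpace ℝ (Fin d))) : Prop :=
  ∃ 𝒦 : Set (Set (EuclideanSpace ℝ (Fin d))), 𝒦.Finite ∧ 𝒦.Nonempty ∧
    (∀ K ∈ 𝒦, IsConvexPolyhedron q K) ∧ M = ⋃₀ 𝒦

/-- A (nondegenerate) `q`-simplex in `ℝ^d`, oriented by the order of its vertices. -/
abbrev OrientedSimplex (q d : ℕ) := Affine.Simplex ℝ (EuclideanSpace ℝ (Fin d)) q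

/-- The closed simplex, as a set. -/
def OrientedSimplex.carrier {q : ℕ} (T : OrientedSimplex q d) : Set (EuclideanSpace ℝ (Fin d)) :=
  convexHull ℝ (range T.points)

/-- The `i`-th face of an oriented simplex, with the vertices in the inherited order. -/
def OrientedSimplex.oppositeFace {q : ℕ} (T : OrientedSimplex (q + 1) d) (i : Fin (q + 2)) :
    OrientedSimplex q d :=
  ⟨fun j => T.points (i.succAbove j),
    T.independent.comp_embedding (Fin.succAboveEmb i)⟩

open Classical in
/-- The orientation of a `q`-simplex relative to an orthonormal `q`-frame `e`: `0` if `e` is not a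
frame of the direction of the simplex, otherwise `1` or `-1` depending on whether the edge
vectors `v₁ - v₀, …, v_q - v₀` induce the same orientation as `e`. -/
noncomputable def OrientedSimplex.sign {q : ℕ} (T : OrientedSimplex q d)
    (e : Fin q → EuclideanSpace ℝ (Fin d)) : ℤ :=
  if vectorSpan ℝ (range T.points) = Submodule.span ℝ (range e) then
    (SignType.sign (Matrix.of fun i j : Fin q =>
      inner ℝ (e i) (T.points j.succ - T.points 0)).det : ℤ)
  else 0

open Classical in
/-- The multiplicity at the point `x`, with respect to the oriented `q`-plane spanned by the frame
`e`, of a formal sum of oriented `q`-simplices with coefficients in `G`. -/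
noncomputable def chainMultiplicity {G : Type} [AddCommGroup G] {q : ℕ} (c : OrientedSimplex q d →₀ G)
    (x : EuclideanSpace ℝ (Fin d)) (e : Fin q → EuclideanSpace ℝ (Fin d)) : G :=
  c.sum fun T g => if x ∈ T.carrier then T.sign e • g else 0

theorem chainMultiplicity_zero {G : Type} [AddCommGroup G] {q : ℕ} (x : EuclideanSpace ℝ (Fin d))
    (e : Fin q → EuclideanSpace ℝ (Fin d)) :
    chainMultiplicity (0 : OrientedSimplex q d →₀ G) x e = 0 := by
  simp [chainMultiplicity]

theorem chainMultiplicity_add {G : Type} [AddCommGroup G] {q : ℕ} (c c' : OrientedSimplex q d →₀ G)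
    (x : EuclideanSpace ℝ (Fin d)) (e : Fin q → EuclideanSpace ℝ (Fin d)) :
    chainMultiplicity (c + c') x e = chainMultiplicity c x e + chainMultiplicity c' x e := by
  classical
  unfold chainMultiplicity
  refine Finsupp.sum_add_index' (fun T => by simp) (fun T g g' => ?_)
  split_ifs <;> simp

theorem chainMultiplicity_neg {G : Type} [AddCommGroup G] {q : ℕ} (c : OrientedSimplex q d →₀ G)
    (x : EuclideanSpace ℝ (Fin d)) (e : Fin q → EuclideanSpace ℝ (Fin d)) :
    chainMultiplicity (-c) x e = -chainMultiplicity c x e := by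
  have h := chainMultiplicity_add c (-c) x e
  rw [add_neg_cancel, chainMultiplicity_zero] at h
  exact (neg_eq_of_add_eq_zero_right h.symm).symm

/-- The formal sums of oriented simplices that represent the zero chain: the multiplicity with
respect to each oriented `q`-plane vanishes at `ℋ^q`-almost every point. -/
noncomputable def nullChains (G : Type) [AddCommGroup G] (q d : ℕ) :
    AddSubgroup (OrientedSimplex q d →₀ G) where
  carrier := {c | ∀ e : Fin q → EuclideanSpace ℝ (Fin d), Orthonormal ℝ e →
    ∀ᵐ x ∂(μH[(q : ℝ)] : Measure (EuclideanSpace ℝ (Fin d))), chainMultiplicity c x e = 0}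
  zero_mem' := fun e _ => Eventually.of_forall fun x => chainMultiplicity_zero x e
  add_mem' := fun {a b} ha hb e he => by
    filter_upwards [ha e he, hb e he] with x h1 h2
    rw [chainMultiplicity_add, h1, h2, add_zero]
  neg_mem' := fun {a} ha e he => by
    filter_upwards [ha e he] with x h1
    rw [chainMultiplicity_neg, h1, neg_zero]

/-- The group of polyhedral `q`-chains in `ℝ^d` with coefficients in `G`: finite sums of oriented
`q`-simplices with coefficients in `G`, where two such sums are identified if they have the same
multiplicities almost everywhere (that is, if they agree after reorientation and common
subdivision of their simplices). -/
abbrev PolyhedralChain (G : Type) [AddCommGroup G] (q d : ℕ) : Type :=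
  (OrientedSimplex q d →₀ G) ⧸ nullChains G q d

/-- The chain `g⟦T⟧` carried by an oriented simplex `T`, with constant multiplicity `g`. -/
noncomputable def simplexChain {G : Type} [AddCommGroup G] {q : ℕ} (g : G)
    (T : OrientedSimplex q d) : PolyhedralChain G q d :=
  QuotientAddGroup.mk (Finsupp.single T g)

/-- The chain `g ∂⟦T⟧`. -/
noncomputable def simplexBoundary {G : Type} [AddCommGroup G] {q : ℕ} (g : G)
    (T : OrientedSimplex (q + 1) d) : PolyhedralChain G q d :=
  ∑ i : Fin (q + 2), (-1 : ℤ) ^ (i : ℕ) • simplexChain g (T.oppositeFace i)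

end Chains

/-! ### Sobolev maps and maps with nice singularities -/

section Maps

variable {d m : ℕ}

/-- `g` is the weak gradient of `f` in `D`. -/
def IsWeakGradient (D : Set (EuclideanSpace ℝ (Fin d)))
    (f : EuclideanSpace ℝ (Fin d) → EuclideanSpace ℝ (Fin m))
    (g : EuclideanSpace ℝ (Fin d) → EuclideanSpace ℝ (Fin d) →L[ℝ] EuclideanSpace ℝ (Fin m)) :
    Prop :=
  ∀ φ : EuclideanSpace ℝ (Fin d) → ℝ, ContDiff ℝ ∞ φ → HasCompactSupport φ → tsupport φ ⊆ D →
    ∀ v : EuclideanSpace ℝ (Fin d),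
      ∫ x in D, (fderiv ℝ φ x v) • f x = -∫ x in D, φ x • g x v

/-- `u ∈ W^{1,p}(D, N)`. -/
def MemSobolev (D : Set (EuclideanSpace ℝ (Fin d))) (p : ENNReal)
    {N : Set (EuclideanSpace ℝ (Fin m))} (u : EuclideanSpace ℝ (Fin d) → N) : Prop :=
  MemLp (fun x => (u x : EuclideanSpace ℝ (Fin m))) p (volume.restrict D) ∧
  ∃ g : EuclideanSpace ℝ (Fin d) → EuclideanSpace ℝ (Fin d) →L[ℝ] EuclideanSpace ℝ (Fin m),
    MemLp g p (volume.restrict D) ∧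
    IsWeakGradient D (fun x => (u x : EuclideanSpace ℝ (Fin m))) g

/-- The map `u : D → N` has a nice singularity at `M`: it is locally Lipschitz on
`closure D \ M` (up to the boundary of `D`; the values on `∂D` are the limits of those in `D`)
and `|∇u| ≤ C / dist(·, M)` almost everywhere in `D \ M`. -/
def HasNiceSingularity (D M : Set (EuclideanSpace ℝ (Fin d)))
    {N : Set (EuclideanSpace ℝ (Fin m))} (u : EuclideanSpace ℝ (Fin d) → N) : Prop :=
  (∀ x ∈ closure D \ M, ∃ L : NNReal, ∃ V ∈ 𝓝 x, LipschitzOnWith L u (V ∩ (D \ M))) ∧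
  ∃ C : ℝ, ∀ᵐ x ∂(volume.restrict (D \ M)),
    ‖fderiv ℝ (fun y => (u y : EuclideanSpace ℝ (Fin m))) x‖ ≤ C / Metric.infDist x M

end Maps

/-! ### The topological singular set -/

section SingularSet

variable {n k m : ℕ}

/-- Given an orthonormal basis `b` of `ℝ^{n+k}`, the restriction of `u` to the `(k-1)`-sphere of
centre `x` and radius `r` in the affine `k`-plane through `x` spanned by the last `k` vectors of
`b`, parametrised by the unit sphere of `ℝ^k` in the coordinates of `b`. -/
noncomputable def linkMap {N : Set (EuclideanSpace ℝ (Fin m))}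
    (u : EuclideanSpace ℝ (Fin (n + k)) → N) (x : EuclideanSpace ℝ (Fin (n + k)))
    (b : OrthonormalBasis (Fin (n + k)) ℝ (EuclideanSpace ℝ (Fin (n + k)))) (r : ℝ) :
    EuclideanSpace ℝ (Fin k) → N :=
  fun w => u (x + r • ∑ j : Fin k, w j • b (Fin.natAdd n j))

/-- The first `n` vectors of `b`. -/
noncomputable def tangentFrame
    (b : OrthonormalBasis (Fin (n + k)) ℝ (EuclideanSpace ℝ (Fin (n + k)))) :
    Fin n → EuclideanSpace ℝ (Fin (n + k)) :=
  fun i => b (Fin.castAdd k i)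

/-- `b` is positively oriented. -/
def IsPositivelyOriented
    (b : OrthonormalBasis (Fin (n + k)) ℝ (EuclideanSpace ℝ (Fin (n + k)))) : Prop :=
  0 < (Matrix.of fun i j : Fin (n + k) => b i j).det

/-- The polyhedral `n`-chain `S` is the topological singular set of the map `u`, which has a nice
singularity at the `n`-dimensional polyhedral set `M`: `S` is carried by `M`, and the multiplicity
of `S` on each `n`-face of `M` is the homotopy class of `u` around that face.  Precisely, for
almost every point `x` near which `M` coincides with the affine `n`-plane `x + span(b₁, …, b_n)`,
where `b` is a positively oriented orthonormal basis of `ℝ^{n+k}`, the multiplicity of `S` at `x`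
with respect to the orientation `(b₁, …, b_n)` is the homotopy class of `u` on all small
`(k-1)`-spheres around `x` in the orthogonal plane, oriented by `(b_{n+1}, …, b_{n+k})`. -/
def IsTopologicalSingularSet [k.AtLeastTwo] {N : Set (EuclideanSpace ℝ (Fin m))}
    [IsAdmissibleTarget k N] {p : N} (u : EuclideanSpace ℝ (Fin (n + k)) → N)
    (M : Set (EuclideanSpace ℝ (Fin (n + k))))
    (S : PolyhedralChain (CoeffGroup k N p) n (n + k)) : Prop :=
  ∃ c : OrientedSimplex n (n + k) →₀ CoeffGroup k N p, S = QuotientAddGroup.mk c ∧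
    (∀ e : Fin n → EuclideanSpace ℝ (Fin (n + k)), Orthonormal ℝ e →
      ∀ᵐ x ∂(μH[(n : ℝ)] : Measure (EuclideanSpace ℝ (Fin (n + k)))),
        x ∉ M → chainMultiplicity c x e = 0) ∧
    ∀ b : OrthonormalBasis (Fin (n + k)) ℝ (EuclideanSpace ℝ (Fin (n + k))),
      IsPositivelyOriented b →
      ∀ᵐ x ∂(μH[(n : ℝ)] : Measure (EuclideanSpace ℝ (Fin (n + k)))),
        x ∈ M →
        (∀ᶠ y in 𝓝 x, y ∈ M ↔ y - x ∈ Submodule.span ℝ (range (tangentFrame b))) →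
        ∀ᶠ r in 𝓝[>] (0 : ℝ),
          HasHomotopyClass k N p (linkMap u x b r) (chainMultiplicity c x (tangentFrame b))

/-- The topological singular set `𝐒(u)` of a map `u` with a nice singularity at `M`: the chain
singled out by `IsTopologicalSingularSet`. -/
noncomputable def topologicalSingularSet [k.AtLeastTwo] {N : Set (EuclideanSpace ℝ (Fin m))}
    [IsAdmissibleTarget k N] (p : N) (u : EuclideanSpace ℝ (Fin (n + k)) → N)
    (M : Set (EuclideanSpace ℝ (Fin (n + k)))) : PolyhedralChain (CoeffGroup k N p) n (n + k) :=
  Classical.epsilon (IsTopologicalSingularSet u M)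

end SingularSet

/-!
The construction is carried out with an *arrangement*: a finite set `A` of affine functions whose
sign vectors decompose the space into finitely many cells. A polyhedral set is adapted to some
arrangement (`IsPolyhedralSet.exists_isAdapted`): membership depends only on the cell, and at
`μH[n]`-almost every point it coincides locally with the `n`-plane on which the functions vanish
that vanish at the point.

**The singular set exists and is unique.** The homotopy class of `u` on small normal spheres is
constant along the cells of dimension `n`, and a cell carries a polyhedral chain because simplices
can be bisected along the hyperplanes of the arrangement (`exists_cut_single`). This gives
`IsPolyhedralSet.exists_isTopologicalSingularSet`. Orthonormal frames with the same tangent plane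
give classes that differ by the sign of a determinant (`HasHomotopyClass.linkMap_change_frame`), as
linear automorphisms of `ℝ^k` act on `π_{k-1}` by the sign of their determinants. Hence the
multiplicities are determined almost everywhere, which is uniqueness.

**The new map.** Let `A` decide both `Σ` and `T`, and let `M` be the union of `Σ` with the set
`cutSet A T`, where functions of `A` that do not vanish identically on `T` have zeros in `T`. The
map `ũ` (`insertMap`) is singular at `M`. Away from a lens around `T \ M`, whose width is
comparable to the distance from `M`, it is `u ∘ Φ`, where `Φ` preserves all cells and pushes all
points at least a constant distance away from `M` (`exists_isPush`). In the lens, in the planes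
orthogonal to `T`, the point `Φ x` first slides to a point `c` chosen once and for all in the cell
of `T` over which `x` lies, the value then moves from `u c` to the base point along a Lipschitz
path, and at last a Lipschitz bubble `(B^{k-1}, ∂B^{k-1}) → (N, p)` is inserted. The slide avoids
`Σ`, since the cells of the hyperplanes that do not contain `T` are convex.

**Nice singularities.** For maps to a compact manifold, a nice singularity amounts to local
Lipschitz constants `C / dist(x, M)` (`HasNiceSingularity.exists_lipNear`,
`HasNiceSingularity.of_lipNear`), and these scale correctly for every part of `ũ`
(`exists_lipNear_insertMap`). As `dist(·, M)^{1-k}` is integrable, such maps belong to `W^{1,k-1}`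
(`memSobolev_of_lipNear`). The bubbles and the paths are Lipschitz thanks to a Lipschitz retraction
of a neighbourhood of `N` onto `N`.

**The change of the singular set.** At a generic point of `M` in a face of `T`, a small normal
sphere meets one half of the lens, in a cap. Shrinking the rest of the sphere shows that the class
of `ũ` is that of `u` plus that of the bubble (`HasHomotopyClass.insert_bubble`). At a generic
point of `M` in the interior of `T`, the sphere meets the lens in two opposite caps with opposite
orientations, whose contributions cancel. By `OrientedSimplex.sign_snoc`, the signs are those of
`∂⟦T⟧`.
-/

open Metric Module
open Bornology (IsBounded)
open Fin (natAdd castAdd)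
open Finset (mem_filter sum_congr sum_eq_zero sum_sub_distrib sum_add_distrib
  affineCombination_eq_linear_combination sum_nonneg sum_mul add_sum_erase sum_smul sum_le_sum
  sum_ite_mem sum_eq_single sum_div single_le_sum)
open Function (update update_of_ne update_self)
open GenLoop (Homotopic)
open LinearMap (ker toContinuousLinearMap)
open Matrix (of toEuclideanLin of_apply toLpLin_apply mulVec det_mul updateRow_self updateRow_ne
  updateCol_ne det_transpose det_one transvection det_diagonal
  diagonal)
open Real (norm_eq_abs norm_of_nonneg)
open Submodule (span finrank_mono subset_span span_le smul_mem_iff smul_mem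
  starProjection_apply_eq_zero_iff eq_of_le_of_finrank_le)

/-- Euclidean space of dimension `d`. -/
notation:max "ℝ^" d:max => EuclideanSpace ℝ (Fin d)

/-! ### Free homotopies of maps of the cube -/

section CubeHomotopy

variable {ι X : Type*} [TopologicalSpace X]

/-- Two maps of the cube that are constant on its boundary are freely homotopic if they are
homotopic through maps that are constant on the boundary. -/
def FreeHomotopic (f g : C(ι → I, X)) : Prop :=
  f.HomotopicWith g fun h => ∀ t ∈ Cube.boundary ι, ∀ t' ∈ Cube.boundary ι, h t = h t'

theorem FreeHomotopic.of_map {f g : C(ι → I, X)} (H : I × (ι → I) → X) (hH : Continuous H)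
    (h0 : ∀ t, H (0, t) = f t) (h1 : ∀ t, H (1, t) = g t)
    (hb : ∀ s, ∀ t ∈ Cube.boundary ι, ∀ t' ∈ Cube.boundary ι, H (s, t) = H (s, t')) :
    FreeHomotopic f g :=
  ⟨{ toFun := H, continuous_toFun := hH, map_zero_left := h0, map_one_left := h1,
     prop' := fun s t ht t' ht' => hb s t ht t' ht' }⟩

theorem FreeHomotopic.exists_map {f g : C(ι → I, X)} (h : FreeHomotopic f g) :
    ∃ H : C(I × (ι → I), X), (∀ t, H (0, t) = f t) ∧ (∀ t, H (1, t) = g t) ∧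
      ∀ s, ∀ t ∈ Cube.boundary ι, ∀ t' ∈ Cube.boundary ι, H (s, t) = H (s, t') := by
  obtain ⟨H⟩ := h
  exact ⟨H.toContinuousMap, H.map_zero_left, H.map_one_left, fun s => H.prop' s⟩

theorem FreeHomotopic.trans {f g h : C(ι → I, X)} (h₁ : FreeHomotopic f g)
    (h₂ : FreeHomotopic g h) : FreeHomotopic f h :=
  ContinuousMap.HomotopicWith.trans h₁ h₂

theorem FreeHomotopic.symm {f g : C(ι → I, X)} (h : FreeHomotopic f g) : FreeHomotopic g f :=
  ContinuousMap.HomotopicWith.symm h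

theorem GenLoop.homotopic_of_map {x : X} {f g : Ω^ ι X x} (H : I × (ι → I) → X)
    (hH : Continuous H) (h0 : ∀ t, H (0, t) = f t) (h1 : ∀ t, H (1, t) = g t)
    (hb : ∀ s, ∀ t ∈ Cube.boundary ι, H (s, t) = x) : Homotopic f g :=
  ⟨{ toFun := H, continuous_toFun := hH, map_zero_left := h0, map_one_left := h1,
     prop' := fun s t ht => (hb s t ht).trans (f.2 t ht).symm }⟩

theorem GenLoop.Homotopic.freeHomotopic {x : X} {f g : Ω^ ι X x} (h : Homotopic f g) :
    FreeHomotopic f.1 g.1 := by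
  obtain ⟨H⟩ := h
  refine FreeHomotopic.of_map H H.continuous H.map_zero_left H.map_one_left ?_
  intro s t ht t' ht'
  have h1 : H (s, t) = f.1 t := H.prop' s t ht
  have h2 : H (s, t') = f.1 t' := H.prop' s t' ht'
  rw [h1, h2]
  exact (f.2 t ht).trans (f.2 t' ht').symm

/-- The point `(1 - s) a + s b` of the unit interval. -/
def lerpI (s a b : I) : I := ⟨(1 - s) * a + s * b, by
    have := s.2.1; have := s.2.2; have := a.2.1; have := a.2.2; have := b.2.1; have := b.2.2
    constructor <;> nlinarith [mul_nonneg s.2.1 b.2.1, mul_nonneg (sub_nonneg.2 s.2.2) a.2.1]⟩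

@[simp] theorem lerpI_zero (a b : I) : lerpI 0 a b = a := by ext; simp [lerpI]
@[simp] theorem lerpI_one (a b : I) : lerpI 1 a b = b := by ext; simp [lerpI]
@[simp] theorem lerpI_self (s a : I) : lerpI s a a = a := by ext; simp [lerpI]; ring

@[fun_prop]
theorem Continuous.lerpI {Y : Type*} [TopologicalSpace Y] {s a b : Y → I} (hs : Continuous s)
    (ha : Continuous a) (hb : Continuous b) : Continuous fun y => lerpI (s y) (a y) (b y) := by
  unfold _root_.lerpI
  fun_prop

/-- The point of the unit interval that is nearest to a given real number. -/
noncomputable def clampI (x : ℝ) : I := projIcc 0 1 zero_le_one x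

@[fun_prop]
theorem continuous_clampI : Continuous clampI := continuous_projIcc (h := zero_le_one)

theorem clampI_of_le {x : ℝ} (h : x ≤ 0) : clampI x = 0 := projIcc_of_le_left _ h
theorem clampI_of_ge {x : ℝ} (h : 1 ≤ x) : clampI x = 1 := projIcc_of_right_le _ h
@[simp] theorem clampI_coe (x : I) : clampI x = x := projIcc_val _ x
theorem clampI_of_mem {x : ℝ} (h0 : 0 ≤ x) (h1 : x ≤ 1) : (clampI x : ℝ) = x := by
  simp [clampI, projIcc_of_mem zero_le_one ⟨h0, h1⟩]

/-- The map of the cube that stretches the central subcube of half the size over the whole cube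
and maps its complement to the boundary. -/
noncomputable def cubeStretch (t : ι → I) : ι → I := fun i => clampI (2 * t i - 1 / 2)

@[fun_prop]
theorem continuous_cubeStretch : Continuous (cubeStretch : (ι → I) → ι → I) := by
  unfold cubeStretch; fun_prop

theorem continuous_lerpI_cubeStretch :
    Continuous fun q : I × (ι → I) => fun j => lerpI q.1 (q.2 j) (cubeStretch q.2 j) := by
  unfold cubeStretch; fun_prop

theorem lerpI_mem_boundary {t t' : ι → I} {i : ι} (h : t i = 0 ∧ t' i = 0 ∨ t i = 1 ∧ t' i = 1)
    (s : I) : (fun j => lerpI s (t j) (t' j)) ∈ Cube.boundary ι := by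
  refine ⟨i, ?_⟩
  rcases h with h | h <;> simp [h.1, h.2]

theorem lerpI_cubeStretch_mem_boundary {t : ι → I} (ht : t ∈ Cube.boundary ι) (s : I) :
    (fun j => lerpI s (t j) (cubeStretch t j)) ∈ Cube.boundary ι := by
  obtain ⟨i, hi⟩ := ht
  refine lerpI_mem_boundary (i := i) ?_ s
  rcases hi with hi | hi
  · left; exact ⟨hi, by simp only [cubeStretch, hi]; apply clampI_of_le; norm_num⟩
  · right; exact ⟨hi, by simp only [cubeStretch, hi]; apply clampI_of_ge; norm_num⟩

theorem cubeStretch_mem_boundary {t : ι → I} (ht : t ∈ Cube.boundary ι) :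
    cubeStretch t ∈ Cube.boundary ι := by
  simpa using lerpI_cubeStretch_mem_boundary ht 1

variable [Fintype ι]

/-- The distance to the centre of the cube in the maximum norm, normalised to be `1` on the
boundary. -/
noncomputable def cubeRadius (t : ι → I) : ℝ := ‖fun i => 2 * (t i : ℝ) - 1‖

@[fun_prop]
theorem continuous_cubeRadius : Continuous (cubeRadius : (ι → I) → ℝ) := by
  unfold cubeRadius; fun_prop

theorem cubeRadius_of_mem_boundary {t : ι → I} (ht : t ∈ Cube.boundary ι) : cubeRadius t = 1 := by
  apply le_antisymm
  · rw [cubeRadius, pi_norm_le_iff_of_nonneg zero_le_one]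
    intro i
    rw [norm_eq_abs, abs_le]
    have := (t i).2.1; have := (t i).2.2
    constructor <;> linarith
  · obtain ⟨i, hi⟩ := ht
    have h := norm_le_pi_norm (fun i => 2 * (t i : ℝ) - 1) i
    refine le_trans ?_ h
    rcases hi with hi | hi <;> simp only [hi] <;> norm_num

theorem cubeStretch_mem_boundary_of_radius {t : ι → I} (ht : 1 / 2 ≤ cubeRadius t) :
    cubeStretch t ∈ Cube.boundary ι := by
  by_contra hcon
  have : cubeRadius t < 1 / 2 := by
    rw [cubeRadius, pi_norm_lt_iff (by norm_num)]
    intro i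
    by_contra hi
    rw [not_lt, norm_eq_abs, le_abs] at hi
    apply hcon
    refine ⟨i, ?_⟩
    rcases hi with hi | hi
    · right; apply clampI_of_ge; linarith
    · left; apply clampI_of_le; linarith
  linarith

/-- A function of the cube radius that is `1` on the central subcube and `0` on the boundary. -/
noncomputable def collarI (t : ι → I) : I := clampI (2 - 2 * cubeRadius t)

@[fun_prop]
theorem continuous_collarI : Continuous (collarI : (ι → I) → I) := by
  unfold collarI; fun_prop

theorem collarI_of_mem_boundary {t : ι → I} (ht : t ∈ Cube.boundary ι) : collarI t = 0 := by
  rw [collarI, cubeRadius_of_mem_boundary ht]; apply clampI_of_le; norm_num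

theorem collarI_of_radius_le {t : ι → I} (ht : cubeRadius t ≤ 1 / 2) : collarI t = 1 :=
  clampI_of_ge (by linarith)

/-- In a space with trivial fundamental group, freely homotopic loops are homotopic. -/
theorem GenLoop.homotopic_of_freeHomotopic [Nonempty ι] {p : X}
    (hπ : ∀ δ : Ω^ (Fin 1) X p, Homotopic δ GenLoop.const) {γ γ' : Ω^ ι X p}
    (h : FreeHomotopic γ.1 γ'.1) : Homotopic γ γ' := by
  obtain ⟨H, h0, h1, hb⟩ := h.exists_map
  have hz : (fun _ => 0 : ι → I) ∈ Cube.boundary ι := ⟨Classical.arbitrary ι, Or.inl rfl⟩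
  -- the loop that is traced by the boundary of the cube
  let δ : Ω^ (Fin 1) X p := ⟨⟨fun s => H (s 0, fun _ => 0), by fun_prop⟩, by
    rintro s ⟨i, hi⟩
    rw [Subsingleton.elim i 0] at hi
    rcases hi with hi | hi
    · simpa [hi, h0] using γ.2 _ hz
    · simpa [hi, h1] using γ'.2 _ hz⟩
  obtain ⟨K⟩ := hπ δ
  have hK0 : ∀ s : I, K (0, fun _ => s) = H (s, fun _ => 0) := fun s => K.map_zero_left _
  have hK1 : ∀ s : I, K (1, fun _ => s) = p := fun s => K.map_one_left _
  have hKb : ∀ τ s : I, (s = 0 ∨ s = 1) → K (τ, fun _ => s) = p := by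
    intro τ s hs
    have h : K (τ, fun _ => s) = δ.1 (fun _ => s) := K.prop' τ _ ⟨0, hs⟩
    rw [h]; exact δ.2 _ ⟨0, hs⟩
  -- the map that follows `δ` in a collar and the second loop inside
  let F : Ω^ ι X p := ⟨⟨fun t => H (collarI t, cubeStretch t), by fun_prop⟩, by
    intro t ht
    simp only [ContinuousMap.coe_mk, collarI_of_mem_boundary ht, h0]
    exact γ.2 _ (cubeStretch_mem_boundary ht)⟩
  let G : Ω^ ι X p := ⟨⟨fun t => γ' (cubeStretch t), by
    exact γ'.1.continuous.comp continuous_cubeStretch⟩, fun t ht =>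
      γ'.2 _ (cubeStretch_mem_boundary ht)⟩
  have e1 : Homotopic γ F := by
    refine GenLoop.homotopic_of_map
      (fun q => H (q.1 * collarI q.2, fun j => lerpI q.1 (q.2 j) (cubeStretch q.2 j)))
      (H.continuous.comp (.prodMk (by fun_prop) continuous_lerpI_cubeStretch))
      (fun t => ?_) (fun t => ?_) fun s t ht => ?_
    · simp only [zero_mul, lerpI_zero]; exact h0 t
    · simp only [one_mul, lerpI_one]; rfl
    · simp only [collarI_of_mem_boundary ht, mul_zero, h0]
      exact γ.2 _ (lerpI_cubeStretch_mem_boundary ht s)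
  have e2 : Homotopic F G := by
    refine GenLoop.homotopic_of_map (fun q => if cubeRadius q.2 ≤ 1 / 2 then γ' (cubeStretch q.2)
        else K (q.1, fun _ => collarI q.2)) ?_ ?_ ?_ ?_
    · refine Continuous.if_le ?_ ?_ (by fun_prop) continuous_const ?_
      · exact γ'.1.continuous.comp (by fun_prop)
      · exact K.continuous.comp (by fun_prop)
      · intro q hq
        rw [collarI_of_radius_le hq.le, hKb _ _ (Or.inr rfl)]
        exact γ'.2 _ (cubeStretch_mem_boundary_of_radius hq.ge)
    · intro t
      simp only
      split_ifs with ht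
      · exact (h1 _).symm.trans (by rw [← collarI_of_radius_le ht]; rfl)
      · rw [hK0]
        exact hb _ _ hz _ (cubeStretch_mem_boundary_of_radius (not_le.1 ht).le)
    · intro t
      simp only
      split_ifs with ht
      · rfl
      · rw [hK1]
        exact (γ'.2 _ (cubeStretch_mem_boundary_of_radius (not_le.1 ht).le)).symm
    · intro s t ht
      simp only
      rw [if_neg (by rw [cubeRadius_of_mem_boundary ht]; norm_num), collarI_of_mem_boundary ht]
      exact hKb _ _ (Or.inl rfl)
  have e3 : Homotopic γ' G := by
    refine GenLoop.homotopic_of_map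
      (fun q => γ' (fun j => lerpI q.1 (q.2 j) (cubeStretch q.2 j)))
      (γ'.1.continuous.comp continuous_lerpI_cubeStretch) (fun t => ?_) (fun t => ?_)
      fun s t ht => γ'.2 _ (lerpI_cubeStretch_mem_boundary ht s)
    · simp only [lerpI_zero]
    · simp only [lerpI_one]; rfl
  exact (e1.trans e2).trans e3.symm

/-- A map of the cube that is constant on the boundary is freely homotopic to a loop at any point
in the path component of its boundary value. -/
theorem FreeHomotopic.exists_genLoop {p q : X} (hpq : Joined q p) (G : C(ι → I, X))
    (hG : ∀ t ∈ Cube.boundary ι, G t = q) : ∃ γ : Ω^ ι X p, FreeHomotopic G γ.1 := by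
  obtain ⟨P⟩ := hpq
  let K : I × (ι → I) → X := fun r => if cubeRadius r.2 ≤ 1 / 2 then G (cubeStretch r.2)
    else P (r.1 * σ (collarI r.2))
  have hK : Continuous K := by
    refine Continuous.if_le ?_ ?_ (by fun_prop) continuous_const ?_
    · fun_prop
    · fun_prop
    · intro r hr
      rw [collarI_of_radius_le hr.le, hG _ (cubeStretch_mem_boundary_of_radius hr.ge)]
      simp
  have hKb : ∀ s, ∀ t ∈ Cube.boundary ι, K (s, t) = P s := by
    intro s t ht
    simp only [K]
    rw [if_neg (by rw [cubeRadius_of_mem_boundary ht]; norm_num), collarI_of_mem_boundary ht]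
    simp
  refine ⟨⟨⟨fun t => K (1, t), by fun_prop⟩, fun t ht => by simpa using hKb 1 t ht⟩, ?_⟩
  have e1 : FreeHomotopic G (G.comp ⟨cubeStretch, continuous_cubeStretch⟩) := by
    refine FreeHomotopic.of_map
      (fun q => G (fun j => lerpI q.1 (q.2 j) (cubeStretch q.2 j)))
      (G.continuous.comp continuous_lerpI_cubeStretch) (fun t => ?_) (fun t => ?_)
      fun s t ht t' ht' => ?_
    · simp only [lerpI_zero]
    · simp only [lerpI_one]; rfl
    · simp only [hG _ (lerpI_cubeStretch_mem_boundary ht s),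
        hG _ (lerpI_cubeStretch_mem_boundary ht' s)]
  refine e1.trans (FreeHomotopic.of_map K hK ?_ (fun t => rfl) ?_)
  · intro t
    simp only [K, zero_mul]
    split_ifs with ht
    · rfl
    · simpa using (hG _ (cubeStretch_mem_boundary_of_radius (not_le.1 ht).le)).symm
  · intro s t ht t' ht'
    rw [hKb s t ht, hKb s t' ht']

end CubeHomotopy

/-! ### Homotopy classes of maps of the sphere -/

section OneDimensional

variable {ι X : Type*} [TopologicalSpace X] [DecidableEq ι] [Subsingleton ι] [Nonempty ι]

/-- The homotopy class of a loop. -/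
def GenLoop.toGroup {ι X : Type*} [TopologicalSpace X] {p : X} (γ : Ω^ ι X p) :
    HomotopyGroup ι X p :=
  Quotient.mk (GenLoop.Homotopic.setoid ι p) γ

/-- Freely homotopic loops of dimension one are conjugate by the loop that the end points trace. -/
theorem GenLoop.exists_conj_of_freeHomotopic {p : X} {γ γ' : Ω^ ι X p}
    (h : FreeHomotopic γ.1 γ'.1) :
    ∃ δ : Ω^ ι X p, GenLoop.toGroup γ = ((GenLoop.toGroup δ)⁻¹ * GenLoop.toGroup γ') *
      GenLoop.toGroup δ := by
  obtain ⟨H, h0, h1, hb⟩ := h.exists_map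
  let i₀ : ι := Classical.arbitrary ι
  have hz : (fun _ => 0 : ι → I) ∈ Cube.boundary ι := ⟨i₀, Or.inl rfl⟩
  have ho : (fun _ => 1 : ι → I) ∈ Cube.boundary ι := ⟨i₀, Or.inr rfl⟩
  let δ : Ω^ ι X p := ⟨⟨fun s => H (s i₀, fun _ => 0), by fun_prop⟩, by
    rintro s ⟨i, hi⟩
    rw [Subsingleton.elim i i₀] at hi
    rcases hi with hi | hi
    · simpa [hi, h0] using γ.2 _ hz
    · simpa [hi, h1] using γ'.2 _ hz⟩
  refine ⟨δ, ?_⟩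
  have hm1 : ((GenLoop.toGroup δ)⁻¹ * GenLoop.toGroup γ') =
      GenLoop.toGroup (GenLoop.transAt i₀ γ' (GenLoop.symmAt i₀ δ)) := by
    rw [show (GenLoop.toGroup δ)⁻¹ = GenLoop.toGroup (GenLoop.symmAt i₀ δ) from
      HomotopyGroup.inv_spec]
    exact HomotopyGroup.mul_spec
  rw [hm1]
  refine Eq.trans ?_ (HomotopyGroup.mul_spec (i := i₀)).symm
  apply Quotient.sound
  let a : I → I := fun x => clampI (2 * x) * clampI (4 - 4 * x)
  let b : I → I := fun x => clampI (4 * x - 2)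
  have ha : Continuous a := by fun_prop
  have hbc : Continuous b := by fun_prop
  have hconst : ∀ t : ι → I, t = fun _ => t i₀ := fun t => by
    funext j; rw [Subsingleton.elim j i₀]
  have hupd : ∀ (t : ι → I) (y : I), update t i₀ y = fun _ => y := fun t y => by
    funext j; rw [Subsingleton.elim j i₀]; simp
  refine GenLoop.homotopic_of_map
    (fun q => H (q.1 * a (q.2 i₀), fun _ => lerpI q.1 (q.2 i₀) (b (q.2 i₀)))) ?_ ?_ ?_ ?_
  · fun_prop
  · intro t
    simp only [zero_mul, lerpI_zero]
    rw [← hconst t]; exact h0 t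
  · intro t
    simp only [one_mul, lerpI_one]
    have hx0 := (t i₀).2.1
    have hx1 := (t i₀).2.2
    simp only [GenLoop.transAt, GenLoop.coe_copy, hupd, GenLoop.symmAt]
    split_ifs with c1 c2
    · have e1 : b (t i₀) = 0 := clampI_of_le (by linarith)
      have e2 : a (t i₀) = clampI (2 * t i₀) := by
        simp only [a]; rw [clampI_of_ge (x := 4 - 4 * _) (by linarith), mul_one]
      rw [e1, e2]; rfl
    · have c1' := not_le.1 c1
      have hy : ((projIcc (0 : ℝ) 1 zero_le_one (2 * (t i₀ : ℝ) - 1) : I) : ℝ)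
          = 2 * (t i₀ : ℝ) - 1 := by rw [projIcc_of_mem zero_le_one ⟨by linarith, by linarith⟩]
      rw [hy] at c2 ⊢
      have e1 : a (t i₀) = 1 := by
        simp only [a]
        rw [clampI_of_ge (x := 4 - 4 * _) (by linarith), clampI_of_ge (by linarith), mul_one]
      rw [e1, h1]
      refine congrArg γ' (funext fun _ => ?_)
      simp only [b, clampI]
      congr 1; ring
    · have c1' := not_le.1 c1
      have c2' := not_le.1 c2
      have hy : ((projIcc (0 : ℝ) 1 zero_le_one (2 * (t i₀ : ℝ) - 1) : I) : ℝ)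
          = 2 * (t i₀ : ℝ) - 1 := by rw [projIcc_of_mem zero_le_one ⟨by linarith, by linarith⟩]
      rw [hy] at c2' ⊢
      have e1 : b (t i₀) = 1 := clampI_of_ge (by linarith)
      have e2 : a (t i₀) = clampI (4 - 4 * t i₀) := by
        simp only [a]; rw [clampI_of_ge (x := 2 * _) (by linarith), one_mul]
      have e3 : σ (projIcc (0 : ℝ) 1 zero_le_one (2 * (2 * (t i₀ : ℝ) - 1) - 1) : I)
          = clampI (4 - 4 * t i₀) := by
        ext
        rw [unitInterval.coe_symm_eq, projIcc_of_mem zero_le_one ⟨by linarith, by linarith⟩,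
          clampI_of_mem (by linarith) (by linarith)]
        ring
      rw [e1, e2, hb _ _ ho _ hz]
      change _ = H (_, _)
      simp only [if_true, e3]
  · intro s t ht
    obtain ⟨i, hi⟩ := ht
    rw [Subsingleton.elim i i₀] at hi
    rcases hi with hi | hi
    · have e1 : a 0 = 0 := by simp only [a]; rw [clampI_of_le (by simp), zero_mul]
      have e2 : b 0 = 0 := clampI_of_le (by simp)
      simp only [hi, e1, e2, mul_zero, lerpI_self, h0]
      exact γ.2 _ hz
    · have e1 : a 1 = 0 := by simp only [a]; rw [clampI_of_le (x := 4 - 4 * _) (by simp), mul_zero]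
      have e2 : b 1 = 1 := clampI_of_ge (by norm_num)
      simp only [hi, e1, e2, mul_zero, lerpI_self, h0]
      exact γ.2 _ ho

end OneDimensional

section CubeToSphere

theorem cubeToSphere_denom_pos {j : ℕ} (c : Fin j → ℝ) :
    0 < ∑ i, c i ^ 2 + (∏ i, (1 - c i ^ 2)) ^ 2 := by
  by_cases h : ∀ i, c i = 0
  · simp [h]
  · push Not at h
    obtain ⟨i, hi⟩ := h
    have : 0 < ∑ i, c i ^ 2 :=
      Finset.sum_pos' (fun i _ => sq_nonneg _) ⟨i, Finset.mem_univ i, by positivity⟩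
    positivity

@[fun_prop]
theorem continuous_cubeToSphere (k : ℕ) : Continuous (cubeToSphere k) := by
  unfold cubeToSphere
  simp only
  refine (PiLp.continuous_toLp 2 _).comp (continuous_pi fun j => ?_)
  split_ifs with h
  · exact Continuous.div (by fun_prop) (by fun_prop) fun t => (cubeToSphere_denom_pos _).ne'
  · exact Continuous.div (by fun_prop) (by fun_prop) fun t => (cubeToSphere_denom_pos _).ne'

theorem norm_cubeToSphere {k : ℕ} (hk : k ≠ 0) (t : Fin (k - 1) → I) : ‖cubeToSphere k t‖ = 1 := by
  obtain ⟨K, rfl⟩ := Nat.exists_eq_succ_of_ne_zero hk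
  have hpos := cubeToSphere_denom_pos (fun i : Fin (K + 1 - 1) => 2 * (t i : ℝ) - 1)
  rw [EuclideanSpace.norm_eq, Real.sqrt_eq_one]
  rw [Fin.sum_univ_castSucc]
  simp only [cubeToSphere, norm_eq_abs, sq_abs, Fin.val_castSucc, Fin.val_last,
    Nat.succ_eq_add_one, Nat.add_sub_cancel, lt_self_iff_false, Fin.is_lt, dite_true, dite_false]
  change Fin K → I at t
  simp only [div_pow, mul_pow, ← sum_div, ← Finset.mul_sum]
  rw [← add_div, div_eq_one_iff_eq (pow_pos hpos 2).ne']
  simp only [Fin.eta]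
  have key : ∀ b s : ℝ, 2 ^ 2 * b ^ 2 * s + (s - b ^ 2) ^ 2 = (s + b ^ 2) ^ 2 := by
    intro b s; ring
  exact key _ _

theorem cubeToSphere_mem_sphere {k : ℕ} [hk : k.AtLeastTwo] (t : Fin (k - 1) → I) :
    cubeToSphere k t ∈ sphere (0 : ℝ^k) 1 := by
  simpa using norm_cubeToSphere (by have := hk.prop; omega) t

theorem cubeToSphere_of_mem_boundary {k : ℕ} {t : Fin (k - 1) → I}
    (ht : t ∈ Cube.boundary (Fin (k - 1))) (j : Fin k) :
    cubeToSphere k t j = if (j : ℕ) < k - 1 then 0 else 1 := by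
  obtain ⟨i, hi⟩ := ht
  have hβ : ∏ i, (1 - (2 * (t i : ℝ) - 1) ^ 2) = 0 := by
    apply Finset.prod_eq_zero (Finset.mem_univ i)
    rcases hi with hi | hi <;> rw [hi] <;> norm_num
  have hpos := cubeToSphere_denom_pos (fun i : Fin (k - 1) => 2 * (t i : ℝ) - 1)
  rw [hβ] at hpos
  simp only [cubeToSphere, hβ]
  split_ifs with h
  · simp
  · have h0 : ∑ i, (2 * (t i : ℝ) - 1) ^ 2 ≠ 0 := by simpa using hpos.ne'
    simpa using h0

theorem cubeToSphere_eq_of_mem_boundary {k : ℕ} {t t' : Fin (k - 1) → I}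
    (ht : t ∈ Cube.boundary (Fin (k - 1))) (ht' : t' ∈ Cube.boundary (Fin (k - 1))) :
    cubeToSphere k t = cubeToSphere k t' := by
  ext j
  rw [cubeToSphere_of_mem_boundary ht, cubeToSphere_of_mem_boundary ht']

end CubeToSphere

section Classes

variable {k m : ℕ} [hk : k.AtLeastTwo] {N : Set ℝ^m} {p : N}

/-- The class of a loop, as an element of the coefficient group. -/
def GenLoop.toCoeff (γ : Ω^ (Fin (k - 1)) N p) : CoeffGroup k N p :=
  Additive.ofMul (GenLoop.toGroup γ)

omit hk in
theorem GenLoop.toCoeff_surjective (g : CoeffGroup k N p) :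
    ∃ γ : Ω^ (Fin (k - 1)) N p, g = GenLoop.toCoeff γ := by
  induction g using Quotient.inductionOn with
  | _ γ => exact ⟨γ, rfl⟩

omit hk in
theorem GenLoop.Homotopic.toCoeff_eq {γ γ' : Ω^ (Fin (k - 1)) N p}
    (h : Homotopic γ γ') : GenLoop.toCoeff γ = GenLoop.toCoeff γ' :=
  congrArg Additive.ofMul (Quotient.sound (s := GenLoop.Homotopic.setoid _ p) h)

omit hk in
theorem hasHomotopyClass_iff {φ : ℝ^k → N} {g : CoeffGroup k N p} :
    HasHomotopyClass k N p φ g ↔ ∃ (γ : Ω^ (Fin (k - 1)) N p) (G : C(Fin (k - 1) → I, N)),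
      g = GenLoop.toCoeff γ ∧ (∀ t, G t = φ (cubeToSphere k t)) ∧ FreeHomotopic G γ.1 := by
  constructor
  · rintro ⟨γ, H, hg, h0, h1, hb⟩
    exact ⟨γ, ⟨fun t => H (0, t), by fun_prop⟩, hg, h0,
      FreeHomotopic.of_map H H.continuous (fun t => rfl) h1 hb⟩
  · rintro ⟨γ, G, hg, h0, hG⟩
    obtain ⟨H, hH0, hH1, hHb⟩ := hG.exists_map
    exact ⟨γ, H, hg, fun t => (hH0 t).trans (h0 t), hH1, hHb⟩

theorem GenLoop.toCoeff_eq_of_freeHomotopic [hN : IsAdmissibleTarget k N]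
    {γ γ' : Ω^ (Fin (k - 1)) N p} (h : FreeHomotopic γ.1 γ'.1) : GenLoop.toCoeff γ =
      GenLoop.toCoeff γ' := by
  have h2 := hk.prop
  rcases eq_or_lt_of_le h2 with h2 | h2
  · have : Subsingleton (Fin (k - 1)) := Fin.subsingleton_iff_le_one.2 (by omega)
    obtain ⟨δ, hδ⟩ := GenLoop.exists_conj_of_freeHomotopic h
    have h3 := homotopyGroup_mul_comm k N p ((GenLoop.toGroup δ)⁻¹ * GenLoop.toGroup γ')
      (GenLoop.toGroup δ)
    refine congrArg Additive.ofMul (hδ.trans (h3.trans ?_))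
    rw [← mul_assoc, mul_inv_cancel, one_mul]
  · refine GenLoop.Homotopic.toCoeff_eq (GenLoop.homotopic_of_freeHomotopic ?_ h)
    intro δ
    have := hN.connected 1 (by omega) p
    exact Quotient.exact (this.elim (GenLoop.toGroup δ) (GenLoop.toGroup GenLoop.const))

/-- The free homotopy class of a map of the sphere determines an element of the homotopy group,
since the fundamental group of the target acts trivially. -/
theorem HasHomotopyClass.unique [IsAdmissibleTarget k N] {φ : ℝ^k → N}
    {g g' : CoeffGroup k N p} (h : HasHomotopyClass k N p φ g) (h' : HasHomotopyClass k N p φ g') :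
    g = g' := by
  obtain ⟨γ, G, rfl, hG, hγ⟩ := hasHomotopyClass_iff.1 h
  obtain ⟨γ', G', rfl, hG', hγ'⟩ := hasHomotopyClass_iff.1 h'
  have : G = G' := by ext1 t; rw [hG, hG']
  subst this
  exact GenLoop.toCoeff_eq_of_freeHomotopic (hγ.symm.trans hγ')

theorem IsAdmissibleTarget.joined [hN : IsAdmissibleTarget k N] (p q : N) : Joined q p := by
  have h0 := hN.connected 0 (by have := hk.prop; omega) p
  have h1 : Subsingleton (ZerothHomotopy N) :=
    (HomotopyGroup.pi0EquivZerothHomotopy (X := N) (x := p)).symm.subsingleton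
  exact Quotient.exact (h1.elim (Quotient.mk (pathSetoid N) q) (Quotient.mk (pathSetoid N) p))

theorem continuous_comp_cubeToSphere {Y : Type*} [TopologicalSpace Y]
    {φ : ℝ^k → Y} (hφ : ContinuousOn φ (sphere 0 1)) :
    Continuous fun t => φ (cubeToSphere k t) :=
  hφ.comp_continuous (continuous_cubeToSphere k) cubeToSphere_mem_sphere

theorem exists_hasHomotopyClass [IsAdmissibleTarget k N] (p : N)
    {φ : ℝ^k → N} (hφ : ContinuousOn φ (sphere 0 1)) :
    ∃ g, HasHomotopyClass k N p φ g := by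
  have hz : (fun _ => 0 : Fin (k - 1) → I) ∈ Cube.boundary (Fin (k - 1)) :=
    ⟨Classical.arbitrary _, Or.inl rfl⟩
  obtain ⟨γ, hγ⟩ := FreeHomotopic.exists_genLoop
    (IsAdmissibleTarget.joined (k := k) p (φ (cubeToSphere k fun _ => 0)))
    ⟨_, continuous_comp_cubeToSphere hφ⟩
    (fun t ht => congrArg φ (cubeToSphere_eq_of_mem_boundary ht hz))
  exact ⟨GenLoop.toCoeff γ, hasHomotopyClass_iff.2 ⟨γ, _, rfl, fun t => rfl, hγ⟩⟩

theorem HasHomotopyClass.of_homotopy {φ φ' : ℝ^k → N} {g : CoeffGroup k N p}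
    (h : HasHomotopyClass k N p φ g) (Φ : ℝ → ℝ^k → N)
    (hΦ : ContinuousOn (fun q : ℝ × ℝ^k => Φ q.1 q.2) (Icc 0 1 ×ˢ sphere 0 1))
    (h0 : ∀ w ∈ sphere (0 : ℝ^k) 1, Φ 0 w = φ w) (h1 : ∀ w ∈ sphere (0 : ℝ^k) 1, Φ 1 w = φ' w) :
    HasHomotopyClass k N p φ' g := by
  obtain ⟨γ, G, rfl, hG, hγ⟩ := hasHomotopyClass_iff.1 h
  have hc : Continuous fun q : I × (Fin (k - 1) → I) => Φ q.1 (cubeToSphere k q.2) :=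
    hΦ.comp_continuous (f := fun q : I × (Fin (k - 1) → I) => ((q.1 : ℝ), cubeToSphere k q.2))
      (by fun_prop) fun q => ⟨q.1.2, cubeToSphere_mem_sphere _⟩
  refine hasHomotopyClass_iff.2 ⟨γ, ⟨fun t => φ' (cubeToSphere k t), ?_⟩, rfl, fun t => rfl, ?_⟩
  · have : Continuous fun t : Fin (k - 1) → I => Φ 1 (cubeToSphere k t) :=
      hc.comp (by fun_prop : Continuous fun t : Fin (k - 1) → I => ((1 : I), t))
    refine this.congr fun t => h1 _ (cubeToSphere_mem_sphere t)
  · refine FreeHomotopic.trans (FreeHomotopic.symm ?_) hγ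
    refine FreeHomotopic.of_map _ hc ?_ ?_ ?_
    · intro t
      exact (h0 _ (cubeToSphere_mem_sphere t)).trans (hG t).symm
    · intro t
      exact h1 _ (cubeToSphere_mem_sphere t)
    · intro s t ht t' ht'
      simp only [cubeToSphere_eq_of_mem_boundary ht ht']

theorem HasHomotopyClass.congr {φ φ' : ℝ^k → N} {g : CoeffGroup k N p}
    (h : HasHomotopyClass k N p φ g) (h' : ∀ w ∈ sphere (0 : ℝ^k) 1, φ w = φ' w) :
    HasHomotopyClass k N p φ' g := by
  obtain ⟨γ, G, rfl, hG, hγ⟩ := hasHomotopyClass_iff.1 h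
  exact hasHomotopyClass_iff.2 ⟨γ, G, rfl, fun t =>
    (hG t).trans (h' _ (cubeToSphere_mem_sphere t)), hγ⟩

omit hk in
/-- The class of a loop is the class of every map of the sphere that it represents. -/
theorem GenLoop.hasHomotopyClass {φ : ℝ^k → N} (γ : Ω^ (Fin (k - 1)) N p)
    (h : ∀ t, φ (cubeToSphere k t) = γ t) : HasHomotopyClass k N p φ (GenLoop.toCoeff γ) :=
  hasHomotopyClass_iff.2 ⟨γ, γ.1, rfl, fun t => (h t).symm,
    (GenLoop.Homotopic.refl γ).freeHomotopic⟩

end Classes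

/-! ### The action of linear maps on homotopy classes -/

section LinearAction

variable {k m : ℕ} [hk : k.AtLeastTwo] {N : Set ℝ^m} {p : N}

theorem FreeHomotopic.comp {ι X : Type*} [TopologicalSpace X] {f g : C(ι → I, X)}
    (h : FreeHomotopic f g) (τ : C(ι → I, ι → I))
    (hτ : ∀ t ∈ Cube.boundary ι, τ t ∈ Cube.boundary ι) :
    FreeHomotopic (f.comp τ) (g.comp τ) := by
  obtain ⟨H, h0, h1, hb⟩ := h.exists_map
  exact FreeHomotopic.of_map (fun q => H (q.1, τ q.2)) (by fun_prop) (fun t => h0 _)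
    (fun t => h1 _) fun s t ht t' ht' => hb s _ (hτ t ht) _ (hτ t' ht')

theorem GenLoop.neg_toCoeff [IsAdmissibleTarget k N] (i : Fin (k - 1)) (γ : Ω^ (Fin (k - 1)) N p) :
    -GenLoop.toCoeff γ = GenLoop.toCoeff (GenLoop.symmAt i γ) :=
  congrArg Additive.ofMul (HomotopyGroup.inv_spec (i := i) (p := γ))

theorem GenLoop.add_toCoeff [IsAdmissibleTarget k N] (i : Fin (k - 1))
    (γ γ' : Ω^ (Fin (k - 1)) N p) :
    GenLoop.toCoeff γ + GenLoop.toCoeff γ' = GenLoop.toCoeff (GenLoop.transAt i γ' γ) :=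
  congrArg Additive.ofMul (HomotopyGroup.mul_spec (i := i) (p := γ) (q := γ'))

/-- The unit vector in the direction of `w`. -/
noncomputable def unitVec {E : Type*} [NormedAddCommGroup E] [NormedSpace ℝ E] (w : E) : E :=
  ‖w‖⁻¹ • w

theorem norm_unitVec {E : Type*} [NormedAddCommGroup E] [NormedSpace ℝ E] {w : E} (hw : w ≠ 0) :
    ‖unitVec w‖ = 1 := by
  rw [unitVec, norm_smul, norm_inv, norm_norm, inv_mul_cancel₀ (norm_ne_zero_iff.2 hw)]

theorem unitVec_of_norm_eq_one {E : Type*} [NormedAddCommGroup E] [NormedSpace ℝ E] {w : E}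
    (hw : ‖w‖ = 1) : unitVec w = w := by simp [unitVec, hw]

theorem unitVec_smul {E : Type*} [NormedAddCommGroup E] [NormedSpace ℝ E] {c : ℝ} (hc : 0 < c)
    (w : E) : unitVec (c • w) = unitVec w := by
  rw [unitVec, unitVec, norm_smul, norm_of_nonneg hc.le, mul_inv, smul_smul]
  congr 1
  field_simp

theorem ContinuousOn.unitVec {E Y : Type*} [NormedAddCommGroup E] [NormedSpace ℝ E]
    [TopologicalSpace Y] {f : Y → E} {s : Set Y} (hf : ContinuousOn f s) (h : ∀ y ∈ s, f y ≠ 0) :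
    ContinuousOn (fun y => _root_.unitVec (f y)) s :=
  (hf.norm.inv₀ fun y hy => norm_ne_zero_iff.2 (h y hy)).smul hf

theorem ne_zero_of_mem_unit_sphere' {E : Type*} [NormedAddCommGroup E] {w : E}
    (hw : w ∈ sphere (0 : E) 1) : w ≠ 0 := by
  rintro rfl; simp at hw

/-- Radial projections of homotopic nonvanishing maps induce the same classes. -/
theorem HasHomotopyClass.of_radial_homotopy {φ : ℝ^k → N}
    {g : CoeffGroup k N p} (hφ : ContinuousOn φ (sphere 0 1)) (F : ℝ → ℝ^k → ℝ^k)
    (hF : ContinuousOn (fun q : ℝ × ℝ^k => F q.1 q.2) (Icc 0 1 ×ˢ sphere 0 1))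
    (hF0 : ∀ s ∈ Icc (0 : ℝ) 1, ∀ w ∈ sphere (0 : ℝ^k) 1, F s w ≠ 0)
    (h : HasHomotopyClass k N p (fun w => φ (unitVec (F 0 w))) g) :
    HasHomotopyClass k N p (fun w => φ (unitVec (F 1 w))) g := by
  refine h.of_homotopy (fun s w => φ (unitVec (F s w))) ?_ (fun w _ => rfl) (fun w _ => rfl)
  refine hφ.comp (hF.unitVec fun q hq => hF0 _ hq.1 _ hq.2) ?_
  intro q hq
  simpa using norm_unitVec (hF0 _ hq.1 _ hq.2)

theorem HasHomotopyClass.of_segment {φ : ℝ^k → N}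
    {g : CoeffGroup k N p} (hφ : ContinuousOn φ (sphere 0 1)) (B : ℝ^k →ₗ[ℝ] ℝ^k)
    (hB : ∀ s ∈ Icc (0 : ℝ) 1, ∀ w ≠ 0, w + s • (B w - w) ≠ 0) (h : HasHomotopyClass k N p φ g) :
    HasHomotopyClass k N p (fun w => φ (unitVec (B w))) g := by
  have hBc : Continuous B := B.continuous_of_finiteDimensional
  have := HasHomotopyClass.of_radial_homotopy hφ (fun s w => w + s • (B w - w))
    (by fun_prop) (fun s hs w hw => hB s hs w (ne_zero_of_mem_unit_sphere' hw)) (g := g)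
    (h.congr fun w hw => by
      simp only [zero_smul, add_zero]
      rw [unitVec_of_norm_eq_one (by simpa using hw)])
  simpa using this

/-- The reflection in the `j`-th coordinate hyperplane. -/
noncomputable abbrev coordReflection (j : Fin k) : Matrix (Fin k) (Fin k) ℝ :=
  diagonal (update 1 j (-1))

omit hk in
theorem det_diagonal_update (j : Fin k) (x : ℝ) :
    (diagonal (update 1 j x)).det = x := by
  rw [det_diagonal, Finset.prod_update_of_mem (Finset.mem_univ j)]; simp

omit hk in
theorem diagonal_update_mul (j : Fin k) (x y : ℝ) :
    diagonal (update 1 j x) * diagonal (update 1 j y) =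
      diagonal (update 1 j (x * y)) := by
  rw [Matrix.diagonal_mul_diagonal]
  congr 1
  ext i
  by_cases h : i = j <;> simp [h]

omit hk in
theorem toEuclideanLin_diagonal_apply (D : Fin k → ℝ) (w : ℝ^k) (i : Fin k) :
    toEuclideanLin (diagonal D) w i = D i * w i := by
  simp [toLpLin_apply, Matrix.mulVec_diagonal]

/-- Reflecting a coordinate of the cube reflects the corresponding coordinate of the sphere. -/
theorem HasHomotopyClass.comp_coordReflection_of_lt [IsAdmissibleTarget k N]
    {φ : ℝ^k → N} {g : CoeffGroup k N p} (j : Fin k) (hj : (j : ℕ) < k - 1)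
    (h : HasHomotopyClass k N p φ g) :
    HasHomotopyClass k N p
      (fun w => φ (unitVec (toEuclideanLin (coordReflection j) w))) (-g) := by
  obtain ⟨γ, G, rfl, hG, hγ⟩ := hasHomotopyClass_iff.1 h
  let i : Fin (k - 1) := ⟨j, hj⟩
  let τ : C(Fin (k - 1) → I, Fin (k - 1) → I) := ⟨fun t l => if l = i then σ (t i) else t l, by
      refine continuous_pi fun l => ?_
      split_ifs <;> fun_prop⟩
  have hτ : ∀ t ∈ Cube.boundary (Fin (k - 1)), τ t ∈ Cube.boundary (Fin (k - 1)) := by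
    rintro t ⟨l, hl⟩
    refine ⟨l, ?_⟩
    by_cases hli : l = i
    · subst hli
      simp only [τ, ContinuousMap.coe_mk, if_true]
      rcases hl with hl | hl <;> simp [hl]
    · simpa [τ, hli] using hl
  refine hasHomotopyClass_iff.2 ⟨GenLoop.symmAt i γ, G.comp τ, GenLoop.neg_toCoeff i γ, ?_, ?_⟩
  · intro t
    have key : cubeToSphere k (τ t) = toEuclideanLin (coordReflection j) (cubeToSphere k t) := by
      have hc : ∀ l, 2 * ((τ t l : I) : ℝ) - 1 =
          (if l = i then -1 else 1) * (2 * (t l : ℝ) - 1) := by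
        intro l
        simp only [τ, ContinuousMap.coe_mk]
        split_ifs with hl
        · rw [hl, unitInterval.coe_symm_eq]; ring
        · ring
      have hc2 : ∀ l, (2 * ((τ t l : I) : ℝ) - 1) ^ 2 = (2 * (t l : ℝ) - 1) ^ 2 := by
        intro l
        rw [hc]; split_ifs <;> ring
      ext l
      rw [toEuclideanLin_diagonal_apply]
      simp only [cubeToSphere, hc2]
      by_cases hl : (l : ℕ) < k - 1
      · simp only [dif_pos hl, hc ⟨l, hl⟩]
        by_cases hlj : l = j
        · subst hlj
          simp only [i, if_true, update_self]
          ring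
        · have : (⟨l, hl⟩ : Fin (k - 1)) ≠ i := by
            intro h; apply hlj; ext; simpa [i] using congrArg Fin.val h
          simp only [this, if_false, one_mul, update_of_ne hlj, Pi.one_apply]
      · simp only [dif_neg hl]
        have : l ≠ j := by rintro rfl; exact hl hj
        simp only [one_mul, update_of_ne this, Pi.one_apply]
    rw [ContinuousMap.comp_apply, hG, key, ← key,
      unitVec_of_norm_eq_one (by simpa using cubeToSphere_mem_sphere (τ t))]
  · exact hγ.comp τ hτ

/-- The statement that the matrix `A` acts on homotopy classes by the sign of its determinant. -/
def ActsBySign (k : ℕ) [k.AtLeastTwo] (N : Set ℝ^m)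
    [IsAdmissibleTarget k N] (p : N) (A : Matrix (Fin k) (Fin k) ℝ) : Prop :=
  ∀ (φ : ℝ^k → N) (g : CoeffGroup k N p), ContinuousOn φ (sphere 0 1) → HasHomotopyClass k N p φ g →
    HasHomotopyClass k N p (fun w => φ (unitVec (toEuclideanLin A w)))
      ((SignType.sign A.det : ℤ) • g)

omit hk in
theorem toEuclideanLin_ne_zero {A : Matrix (Fin k) (Fin k) ℝ} (hA : A.det ≠ 0)
    {w : ℝ^k} (hw : w ≠ 0) : toEuclideanLin A w ≠ 0 := by
  intro h
  apply hw
  have h1 : A.mulVec w.ofLp = 0 := by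
    have := congrArg WithLp.ofLp h
    simpa [toLpLin_apply] using this
  have := Matrix.eq_zero_of_mulVec_eq_zero hA h1
  ext i; exact congrFun this i

omit hk in
theorem continuousOn_unitVec_toEuclideanLin {A : Matrix (Fin k) (Fin k) ℝ} (hA : A.det ≠ 0) :
    ContinuousOn (fun w => unitVec (toEuclideanLin A w)) (sphere (0 : ℝ^k) 1) :=
  ((LinearMap.continuous_of_finiteDimensional _).continuousOn).unitVec fun _ hw =>
    toEuclideanLin_ne_zero hA (ne_zero_of_mem_unit_sphere' hw)

omit hk in
theorem unitVec_toEuclideanLin_mem {A : Matrix (Fin k) (Fin k) ℝ} (hA : A.det ≠ 0)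
    {w : ℝ^k} (hw : w ∈ sphere (0 : ℝ^k) 1) :
    unitVec (toEuclideanLin A w) ∈ sphere (0 : ℝ^k) 1 := by
  simpa using norm_unitVec (toEuclideanLin_ne_zero hA (ne_zero_of_mem_unit_sphere' hw))

theorem ActsBySign.mul [IsAdmissibleTarget k N] {A B : Matrix (Fin k) (Fin k) ℝ}
    (hA0 : A.det ≠ 0) (hB0 : B.det ≠ 0) (hA : ActsBySign k N p A) (hB : ActsBySign k N p B) :
    ActsBySign k N p (A * B) := by
  intro φ g hφ h
  have h1 := hA φ g hφ h
  have hc : ContinuousOn (fun w => φ (unitVec (toEuclideanLin A w))) (sphere 0 1) :=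
    hφ.comp (continuousOn_unitVec_toEuclideanLin hA0) fun w hw => unitVec_toEuclideanLin_mem hA0 hw
  have h2 := hB _ _ hc h1
  rw [det_mul, sign_mul, SignType.coe_mul, mul_comm, mul_smul]
  refine h2.congr fun w hw => ?_
  have hBw := toEuclideanLin_ne_zero hB0 (ne_zero_of_mem_unit_sphere' hw)
  have e : toEuclideanLin (A * B) w = toEuclideanLin A (toEuclideanLin B w) := by
    simp [toLpLin_apply, Matrix.mulVec_mulVec]
  rw [e]
  congr 1
  rw [show unitVec (toEuclideanLin B w) = ‖toEuclideanLin B w‖⁻¹ •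
    toEuclideanLin B w from rfl, map_smul,
    unitVec_smul (inv_pos.2 (norm_pos_iff.2 hBw))]

theorem ActsBySign.of_segment [IsAdmissibleTarget k N] {A : Matrix (Fin k) (Fin k) ℝ}
    (hA : ∀ s ∈ Icc (0 : ℝ) 1, (1 + s • (A - 1)).det ≠ 0) (hpos : 0 < A.det) :
    ActsBySign k N p A := by
  intro φ g hφ h
  rw [sign_pos hpos]
  have := HasHomotopyClass.of_segment hφ (toEuclideanLin A) ?_ h
  · simpa using this
  · intro s hs w hw
    have h2 := toEuclideanLin_ne_zero (hA s hs) hw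
    simpa using h2

theorem actsBySign_diagonal_update_pos [IsAdmissibleTarget k N] (j : Fin k) {d : ℝ} (hd : 0 < d) :
    ActsBySign k N p (diagonal (update 1 j d)) := by
  refine ActsBySign.of_segment (fun s hs => ?_) (by rwa [det_diagonal_update])
  have e : 1 + s • (diagonal (update (1 : Fin k → ℝ) j d) - 1) =
      diagonal (update (1 : Fin k → ℝ) j (1 + s * (d - 1))) := by
    rw [← Matrix.diagonal_one, Matrix.diagonal_sub, ← Matrix.diagonal_smul, Matrix.diagonal_add]
    congr 1
    ext i
    by_cases h : i = j <;> simp [h]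
  rw [e, det_diagonal_update]
  rcases eq_or_lt_of_le hs.2 with h3 | h3
  · rw [h3]; intro h; linarith
  · nlinarith [mul_nonneg hs.1 hd.le]

theorem actsBySign_transvection [IsAdmissibleTarget k N] {a b : Fin k} (hab : a ≠ b) (c : ℝ) :
    ActsBySign k N p (transvection a b c) := by
  refine ActsBySign.of_segment (fun s _ => ?_) (by simp [Matrix.det_transvection_of_ne _ _ hab])
  have e : 1 + s • (transvection a b c - 1) = transvection a b (s * c) := by
    simp [transvection, Matrix.smul_single]
  simp [e, Matrix.det_transvection_of_ne _ _ hab]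

open Matrix in
omit hk in
/-- The half-turn in a coordinate plane is the square of a quarter-turn, which is a product of
transvections. -/
theorem halfTurn_eq_transvections {a b : Fin k} (hab : a ≠ b) :
    coordReflection a * coordReflection b =
      (transvection a b (-1) * transvection b a 1 * transvection a b (-1)) *
        (transvection a b (-1) * transvection b a 1 * transvection a b (-1)) := by
  have h1 : transvection a b (-1 : ℝ) * transvection b a 1 * transvection a b (-1) =
      1 - single a a 1 - single b b 1 + single b a 1 - single a b 1 := by
    have h0 : single a b (-1 : ℝ) = -single a b 1 := by ext; simp [single, neg_ite]
    simp only [transvection, h0]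
    simp [mul_add, add_mul, hab.symm]
    abel
  have h2 (j : Fin k) : coordReflection j = 1 - 2 • single j j (1 : ℝ) := by
    ext i l
    by_cases h : i = l
    · subst h
      by_cases hi : i = j
      · subst hi; simp; norm_num
      · simp [hi, Ne.symm hi]
    · by_cases hi : j = i <;> simp_all
  rw [h1, h2, h2]
  simp only [mul_add, add_mul, sub_mul, mul_sub, mul_one, one_mul]
  simp [hab, hab.symm, two_smul, add_mul, mul_add]
  abel

theorem actsBySign_coordReflection [IsAdmissibleTarget k N] (j : Fin k) :
    ActsBySign k N p (coordReflection j) := by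
  have hlt : ∀ a : Fin k, (a : ℕ) < k - 1 → ActsBySign k N p (coordReflection a) :=
    fun a ha φ g hφ h => by
      rw [det_diagonal_update]
      simpa using h.comp_coordReflection_of_lt a ha
  have h2 := hk.prop
  by_cases hj : (j : ℕ) < k - 1
  · exact hlt j hj
  · let a : Fin k := ⟨0, by omega⟩
    have haj : a ≠ j := fun h => by
      have h' : 0 = (j : ℕ) := congrArg Fin.val h
      omega
    have hT := @actsBySign_transvection k m hk N p _
    have hq := ((hT haj (-1)).mul (by simp [haj]) (by simp [haj.symm]) (hT haj.symm 1)).mul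
      (by simp [haj, haj.symm]) (by simp [haj]) (hT haj (-1))
    have h3 := ActsBySign.mul (N := N) (p := p) (by rw [det_diagonal_update]; norm_num)
      (by simp [haj, haj.symm]) (hlt a (by simp only [a]; omega))
      (hq.mul (by simp [haj, haj.symm]) (by simp [haj, haj.symm]) hq)
    rw [← halfTurn_eq_transvections haj, ← mul_assoc, diagonal_update_mul] at h3
    simpa using h3

theorem actsBySign_diagonal_update [IsAdmissibleTarget k N] (j : Fin k) {d : ℝ} (hd : d ≠ 0) :
    ActsBySign k N p (diagonal (update 1 j d)) := by
  rcases lt_or_gt_of_ne hd with hd | hd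
  · have h := ActsBySign.mul (by rw [det_diagonal_update]; norm_num)
      (by rw [det_diagonal_update]; linarith)
      (actsBySign_coordReflection (N := N) (p := p) j)
      (actsBySign_diagonal_update_pos j (neg_pos.2 hd))
    rwa [diagonal_update_mul, neg_one_mul, neg_neg] at h
  · exact actsBySign_diagonal_update_pos j hd

/-- An invertible linear map of `ℝ^k` acts on the homotopy classes of maps of the sphere by the
sign of its determinant: it is a product of transvections, which are joined to the identity, and
of diagonal matrices. -/
theorem actsBySign_of_det_ne_zero [IsAdmissibleTarget k N] {A : Matrix (Fin k) (Fin k) ℝ}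
    (hA : A.det ≠ 0) : ActsBySign k N p A := by
  refine Matrix.diagonal_transvection_induction_of_det_ne_zero _ A hA ?_ ?_ ?_
  · intro D hD
    rw [det_diagonal, Finset.prod_ne_zero_iff] at hD
    have key : ∀ S : Finset (Fin k),
        ActsBySign k N p (diagonal fun i => if i ∈ S then D i else 1) := by
      intro S
      induction S using Finset.induction_on with
      | empty =>
        simp only [Finset.notMem_empty, if_false]
        have e : (diagonal fun _ : Fin k => (1 : ℝ)) = 1 := Matrix.diagonal_one
        rw [e]
        exact ActsBySign.of_segment (by simp) (by simp)
      | insert a S ha ih =>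
        have h := ActsBySign.mul ?_ ?_ ih (actsBySign_diagonal_update a (hD a (Finset.mem_univ a)))
        · rw [Matrix.diagonal_mul_diagonal] at h
          have e : (fun i => if i ∈ insert a S then D i else 1) =
              fun i => (if i ∈ S then D i else 1) * update (1 : Fin k → ℝ) a (D a) i := by
            funext i
            by_cases hi : i = a
            · subst hi; simp [ha]
            · simp [hi]
          rw [e]; exact h
        · rw [det_diagonal, Finset.prod_ne_zero_iff]
          intro i _
          split_ifs
          · exact hD i (Finset.mem_univ i)
          · exact one_ne_zero
        · rw [det_diagonal, Finset.prod_update_of_mem (Finset.mem_univ a)]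
          simpa using hD a (Finset.mem_univ a)
    simpa using key Finset.univ
  · exact fun t => actsBySign_transvection t.hij t.c
  · intro A B hA hB h1 h2
    exact ActsBySign.mul hA hB h1 h2

end LinearAction

/-! ### Additivity of homotopy classes -/

section Additivity

theorem continuousOn_if_le' {Y Z : Type*} [TopologicalSpace Y] [TopologicalSpace Z] {f g : Y → ℝ}
    {F G : Y → Z} {s : Set Y} (hf : Continuous f) (hg : Continuous g)
    (hF : ContinuousOn F (s ∩ {y | f y ≤ g y})) (hG : ContinuousOn G (s ∩ {y | g y ≤ f y}))
    (h : ∀ y ∈ s, f y = g y → F y = G y) :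
    ContinuousOn (fun y => if f y ≤ g y then F y else G y) s := by
  rw [continuousOn_iff_continuous_domRestrict]
  refine continuous_if_le (f := fun y : s => f y) (g := fun y : s => g y)
    (f' := fun y : s => F y) (g' := fun y : s => G y) (by fun_prop) (by fun_prop) ?_ ?_ ?_
  · exact hF.comp continuous_subtype_val.continuousOn fun y hy => ⟨y.2, hy⟩
  · exact hG.comp continuous_subtype_val.continuousOn fun y hy => ⟨y.2, hy⟩
  · exact fun y hy => h y y.2 hy

variable {k m : ℕ} [hk : k.AtLeastTwo] {N : Set ℝ^m} {p : N}

/-- The first coordinate of the cube. -/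
def cubeZero (k : ℕ) [hk : k.AtLeastTwo] : Fin (k - 1) := ⟨0, by have := hk.prop; omega⟩

theorem cubeToSphere_zero (t : Fin (k - 1) → I) :
    cubeToSphere k t 0 = 2 * (∏ i, (1 - (2 * (t i : ℝ) - 1) ^ 2)) * (2 * (t (cubeZero k) : ℝ) - 1) /
      (∑ i, (2 * (t i : ℝ) - 1) ^ 2 + (∏ i, (1 - (2 * (t i : ℝ) - 1) ^ 2)) ^ 2) := by
  have h : ((0 : Fin k) : ℕ) < k - 1 := by
    have := hk.prop
    simp only [Fin.val_zero]
    omega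
  simp only [cubeToSphere, dif_pos h]
  rfl

omit hk in
theorem cube_prod_nonneg (t : Fin (k - 1) → I) : 0 ≤ ∏ i, (1 - (2 * (t i : ℝ) - 1) ^ 2) := by
  refine Finset.prod_nonneg fun i _ => ?_
  have h0 := (t i).2.1
  have h1 := (t i).2.2
  nlinarith

theorem cubeToSphere_zero_nonneg {t : Fin (k - 1) → I} (h : 1 / 2 ≤ (t (cubeZero k) : ℝ)) :
    0 ≤ cubeToSphere k t 0 := by
  rw [cubeToSphere_zero]
  have := cube_prod_nonneg t
  have := cubeToSphere_denom_pos fun i => 2 * (t i : ℝ) - 1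
  have : 0 ≤ 2 * (t (cubeZero k) : ℝ) - 1 := by linarith
  positivity

theorem cubeToSphere_zero_nonpos {t : Fin (k - 1) → I} (h : (t (cubeZero k) : ℝ) ≤ 1 / 2) :
    cubeToSphere k t 0 ≤ 0 := by
  rw [cubeToSphere_zero]
  have h1 := cube_prod_nonneg t
  have h2 := cubeToSphere_denom_pos fun i => 2 * (t i : ℝ) - 1
  have h3 : 2 * (t (cubeZero k) : ℝ) - 1 ≤ 0 := by linarith
  exact div_nonpos_of_nonpos_of_nonneg (mul_nonpos_of_nonneg_of_nonpos (by linarith) h3) h2.le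

theorem cubeToSphere_zero_of_mem_boundary {t : Fin (k - 1) → I}
    (ht : t ∈ Cube.boundary (Fin (k - 1))) : cubeToSphere k t 0 = 0 := by
  rw [cubeToSphere_of_mem_boundary ht, if_pos]
  have := hk.prop
  simp only [Fin.val_zero]
  omega

/-- The loop that a map of the sphere induces if it maps the equator `w₀ = 0` to the base point. -/
noncomputable def sphereLoop (φ : ℝ^k → N) (hφ : ContinuousOn φ (sphere 0 1))
    (hp : ∀ w ∈ sphere (0 : ℝ^k) 1, w 0 = 0 → φ w = p) :
    Ω^ (Fin (k - 1)) N p :=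
  ⟨⟨fun t => φ (cubeToSphere k t), continuous_comp_cubeToSphere hφ⟩, fun t ht =>
    hp _ (cubeToSphere_mem_sphere t) (cubeToSphere_zero_of_mem_boundary ht)⟩

/-- If a loop is trivial on the faces `t₀ = 0`, `t₀ = 1` after the reparametrisation `α` of the
first coordinate and along the segment from the identity to `α`, this does not change its class. -/
theorem GenLoop.exists_homotopic_reparam {ι X : Type*} [TopologicalSpace X] [DecidableEq ι] {x : X}
    (i : ι) (γ : Ω^ ι X x) (α : I → I) (hα : Continuous α)
    (h0 : ∀ t : ι → I, ∀ s, t i = lerpI s 0 (α 0) → γ t = x)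
    (h1 : ∀ t : ι → I, ∀ s, t i = lerpI s 1 (α 1) → γ t = x) :
    ∃ γ' : Ω^ ι X x, (∀ t, γ' t = γ (update t i (α (t i)))) ∧ Homotopic γ γ' := by
  let H : I × (ι → I) → X :=
    fun q => γ (update q.2 i (lerpI q.1 (q.2 i) (α (q.2 i))))
  have hH : Continuous H := γ.1.continuous.comp (by fun_prop)
  have hb : ∀ s, ∀ t ∈ Cube.boundary ι, H (s, t) = x := by
    rintro s t ⟨j, hj⟩
    by_cases hji : j = i
    · subst hji
      rcases hj with hj | hj
      · exact h0 _ s (by simp [hj])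
      · exact h1 _ s (by simp [hj])
    · exact γ.2 _ ⟨j, by simpa [hji] using hj⟩
  exact ⟨⟨⟨fun t => H (1, t), by fun_prop⟩, hb 1⟩, fun t => congrArg γ (by simp),
    GenLoop.homotopic_of_map H hH (fun t => by simp [H]) (fun t => rfl) hb⟩

theorem coe_lerpI (s a b : I) : (lerpI s a b : ℝ) = (1 - s) * a + s * b := rfl

/-- Additivity: a map that is glued from two maps of complementary hemispheres, both of which are
constant on the other hemisphere, represents the sum of their classes. -/
theorem HasHomotopyClass.add [IsAdmissibleTarget k N] {φ ψ φ' : ℝ^k → N}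
    (hφ : ContinuousOn φ (sphere 0 1)) (hψ : ContinuousOn ψ (sphere 0 1))
    (hφp : ∀ w ∈ sphere (0 : ℝ^k) 1, 0 ≤ w 0 → φ w = p)
    (hψp : ∀ w ∈ sphere (0 : ℝ^k) 1, w 0 ≤ 0 → ψ w = p)
    (h1 : ∀ w ∈ sphere (0 : ℝ^k) 1, w 0 ≤ 0 → φ' w = φ w)
    (h2 : ∀ w ∈ sphere (0 : ℝ^k) 1, 0 ≤ w 0 → φ' w = ψ w)
    {a b : CoeffGroup k N p} (ha : HasHomotopyClass k N p φ a) (hb : HasHomotopyClass k N p ψ b) :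
    HasHomotopyClass k N p φ' (a + b) := by
  let i := cubeZero k
  let F : Ω^ (Fin (k - 1)) N p := sphereLoop φ hφ fun w hw h => hφp w hw h.ge
  let G : Ω^ (Fin (k - 1)) N p := sphereLoop ψ hψ fun w hw h => hψp w hw h.le
  have eF : a = GenLoop.toCoeff F := ha.unique (GenLoop.hasHomotopyClass F fun t => rfl)
  have eG : b = GenLoop.toCoeff G := hb.unique (GenLoop.hasHomotopyClass G fun t => rfl)
  have hFp : ∀ t, 1 / 2 ≤ (t i : ℝ) → F t = p := fun t ht =>
    hφp _ (cubeToSphere_mem_sphere t) (cubeToSphere_zero_nonneg ht)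
  have hGp : ∀ t, (t i : ℝ) ≤ 1 / 2 → G t = p := fun t ht =>
    hψp _ (cubeToSphere_mem_sphere t) (cubeToSphere_zero_nonpos ht)
  let α : I → I := fun x => clampI (x / 2)
  let β : I → I := fun x => clampI ((1 + x) / 2)
  have hα : Continuous α := by fun_prop
  have hβ : Continuous β := by fun_prop
  have cα : ∀ x : I, (α x : ℝ) = x / 2 := fun x =>
    clampI_of_mem (by linarith [x.2.1]) (by linarith [x.2.2])
  have cβ : ∀ x : I, (β x : ℝ) = (1 + x) / 2 := fun x =>
    clampI_of_mem (by linarith [x.2.1]) (by linarith [x.2.2])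
  obtain ⟨A, hAF, hA⟩ := GenLoop.exists_homotopic_reparam i F α hα
    (fun t s h => F.2 _ ⟨i, Or.inl (by rw [h]; ext; simp [coe_lerpI, cα])⟩) fun t s h => by
      apply hFp
      rw [h, coe_lerpI, cα]
      have := s.2.2
      simp; linarith
  obtain ⟨B, hBG, hB⟩ := GenLoop.exists_homotopic_reparam i G β hβ (fun t s h => by
      apply hGp
      rw [h, coe_lerpI, cβ]
      have := s.2.2
      simp; linarith) fun t s h => G.2 _ ⟨i, Or.inr (by rw [h]; ext; simp [coe_lerpI, cβ])⟩
  rw [eF, eG, GenLoop.Homotopic.toCoeff_eq hA, GenLoop.Homotopic.toCoeff_eq hB, add_comm,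
    GenLoop.add_toCoeff i]
  apply GenLoop.hasHomotopyClass
  intro t
  have h0 := (t i).2.1
  have h3 := (t i).2.2
  have hx := cubeToSphere_mem_sphere t
  simp only [GenLoop.transAt, GenLoop.coe_copy]
  split_ifs with ht
  · refine (h1 _ hx (cubeToSphere_zero_nonpos ht)).trans ((hAF _).trans (congrArg F ?_)).symm
    have : (α (projIcc 0 1 zero_le_one (2 * (t i : ℝ)))) = t i := by
      ext; rw [cα, projIcc_of_mem zero_le_one ⟨by linarith, by linarith⟩]; simp
    simp [this]
  · rw [not_le] at ht
    refine (h2 _ hx (cubeToSphere_zero_nonneg ht.le)).trans ((hBG _).trans (congrArg G ?_)).symm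
    have : (β (projIcc 0 1 zero_le_one (2 * (t i : ℝ) - 1))) = t i := by
      ext; rw [cβ, projIcc_of_mem zero_le_one ⟨by linarith, by linarith⟩]; simp
    simp [this]

end Additivity

/-! ### Insertion of a bubble into a cap of the sphere -/

section Caps

variable {k m : ℕ} [hk : k.AtLeastTwo] {N : Set ℝ^m} {p : N}

/-- The first vector of the standard basis of `ℝ^k`. -/
noncomputable def poleVec (k : ℕ) [k.AtLeastTwo] : ℝ^k := EuclideanSpace.single 0 1

/-- The component of a vector of `ℝ^k` that is orthogonal to the first basis vector. -/
noncomputable def tailVec (w : ℝ^k) : ℝ^k := w - w 0 • poleVec k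

@[simp] theorem poleVec_zero : poleVec k 0 = 1 := by simp [poleVec]
theorem poleVec_of_ne {i : Fin k} (h : i ≠ 0) : poleVec k i = 0 := by simp [poleVec, h]
@[simp] theorem norm_poleVec : ‖poleVec k‖ = 1 := by simp [poleVec]
@[simp] theorem tailVec_zero (w : ℝ^k) : tailVec w 0 = 0 := by simp [tailVec]
theorem tailVec_of_ne (w : ℝ^k) {i : Fin k} (h : i ≠ 0) :
    tailVec w i = w i := by simp [tailVec, poleVec_of_ne h]

theorem tailVec_smul (c : ℝ) (w : ℝ^k) : tailVec (c • w) = c • tailVec w := by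
  simp [tailVec, smul_sub, mul_smul]

theorem tailVec_add (v w : ℝ^k) : tailVec (v + w) = tailVec v + tailVec w := by
  simp [tailVec, add_smul]; abel

@[simp] theorem tailVec_poleVec : tailVec (poleVec k) = 0 := by simp [tailVec]
@[simp] theorem tailVec_tailVec (w : ℝ^k) : tailVec (tailVec w) = tailVec w := by
  rw [tailVec, tailVec_zero, zero_smul, sub_zero]

theorem eq_pole_add_tail (w : ℝ^k) : w = w 0 • poleVec k + tailVec w := by
  simp [tailVec]

@[fun_prop]
theorem continuous_tailVec : Continuous (tailVec : ℝ^k → _) := by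
  unfold tailVec; fun_prop

theorem norm_sq_eq_pole_add_tail (w : ℝ^k) : ‖w‖ ^ 2 = w 0 ^ 2 + ‖tailVec w‖ ^ 2 := by
  rw [EuclideanSpace.norm_sq_eq, EuclideanSpace.norm_sq_eq,
    ← add_sum_erase _ _ (Finset.mem_univ (0 : Fin k)),
    ← add_sum_erase _ (fun i => ‖tailVec w i‖ ^ 2) (Finset.mem_univ (0 : Fin k))]
  have : ∀ i ∈ Finset.univ.erase (0 : Fin k), ‖tailVec w i‖ ^ 2 = ‖w i‖ ^ 2 := fun i hi => by
    rw [tailVec_of_ne w (Finset.ne_of_mem_erase hi)]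
  rw [sum_congr rfl this]
  simp

theorem norm_tailVec_le (w : ℝ^k) : ‖tailVec w‖ ≤ ‖w‖ := by
  have := norm_sq_eq_pole_add_tail w
  exact le_of_sq_le_sq (by nlinarith [sq_nonneg (w 0)]) (norm_nonneg _)

/-- The map of the sphere that is constant on the hemisphere `w₀ ≤ 0` and is given by `f` on the
hemisphere `w₀ ≥ 0`, which is identified with the unit ball orthogonal to the pole. -/
noncomputable def capFill (p : N) (f : ℝ^k → N) (w : ℝ^k) : N :=
  if 0 ≤ w 0 then f ((w 0 + ‖tailVec w‖)⁻¹ • tailVec w) else p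

theorem pole_add_tail_pos {w : ℝ^k} (hw : w ∈ sphere (0 : ℝ^k) 1) (h0 : 0 ≤ w 0) :
    0 < w 0 + ‖tailVec w‖ := by
  have h := norm_sq_eq_pole_add_tail w
  rw [show ‖w‖ = 1 by simpa using hw] at h
  by_contra hcon
  have h1 := norm_nonneg (tailVec w)
  have h2 : w 0 = 0 := by linarith
  have h3 : ‖tailVec w‖ = 0 := by linarith
  rw [h2, h3] at h
  norm_num at h

theorem capFill_of_nonpos {f : ℝ^k → N} (hf : ∀ ζ, 1 ≤ ‖tailVec ζ‖ → f ζ = p) {w : ℝ^k}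
    (hw : w ∈ sphere (0 : ℝ^k) 1) (h0 : w 0 ≤ 0) :
    capFill p f w = p := by
  unfold capFill
  split_ifs with h
  · have h1 : w 0 = 0 := le_antisymm h0 h
    have h2 := pole_add_tail_pos hw h
    apply hf
    rw [tailVec_smul, tailVec_tailVec, norm_smul, norm_inv, norm_of_nonneg h2.le, h1, zero_add]
    rw [h1, zero_add] at h2
    rw [inv_mul_cancel₀ h2.ne']
  · rfl

theorem continuousOn_capFill {f : ℝ^k → N} (hfc : Continuous f)
    (hf : ∀ ζ, 1 ≤ ‖tailVec ζ‖ → f ζ = p) :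
    ContinuousOn (capFill p f) (sphere 0 1) := by
  unfold capFill
  refine continuousOn_if_le' continuous_const (by fun_prop) ?_ continuousOn_const ?_
  · refine hfc.comp_continuousOn ?_
    have h1 : Continuous fun w : ℝ^k => w 0 + ‖tailVec w‖ := by fun_prop
    exact ContinuousOn.smul (h1.continuousOn.inv₀ fun w hw => (pole_add_tail_pos hw.1 hw.2).ne')
      continuous_tailVec.continuousOn
  · intro w hw h0
    have := capFill_of_nonpos hf hw h0.ge
    rwa [capFill, if_pos h0.le] at this

/-- The homotopy that expands a cap around the pole to the hemisphere `w₀ ≥ 0`. -/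
noncomputable def capExpand (c s : ℝ) (w : ℝ^k) : ℝ^k :=
  (w 0 + s * ‖tailVec w‖) • poleVec k + (1 - s + s / c) • tailVec w

theorem capExpand_pole (c s : ℝ) (w : ℝ^k) :
    capExpand c s w 0 = w 0 + s * ‖tailVec w‖ := by simp [capExpand]

theorem tailVec_capExpand (c s : ℝ) (w : ℝ^k) :
    tailVec (capExpand c s w) = (1 - s + s / c) • tailVec w := by
  simp [capExpand, tailVec_add, tailVec_smul]

theorem capExpand_ne_zero {c s : ℝ} (hc : 0 < c) (hs : s ∈ Icc (0 : ℝ) 1)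
    {w : ℝ^k} (hw : w ≠ 0) : capExpand c s w ≠ 0 := by
  intro h
  have h1 : (1 - s + s / c) • tailVec w = 0 := by
    rw [← tailVec_capExpand, h]; simp [tailVec]
  have hpos : 0 < 1 - s + s / c := by
    rcases eq_or_lt_of_le hs.2 with h2 | h2
    · rw [h2]; simp [hc]
    · have := div_nonneg hs.1 hc.le
      linarith
  have h3 : tailVec w = 0 := (smul_eq_zero.1 h1).resolve_left hpos.ne'
  have h4 : w 0 = 0 := by
    have := capExpand_pole c s w
    rw [h, h3] at this
    simpa using this.symm
  apply hw
  rw [eq_pole_add_tail w, h3, h4]; simp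

/-- Inserting a bubble of class `g` into a cap of the sphere adds `g` to the homotopy class.  On the
cap, with its coordinate `ζ = c w' / w₀`, the new map is the bubble `f` where `‖ζ‖ ≤ 1`, and where
`1 ≤ ‖ζ‖ ≤ 3` it slides from the given map to the base point along `Γ`. -/
theorem HasHomotopyClass.insert_bubble [IsAdmissibleTarget k N]
    {φ φ' f : ℝ^k → N} {c : ℝ} (hc : 0 < c)
    (hφ : ContinuousOn φ (sphere 0 1)) (hφ' : ContinuousOn φ' (sphere 0 1))
    (hfc : Continuous f) (hf : ∀ ζ, 1 ≤ ‖tailVec ζ‖ → f ζ = p)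
    {a g : CoeffGroup k N p} (hg : HasHomotopyClass k N p (capFill p f) g) (Γ : ℝ^k → ℝ → N)
    (hΓ : ContinuousOn (fun q : ℝ^k × ℝ => Γ q.1 q.2)
      ((sphere 0 1 ∩ {w | c * ‖tailVec w‖ ≤ 3 * w 0}) ×ˢ Icc 0 2))
    (hΓ0 : ∀ w ∈ sphere (0 : ℝ^k) 1, c * ‖tailVec w‖ ≤ 3 * w 0 → Γ w 0 = φ w)
    (hΓ2 : ∀ w ∈ sphere (0 : ℝ^k) 1, c * ‖tailVec w‖ ≤ 3 * w 0 → Γ w 2 = p)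
    (hoff : ∀ w ∈ sphere (0 : ℝ^k) 1, 3 * w 0 < c * ‖tailVec w‖ → φ' w = φ w)
    (hmid : ∀ w ∈ sphere (0 : ℝ^k) 1, c * ‖tailVec w‖ ≤ 3 * w 0 →
      w 0 ≤ c * ‖tailVec w‖ → φ' w = Γ w (min 2 (3 - c * ‖tailVec w‖ / w 0)))
    (hin : ∀ w ∈ sphere (0 : ℝ^k) 1, c * ‖tailVec w‖ ≤ w 0 → φ' w = f ((c / w 0) • tailVec w))
    (h : HasHomotopyClass k N p φ a) : HasHomotopyClass k N p φ' (a + g) := by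
  have hpos : ∀ w ∈ sphere (0 : ℝ^k) 1, c * ‖tailVec w‖ ≤ 3 * w 0 → 0 < w 0 := by
    intro w hw h1
    have h2 := mul_nonneg hc.le (norm_nonneg (tailVec w))
    have h3 := pole_add_tail_pos hw (by linarith)
    by_contra h4
    have h5 : w 0 = 0 := by linarith
    rw [h5] at h1 h3
    have : 0 < c * ‖tailVec w‖ := mul_pos hc (by linarith)
    linarith
  let Φ : ℝ → ℝ^k → N := fun s w =>
    if c * ‖tailVec w‖ ≤ 3 * w 0 then Γ w (s * min 2 (3 - c * ‖tailVec w‖ / w 0)) else φ w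
  have hmem : ∀ s ∈ Icc (0 : ℝ) 1, ∀ w ∈ sphere (0 : ℝ^k) 1,
      c * ‖tailVec w‖ ≤ 3 * w 0 → s * min 2 (3 - c * ‖tailVec w‖ / w 0) ∈ Icc (0 : ℝ) 2 := by
    intro s hs w hw h1
    have h2 : c * ‖tailVec w‖ / w 0 ≤ 3 := by rwa [div_le_iff₀ (hpos w hw h1)]
    have h3 : 0 ≤ min 2 (3 - c * ‖tailVec w‖ / w 0) := le_min (by norm_num) (by linarith)
    exact ⟨mul_nonneg hs.1 h3, (mul_le_of_le_one_left h3 hs.2).trans (min_le_left _ _)⟩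
  have hΦ : ContinuousOn (fun q : ℝ × ℝ^k => Φ q.1 q.2) (Icc 0 1 ×ˢ sphere 0 1) := by
    refine continuousOn_if_le' (by fun_prop) (by fun_prop) ?_ ?_ ?_
    · refine hΓ.comp (f := fun q : ℝ × ℝ^k =>
        (q.2, q.1 * min 2 (3 - c * ‖tailVec q.2‖ / q.2 0))) ?_ ?_
      · refine ContinuousOn.prodMk (by fun_prop) (ContinuousOn.mul (by fun_prop) ?_)
        refine ContinuousOn.inf continuousOn_const (ContinuousOn.sub continuousOn_const ?_)
        exact ContinuousOn.div (by fun_prop) (by fun_prop) fun q hq => (hpos _ hq.1.2 hq.2).ne'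
      · intro q hq
        exact ⟨⟨hq.1.2, hq.2⟩, hmem _ hq.1.1 _ hq.1.2 hq.2⟩
    · exact hφ.comp (by fun_prop) fun q hq => hq.1.2
    · intro q hq h1
      have h2 := hpos _ hq.2 h1.le
      have h3 : c * ‖tailVec q.2‖ / q.2 0 = 3 := by rw [h1]; field_simp
      rw [h3]
      norm_num
      exact hΓ0 _ hq.2 h1.le
  have h1 : HasHomotopyClass k N p (Φ 1) a := by
    refine h.of_homotopy Φ hΦ ?_ fun w _ => rfl
    intro w hw
    simp only [Φ, zero_mul]
    split_ifs with h1
    · exact hΓ0 w hw h1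
    · rfl
  have hΦ1 : ContinuousOn (Φ 1) (sphere 0 1) :=
    hΦ.comp (f := fun w => ((1 : ℝ), w)) (by fun_prop) fun w hw => ⟨by simp, hw⟩
  have hcont : ContinuousOn (fun q : ℝ × ℝ^k => capExpand c q.1 q.2) (Icc 0 1 ×ˢ sphere 0 1) := by
    unfold capExpand; fun_prop
  have hzero : ∀ w : ℝ^k, capExpand c 0 w = w := fun w => by
    simp only [capExpand, zero_mul, add_zero, sub_zero, zero_div, one_smul]
    exact (eq_pole_add_tail w).symm
  have hne : ∀ s ∈ Icc (0 : ℝ) 1, ∀ w ∈ sphere (0 : ℝ^k) 1, capExpand c s w ≠ 0 := fun s hs w hw =>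
    capExpand_ne_zero hc hs (ne_zero_of_mem_unit_sphere' hw)
  let U : ℝ^k → ℝ^k := fun w => unitVec (capExpand c 1 w)
  have h2 : HasHomotopyClass k N p (fun w => Φ 1 (U w)) a := by
    refine HasHomotopyClass.of_radial_homotopy hΦ1 (capExpand c) hcont hne (h1.congr ?_)
    intro w hw
    rw [hzero, unitVec_of_norm_eq_one (by simpa using hw)]
  have hsph : ∀ w ∈ sphere (0 : ℝ^k) 1,
      U w ∈ sphere (0 : ℝ^k) 1 := fun w hw => by
    simpa using norm_unitVec (hne 1 (by simp) w hw)
  have hucont : ContinuousOn U (sphere (0 : ℝ^k) 1) := by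
    refine ContinuousOn.unitVec ?_ (hne 1 (by simp))
    unfold capExpand; fun_prop
  -- the coordinates of the expanded points
  have hu : ∀ w ∈ sphere (0 : ℝ^k) 1, ∃ r : ℝ, 0 < r ∧ U w 0 = r * (w 0 + ‖tailVec w‖) ∧
      tailVec (U w) = (r / c) • tailVec w ∧ c * ‖tailVec (U w)‖ = r * ‖tailVec w‖ := by
    intro w hw
    have hr : 0 < ‖capExpand c 1 w‖⁻¹ := inv_pos.2 (norm_pos_iff.2 (hne 1 (by simp) w hw))
    have ht : tailVec (U w) = (‖capExpand c 1 w‖⁻¹ / c) • tailVec w := by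
      simp only [U, unitVec, tailVec_smul, tailVec_capExpand, smul_smul]
      congr 1; ring
    refine ⟨_, hr, by simp [U, unitVec, capExpand_pole], ht, ?_⟩
    rw [ht, norm_smul, norm_of_nonneg (by positivity)]
    field_simp
  have hle : ∀ w ∈ sphere (0 : ℝ^k) 1, 0 ≤ w 0 → 0 < U w 0 ∧ c * ‖tailVec (U w)‖ ≤ U w 0 := by
    intro w hw hw0
    obtain ⟨r, hr, e1, -, e3⟩ := hu w hw
    have hp := pole_add_tail_pos hw hw0
    rw [e1, e3]
    exact ⟨by positivity, by nlinarith [norm_nonneg (tailVec w)]⟩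
  have h3 : HasHomotopyClass k N p (fun w => φ' (U w)) (a + g) := by
    refine HasHomotopyClass.add (φ := fun w => Φ 1 (U w))
      (hΦ1.comp hucont hsph) (continuousOn_capFill hfc hf) ?_ ?_ ?_ ?_ h2 hg
    · intro w hw hw0
      obtain ⟨hp, hle⟩ := hle w hw hw0
      simp only [Φ]
      rw [if_pos (by linarith), min_eq_left, one_mul]
      · exact hΓ2 _ (hsph w hw) (by linarith)
      · linarith [(div_le_one hp).2 hle]
    · exact fun w hw hw0 => capFill_of_nonpos hf hw hw0
    · intro w hw hw0
      obtain ⟨r, hr, e1, -, e3⟩ := hu w hw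
      simp only [Φ]
      split_ifs with hcap
      · rw [one_mul]
        refine hmid _ (hsph w hw) hcap ?_
        rw [e1, e3]
        nlinarith
      · exact hoff _ (hsph w hw) (not_le.1 hcap)
    · intro w hw hw0
      obtain ⟨r, hr, e1, e2, e3⟩ := hu w hw
      have hp := pole_add_tail_pos hw hw0
      rw [hin _ (hsph w hw) (hle w hw hw0).2, capFill, if_pos hw0, e1, e2, smul_smul]
      congr 2
      field_simp
  have h4 := HasHomotopyClass.of_radial_homotopy hφ' (fun s => capExpand c (1 - s)) (g := a + g)
    (by unfold capExpand; fun_prop)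
    (fun s hs w hw => hne (1 - s) ⟨by linarith [hs.2], by linarith [hs.1]⟩ w hw)
    (by simpa using h3)
  refine h4.congr fun w hw => ?_
  simp only [sub_self]
  rw [hzero, unitVec_of_norm_eq_one (by simpa using hw)]

end Caps

/-! ### Local Lipschitz constants -/

section LipNear

variable {X Y Z : Type*} [PseudoMetricSpace X] [PseudoMetricSpace Y] [PseudoMetricSpace Z]

/-- The map `f` is Lipschitz with constant `K` in a neighbourhood of `x`. -/
def LipNear (K : ℝ) (f : X → Y) (x : X) : Prop :=
  ∃ V ∈ 𝓝 x, ∀ y ∈ V, ∀ z ∈ V, dist (f y) (f z) ≤ K * dist y z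

theorem LipNear.mono {K L : ℝ} {f : X → Y} {x : X} (h : LipNear K f x) (hKL : K ≤ L) :
    LipNear L f x := by
  obtain ⟨V, hV, h⟩ := h
  exact ⟨V, hV, fun y hy z hz => (h y hy z hz).trans (by gcongr)⟩

theorem LipNear.congr {K : ℝ} {f g : X → Y} {x : X} (h : LipNear K f x) (hfg : f =ᶠ[𝓝 x] g) :
    LipNear K g x := by
  obtain ⟨V, hV, h⟩ := h
  refine ⟨V ∩ {y | f y = g y}, inter_mem hV hfg, fun y hy z hz => ?_⟩
  rw [← hy.2, ← hz.2]
  exact h y hy.1 z hz.1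

theorem LipNear.eventually {K : ℝ} {f : X → Y} {x : X} (h : LipNear K f x) :
    ∀ᶠ y in 𝓝 x, LipNear K f y := by
  obtain ⟨V, hV, h⟩ := h
  filter_upwards [eventually_mem_nhds_iff.2 hV] with y hy
  exact ⟨V, hy, h⟩

theorem LipNear.continuousAt {K : ℝ} {f : X → Y} {x : X} (h : LipNear K f x) :
    ContinuousAt f x := by
  obtain ⟨V, hV, h⟩ := h
  rw [ContinuousAt, tendsto_iff_dist_tendsto_zero]
  have h1 : Tendsto (fun y => K * dist y x) (𝓝 x) (𝓝 0) := by
    have : Continuous fun y => K * dist y x := by fun_prop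
    simpa using this.tendsto x
  refine squeeze_zero' (Eventually.of_forall fun y => dist_nonneg) ?_ h1
  filter_upwards [hV] with y hy using h y hy x (mem_of_mem_nhds hV)

theorem LipNear.comp {K L : ℝ} (hK : 0 ≤ K) {g : Y → Z} {f : X → Y} {x : X}
    (hg : LipNear K g (f x)) (hf : LipNear L f x) : LipNear (K * L) (fun y => g (f y)) x := by
  have hc := hf.continuousAt
  obtain ⟨V, hV, hg⟩ := hg
  obtain ⟨W, hW, hf⟩ := hf
  refine ⟨f ⁻¹' V ∩ W, inter_mem (hc hV) hW, fun y hy z hz => ?_⟩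
  rw [mul_assoc]
  exact (hg _ hy.1 _ hz.1).trans (mul_le_mul_of_nonneg_left (hf _ hy.2 _ hz.2) hK)

theorem LipschitzWith.lipNear {K : NNReal} {f : X → Y} (h : LipschitzWith K f) (x : X) :
    LipNear K f x := ⟨univ, univ_mem, fun y _ z _ => h.dist_le_mul y z⟩

theorem lipNear_const {K : ℝ} (hK : 0 ≤ K) (c : Y) (x : X) : LipNear K (fun _ : X => c) x :=
  ⟨univ, univ_mem, fun y _ z _ => by rw [dist_self]; positivity⟩

theorem LipNear.prodMk {K L : ℝ} {f : X → Y} {g : X → Z} {x : X} (hf : LipNear K f x)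
    (hg : LipNear L g x) : LipNear (max K L) (fun y => (f y, g y)) x := by
  obtain ⟨V, hV, hf⟩ := hf
  obtain ⟨W, hW, hg⟩ := hg
  refine ⟨V ∩ W, inter_mem hV hW, fun y hy z hz => ?_⟩
  rw [Prod.dist_eq]
  refine max_le ((hf y hy.1 z hz.1).trans ?_) ((hg y hy.2 z hz.2).trans ?_)
  · gcongr; exact le_max_left _ _
  · gcongr; exact le_max_right _ _

/-- Local Lipschitz constants are locally uniform, hence uniform on compact sets. -/
theorem IsCompact.exists_lipNear {f : X → Y} {s : Set X} (hs : IsCompact s)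
    (h : ∀ x ∈ s, ∃ K, LipNear K f x) : ∃ K, 0 ≤ K ∧ ∀ x ∈ s, LipNear K f x := by
  refine hs.induction_on (p := fun t => ∃ K, 0 ≤ K ∧ ∀ x ∈ t, LipNear K f x) ⟨0, le_rfl, by simp⟩
    ?_ ?_ ?_
  · rintro s t hst ⟨K, hK, h'⟩
    exact ⟨K, hK, fun x hx => h' x (hst hx)⟩
  · rintro s t ⟨K, hK, hs⟩ ⟨L, hL, ht⟩
    refine ⟨max K L, hK.trans (le_max_left _ _), ?_⟩
    rintro x (hx | hx)
    · exact (hs x hx).mono (le_max_left _ _)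
    · exact (ht x hx).mono (le_max_right _ _)
  · intro x hx
    obtain ⟨K, hK⟩ := h x hx
    exact ⟨_, mem_nhdsWithin_of_mem_nhds (hK.mono (le_max_left K 0)).eventually, max K 0,
      le_max_right _ _, fun y hy => hy⟩

theorem LipNear.exists_nonneg {f : X → Y} {x : X} (h : ∃ K, LipNear K f x) :
    ∃ K, 0 ≤ K ∧ LipNear K f x := by
  obtain ⟨K, hK⟩ := h
  exact ⟨max K 0, le_max_right _ _, hK.mono (le_max_left _ _)⟩

theorem LipNear.exists_comp {g : Y → Z} {f : X → Y} {x : X} (hg : ∃ K, LipNear K g (f x))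
    (hf : ∃ K, LipNear K f x) : ∃ K, LipNear K (fun y => g (f y)) x := by
  obtain ⟨K, hK, hg⟩ := LipNear.exists_nonneg hg
  obtain ⟨L, hf⟩ := hf
  exact ⟨_, hg.comp hK hf⟩

theorem LipNear.exists_prodMk {f : X → Y} {g : X → Z} {x : X} (hf : ∃ K, LipNear K f x)
    (hg : ∃ K, LipNear K g x) : ∃ K, LipNear K (fun y => (f y, g y)) x := by
  obtain ⟨K, hf⟩ := hf
  obtain ⟨L, hg⟩ := hg
  exact ⟨_, hf.prodMk hg⟩

theorem ContDiffAt.exists_lipNear {E F : Type*} [NormedAddCommGroup E] [NormedSpace ℝ E]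
    [NormedAddCommGroup F] [NormedSpace ℝ F] {f : E → F} {x : E} (h : ContDiffAt ℝ 1 f x) :
    ∃ K, LipNear K f x := by
  obtain ⟨K, t, ht, hK⟩ := h.exists_lipschitzOnWith
  exact ⟨K, t, ht, fun y hy z hz => hK.dist_le_mul y hy z hz⟩

end LipNear

/-! ### A Lipschitz retraction onto a compact submanifold -/

section Retraction

variable {m : ℕ}

/-- Near `x`, the map `R` is a Lipschitz retraction to `N`. -/
def IsRetractionNear (N : Set ℝ^m) (R : ℝ^m → ℝ^m) (x : ℝ^m) : Prop :=
  (∃ K, LipNear K R x) ∧ ∀ᶠ y in 𝓝 x, R y ∈ N ∧ (y ∈ N → R y = y)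

theorem IsRetractionNear.eventually {N : Set ℝ^m} {R : ℝ^m → ℝ^m} {x : ℝ^m}
    (h : IsRetractionNear N R x) : ∀ᶠ y in 𝓝 x, IsRetractionNear N R y := by
  obtain ⟨⟨K, hK⟩, h⟩ := h
  filter_upwards [hK.eventually, h.eventually_nhds] with y h1 h2 using ⟨⟨K, h1⟩, h2⟩

/-- A retraction near a part of a submanifold is glued with the retraction that a chart at `q`
yields; the interpolation of the two takes place in the chart. -/
theorem IsRetractionNear.extend {N : Set ℝ^m} {q : ℝ^m} (hN : IsSmoothSubmanifold N) (hq : q ∈ N) :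
    ∃ r > 0, ∀ R, ∃ R', ∀ x ∈ N, IsRetractionNear N R x ∨ x ∈ ball q r →
      IsRetractionNear N R' x := by
  obtain ⟨Φ, W, hqΦ, hΦ, hΨ, hW⟩ := hN q hq
  let P : ℝ^m → ℝ^m := fun v => W.starProjection v
  have hPc : ContDiff ℝ 1 P := W.starProjection.contDiff
  have hPs : ∀ v ∈ W, P v = v := fun v hv => W.starProjection_eq_self_iff.2 hv
  obtain ⟨ε, hε, hball⟩ := Metric.mem_nhds_iff.1 (Φ.open_source.mem_nhds hqΦ)
  refine ⟨ε / 3, by positivity, fun R => ?_⟩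
  let b : ContDiffBump q := ⟨ε / 3, 2 * (ε / 3), by positivity, by linarith⟩
  let G : ℝ^m → ℝ^m := fun x => P (b x • Φ x + (1 - b x) • Φ (R x))
  let R' : ℝ^m → ℝ^m := fun x => if dist x q < 2 * (ε / 3) then Φ.symm (G x) else R x
  have hΦL : ∀ x ∈ Φ.source, ∃ K, LipNear K Φ x := fun x hx =>
    ((hΦ.contDiffAt (Φ.open_source.mem_nhds hx)).of_le (by norm_num)).exists_lipNear
  have main : ∀ x ∈ N, x ∈ ball q ε → (∃ K, LipNear K G x) → (∀ᶠ y in 𝓝 x, y ∈ N → G y = Φ y) →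
      (∀ᶠ y in 𝓝 x, R' y = Φ.symm (G y)) → IsRetractionNear N R' x := by
    rintro x hxN hxb ⟨K, hK⟩ hG hR'
    have hxt : G x ∈ Φ.target := by
      rw [hG.self_of_nhds hxN]
      exact Φ.map_source (hball hxb)
    obtain ⟨L, hL⟩ := LipNear.exists_comp
      ((hΨ.contDiffAt (Φ.open_target.mem_nhds hxt)).of_le (by norm_num)).exists_lipNear ⟨K, hK⟩
    refine ⟨⟨L, hL.congr (hR'.mono fun y h => h.symm)⟩, ?_⟩
    filter_upwards [hG, hR', hK.continuousAt.eventually_mem (Φ.open_target.mem_nhds hxt),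
      isOpen_ball.mem_nhds hxb] with y h1 h2 h3 h4
    rw [h2]
    refine ⟨?_, fun hy => by rw [h1 hy, Φ.left_inv (hball h4)]⟩
    rw [hW _ (Φ.map_target h3), Φ.right_inv h3]
    exact W.starProjection_apply_mem _
  refine ⟨R', fun x hxN hx => ?_⟩
  by_cases hxr : x ∈ ball q (ε / 3)
  · have hxb : x ∈ ball q ε := ball_subset_ball (by linarith) hxr
    have hG : ∀ᶠ y in 𝓝 x, P (Φ y) = G y := by
      filter_upwards [isOpen_ball.mem_nhds hxr] with y hy
      simp only [G, b.one_of_mem_closedBall (ball_subset_closedBall hy)]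
      simp
    obtain ⟨K, hK⟩ := LipNear.exists_comp hPc.contDiffAt.exists_lipNear (hΦL x (hball hxb))
    refine main x hxN hxb ⟨K, hK.congr hG⟩ ?_ ?_
    · filter_upwards [hG, isOpen_ball.mem_nhds hxb] with y h1 h2 hy
      rw [← h1, hPs _ ((hW y (hball h2)).1 hy)]
    · filter_upwards [isOpen_ball.mem_nhds hxr] with y hy
      exact if_pos ((mem_ball.1 hy).trans (by linarith))
  obtain ⟨⟨K, hK⟩, hR⟩ := hx.resolve_right hxr
  by_cases hxb : x ∈ ball q ε
  · have hRx := hR.self_of_nhds.2 hxN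
    have hs : ContDiff ℝ 1 (fun a : (ℝ × ℝ^m) × ℝ^m => P (a.1.1 • a.1.2 + (1 - a.1.1) • a.2)) :=
      hPc.comp (by fun_prop)
    refine main x hxN hxb (LipNear.exists_comp (f := fun x => ((b x, Φ x), Φ (R x)))
      hs.contDiffAt.exists_lipNear (LipNear.exists_prodMk (LipNear.exists_prodMk
        b.contDiffAt.exists_lipNear (hΦL x (hball hxb)))
        (LipNear.exists_comp (hΦL _ (hRx.symm ▸ hball hxb)) ⟨K, hK⟩))) ?_ ?_
    · filter_upwards [hR, isOpen_ball.mem_nhds hxb] with y h1 h2 hy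
      simp only [G, h1.2 hy, ← add_smul, add_sub_cancel, one_smul]
      exact hPs _ ((hW y (hball h2)).1 hy)
    · filter_upwards [hR, hK.continuousAt.eventually_mem
        (Φ.open_source.mem_nhds (hRx.symm ▸ hball hxb))] with y h1 h2
      simp only [R']
      split_ifs with h
      · rfl
      · simp only [G, b.zero_of_le_dist (not_lt.1 h), zero_smul, sub_zero, one_smul, zero_add]
        rw [hPs _ ((hW _ h2).1 h1.1), Φ.left_inv h2]
  · have hR' : ∀ᶠ y in 𝓝 x, R y = R' y := by
      have : 2 * (ε / 3) < dist x q := by linarith [not_lt.1 (mem_ball.not.1 hxb)]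
      filter_upwards [(continuous_id.dist continuous_const).continuousAt.eventually
        (lt_mem_nhds this)] with y hy using (if_neg hy.not_gt).symm
    exact ⟨⟨K, hK.congr hR'⟩, by filter_upwards [hR, hR'] with y h1 h2 using h2 ▸ h1⟩

theorem exists_isRetractionNear {N : Set ℝ^m} (hN : IsSmoothSubmanifold N) (hNc : IsCompact N) :
    ∃ R, ∀ x ∈ N, IsRetractionNear N R x := by
  choose! r hr hext using fun q (hq : q ∈ N) => IsRetractionNear.extend hN hq
  obtain ⟨t, htN, ht⟩ := hNc.elim_nhds_subcover (fun q => ball q (r q))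
    fun q hq => ball_mem_nhds q (hr q hq)
  have key : ∀ s : Finset ℝ^m, (∀ q ∈ s, q ∈ N) →
      ∃ R, ∀ x ∈ N, ∀ q ∈ s, x ∈ ball q (r q) → IsRetractionNear N R x := by
    classical
    intro s
    induction s using Finset.induction_on with
    | empty => simp
    | insert q s hqs ih =>
      intro h
      obtain ⟨R, hR⟩ := ih fun q' hq' => h q' (Finset.mem_insert_of_mem hq')
      obtain ⟨R', hR'⟩ := hext q (h q (Finset.mem_insert_self _ _)) R
      refine ⟨R', fun x hx q' hq' hxq => hR' x hx ?_⟩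
      rcases Finset.mem_insert.1 hq' with rfl | hq'
      exacts [Or.inr hxq, Or.inl (hR x hx q' hq' hxq)]
  obtain ⟨R, hR⟩ := key t htN
  refine ⟨R, fun x hx => ?_⟩
  obtain ⟨q, hq, hxq⟩ := mem_iUnion₂.1 (ht hx)
  exact hR x hx q hq hxq

/-- Continuous maps that are uniformly close to a map to `N` can be retracted to `N`. -/
theorem exists_thickening_retraction {N : Set ℝ^m}
    (hN : IsSmoothSubmanifold N) (hNc : IsCompact N) :
    ∃ ε > 0, ∃ R : ℝ^m → ℝ^m,
      (∀ q ∈ N, R q = q) ∧ ∀ x, ∀ q ∈ N, dist x q < ε → R x ∈ N ∧ ∃ K, LipNear K R x := by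
  obtain ⟨R, hR⟩ := exists_isRetractionNear hN hNc
  obtain ⟨ε, hε, h⟩ := hNc.exists_thickening_subset_open
    (isOpen_iff_mem_nhds.2 fun x (hx : IsRetractionNear N R x) => hx.eventually) hR
  refine ⟨ε, hε, R, fun q hq => (hR q hq).2.self_of_nhds.2 hq, fun x q hq hx => ?_⟩
  have hx : IsRetractionNear N R x := h (mem_thickening_iff.2 ⟨q, hq, hx⟩)
  exact ⟨hx.2.self_of_nhds.1, hx.1⟩

end Retraction

/-! ### Lipschitz bubbles and Lipschitz paths -/

section Bubbles

variable {k m : ℕ} [hk : k.AtLeastTwo] {N : Set ℝ^m} {p : N}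

/-- The coordinates of `ℝ^k` other than the one of the pole. -/
def succCoord (i : Fin (k - 1)) : Fin k := ⟨i + 1, by omega⟩

omit hk in
theorem sum_eq_zero_add_succ [hk : k.AtLeastTwo] (f : Fin k → ℝ) :
    ∑ j, f j = f 0 + ∑ i : Fin (k - 1), f (succCoord i) := by
  have h : k = (k - 1) + 1 := by have := hk.prop; omega
  rw [← Equiv.sum_comp (finCongr h.symm), Fin.sum_univ_succ]
  rfl

/-- The dilation of the cube from its centre by the factor `2 * c`, clamped to the cube. -/
noncomputable def cubeDilate {ι : Type*} (c : ℝ) (t : ι → I) : ι → I :=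
  fun i => clampI (1 / 2 + c * (2 * t i - 1))

theorem GenLoop.homotopic_dilate {ι X : Type*} [TopologicalSpace X] {x : X} {γ γ' : Ω^ ι X x}
    {κ : (ι → I) → ℝ} (hκ : Continuous κ) (h1 : ∀ t, 1 / 2 ≤ κ t)
    (h : ∀ t, γ' t = γ (cubeDilate (κ t) t)) : Homotopic γ γ' := by
  refine GenLoop.homotopic_of_map
    (fun q => γ (cubeDilate ((1 - q.1) / 2 + q.1 * κ q.2) q.2)) ?_ (fun t => ?_) (fun t => ?_) ?_
  · refine γ.1.continuous.comp (continuous_pi fun i => continuous_clampI.comp ?_)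
    fun_prop
  · congr 1
    funext i
    rw [cubeDilate, ← clampI_coe (t i)]
    congr 1
    simp
    ring
  · simp [h]
  · rintro s t ⟨i, hi⟩
    have h2 : 1 / 2 ≤ (1 - (s : ℝ)) / 2 + s * κ t := by nlinarith [s.2.1, h1 t]
    refine γ.2 _ ⟨i, ?_⟩
    rcases hi with hi | hi
    · exact Or.inl (clampI_of_le (by simp only [hi, Icc.coe_zero]; linarith))
    · exact Or.inr (clampI_of_ge (by simp only [hi, Icc.coe_one]; linarith))

theorem exists_le_abs_coord {v : Fin (k - 1) → ℝ} {r : ℝ} (hr : 0 < r) (h : r ^ 2 ≤ ∑ i, v i ^ 2) :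
    ∃ i, r ≤ k * |v i| := by
  have hk2 : (2 : ℝ) ≤ k := by exact_mod_cast hk.prop
  by_contra! hcon
  have h1 : ∀ i ∈ Finset.univ, v i ^ 2 ≤ (r / k) ^ 2 := fun i _ => by
    rw [← sq_abs]
    have : |v i| ≤ r / k := by rw [le_div_iff₀ (by positivity), mul_comm]; exact (hcon i).le
    gcongr
  have h2 := Finset.sum_le_card_nsmul _ _ _ h1
  rw [Finset.card_univ, Fintype.card_fin, nsmul_eq_mul, Nat.cast_sub (by linarith [hk.prop])] at h2
  have h3 := h.trans h2
  have h4 : 0 < r ^ 2 / k ^ 2 := by positivity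
  have h5 : r ^ 2 = k ^ 2 * (r ^ 2 / k ^ 2) := by field_simp
  rw [div_pow] at h3
  push_cast at h3
  nlinarith

theorem clampI_mem_boundary {ι : Type*} {t : ι → I} {i : ι} {x : ℝ} (hx : 1 / 2 ≤ |x|)
    (h : t i = clampI (1 / 2 + x)) : t ∈ Cube.boundary ι := by
  refine ⟨i, ?_⟩
  rcases le_abs.1 hx with h' | h'
  · exact Or.inr (h.trans (clampI_of_ge (by linarith)))
  · exact Or.inl (h.trans (clampI_of_le (by linarith)))

/-- The map of `ℝ^k` that is given by the loop `γ` in the coordinates orthogonal to the pole. -/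
noncomputable def loopBubble (γ : Ω^ (Fin (k - 1)) N p) (ζ : ℝ^k) : N :=
  γ fun i => clampI (1 / 2 + k * ζ (succCoord i))

omit hk in
theorem continuous_loopBubble (γ : Ω^ (Fin (k - 1)) N p) : Continuous (loopBubble γ) :=
  γ.1.continuous.comp (continuous_pi fun i => continuous_clampI.comp (by fun_prop))

theorem loopBubble_tailVec (γ : Ω^ (Fin (k - 1)) N p) (ζ : ℝ^k) :
    loopBubble γ (tailVec ζ) = loopBubble γ ζ := by
  simp only [loopBubble]
  congr! 5 with i
  exact tailVec_of_ne _ fun h => by simpa [succCoord] using congrArg Fin.val h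

theorem loopBubble_eq (γ : Ω^ (Fin (k - 1)) N p) {ζ : ℝ^k}
    (h : 1 / 2 ≤ ‖tailVec ζ‖) : loopBubble γ ζ = p := by
  rw [← loopBubble_tailVec]
  obtain ⟨i, hi⟩ := exists_le_abs_coord (v := fun i => tailVec ζ (succCoord i)) (r := 1 / 2)
    (by norm_num) (by
      have h2 := EuclideanSpace.norm_sq_eq (tailVec ζ)
      rw [sum_eq_zero_add_succ, tailVec_zero] at h2
      simp only [norm_eq_abs, sq_abs] at h2
      nlinarith)
  exact γ.2 _ (clampI_mem_boundary (i := i) (by rwa [abs_mul, Nat.abs_cast]) rfl)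

/-- The rotation `(w₀, …, w_{k-1}) ↦ (-w_{k-1}, w₀, …, w_{k-2})`. -/
noncomputable def poleRotation (k : ℕ) [k.AtLeastTwo] : Matrix (Fin k) (Fin k) ℝ :=
  of fun i j => if i = 0 then if (j : ℕ) = k - 1 then -1 else 0
    else if (i : ℕ) = j + 1 then 1 else 0

theorem poleRotation_zero (w : ℝ^k) :
    toEuclideanLin (poleRotation k) w 0 = -w ⟨k - 1, by have := hk.prop; omega⟩ := by
  simp only [toLpLin_apply, mulVec, dotProduct, poleRotation, of_apply, if_true]
  rw [Finset.sum_eq_single_of_mem ⟨k - 1, by have := hk.prop; omega⟩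
    (Finset.mem_univ _) fun j _ hj => by
    rw [if_neg fun h => hj (Fin.ext h), zero_mul], if_pos rfl, neg_one_mul]

theorem poleRotation_succ (w : ℝ^k) (i : Fin (k - 1)) :
    toEuclideanLin (poleRotation k) w (succCoord i) = w ⟨i, by omega⟩ := by
  have h0 : succCoord i ≠ 0 := fun h => by simpa [succCoord] using congrArg Fin.val h
  have h : ∀ j : Fin k, ((succCoord i : Fin k) : ℕ) = j + 1 ↔ j = ⟨i, by omega⟩ := fun j =>
    ⟨fun h => Fin.ext (Nat.succ.inj h).symm, fun h => by rw [h]; rfl⟩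
  simp [toLpLin_apply, mulVec, dotProduct, poleRotation, h0, h]

theorem norm_poleRotation (w : ℝ^k) : ‖toEuclideanLin (poleRotation k) w‖ = ‖w‖ := by
  have h : ∀ f : Fin k → ℝ, ∑ j, f j =
      ∑ i : Fin (k - 1), f ⟨i, by omega⟩ + f ⟨k - 1, by have := hk.prop; omega⟩ := fun f => by
    have h : k = (k - 1) + 1 := by have := hk.prop; omega
    rw [← Equiv.sum_comp (finCongr h.symm), Fin.sum_univ_castSucc]
    rfl
  rw [EuclideanSpace.norm_eq, EuclideanSpace.norm_eq, h fun j => ‖w j‖ ^ 2, sum_eq_zero_add_succ,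
    poleRotation_zero, norm_neg, add_comm]
  simp only [poleRotation_succ]

/-- After a rotation of the sphere, the bubble of a loop `γ` has the class of `γ`: composed with the
quotient map from the cube, it is a dilation of the cube followed by `γ`. -/
theorem hasHomotopyClass_loopBubble [IsAdmissibleTarget k N] (γ : Ω^ (Fin (k - 1)) N p) :
    HasHomotopyClass k N p
      (fun w => capFill p (loopBubble γ) (toEuclideanLin (poleRotation k) w))
      (GenLoop.toCoeff γ) := by
  have hk2 : (2 : ℝ) ≤ k := by exact_mod_cast hk.prop
  set W := fun t => toEuclideanLin (poleRotation k) (cubeToSphere k t) with hWdef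
  let β : (Fin (k - 1) → I) → ℝ := fun t => ∏ i, (1 - (2 * (t i : ℝ) - 1) ^ 2)
  let r : (Fin (k - 1) → I) → ℝ := fun t => √(∑ i, (2 * (t i : ℝ) - 1) ^ 2)
  have hβc : Continuous β := by fun_prop
  have hrc : Continuous r := by fun_prop
  have hr2 : ∀ t, r t ^ 2 = ∑ i, (2 * (t i : ℝ) - 1) ^ 2 := fun t =>
    Real.sq_sqrt (sum_nonneg fun i _ => sq_nonneg _)
  have hr0 : ∀ t, 0 ≤ r t := fun t => Real.sqrt_nonneg _
  have hβ0 : ∀ t, 0 ≤ β t := fun t => cube_prod_nonneg t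
  have hc1 : ∀ (t : Fin (k - 1) → I) i, (2 * (t i : ℝ) - 1) ^ 2 ≤ 1 := fun t i => by
    nlinarith [(t i).2.1, (t i).2.2]
  have hβ1 : ∀ t, β t ≤ 1 := fun t =>
    Finset.prod_le_one (fun i _ => sub_nonneg.2 (hc1 t i)) fun i _ => by
      linarith [sq_nonneg (2 * (t i : ℝ) - 1)]
  have hrk : ∀ t, r t ≤ k := fun t => by
    refine Real.sqrt_le_iff.2 ⟨by positivity,
      (Finset.sum_le_card_nsmul _ _ 1 fun i _ => hc1 t i).trans ?_⟩
    rw [Finset.card_univ, Fintype.card_fin, nsmul_eq_mul, mul_one, Nat.cast_sub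
      (by linarith [hk.prop])]
    push_cast
    nlinarith
  have hden : ∀ t, 0 < r t ^ 2 + β t ^ 2 := fun t => hr2 t ▸ cubeToSphere_denom_pos _
  have hden' : ∀ t, r t ≤ β t → 0 < β t ^ 2 - r t ^ 2 + 2 * β t * r t := fun t h => by
    nlinarith [hden t, mul_le_mul_of_nonneg_right h (hr0 t)]
  have hr1 : ∀ t, β t ≤ r t → 0 < r t := fun t h => (hr0 t).lt_of_ne fun h0 => by
    have h1 : β t = 0 := le_antisymm (h0 ▸ h) (hβ0 t)
    have := hden t
    rw [← h0, h1] at this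
    norm_num at this
  have hW0 : ∀ t, W t 0 = (β t ^ 2 - r t ^ 2) / (r t ^ 2 + β t ^ 2) := fun t => by
    simp only [hWdef]
    rw [poleRotation_zero, hr2]
    simp only [cubeToSphere, lt_irrefl, dite_false, β]
    ring
  have hWi : ∀ t i, W t (succCoord i) = 2 * β t * (2 * t i - 1) / (r t ^ 2 + β t ^ 2) :=
    fun t i => by
    simp only [hWdef]
    rw [poleRotation_succ, hr2]
    simp only [cubeToSphere, i.2, dite_true, Fin.eta, β]
  have hW1 : ∀ t, W t ∈ sphere (0 : ℝ^k) 1 := fun t => by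
    rw [mem_sphere_zero_iff_norm, norm_poleRotation]
    exact mem_sphere_zero_iff_norm.1 (cubeToSphere_mem_sphere t)
  have hWt : ∀ t, ‖tailVec (W t)‖ = 2 * β t * r t / (r t ^ 2 + β t ^ 2) := fun t => by
    have h := norm_sq_eq_pole_add_tail (W t)
    rw [mem_sphere_zero_iff_norm.1 (hW1 t), hW0] at h
    have h1 : 0 ≤ 2 * β t * r t / (r t ^ 2 + β t ^ 2) :=
      div_nonneg (by have := hβ0 t; have := hr0 t; positivity) (hden t).le
    rw [← sq_eq_sq₀ (norm_nonneg _) h1]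
    have hd := (hden t).ne'
    rw [one_pow, ← sub_eq_iff_eq_add'] at h
    rw [← h]
    field_simp
    ring
  -- in the coordinates of the cube, the map is a dilation followed by `γ`
  let κ : (Fin (k - 1) → I) → ℝ := fun t =>
    if r t ≤ β t then k * (2 * β t) / (β t ^ 2 - r t ^ 2 + 2 * β t * r t) else k / r t
  have hκc : Continuous κ := continuousOn_univ.1 <| by
    refine continuousOn_if_le' hrc hβc (ContinuousOn.div (by fun_prop) (by fun_prop) fun t ht =>
      (hden' t ht.2).ne') (ContinuousOn.div (by fun_prop) (by fun_prop) fun t ht =>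
      (hr1 t ht.2).ne') fun t _ h => ?_
    have := hr1 t h.ge
    rw [← h]
    field_simp
    ring
  have hκ : ∀ t, 1 / 2 ≤ κ t := fun t => by
    simp only [κ]
    split_ifs with h
    · rw [le_div_iff₀ (hden' t h)]
      nlinarith [hβ0 t, hr0 t, hβ1 t, mul_nonneg (hβ0 t) (sub_nonneg.2 (hβ1 t)),
        mul_nonneg (hβ0 t) (sub_nonneg.2 hk2), mul_le_mul_of_nonneg_left h (hβ0 t)]
    · rw [le_div_iff₀ (hr1 t (not_le.1 h).le)]
      linarith [hrk t, hr0 t]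
  have hval : ∀ t, capFill p (loopBubble γ) (W t) = γ (cubeDilate (κ t) t) := fun t => by
    have hd := hden t
    rw [capFill, hW0]
    by_cases h : r t ≤ β t
    · rw [if_pos (div_nonneg (by nlinarith [hr0 t]) hd.le), loopBubble]
      congr 1
      funext i
      have h0 : succCoord i ≠ 0 := fun h => by simpa [succCoord] using congrArg Fin.val h
      rw [cubeDilate, PiLp.smul_apply, smul_eq_mul, tailVec_of_ne _ h0, hWt, hWi]
      simp only [κ, if_pos h]
      have h1 := (hden' t h).ne'
      have h2 := hd.ne'
      congr 2
      rw [← add_div, inv_div]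
      field_simp
    · rw [if_neg (not_le.2 (div_neg_of_neg_of_pos (by nlinarith [hβ0 t, not_le.1 h]) hd))]
      have h1 := hr1 t (not_le.1 h).le
      obtain ⟨i, hi⟩ := exists_le_abs_coord h1 (hr2 t).le
      refine (γ.2 _ (clampI_mem_boundary (i := i) ?_ rfl)).symm
      simp only [κ, if_neg h]
      rw [div_mul_eq_mul_div, abs_div, abs_mul, Nat.abs_cast, abs_of_pos h1, le_div_iff₀ h1]
      linarith
  let γ' : Ω^ (Fin (k - 1)) N p := ⟨⟨fun t => γ (cubeDilate (κ t) t), γ.1.continuous.comp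
    (continuous_pi fun i => continuous_clampI.comp (by fun_prop))⟩, fun t ⟨i, hi⟩ => by
      refine γ.2 _ (clampI_mem_boundary (i := i) ?_ rfl)
      rw [abs_mul, show |2 * (t i : ℝ) - 1| = 1 by rcases hi with hi | hi <;> rw [hi] <;> norm_num,
        mul_one]
      exact (hκ t).trans (le_abs_self _)⟩
  rw [(GenLoop.homotopic_dilate (γ' := γ') hκc hκ fun t => rfl).toCoeff_eq]
  exact GenLoop.hasHomotopyClass γ' hval

theorem sign_mul_sign_self {a : ℝ} (ha : a ≠ 0) :
    (SignType.sign a : ℤ) * (SignType.sign a : ℤ) = 1 := by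
  rcases lt_or_gt_of_ne ha with h | h <;> simp [h]

/-- Every class is represented by a continuous bubble. -/
theorem exists_continuous_bubble [IsAdmissibleTarget k N] (g : CoeffGroup k N p) :
    ∃ f : ℝ^k → N, Continuous f ∧ (∀ ζ, f (tailVec ζ) = f ζ) ∧
      (∀ ζ, 1 / 2 ≤ ‖tailVec ζ‖ → f ζ = p) ∧ HasHomotopyClass k N p (capFill p f) g := by
  have hdet : (poleRotation k).det ≠ 0 := fun h => by
    obtain ⟨v, hv, h0⟩ := Matrix.exists_mulVec_eq_zero_iff.2 h
    have := norm_poleRotation (WithLp.toLp 2 v)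
    rw [toLpLin_apply, h0, WithLp.toLp_zero, norm_zero] at this
    exact hv (by simpa using this.symm)
  obtain ⟨γ, hγ⟩ := GenLoop.toCoeff_surjective ((SignType.sign (poleRotation k).det : ℤ) • g)
  have hp := fun ζ (h : 1 ≤ ‖tailVec ζ‖) => loopBubble_eq γ (ζ := ζ) (by linarith)
  refine ⟨loopBubble γ, continuous_loopBubble γ, loopBubble_tailVec γ, fun ζ => loopBubble_eq γ, ?_⟩
  have hc := continuousOn_capFill (continuous_loopBubble γ) hp
  obtain ⟨a, ha⟩ := exists_hasHomotopyClass p hc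
  have h1 := actsBySign_of_det_ne_zero hdet _ _ hc ha
  have h2 := h1.unique ((hasHomotopyClass_loopBubble γ).congr fun w hw => by
    rw [unitVec_of_norm_eq_one]
    rw [norm_poleRotation]
    exact mem_sphere_zero_iff_norm.1 hw)
  rw [← hγ] at h2
  have h4 := congrArg (fun x => (SignType.sign (poleRotation k).det : ℤ) • x) h2
  simp only [smul_smul, sign_mul_sign_self hdet, one_smul] at h4
  rwa [h4] at ha

/-- A continuous map into the target is homotopic to a locally Lipschitz map, relative to a closed
set near which it is constant or, more generally, smooth. -/
theorem exists_lipschitz_approx [hN : IsAdmissibleTarget k N] {E : Type*} [NormedAddCommGroup E]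
    [NormedSpace ℝ E] [FiniteDimensional ℝ E] {e : E → N} (he : Continuous e) {S U : Set E}
    (hS : IsClosed S) (hU : IsOpen U) (hSU : S ⊆ U) (hsm : ∀ x ∈ U, ∃ q : N, ∀ᶠ y in 𝓝 x, e y = q) :
    ∃ F : ℝ → E → N, Continuous (fun q : ℝ × E => F q.1 q.2) ∧ F 0 = e ∧
      (∀ x, ∃ K, LipNear K (F 1) x) ∧ ∀ s, ∀ x ∈ S, F s x = e x := by
  obtain ⟨ε, hε, R, hRN, hR⟩ := exists_thickening_retraction hN.isSmoothSubmanifold hN.isCompact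
  obtain ⟨h, hh, hclose, heq, -⟩ := Continuous.exists_contDiff_approx_and_eqOn 1
    (f := fun t => (e t : ℝ^m)) (ε := fun _ => ε) (by fun_prop)
    continuous_const (fun _ => hε) hS (hU.mem_nhdsSet.2 hSU) fun x hx => by
      obtain ⟨q, hq⟩ := hsm x hx
      exact ((contDiffAt_const (c := (q : ℝ^m))).congr_of_eventuallyEq
        (hq.mono fun y hy => congrArg Subtype.val hy)).contDiffWithinAt
  let F : ℝ → E → ℝ^m := fun s x =>
    (e x : ℝ^m) + (clampI s : ℝ) • (h x - e x)
  have hF : ∀ s x, dist (F s x) (e x) < ε := fun s x => by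
    rw [dist_self_add_left, norm_smul, norm_of_nonneg (clampI s).2.1, ← dist_eq_norm]
    exact (mul_le_of_le_one_left dist_nonneg (clampI s).2.2).trans_lt (hclose x)
  have hFc : Continuous fun q : ℝ × E => F q.1 q.2 := by
    have h1 := hh.continuous
    have h2 : Continuous fun q : ℝ × E => (clampI q.1 : ℝ) :=
      continuous_subtype_val.comp (continuous_clampI.comp continuous_fst)
    fun_prop
  refine ⟨fun s x => ⟨R (F s x), (hR _ _ (e x).2 (hF s x)).1⟩, ?_, funext fun x => Subtype.ext ?_,
    fun x => ?_, fun s x hx => Subtype.ext ?_⟩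
  · refine continuous_induced_rng.2 (continuous_iff_continuousAt.2 fun q => ?_)
    obtain ⟨K, hK⟩ := (hR _ _ (e q.2).2 (hF q.1 q.2)).2
    exact ContinuousAt.comp (g := R) hK.continuousAt hFc.continuousAt
  · simp only [F, clampI_of_le le_rfl, Icc.coe_zero, zero_smul, add_zero]
    exact hRN _ (e x).2
  · have h1 : F 1 = h := funext fun x => by
      simp only [F, clampI_of_ge le_rfl, Icc.coe_one, one_smul, add_sub_cancel]
    obtain ⟨K, V, hV, hK⟩ := LipNear.exists_comp (hR _ _ (e x).2 (hF 1 x)).2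
      (h1 ▸ hh.contDiffAt.exists_lipNear)
    exact ⟨K, V, hV, hK⟩
  · simp only [F, heq hx, sub_self, smul_zero, add_zero]
    exact hRN _ (e x).2

omit hk in
theorem lipNear_tailVec [k.AtLeastTwo] (ζ : ℝ^k) : LipNear 1 (tailVec : ℝ^k → _) ζ := by
  have : LipschitzWith 1 (tailVec : ℝ^k → _) := LipschitzWith.of_dist_le_mul fun a b => by
      have h : tailVec a - tailVec b = tailVec (a - b) := by simp [tailVec, sub_smul]; abel
      rw [dist_eq_norm, dist_eq_norm, NNReal.coe_one, one_mul, h]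
      exact norm_tailVec_le _
  exact this.lipNear ζ

/-- Every class is represented by a Lipschitz bubble: a Lipschitz map `f` of the hyperplane
orthogonal to the pole that is constant off the unit ball. -/
theorem exists_lipschitz_bubble [hN : IsAdmissibleTarget k N] (g : CoeffGroup k N p) :
    ∃ (f : ℝ^k → N) (K : ℝ), 0 ≤ K ∧ (∀ ζ, LipNear K f ζ) ∧
      (∀ ζ, 1 ≤ ‖tailVec ζ‖ → f ζ = p) ∧ HasHomotopyClass k N p (capFill p f) g := by
  obtain ⟨f₀, hf₀, hf₀t, hf₀p, hcl⟩ := exists_continuous_bubble g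
  have hn : Continuous fun ζ : ℝ^k => ‖tailVec ζ‖ := by fun_prop
  have hnear : ∀ ζ ∈ {ζ : ℝ^k | 1 / 2 < ‖tailVec ζ‖},
      ∀ᶠ ξ in 𝓝 ζ, 1 / 2 < ‖tailVec ξ‖ := fun ζ hζ => hn.continuousAt.eventually (lt_mem_nhds hζ)
  obtain ⟨F, hF, hF0, hF1, hFS⟩ := exists_lipschitz_approx (k := k) hf₀
    (isClosed_le continuous_const hn) (isOpen_lt continuous_const hn)
    (fun ζ (hζ : 1 ≤ ‖tailVec ζ‖) => (show (1 : ℝ) / 2 < _ by linarith))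
    fun ζ hζ => ⟨p, (hnear ζ hζ).mono fun ξ hξ => hf₀p ξ hξ.le⟩
  have hFp : ∀ s, ∀ ζ, 1 ≤ ‖tailVec ζ‖ → F s (tailVec ζ) = p := fun s ζ hζ => by
    rw [hFS s _ (show 1 ≤ ‖tailVec (tailVec ζ)‖ by rwa [tailVec_tailVec]), hf₀t]
    exact hf₀p ζ (by linarith)
  obtain ⟨K, hK0, hK⟩ := (isCompact_closedBall (0 : ℝ^k) 2).exists_lipNear
    (f := F 1) fun ζ _ => hF1 ζ
  refine ⟨fun ζ => F 1 (tailVec ζ), K, hK0, fun ζ => ?_, hFp 1, ?_⟩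
  · by_cases hζ : ‖tailVec ζ‖ ≤ 1
    · simpa using LipNear.comp hK0 (hK (tailVec ζ) (by simp; linarith)) (lipNear_tailVec ζ)
    · refine (lipNear_const hK0 p ζ).congr ?_
      filter_upwards [hn.continuousAt.eventually (lt_mem_nhds (not_le.1 hζ))] with ξ hξ
      exact (hFp 1 ξ hξ.le).symm
  · refine hcl.of_homotopy (fun s => capFill p fun ζ => F s (tailVec ζ)) ?_ (fun w _ => by
      simp only [hF0, hf₀t]) fun w _ => rfl
    unfold capFill
    refine continuousOn_if_le' continuous_const
      (by fun_prop) ?_ continuousOn_const fun q hq h0 => ?_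
    · refine hF.comp_continuousOn (f := fun q : ℝ × ℝ^k =>
        (q.1, tailVec ((q.2 0 + ‖tailVec q.2‖)⁻¹ • tailVec q.2))) ?_
      have h1 : Continuous fun q : ℝ × ℝ^k => q.2 0 + ‖tailVec q.2‖ := by
        fun_prop
      have h2 : Continuous fun q : ℝ × ℝ^k => tailVec q.2 := by fun_prop
      exact continuousOn_fst.prodMk (continuous_tailVec.comp_continuousOn (ContinuousOn.smul
        (h1.continuousOn.inv₀ fun q hq => (pole_add_tail_pos hq.1.2 hq.2).ne') h2.continuousOn))
    · have := capFill_of_nonpos (f := fun ζ => F q.1 (tailVec ζ)) (hFp q.1) hq.2 h0.ge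
      rwa [capFill, if_pos h0.le] at this

/-- Points of the target are joined by Lipschitz paths, parametrised by `[1, 2]`. -/
theorem exists_lipschitz_path [hN : IsAdmissibleTarget k N] (p q : N) :
    ∃ (γ : ℝ → N) (K : ℝ), 0 ≤ K ∧ (∀ t, LipNear K γ t) ∧ (∀ t ≤ 1, γ t = p) ∧
      ∀ t, 2 ≤ t → γ t = q := by
  obtain ⟨γ⟩ := IsAdmissibleTarget.joined (k := k) q p
  let e : ℝ → N := fun t => γ (clampI (2 * t - 5 / 2))
  have hec : Continuous e := by fun_prop
  have he1 : ∀ t, t < 5 / 4 → e t = p := fun t ht => by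
    simp only [e, clampI_of_le (show 2 * t - 5 / 2 ≤ 0 by linarith), γ.source]
  have he2 : ∀ t, 7 / 4 < t → e t = q := fun t ht => by
    simp only [e, clampI_of_ge (show 1 ≤ 2 * t - 5 / 2 by linarith), γ.target]
  obtain ⟨F, -, -, hF1, hFS⟩ := exists_lipschitz_approx (k := k) hec (S := Iic 1 ∪ Ici 2)
    (U := Iio (5 / 4) ∪ Ioi (7 / 4)) (isClosed_Iic.union isClosed_Ici)
    (isOpen_Iio.union isOpen_Ioi)
    (union_subset_union (Iic_subset_Iio.2 (by norm_num)) (Ici_subset_Ioi.2 (by norm_num)))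
    (by
      rintro t (ht | ht)
      · exact ⟨p, (eventually_lt_nhds ht).mono he1⟩
      · exact ⟨q, (eventually_gt_nhds ht).mono he2⟩)
  have h1 : ∀ t ≤ 1, F 1 t = p := fun t ht => (hFS 1 t (Or.inl ht)).trans (he1 t (by linarith))
  have h2 : ∀ t, 2 ≤ t → F 1 t = q := fun t ht => (hFS 1 t (Or.inr ht)).trans (he2 t (by linarith))
  obtain ⟨K, hK0, hK⟩ := (isCompact_Icc (a := (1 : ℝ)) (b := 2)).exists_lipNear (f := F 1)
    fun t _ => hF1 t
  refine ⟨F 1, K, hK0, fun t => ?_, h1, h2⟩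
  rcases lt_or_ge t 1 with ht | ht
  · refine (lipNear_const hK0 p t).congr ?_
    filter_upwards [Iio_mem_nhds ht] with x hx using (h1 x (le_of_lt hx)).symm
  rcases lt_or_ge 2 t with ht' | ht'
  · refine (lipNear_const hK0 q t).congr ?_
    filter_upwards [Ioi_mem_nhds ht'] with x hx using (h2 x (le_of_lt hx)).symm
  · exact hK t ⟨ht, ht'⟩

end Bubbles

/-! ### Maps with nice singularities: pointwise Lipschitz bounds -/

section Nice

/-- A bound on the local Lipschitz constants along a segment integrates to a bound on the
increment. -/
theorem dist_le_of_lipNear_segment {E Y : Type*} [NormedAddCommGroup E] [NormedSpace ℝ E]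
    [PseudoMetricSpace Y] {f : E → Y} {K : ℝ} {x y : E}
    (h : ∀ z ∈ segment ℝ x y, LipNear K f z) : dist (f x) (f y) ≤ K * dist x y := by
  let c : ℝ → E := fun s => x + s • (y - x)
  have hc : Continuous c := by fun_prop
  have hseg : ∀ s ∈ Icc (0 : ℝ) 1, c s ∈ segment ℝ x y := fun s hs => by
    rw [segment_eq_image']; exact ⟨s, hs, rfl⟩
  have hfc : ContinuousOn (fun s => f (c s)) (Icc 0 1) := fun s hs =>
    ((h _ (hseg s hs)).continuousAt.comp hc.continuousAt).continuousWithinAt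
  have key := image_le_of_liminf_slope_right_le_deriv_boundary (f := fun s => dist (f x) (f (c s)))
    (B := fun s => K * dist x y * s) (B' := fun _ => K * dist x y) (a := 0) (b := 1)
    (continuous_dist.comp_continuousOn (continuousOn_const.prodMk hfc)) (by simp [c]) (by fun_prop)
    (fun s _ => by simpa using ((hasDerivAt_id s).const_mul (K * dist x y)).hasDerivWithinAt)
    (fun s hs r hr => by
      obtain ⟨V, hV, hL⟩ := h _ (hseg s ⟨hs.1, hs.2.le⟩)
      refine Eventually.frequently ?_
      filter_upwards [(hc.continuousAt.eventually_mem hV).filter_mono nhdsWithin_le_nhds,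
        self_mem_nhdsWithin] with z hz (hsz : s < z)
      refine lt_of_le_of_lt ?_ hr
      have h3 := hL _ (mem_of_mem_nhds hV) _ hz
      have h4 : dist (c s) (c z) = (z - s) * dist x y := by
        have : c s - c z = (z - s) • (x - y) := by simp only [c]; module
        rw [dist_eq_norm, this, norm_smul, norm_of_nonneg (sub_pos.2 hsz).le, dist_eq_norm]
      rw [slope_def_field, div_le_iff₀ (sub_pos.2 hsz)]
      have := dist_triangle (f x) (f (c s)) (f (c z))
      rw [h4] at h3
      linarith)
  simpa [c] using key (show (1 : ℝ) ∈ Icc 0 1 by simp)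

variable {d m : ℕ}

/-- A Lipschitz map whose derivative is almost everywhere bounded by `K` near `x` is Lipschitz with
constant `K` near `x`: by Fubini's theorem, the bound holds almost everywhere on almost all
translates of a given segment. -/
theorem lipNear_of_ae_fderiv_le {f : ℝ^d → ℝ^m} {x : ℝ^d} {r K : ℝ} (hr : 0 < r) {L : NNReal}
    (hL : LipschitzOnWith L f (ball x r)) (hK0 : 0 ≤ K)
    (hK : ∀ᵐ y ∂(volume : Measure ℝ^d), y ∈ ball x r → ‖fderiv ℝ f y‖ ≤ K) : LipNear K f x := by
  obtain ⟨G, hG, hGf⟩ := hL.extend_finite_dimension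
  have hGc := hG.continuous
  let Q : Set ℝ^d := {w | DifferentiableAt ℝ G w} ∩ ((ball x r)ᶜ ∪ {w | ‖fderiv ℝ G w‖ ≤ K})
  have hQ : MeasurableSet Q := (measurableSet_of_differentiableAt ℝ G).inter
    (measurableSet_ball.compl.union (measurableSet_le
      (measurable_fderiv ℝ G).norm measurable_const))
  have hQae : ∀ᵐ w, w ∈ Q := by
    filter_upwards [hG.ae_differentiableAt (μ := volume), hK] with w hw hwK
    refine ⟨hw, or_iff_not_imp_left.2 fun hwr => ?_⟩
    have hwr := notMem_compl_iff.1 hwr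
    have : G =ᶠ[𝓝 w] f := by
      filter_upwards [isOpen_ball.mem_nhds hwr] with z hz using (hGf hz).symm
    rw [mem_ofPred_eq, this.fderiv_eq]
    exact hwK hwr
  refine ⟨ball x (r / 2), ball_mem_nhds x (by positivity), fun y hy z hz => ?_⟩
  rw [hGf (ball_subset_ball (by linarith) hy), hGf (ball_subset_ball (by linarith) hz)]
  let c : ℝ → ℝ^d → ℝ^d := fun s t => y + s • (z - y) + t
  have hae : ∀ᵐ t : ℝ^d, ∀ᵐ s : ℝ, c s t ∈ Q := by
    refine (Measure.ae_ae_comm (p := fun s t => c s t ∈ Q) ?_).1 (Eventually.of_forall fun s =>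
      (measurePreserving_add_left volume _).quasiMeasurePreserving.ae hQae)
    have : Continuous fun q : ℝ × ℝ^d => c q.1 q.2 := by fun_prop
    exact this.measurable hQ
  have hle : ∀ᵐ t : ℝ^d, t ∈ (ball 0 (r / 2))ᶜ ∪ {t |
      dist (G (y + t)) (G (z + t)) ≤ K * dist y z} := by
    filter_upwards [hae] with t ht
    refine or_iff_not_imp_left.2 fun htr => ?_
    have htr := mem_ball_zero_iff.1 (notMem_compl_iff.1 htr)
    have hc0 : c 0 t = y + t := by simp [c]
    have hc1 : c 1 t = z + t := by simp [c]
    set w := G (z + t) - G (y + t)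
    have hLip : LipschitzWith _ fun s => innerSL ℝ w (G (c s t)) :=
      ((innerSL ℝ w).lipschitz.comp hG).comp <| LipschitzWith.of_dist_le_mul (K := ‖z - y‖₊)
        fun a b => by
          have : c a t - c b t = (a - b) • (z - y) := by simp only [c]; module
          rw [dist_eq_norm, this, norm_smul, mul_comm, dist_eq_norm, coe_nnnorm]
    have hftc := (hLip.lipschitzOnWith (s := uIcc 0 1)).absolutelyContinuousOnInterval
      |>.integral_deriv_eq_sub
    have hbd := intervalIntegral.norm_integral_le_of_norm_le_const_ae (a := 0) (b := 1)
      (C := ‖w‖ * (K * dist y z)) (f := deriv fun s => innerSL ℝ w (G (c s t))) (by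
        filter_upwards [ht] with s hs hs01
        rw [uIoc_of_le zero_le_one] at hs01
        have h1 : HasDerivAt (fun s : ℝ => c s t) (z - y) s := by
          simpa [c] using (((hasDerivAt_id s).smul_const (z - y)).const_add y).add_const t
        have h2 := (innerSL ℝ w).hasFDerivAt.comp_hasDerivAt s
          (hs.1.hasFDerivAt.comp_hasDerivAt s h1)
        have h3 : c s t ∈ ball x r := by
          have h4 := (convex_ball x (r / 2)).add_smul_sub_mem hy hz ⟨hs01.1.le, hs01.2⟩
          have h5 := dist_triangle (c s t) (y + s • (z - y)) x
          rw [dist_self_add_left] at h5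
          rw [mem_ball] at h4 ⊢
          linarith
        refine (congrArg norm h2.deriv).trans_le ((norm_inner_le_norm _ _).trans
          (mul_le_mul_of_nonneg_left ?_ (norm_nonneg w)))
        rw [dist_comm, dist_eq_norm]
        exact ContinuousLinearMap.le_of_opNorm_le _ (hs.2.resolve_left fun h => h h3) _)
    rw [hftc, hc0, hc1, ← map_sub, innerSL_apply_apply, real_inner_self_eq_norm_sq, sub_zero,
      abs_one, mul_one, norm_of_nonneg (sq_nonneg _)] at hbd
    rw [mem_ofPred_eq, dist_comm, dist_eq_norm]
    have : 0 ≤ K * dist y z := by positivity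
    by_contra! hlt
    nlinarith
  have hcl : IsClosed ((ball 0 (r / 2))ᶜ ∪ {t | dist (G (y + t)) (G (z + t)) ≤ K * dist y z}) :=
    isOpen_ball.isClosed_compl.union (isClosed_le (by fun_prop) continuous_const)
  have h0 := hcl.closure_eq ▸ Measure.dense_of_ae hle 0
  simpa using h0.resolve_left (by simpa using hr)

variable {N : Set ℝ^m} {D M : Set ℝ^d} {u : ℝ^d → N}

theorem lipNear_coe_iff {K : ℝ} {x : ℝ^d} :
    LipNear K (fun y => (u y : ℝ^m)) x ↔ LipNear K u x := Iff.rfl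

theorem LipNear.norm_fderiv_le {f : ℝ^d → ℝ^m} {K : ℝ}
    (hK : 0 ≤ K) {x : ℝ^d} (h : LipNear K f x) : ‖fderiv ℝ f x‖ ≤ K := by
  obtain ⟨V, hV, h⟩ := h
  refine norm_fderiv_le_of_lip' ℝ hK ?_
  filter_upwards [hV] with y hy
  simpa only [dist_eq_norm] using h y hy x (mem_of_mem_nhds hV)

/-- A map with a nice singularity at `M` has local Lipschitz constants of order `dist(·, M)⁻¹`. -/
theorem HasNiceSingularity.exists_lipNear (h : HasNiceSingularity D M u) (hD : IsOpen D)
    (hM : IsClosed M) (hMne : M.Nonempty) :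
    ∃ C, 0 ≤ C ∧ ∀ x ∈ D \ M, LipNear (C / infDist x M) u x := by
  obtain ⟨hloc, C, hC⟩ := h
  have hDM : IsOpen (D \ M) := hD.sdiff hM
  rw [ae_restrict_iff' hDM.measurableSet] at hC
  refine ⟨2 * |C|, by positivity, fun x hx => ?_⟩
  obtain ⟨L, V, hV, hL⟩ := hloc x ⟨subset_closure hx.1, hx.2⟩
  have hx0 : 0 < infDist x M := (hM.notMem_iff_infDist_pos hMne).1 hx.2
  have h1 : ∀ᶠ y in 𝓝 x, y ∈ V ∩ (D \ M) ∧ infDist x M / 2 < infDist y M :=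
    (show ∀ᶠ y in 𝓝 x, y ∈ V ∩ (D \ M) from inter_mem hV (hDM.mem_nhds hx)).and
      ((continuous_infDist_pt M).continuousAt.eventually (lt_mem_nhds (by linarith)))
  obtain ⟨r, hr, hball⟩ := eventually_nhds_iff_ball.1 h1
  refine lipNear_coe_iff.1 (lipNear_of_ae_fderiv_le hr (L := L) ?_ (by positivity) ?_)
  · exact LipschitzOnWith.of_dist_le_mul fun y hy z hz =>
      hL.dist_le_mul y (hball y hy).1 z (hball z hz).1
  · filter_upwards [hC] with y hy hyr
    obtain ⟨h2, h3⟩ := hball y hyr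
    have hy0 : 0 < infDist y M := lt_trans (by positivity) h3
    refine (hy h2.2).trans ?_
    rw [div_le_div_iff₀ hy0 hx0]
    nlinarith [abs_nonneg C, le_abs_self C]

/-- Conversely, local Lipschitz constants of order `dist(·, M)⁻¹` characterise nice singularities at
`M`, up to the behaviour at the boundary of `D`. -/
theorem HasNiceSingularity.of_lipNear (hD : IsOpen D) (hM : IsClosed M) {C : ℝ} (hC : 0 ≤ C)
    (h : ∀ x ∈ D \ M, LipNear (C / infDist x M) u x)
    (hbd : ∀ x ∈ frontier D, ∃ L : NNReal, ∃ V ∈ 𝓝 x, LipschitzOnWith L u (V ∩ (D \ M))) :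
    HasNiceSingularity D M u := by
  refine ⟨fun x hx => ?_, C, ?_⟩
  · by_cases hxD : x ∈ D
    · obtain ⟨V, hV, hL⟩ := h x ⟨hxD, hx.2⟩
      have h0 : 0 ≤ C / infDist x M := div_nonneg hC infDist_nonneg
      refine ⟨⟨_, h0⟩, V, hV, LipschitzOnWith.of_dist_le_mul fun y hy z hz => ?_⟩
      exact hL y hy.1 z hz.1
    · exact hbd x ⟨hx.1, by rwa [hD.interior_eq]⟩
  · rw [ae_restrict_iff' (hD.sdiff hM).measurableSet]
    refine Eventually.of_forall fun x hx => ?_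
    exact LipNear.norm_fderiv_le (div_nonneg hC infDist_nonneg) (lipNear_coe_iff.2 (h x hx))

end Nice

/-! ### Maps with nice singularities are Sobolev maps -/

section Sobolev

/-- The function `‖pr x‖^{-(k-1)}` is locally integrable if `pr` is the orthogonal projection to a
`k`-dimensional space. -/
theorem integrableOn_inv_norm_starProjection {E : Type*} [NormedAddCommGroup E]
    [InnerProductSpace ℝ E] [FiniteDimensional ℝ E] [MeasurableSpace E] [BorelSpace E]
    (W : Submodule ℝ E) {k : ℕ} (hk : 2 ≤ k) (hW : finrank ℝ Wᗮ = k) (R : ℝ) :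
    IntegrableOn (fun x => (‖Wᗮ.starProjection x‖⁻¹) ^ (k - 1)) (ball (0 : E) R) := by
  have hnt : Nontrivial Wᗮ := nontrivial_of_finrank_pos (R := ℝ) (by omega)
  have hmp := (WithLp.volume_preserving_ofLp W Wᗮ).comp W.orthogonalDecomposition.measurePreserving
  have h1 : IntegrableOn (fun _ : W => (1 : ℝ)) (ball 0 R) :=
    integrableOn_const measure_ball_lt_top.ne
  have h2 : IntegrableOn (fun b : Wᗮ => (‖b‖⁻¹) ^ (k - 1)) (ball 0 R) := by
    rw [integrableOn_fun_norm_addHaar volume (f := fun y => (y⁻¹) ^ (k - 1)), hW]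
    refine (integrableOn_const (C := (1 : ℝ)) (by simp)).congr_fun
      (fun y hy => ?_) measurableSet_Ioo
    rw [smul_eq_mul, ← mul_pow, mul_inv_cancel₀ hy.1.ne', one_pow]
  have h3 := h1.mul_prod h2
  rw [Measure.prod_restrict] at h3
  have h4 := (hmp.restrict_preimage
    (measurableSet_ball.prod measurableSet_ball)).integrable_comp_of_integrable h3
  simp only [Function.comp_def, one_mul, Submodule.orthogonalDecomposition_apply] at h4
  refine IntegrableOn.mono_set h4 fun x hx => ?_
  rw [mem_ball_zero_iff] at hx
  have n1 := (W.norm_starProjection_apply_le x).trans_lt hx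
  have n2 := (Wᗮ.norm_starProjection_apply_le x).trans_lt hx
  simpa using And.intro n1 n2

variable {n k m : ℕ}

/-- The set `M` is covered by finitely many affine planes of dimension `n`. -/
def CoveredByPlanes {d : ℕ} (n : ℕ) (M : Set ℝ^d) : Prop := ∃ S : Finset (ℝ^d × Submodule ℝ ℝ^d),
    (∀ P ∈ S, finrank ℝ P.2 = n) ∧ ∀ x ∈ M, ∃ P ∈ S, x - P.1 ∈ P.2

theorem CoveredByPlanes.volume_eq_zero (hk : 0 < k) {M : Set ℝ^(n + k)}
    (h : CoveredByPlanes n M) : volume M = 0 := by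
  obtain ⟨S, hS, hM⟩ := h
  have : M ⊆ ⋃ P ∈ S, {x | x - P.1 ∈ P.2} := fun x hx => by
    obtain ⟨P, hP, h⟩ := hM x hx
    exact mem_iUnion₂.2 ⟨P, hP, h⟩
  refine measure_mono_null this ((measure_biUnion_null_iff S.countable_toSet).2 fun P hP => ?_)
  have hne : P.2 ≠ ⊤ := by
    rintro h
    have h1 := hS P hP
    rw [h, finrank_top, finrank_euclideanSpace_fin] at h1
    omega
  have h0 : volume ((P.2 : Submodule ℝ _) : Set ℝ^(n + k)) = 0 := Measure.addHaar_submodule _ _ hne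
  have : {x | x - P.1 ∈ P.2} = (fun x => x + -P.1) ⁻¹' (P.2 : Set _) := by
    ext x; simp [sub_eq_add_neg]
  rw [this, measure_preimage_add_right, h0]

/-- The function `dist(·, M)⁻¹` belongs to `L^{k-1}` on bounded sets, where `k` is the codimension.
-/
theorem CoveredByPlanes.memLp_inv_infDist (hk : 2 ≤ k) {M D : Set ℝ^(n + k)}
    (h : CoveredByPlanes n M) (hM : IsCompact M) (hMne : M.Nonempty) (hD : IsBounded D) :
    MemLp (fun x => (infDist x M)⁻¹) ((k - 1 : ℕ) : ENNReal) (volume.restrict D) := by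
  have hvol := h.volume_eq_zero (by omega)
  obtain ⟨S, hS, hMS⟩ := h
  let F : ℝ^(n + k) × Submodule ℝ ℝ^(n + k) →
    ℝ^(n + k) → ℝ := fun P x => ‖P.2ᗮ.starProjection (x - P.1)‖⁻¹
  have hp0 : (((k - 1 : ℕ) : ENNReal)) ≠ 0 := by
    rw [Ne, Nat.cast_eq_zero]; omega
  have hF : ∀ P ∈ S, MemLp (F P) ((k - 1 : ℕ) : ENNReal) (volume.restrict D) := by
    intro P hP
    have hm : Measurable (F P) := by
      have : Continuous fun x => ‖P.2ᗮ.starProjection (x - P.1)‖ := by fun_prop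
      exact this.measurable.inv
    rw [← integrable_norm_rpow_iff hm.aestronglyMeasurable hp0 (by simp)]
    obtain ⟨R, hR⟩ := hD.subset_ball P.1
    have hfr : finrank ℝ P.2ᗮ = k := by
      have h1 := P.2.finrank_add_finrank_orthogonal
      rw [hS P hP, finrank_euclideanSpace_fin] at h1
      omega
    have h1 := integrableOn_inv_norm_starProjection P.2 hk hfr R
    have h2 : IntegrableOn (fun x => (‖P.2ᗮ.starProjection (x - P.1)‖⁻¹) ^ (k - 1))
        (ball P.1 R) := by
      have hmp := measurePreserving_sub_right (volume : Measure ℝ^(n + k)) P.1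
      have := (hmp.integrableOn_comp_preimage (MeasurableEquiv.subRight P.1).measurableEmbedding
        (f := fun x => (‖P.2ᗮ.starProjection x‖⁻¹) ^ (k - 1)) (s := ball 0 R)).2 h1
      have hb : ball P.1 R = (fun x => x - P.1) ⁻¹' ball 0 R := by
        ext x; simp [dist_eq_norm]
      rw [hb]
      exact this
    refine (h2.mono_set hR).congr (Eventually.of_forall fun x => ?_)
    simp only [F, ENNReal.toReal_natCast, Real.rpow_natCast, norm_inv, norm_norm]
  have hsum : MemLp (fun x => ∑ P ∈ S, F P x) ((k - 1 : ℕ) : ENNReal) (volume.restrict D) :=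
    memLp_finsetSum S hF
  refine hsum.mono' (continuous_infDist_pt M).measurable.inv.aestronglyMeasurable ?_
  have hplane : volume (⋃ P ∈ S, {x : ℝ^(n + k) | x - P.1 ∈ P.2}) = 0 :=
    CoveredByPlanes.volume_eq_zero (by omega) ⟨S, hS, fun x hx => by simpa using hx⟩
  have hae : ∀ᵐ x ∂(volume : Measure ℝ^(n + k)),
      x ∉ ⋃ P ∈ S, {x : ℝ^(n + k) | x - P.1 ∈ P.2} := measure_eq_zero_iff_ae_notMem.1 hplane
  filter_upwards [ae_restrict_of_ae hae] with x hx
  obtain ⟨y, hy, hxy⟩ := hM.exists_infDist_eq_dist hMne x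
  obtain ⟨P, hP, hyP⟩ := hMS y hy
  have hxP : x - P.1 ∉ P.2 := fun h => hx (mem_iUnion₂.2 ⟨P, hP, h⟩)
  have hpos : 0 < ‖P.2ᗮ.starProjection (x - P.1)‖ := by
    rw [norm_pos_iff]
    intro h0
    rw [starProjection_apply_eq_zero_iff, Submodule.orthogonal_orthogonal] at h0
    exact hxP h0
  have hle : ‖P.2ᗮ.starProjection (x - P.1)‖ ≤ dist x y := by
    have : P.2ᗮ.starProjection (x - P.1) = P.2ᗮ.starProjection (x - y) := by
      have h1 : x - P.1 = (x - y) + (y - P.1) := by abel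
      rw [h1, map_add, (starProjection_apply_eq_zero_iff _).2
        (Submodule.le_orthogonal_orthogonal P.2 hyP), add_zero]
    rw [this, dist_eq_norm]
    exact P.2ᗮ.norm_starProjection_apply_le _
  rw [norm_inv, norm_of_nonneg infDist_nonneg, hxy]
  refine (inv_anti₀ hpos hle).trans ?_
  exact single_le_sum (f := fun P => F P x) (fun P _ => inv_nonneg.2 (norm_nonneg _)) hP

theorem ae_differentiableAt_of_lipNear {d m : ℕ} {f : ℝ^d → ℝ^m} {s : Set ℝ^d}
    (h : ∀ x ∈ s, ∃ K, LipNear K f x) :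
    ∀ᵐ x ∂(volume : Measure ℝ^d), x ∈ s → DifferentiableAt ℝ f x := by
  rw [ae_iff]
  refine measure_null_of_locally_null _ fun x hx => ?_
  simp only [mem_ofPred_eq, Classical.not_imp] at hx
  obtain ⟨K, hK, V, hV, hL⟩ := LipNear.exists_nonneg (h x hx.1)
  obtain ⟨r, hr, hrV⟩ := Metric.mem_nhds_iff.1 hV
  have hLip : LipschitzOnWith ⟨K, hK⟩ f (ball x r) :=
    LipschitzOnWith.of_dist_le_mul fun y hy z hz => hL y (hrV hy) z (hrV hz)
  refine ⟨_, inter_mem_nhdsWithin _ (ball_mem_nhds x hr), ?_⟩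
  have := hLip.ae_differentiableWithinAt_of_mem (μ := volume)
  rw [ae_iff] at this
  refine measure_mono_null (fun y hy => ?_) this
  simp only [mem_ofPred_eq, Classical.not_imp] at hy ⊢
  exact ⟨hy.2, fun hd => hy.1.2 (hd.differentiableAt (isOpen_ball.mem_nhds hy.2))⟩

/-- A compactly supported map whose local Lipschitz constants are dominated by `dist(·, M)⁻¹`, where
`M` has codimension at least two, has derivative of integral zero: its difference quotients have
integral zero and are dominated by a multiple of `dist(·, M)⁻¹`. -/
theorem integral_fderiv_eq_zero_of_lipNear (hk : 2 ≤ k) {M : Set ℝ^(n + k)} (hM : IsCompact M)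
    (hMne : M.Nonempty) (hMp : CoveredByPlanes n M) {F : ℝ^(n + k) → ℝ^m} (hF : HasCompactSupport F)
    (hFm : AEStronglyMeasurable F) {B C : ℝ} (hB : ∀ x, ‖F x‖ ≤ B) (hC : 0 ≤ C)
    (h : ∀ x ∉ M, LipNear (C / infDist x M) F x) (v : ℝ^(n + k)) : ∫ x, fderiv ℝ F x v = 0 := by
  have hpos : ∀ {x}, x ∉ M → 0 < infDist x M := (hM.isClosed.notMem_iff_infDist_pos hMne).1
  have haeM : ∀ᵐ x ∂(volume : Measure ℝ^(n + k)), x ∉ M :=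
    measure_eq_zero_iff_ae_notMem.1 (hMp.volume_eq_zero (by omega))
  set K : ℝ := max (2 * C) (4 * B)
  have hquot : ∀ x ∉ M, ∀ t : ℝ, t ≠ 0 →
      ‖t⁻¹ • (F (x + t • v) - F x)‖ ≤ K * ‖v‖ * (infDist x M)⁻¹ := by
    intro x hxM t ht
    have hx0 := hpos hxM
    have hd : ∀ s : ℝ, dist x (x + s • v) = |s| * ‖v‖ := fun s => by
      rw [dist_self_add_right, norm_smul, norm_eq_abs]
    suffices main : ‖F (x + t • v) - F x‖ ≤ K / infDist x M * (|t| * ‖v‖) by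
      rw [norm_smul, norm_inv, norm_eq_abs, inv_mul_le_iff₀ (abs_pos.2 ht)]
      exact main.trans (le_of_eq (by ring))
    by_cases hc : 2 * (|t| * ‖v‖) ≤ infDist x M
    · have hseg : ∀ z ∈ segment ℝ x (x + t • v), LipNear (K / infDist x M) F z := by
        intro z hz
        have h1 : dist x z ≤ |t| * ‖v‖ := by
          rw [← hd, dist_comm x z, dist_comm x]
          exact (convexOn_dist x convex_univ).le_on_segment (mem_univ _) (mem_univ _) hz |>.trans
            (by simp)
        have h2 := infDist_le_infDist_add_dist (s := M) (x := x) (y := z)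
        have h4 : 0 < infDist z M := by linarith
        refine (h z ((hM.isClosed.notMem_iff_infDist_pos hMne).2 h4)).mono ?_
        rw [div_le_div_iff₀ h4 hx0]
        nlinarith [le_max_left (2 * C) (4 * B)]
      have h5 := dist_le_of_lipNear_segment hseg
      rwa [hd, dist_comm, dist_eq_norm] at h5
    · rw [not_le] at hc
      have h6 := norm_sub_le (F (x + t • v)) (F x)
      have h7 := hB x
      rw [div_mul_eq_mul_div, le_div_iff₀ hx0]
      nlinarith [le_max_right (2 * C) (4 * B), hB (x + t • v), norm_nonneg (F x)]
  have hint : Integrable F := by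
    rw [← integrableOn_iff_integrable_of_support_subset (subset_tsupport F)]
    exact Measure.integrableOn_of_bounded (IsCompact.measure_lt_top hF).ne hFm
      (Eventually.of_forall hB)
  set S := cthickening ‖v‖ (tsupport F)
  have hS := (hF.isCompact.isBounded.cthickening (δ := ‖v‖))
  have hinv : IntegrableOn (fun x => (infDist x M)⁻¹) S := by
    have := isFiniteMeasure_restrict.2 (hS.measure_lt_top (μ := volume)).ne
    exact (hMp.memLp_inv_infDist hk hM hMne hS).integrable
      (by exact_mod_cast (show 1 ≤ k - 1 by omega))
  have hlim : Tendsto (fun t : ℝ => ∫ x, t⁻¹ • (F (x + t • v) - F x)) (𝓝[≠] 0)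
      (𝓝 (∫ x, fderiv ℝ F x v)) := by
    refine tendsto_integral_filter_of_dominated_convergence
      (S.indicator fun x => K * ‖v‖ * (infDist x M)⁻¹)
      (Eventually.of_forall fun t => (((hint.comp_add_right _).sub hint).smul t⁻¹).1) ?_
      ((integrable_indicator_iff isClosed_cthickening.measurableSet).2 (hinv.const_mul _)) ?_
    · have hsmall : ∀ᶠ t : ℝ in 𝓝[≠] 0, |t| < 1 :=
        (continuous_abs.tendsto' (0 : ℝ) 0 abs_zero).eventually (gt_mem_nhds one_pos)
          |>.filter_mono nhdsWithin_le_nhds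
      filter_upwards [hsmall, self_mem_nhdsWithin] with t ht ht0
      filter_upwards [haeM] with x hxM
      by_cases hx : x ∈ S
      · rw [indicator_of_mem hx]
        exact hquot x hxM t ht0
      · have h0 : ∀ y, dist x y ≤ ‖v‖ → F y = 0 := fun y hy => by
          by_contra hne
          exact hx (mem_cthickening_of_dist_le x y _ _ (subset_tsupport F hne) hy)
        rw [indicator_of_notMem hx, h0 x (by simp), h0 (x + t • v), sub_zero, smul_zero, norm_zero]
        rw [dist_self_add_right, norm_smul, norm_eq_abs]
        exact mul_le_of_le_one_left (norm_nonneg v) ht.le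
    · filter_upwards [haeM, ae_differentiableAt_of_lipNear (s := Mᶜ) fun x hx => ⟨_, h x hx⟩]
        with x hxM hxd
      exact ((hxd hxM).hasFDerivAt.hasLineDerivAt v).tendsto_slope_zero
  refine tendsto_nhds_unique hlim (tendsto_const_nhds.congr fun t => ?_)
  rw [integral_smul, integral_sub (hint.comp_add_right _) hint,
    integral_add_right_eq_self (fun x => F x), sub_self, smul_zero]

/-- A map with a nice singularity along a set of codimension `k` in a bounded set is a Sobolev map,
and the classical derivative is the weak one. -/
theorem memSobolev_of_lipNear (hk : 2 ≤ k) {N : Set ℝ^m} (hN : IsCompact N) {D M : Set ℝ^(n + k)}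
    {u : ℝ^(n + k) → N} (hDo : IsOpen D) (hD : IsBounded D) (hM : IsCompact M)
    (hMne : M.Nonempty) (hMp : CoveredByPlanes n M) {C : ℝ} (hC : 0 ≤ C)
    (h : ∀ x ∈ D \ M, LipNear (C / infDist x M) u x) :
    MemSobolev D ((k - 1 : ℕ) : ENNReal) u := by
  have hvol := hMp.volume_eq_zero (by omega)
  have hinv := hMp.memLp_inv_infDist hk hM hMne hD
  have hfin : IsFiniteMeasure (volume.restrict D) := isFiniteMeasure_restrict.2 hD.measure_lt_top.ne
  have hDM : IsOpen (D \ M) := hDo.sdiff hM.isClosed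
  have haeM : ∀ᵐ x ∂(volume : Measure ℝ^(n + k)), x ∉ M := measure_eq_zero_iff_ae_notMem.1 hvol
  obtain ⟨B, hB⟩ := hN.isBounded.exists_norm_le
  set U : ℝ^(n + k) → ℝ^m := fun x => u x
  have hUB : ∀ x, ‖U x‖ ≤ B := fun x => hB _ (u x).2
  have hB0 : 0 ≤ B := (norm_nonneg _).trans (hUB 0)
  have hUlip : ∀ x ∈ D \ M, LipNear (C / infDist x M) U x := fun x hx => lipNear_coe_iff.2 (h x hx)
  have hUm : AEStronglyMeasurable U (volume.restrict D) := by
    have h1 : ContinuousOn U (D \ M) := fun x hx => (hUlip x hx).continuousAt.continuousWithinAt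
    have h2 := h1.aestronglyMeasurable (μ := volume) hDM.measurableSet
    rwa [Measure.restrict_congr_set (sdiff_null_ae_eq_self hvol)] at h2
  have hg : MemLp (fderiv ℝ U) ((k - 1 : ℕ) : ENNReal) (volume.restrict D) := by
    refine (hinv.const_mul C).mono' (measurable_fderiv ℝ U).aestronglyMeasurable ?_
    filter_upwards [ae_restrict_of_ae haeM, ae_restrict_mem hDo.measurableSet] with x hxM hxD
    simpa [div_eq_mul_inv] using
      (hUlip x ⟨hxD, hxM⟩).norm_fderiv_le (div_nonneg hC infDist_nonneg)
  have hp : (1 : ENNReal) ≤ ((k - 1 : ℕ) : ENNReal) := by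
    exact_mod_cast (show 1 ≤ k - 1 by omega)
  refine ⟨MemLp.of_bound hUm B (Eventually.of_forall hUB), fderiv ℝ U, hg, fun φ hφ hφc hφD v => ?_⟩
  obtain ⟨L, hL⟩ := ContDiff.lipschitzWith_of_hasCompactSupport hφc hφ (by simp)
  obtain ⟨b, hb⟩ := hφc.exists_bound_of_continuous hφ.continuous
  have hb0 : 0 ≤ b := (norm_nonneg _).trans (hb 0)
  obtain ⟨y, hy⟩ := hMne
  obtain ⟨R, hR0, hR⟩ := hD.subset_closedBall_lt 0 y
  set F : ℝ^(n + k) → ℝ^m := fun x => φ x • U x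
  have hF0 : ∀ x ∉ D, φ x = 0 := fun x hx =>
    image_eq_zero_of_notMem_tsupport fun hx' => hx (hφD hx')
  have hFm : AEStronglyMeasurable F := by
    have h1 := (aestronglyMeasurable_indicator_iff hDo.measurableSet).2
      (hφ.continuous.aestronglyMeasurable.smul hUm)
    rwa [indicator_eq_self.2 fun x hx => by_contra fun hxD => hx (by simp [hF0 x hxD])] at h1
  have key := integral_fderiv_eq_zero_of_lipNear hk hM ⟨y, hy⟩ hMp (F := F) hφc.smul_right hFm
    (B := b * B) (C := L * B * R + b * C) (fun x => (norm_smul_le _ _).trans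
      (mul_le_mul (hb x) (hUB x) (norm_nonneg _) hb0)) (by positivity) (fun x hxM => by
        have hx0 := (hM.isClosed.notMem_iff_infDist_pos ⟨y, hy⟩).1 hxM
        by_cases hx : x ∈ tsupport φ
        · obtain ⟨V, hV, hVL⟩ := hUlip x ⟨hφD hx, hxM⟩
          refine LipNear.mono (K := L * B + b * (C / infDist x M))
            ⟨V, hV, fun z hz z' hz' => ?_⟩ ?_
          · have : F z - F z' = (φ z - φ z') • U z + φ z' • (U z - U z') := by
              simp only [F]; module
            rw [dist_eq_norm, this, add_mul, mul_right_comm, mul_assoc b]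
            refine (norm_add_le _ _).trans (add_le_add ?_ ?_) <;>
              rw [norm_smul, ← dist_eq_norm]
            · exact mul_le_mul (hL.dist_le_mul z z') (hUB z) (norm_nonneg _) (by positivity)
            · exact mul_le_mul (hb z') (hVL z hz z' hz') dist_nonneg hb0
          · have := (infDist_le_dist_of_mem hy).trans (hR (hφD hx))
            rw [add_div, mul_div_assoc b]
            gcongr
            rw [le_div_iff₀ hx0]
            gcongr
        · refine (lipNear_const (div_nonneg (by positivity) hx0.le) (0 : ℝ^m) x).congr ?_
          filter_upwards [(isClosed_tsupport φ).isOpen_compl.mem_nhds hx] with z hz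
          simp [F, image_eq_zero_of_notMem_tsupport hz]) v
  have hsum : ∀ᵐ x ∂(volume.restrict D),
      fderiv ℝ F x v = fderiv ℝ φ x v • U x + φ x • fderiv ℝ U x v := by
    filter_upwards [ae_restrict_of_ae haeM, ae_restrict_mem hDo.measurableSet, ae_restrict_of_ae
      (ae_differentiableAt_of_lipNear fun x hx => ⟨_, hUlip x hx⟩)] with x hxM hxD hxd
    rw [fderiv_fun_smul (hφ.differentiable (by simp) x) (hxd ⟨hxD, hxM⟩)]
    simp [add_comm]
  have i1 : Integrable (fun x => fderiv ℝ φ x v • U x) (volume.restrict D) := by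
    have hc := (hφ.continuous_fderiv (by simp)).clm_apply (continuous_const (y := v))
    exact ((MemLp.of_bound (p := 1) hUm B (Eventually.of_forall hUB)).integrable le_rfl).bdd_smul
      (L * ‖v‖) hc.aestronglyMeasurable (Eventually.of_forall fun x =>
        (fderiv ℝ φ x).le_of_opNorm_le (norm_fderiv_le_of_lipschitz ℝ hL) v)
  have i2 : Integrable (fun x => φ x • fderiv ℝ U x v) (volume.restrict D) :=
    ((hg.integrable hp).apply_continuousLinearMap v).bdd_smul b hφ.continuous.aestronglyMeasurable
      (Eventually.of_forall hb)
  rw [eq_neg_iff_add_eq_zero, ← integral_add i1 i2, ← integral_congr_ae hsum, ← key]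
  refine setIntegral_eq_integral_of_forall_compl_eq_zero fun x hx => ?_
  have : fderiv ℝ F x = 0 := image_eq_zero_of_notMem_tsupport fun h =>
    hx (hφD (tsupport_smul_subset_left φ U (tsupport_fderiv_subset ℝ h)))
  rw [this]; rfl

end Sobolev

/-- A finite family of affine functions. Its zero sets cut the space into cells. -/
abbrev Arrangement (d : ℕ) := Finset (ℝ^d →ᵃ[ℝ] ℝ)

/-! ### Arrangements of hyperplanes and adapted sets -/

section Arrangements

variable {d : ℕ}

/-- Two points lie in the same cell of the arrangement `A`: all functions in `A` have the same sign
at both points. -/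
def SameCell (A : Arrangement d) (x y : ℝ^d) : Prop :=
  ∀ f ∈ A, SignType.sign (f x) = SignType.sign (f y)

/-- The direction of the cell of the arrangement `A` that contains `x`: the common kernel of the
functions that vanish at `x`. -/
def zeroDir (A : Arrangement d) (x : ℝ^d) : Submodule ℝ ℝ^d where
  carrier := {v | ∀ f ∈ A, f x = 0 → f.linear v = 0}
  zero_mem' := fun f _ _ => map_zero _
  add_mem' := fun ha hb f hf hx => by rw [map_add, ha f hf hx, hb f hf hx, add_zero]
  smul_mem' := fun c v hv f hf hx => by rw [map_smul, hv f hf hx, smul_zero]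

/-- The set `P` is a union of cells of `A`. -/
def Decides (A : Arrangement d) (P : Set ℝ^d) : Prop := ∀ x y, SameCell A x y → x ∈ P → y ∈ P

/-- The distance from the zero sets of the functions in `B`, cut off at `1`. -/
noncomputable def gap (B : Arrangement d) (x : ℝ^d) : ℝ := B.fold min 1 fun f => |f x|

variable {A A' B : Arrangement d} {x y z : ℝ^d} {P : Set ℝ^d}

theorem le_gap_iff {c : ℝ} : c ≤ gap B x ↔ c ≤ 1 ∧ ∀ f ∈ B, c ≤ |f x| := Finset.le_fold_min c

theorem lt_gap_iff {c : ℝ} : c < gap B x ↔ c < 1 ∧ ∀ f ∈ B, c < |f x| := Finset.lt_fold_min c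

theorem gap_le_one : gap B x ≤ 1 := (le_gap_iff.1 le_rfl).1

theorem gap_le_abs {f : ℝ^d →ᵃ[ℝ] ℝ} (hf : f ∈ B) : gap B x ≤ |f x| := (le_gap_iff.1 le_rfl).2 f hf

theorem gap_nonneg : 0 ≤ gap B x := le_gap_iff.2 ⟨zero_le_one, fun _ _ => abs_nonneg _⟩

theorem gap_pos_iff : 0 < gap B x ↔ ∀ f ∈ B, f x ≠ 0 :=
  lt_gap_iff.trans ⟨fun h f hf => abs_pos.1 (h.2 f hf), fun h => ⟨one_pos, fun f hf => abs_pos.2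
    (h f hf)⟩⟩

/-- All functions in the arrangement are Lipschitz with constant `1`. -/
def IsLipArrangement (A : Arrangement d) : Prop := ∀ f ∈ A, ∀ x y, |f x - f y| ≤ dist x y

theorem gap_le_add_dist (hB : IsLipArrangement B) : gap B x ≤ gap B y + dist x y := by
  rw [← sub_le_iff_le_add, le_gap_iff]
  refine ⟨(sub_le_self _ dist_nonneg).trans gap_le_one, fun f hf => ?_⟩
  have h1 := gap_le_abs (x := x) hf
  have h2 := hB f hf x y
  have h3 := abs_sub_abs_le_abs_sub (f x) (f y)
  linarith

theorem continuous_gap (hB : IsLipArrangement B) : Continuous (gap B) := by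
  refine (LipschitzWith.of_dist_le_mul (K := 1) fun x y => ?_).continuous
  rw [NNReal.coe_one, one_mul, Real.dist_eq, abs_le]
  have h1 := gap_le_add_dist (x := x) (y := y) hB
  have h2 := gap_le_add_dist (x := y) (y := x) hB
  rw [dist_comm] at h2
  constructor <;> linarith

theorem SameCell.refl (x : ℝ^d) : SameCell A x x := fun _ _ => rfl
theorem SameCell.symm (h : SameCell A x y) : SameCell A y x := fun f hf => (h f hf).symm
theorem SameCell.trans (h : SameCell A x y) (h' : SameCell A y z) : SameCell A x z :=
  fun f hf => (h f hf).trans (h' f hf)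
theorem SameCell.mono (hA : A' ⊆ A) (h : SameCell A x y) : SameCell A' x y :=
  fun f hf => h f (hA hf)

theorem SameCell.eq_zero_iff (h : SameCell A x y) {f : ℝ^d →ᵃ[ℝ] ℝ}
    (hf : f ∈ A) : f x = 0 ↔ f y = 0 := by
  rw [← sign_eq_zero_iff, h f hf, sign_eq_zero_iff]

theorem Decides.mono (hA : A' ⊆ A) (h : Decides A' P) : Decides A P :=
  fun x y hxy => h x y (hxy.mono hA)

theorem Decides.iff (h : Decides A P) (hxy : SameCell A x y) : x ∈ P ↔ y ∈ P :=
  ⟨h x y hxy, h y x hxy.symm⟩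

theorem Decides.union {Q : Set ℝ^d} (hP : Decides A P) (hQ : Decides A Q) :
    Decides A (P ∪ Q) := fun x y h => Or.imp (hP x y h) (hQ x y h)

theorem mem_zeroDir_iff {v : ℝ^d} : v ∈ zeroDir A x ↔ ∀ f ∈ A, f x = 0 → f.linear v = 0 := Iff.rfl

theorem SameCell.zeroDir_eq (h : SameCell A x y) : zeroDir A x = zeroDir A y := by
  ext v
  simp only [mem_zeroDir_iff]
  exact ⟨fun hv f hf hy => hv f hf ((h.eq_zero_iff hf).2 hy),
    fun hv f hf hx => hv f hf ((h.eq_zero_iff hf).1 hx)⟩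

theorem affineMap_sub (f : ℝ^d →ᵃ[ℝ] ℝ) (x y : ℝ^d) : f.linear (y - x) = f y - f x := by
  have := f.linearMap_vsub y x
  simpa using this

theorem SameCell.sub_mem_zeroDir (h : SameCell A x y) : y - x ∈ zeroDir A x := fun f hf hx => by
  rw [affineMap_sub, hx, (h.eq_zero_iff hf).1 hx, sub_zero]

theorem sign_eq_of_abs_sub_lt {a b : ℝ} (h : |a - b| < |a|) :
    SignType.sign b = SignType.sign a := by
  rcases lt_trichotomy a 0 with ha | ha | ha
  · rw [abs_of_neg ha, abs_lt] at h
    rw [sign_neg ha, sign_neg (by linarith)]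
  · rw [ha] at h; simp at h
    exact absurd h (not_lt.2 (abs_nonneg _))
  · rw [abs_of_pos ha, abs_lt] at h
    rw [sign_pos ha, sign_pos (by linarith)]

/-- A point that is close to `x`, in the direction of the cell of `x`, belongs to that cell. -/
theorem sameCell_of_mem_zeroDir (hA : IsLipArrangement A) (hv : y - x ∈ zeroDir A x)
    (hxy : ∀ f ∈ A, f x ≠ 0 → dist x y < |f x|) : SameCell A x y := by
  intro f hf
  by_cases hx : f x = 0
  · have := hv f hf hx
    rw [affineMap_sub, hx, sub_zero] at this
    rw [hx, this]
  · exact (sign_eq_of_abs_sub_lt ((hA f hf x y).trans_lt (hxy f hf hx))).symm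

theorem eventually_dist_lt (A : Arrangement d) (x : ℝ^d) :
    ∃ ρ > 0, ρ ≤ 1 ∧ ∀ f ∈ A, f x ≠ 0 → ρ ≤ |f x| := by
  classical
  refine ⟨gap (A.filter fun f => f x ≠ 0) x, gap_pos_iff.2 fun f hf => (mem_filter.1 hf).2,
    gap_le_one, fun f hf hx => gap_le_abs (mem_filter.2 ⟨hf, hx⟩)⟩

/-- Near `x`, only functions that vanish at `x` have zeros. -/
theorem zeroDir_le_of_dist_lt (hA : IsLipArrangement A)
    (hxy : ∀ f ∈ A, f x ≠ 0 → dist x y < |f x|) : zeroDir A x ≤ zeroDir A y := by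
  intro v hv f hf hy
  refine hv f hf ?_
  by_contra hx
  have := (hA f hf x y).trans_lt (hxy f hf hx)
  rw [hy, sub_zero] at this
  exact lt_irrefl _ this

theorem sign_lineMap {a b t : ℝ} (h : SignType.sign a = SignType.sign b) (ht : t ∈ Icc (0 : ℝ) 1) :
    SignType.sign ((1 - t) * a + t * b) = SignType.sign a := by
  have h0 := ht.1
  have h1 : 0 ≤ 1 - t := by linarith [ht.2]
  rcases lt_trichotomy a 0 with ha | ha | ha
  · have hb : b < 0 := by rwa [sign_neg ha, eq_comm, sign_eq_neg_one_iff] at h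
    rw [sign_neg ha]
    apply sign_neg
    rcases eq_or_lt_of_le h0 with rfl | h0
    · simpa using ha
    · nlinarith
  · have hb : b = 0 := by rwa [ha, sign_zero, eq_comm, sign_eq_zero_iff] at h
    simp [ha, hb]
  · have hb : 0 < b := by rwa [sign_pos ha, eq_comm, sign_eq_one_iff] at h
    rw [sign_pos ha]
    apply sign_pos
    rcases eq_or_lt_of_le h0 with rfl | h0
    · simpa using ha
    · nlinarith

theorem affineMap_segment (f : ℝ^d →ᵃ[ℝ] ℝ) (x y : ℝ^d)
    (t : ℝ) : f ((1 - t) • x + t • y) = (1 - t) * f x + t * f y := by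
  have h1 : (1 - t) • x + t • y = AffineMap.lineMap x y t := by
    rw [AffineMap.lineMap_apply_module]
  rw [h1, f.apply_lineMap, AffineMap.lineMap_apply_module]
  simp

/-- Cells are convex. -/
theorem SameCell.segment (h : SameCell A x y) {t : ℝ} (ht : t ∈ Icc (0 : ℝ) 1) :
    SameCell A x ((1 - t) • x + t • y) := fun f hf => by
  rw [affineMap_segment, sign_lineMap (h f hf) ht]

/-- The sign vector of a point. -/
noncomputable def signVector (A : Arrangement d)
    (x : ℝ^d) : A → SignType := fun f => SignType.sign (f.1 x)

theorem sameCell_iff_signVector : SameCell A x y ↔ signVector A x = signVector A y := by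
  constructor
  · intro h; funext f; exact h f.1 f.2
  · intro h f hf; exact congrFun h ⟨f, hf⟩

/-- A point in the cell of `x` that depends only on the cell. -/
noncomputable def cellPoint (A : Arrangement d) (x : ℝ^d) : ℝ^d :=
  Function.invFun (signVector A) (signVector A x)

theorem sameCell_cellPoint (A : Arrangement d) (x : ℝ^d) : SameCell A (cellPoint A x) x :=
  sameCell_iff_signVector.2 (Function.invFun_eq ⟨x, rfl⟩)

theorem SameCell.cellPoint_eq (h : SameCell A x y) : cellPoint A x = cellPoint A y := by
  rw [cellPoint, cellPoint, sameCell_iff_signVector.1 h]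

theorem finite_range_cellPoint (A : Arrangement d) : (range (cellPoint A)).Finite := by
  refine (Set.finite_range (Function.invFun (signVector A))).subset ?_
  rintro _ ⟨x, rfl⟩
  exact ⟨_, rfl⟩

end Arrangements

/-! ### Null sets for the Hausdorff measure -/

section Null

variable {d n : ℕ}

theorem hausdorffMeasure_plane_eq_zero (a : ℝ^d) (W : Submodule ℝ ℝ^d) (hW : finrank ℝ W < n) :
    (μH[(n : ℝ)] : Measure ℝ^d) {x | x - a ∈ W} = 0 := by
  have hd : dimH {x : ℝ^d | x - a ∈ W} < ((n : NNReal) : ENNReal) := by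
    have himg : {x : ℝ^d | x - a ∈ W} = (fun w => w + a) '' (W : Set _) := by
      ext x; simp [sub_eq_add_neg]
    have hiso : Isometry fun w : ℝ^d => w + a := Isometry.of_dist_eq fun x y => by simp
    rw [himg, hiso.dimH_image]
    have h2 : (W : Set ℝ^d) = (Subtype.val : W → _) '' univ := by simp
    rw [h2, isometry_subtype_coe.dimH_image, Real.dimH_univ_eq_finrank]
    exact_mod_cast hW
  simpa using hausdorffMeasure_of_dimH_lt hd

variable {A : Arrangement d}

/-- The cells of dimension less than `n` are `n`-dimensional null sets. -/
theorem ae_le_finrank_zeroDir (A : Arrangement d) (n : ℕ) :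
    ∀ᵐ x ∂(μH[(n : ℝ)] : Measure ℝ^d), n ≤ finrank ℝ (zeroDir A x) := by
  rw [ae_iff]
  simp only [not_le]
  have : {x | finrank ℝ (zeroDir A x) < n} ⊆ ⋃ c ∈ range (cellPoint A) ∩
      {c | finrank ℝ (zeroDir A c) < n}, {x | x - c ∈ zeroDir A c} := by
    intro x hx
    have h := sameCell_cellPoint A x
    refine mem_iUnion₂.2 ⟨cellPoint A x, ⟨⟨x, rfl⟩, ?_⟩, h.sub_mem_zeroDir⟩
    have hx' : finrank ℝ (zeroDir A x) < n := hx
    rw [← h.zeroDir_eq] at hx'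
    exact hx'
  refine measure_mono_null this ?_
  rw [measure_biUnion_null_iff ((finite_range_cellPoint A).inter_of_left _).countable]
  exact fun c hc => hausdorffMeasure_plane_eq_zero c _ hc.2

end Null

/-! ### Coordinates of a simplex -/

section SimplexCoordinates

variable {d q : ℕ}

theorem OrientedSimplex.mem_carrier_iff (T : OrientedSimplex q d) {x : ℝ^d} :
    x ∈ T.carrier ↔ ∃ w : Fin (q + 1) → ℝ, (∀ i, 0 ≤ w i) ∧ ∑ i, w i = 1 ∧
      x = ∑ i, w i • T.points i := by
  rw [OrientedSimplex.carrier, convexHull_range_eq_exists_affineCombination]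
  constructor
  · rintro ⟨s, w, h0, h1, rfl⟩
    refine ⟨fun i => if i ∈ s then w i else 0, ?_, ?_, ?_⟩
    · intro i; dsimp only; split_ifs with h
      · exact h0 i h
      · exact le_rfl
    · simpa using h1
    · rw [affineCombination_eq_linear_combination _ _ _ h1]
      simp [ite_smul]
  · rintro ⟨w, h0, h1, rfl⟩
    refine ⟨Finset.univ, w, fun i _ => h0 i, h1, ?_⟩
    rw [affineCombination_eq_linear_combination _ _ _ h1]

/-- The barycentric coordinates of a simplex extend to affine functions on the whole space. -/
theorem OrientedSimplex.exists_coord (T : OrientedSimplex q d) : ∃ l : Fin (q + 1) → (ℝ^d →ᵃ[ℝ] ℝ),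
      ∀ w : Fin (q + 1) → ℝ, ∑ i, w i = 1 → ∀ i, l i (∑ j, w j • T.points j) = w i := by
  have hli : LinearIndependent ℝ fun i => ((T.points i, (1 : ℝ)) : ℝ^d × ℝ) := by
    rw [Fintype.linearIndependent_iff]
    intro g hg
    have h1 : ∑ i, g i • T.points i = 0 := by
      have := congrArg Prod.fst hg
      simpa [Prod.fst_sum] using this
    have h2 : ∑ i, g i = 0 := by
      have := congrArg Prod.snd hg
      simpa [Prod.snd_sum] using this
    have := (affineIndependent_iff.1 T.independent) Finset.univ g h2 h1
    exact fun i => this i (Finset.mem_univ i)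
  obtain ⟨L, hL⟩ := LinearMap.exists_leftInverse_of_injective
    (Fintype.linearCombination ℝ fun i => ((T.points i, (1 : ℝ)) : ℝ^d × ℝ))
    (LinearMap.ker_eq_bot.2 (linearIndependent_iff_injective_fintypeLinearCombination.1 hli))
  let ι : ℝ^d →ᵃ[ℝ] ℝ^d × ℝ := (LinearMap.inl ℝ ℝ^d ℝ).toAffineMap +
      AffineMap.const ℝ ℝ^d ((0 : ℝ^d), (1 : ℝ))
  have hι : ∀ x, ι x = (x, 1) := fun x => by simp [ι]
  refine ⟨fun i => ((LinearMap.proj i).comp L).toAffineMap.comp ι, fun w hw i => ?_⟩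
  have h1 : ι (∑ j, w j • T.points j) = Fintype.linearCombination ℝ
      (fun i => ((T.points i, (1 : ℝ)) : ℝ^d × ℝ)) w := by
    rw [hι, Fintype.linearCombination_apply]
    ext1
    · simp [Prod.fst_sum]
    · simp [Prod.snd_sum, hw]
  have h2 := congrArg (fun F => F w) hL
  simp only [LinearMap.comp_apply, LinearMap.id_apply] at h2
  simp only [AffineMap.comp_apply, LinearMap.coe_toAffineMap, h1, LinearMap.comp_apply, h2,
    LinearMap.proj_apply]

/-- The barycentric coordinates of a simplex, extended to affine functions on the whole space. -/
noncomputable def OrientedSimplex.coord (T : OrientedSimplex q d) :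
    Fin (q + 1) → (ℝ^d →ᵃ[ℝ] ℝ) := T.exists_coord.choose

theorem OrientedSimplex.coord_sum (T : OrientedSimplex q d) {w : Fin (q + 1) → ℝ}
    (hw : ∑ i, w i = 1) (i : Fin (q + 1)) : T.coord i (∑ j, w j • T.points j) = w i :=
  T.exists_coord.choose_spec w hw i

theorem OrientedSimplex.coord_point (T : OrientedSimplex q d) (i j : Fin (q + 1)) :
    T.coord i (T.points j) = if i = j then 1 else 0 := by
  have := T.coord_sum (w := Pi.single j 1) (by simp) i
  rw [Pi.single_apply] at this
  rw [← this]
  congr 1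
  simp [Pi.single_apply, ite_smul]

/-- The direction of a simplex. -/
noncomputable abbrev OrientedSimplex.dir (T : OrientedSimplex q d) : Submodule ℝ ℝ^d :=
  vectorSpan ℝ (range T.points)

theorem OrientedSimplex.finrank_dir (T : OrientedSimplex q d) : finrank ℝ T.dir = q :=
  T.independent.finrank_vectorSpan (by simp)

/-- The points of the plane of a simplex are the affine combinations of its vertices. -/
theorem OrientedSimplex.eq_sum_coord (T : OrientedSimplex q d) {x : ℝ^d}
    (hx : x - T.points 0 ∈ T.dir) :
    ∑ i, T.coord i x = 1 ∧ x = ∑ i, T.coord i x • T.points i := by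
  have h1 : x ∈ affineSpan ℝ (range T.points) := by
    rw [← AffineSubspace.vsub_right_mem_direction_iff_mem
      (mem_affineSpan ℝ (mem_range_self (0 : Fin (q + 1)))), direction_affineSpan]
    exact hx
  obtain ⟨w, hw, rfl⟩ := eq_affineCombination_of_mem_affineSpan_of_fintype h1
  rw [affineCombination_eq_linear_combination _ _ _ hw]
  simp only [T.coord_sum hw]
  exact ⟨hw, trivial⟩

theorem OrientedSimplex.sum_sub_mem_dir (T : OrientedSimplex q d) {w : Fin (q + 1) → ℝ}
    (hw : ∑ i, w i = 1) (j : Fin (q + 1)) : ∑ i, w i • T.points i - T.points j ∈ T.dir := by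
  have : ∑ i, w i • T.points i - T.points j = ∑ i, w i • (T.points i - T.points j) := by
    simp only [smul_sub, sum_sub_distrib, ← sum_smul, hw, one_smul]
  rw [this]
  exact Submodule.sum_mem _ fun i _ => smul_mem _ _
    (vsub_mem_vectorSpan ℝ (mem_range_self i) (mem_range_self j))

theorem OrientedSimplex.sub_mem_dir (T : OrientedSimplex q d) {x : ℝ^d}
    (hx : x ∈ T.carrier) (j : Fin (q + 1)) : x - T.points j ∈ T.dir := by
  obtain ⟨w, -, hw, rfl⟩ := T.mem_carrier_iff.1 hx
  exact T.sum_sub_mem_dir hw j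

theorem OrientedSimplex.mem_carrier_iff_coord (T : OrientedSimplex q d) {x : ℝ^d} :
    x ∈ T.carrier ↔ x - T.points 0 ∈ T.dir ∧ ∀ i, 0 ≤ T.coord i x := by
  constructor
  · intro hx
    refine ⟨T.sub_mem_dir hx 0, fun i => ?_⟩
    obtain ⟨w, h0, hw, rfl⟩ := T.mem_carrier_iff.1 hx
    rw [T.coord_sum hw]
    exact h0 i
  · rintro ⟨h1, h2⟩
    obtain ⟨h3, h4⟩ := T.eq_sum_coord h1
    exact T.mem_carrier_iff.2 ⟨_, h2, h3, h4⟩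

theorem OrientedSimplex.isCompact_carrier (T : OrientedSimplex q d) : IsCompact T.carrier :=
  (Set.finite_range T.points).isCompact_convexHull ℝ

theorem OrientedSimplex.points_mem_carrier (T : OrientedSimplex q d) (i : Fin (q + 1)) :
    T.points i ∈ T.carrier := subset_convexHull ℝ _ (mem_range_self i)

end SimplexCoordinates

/-! ### Arrangements adapted to polyhedral sets -/

section Adapted

variable {d : ℕ}

/-- The arrangement `A` is adapted to the set `M` of dimension `n`: it consists of `1`-Lipschitz
functions, and `M` is a union of cells of `A`, all of dimension at most `n`. -/
structure IsAdapted (A : Arrangement d) (n : ℕ)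
    (M : Set ℝ^d) : Prop where
  lip : IsLipArrangement A
  decides : Decides A M
  finrank_le : ∀ x ∈ M, finrank ℝ (zeroDir A x) ≤ n

/-- Up to a positive factor, every affine function is `1`-Lipschitz. -/
theorem exists_pos_smul_lipschitz (f : ℝ^d →ᵃ[ℝ] ℝ) :
    ∃ c : ℝ, 0 < c ∧ ∀ x y, |(c • f) x - (c • f) y| ≤ dist x y := by
  have hpos : 0 < 1 + ‖toContinuousLinearMap f.linear‖ := by positivity
  refine ⟨(1 + ‖toContinuousLinearMap f.linear‖)⁻¹, inv_pos.2 hpos, fun x y => ?_⟩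
  have h1 : |f x - f y| ≤ ‖toContinuousLinearMap f.linear‖ * ‖x - y‖ := by
    rw [← affineMap_sub, ← norm_eq_abs]
    exact (toContinuousLinearMap f.linear).le_opNorm (x - y)
  have h2 : |f x - f y| ≤ (1 + ‖toContinuousLinearMap f.linear‖) * dist x y := by
    rw [dist_eq_norm]
    nlinarith [norm_nonneg (x - y)]
  simp only [AffineMap.coe_smul, Pi.smul_apply, smul_eq_mul]
  rw [← mul_sub, abs_mul, abs_of_pos (inv_pos.2 hpos), inv_mul_le_iff₀ hpos]
  exact h2

/-- An affine function that is positively proportional to a given one and `1`-Lipschitz. -/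
noncomputable def lipNormalize (f : ℝ^d →ᵃ[ℝ] ℝ) :
    ℝ^d →ᵃ[ℝ] ℝ := (exists_pos_smul_lipschitz f).choose • f

theorem lipNormalize_lipschitz (f : ℝ^d →ᵃ[ℝ] ℝ) (x y : ℝ^d) :
    |lipNormalize f x - lipNormalize f y| ≤ dist x y :=
  (exists_pos_smul_lipschitz f).choose_spec.2 x y

theorem lipNormalize_eq (f : ℝ^d →ᵃ[ℝ] ℝ) : ∃ c : ℝ, 0 < c ∧ (∀ x, lipNormalize f x = c * f x) ∧
      ∀ v, (lipNormalize f).linear v = c * f.linear v :=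
  ⟨_, (exists_pos_smul_lipschitz f).choose_spec.1, fun _ => rfl, fun _ => rfl⟩

theorem sign_lipNormalize (f : ℝ^d →ᵃ[ℝ] ℝ) (x) :
    SignType.sign (lipNormalize f x) = SignType.sign (f x) := by
  obtain ⟨c, hc, h, -⟩ := lipNormalize_eq f
  rw [h, sign_mul, sign_pos hc, one_mul]

/-- Every plane is the common zero set of a finite set of affine functions. -/
theorem exists_plane_functions (a : ℝ^d) (W : Submodule ℝ ℝ^d) :
    ∃ B : Arrangement d, IsLipArrangement B ∧
      (∀ x, x - a ∈ W ↔ ∀ f ∈ B, f x = 0) ∧ ∀ v, v ∈ W ↔ ∀ f ∈ B, f.linear v = 0 := by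
  classical
  let L : Fin d → ℝ^d →L[ℝ] ℝ := fun l => (EuclideanSpace.proj l).comp Wᗮ.starProjection
  let F : Fin d → (ℝ^d →ᵃ[ℝ] ℝ) := fun l =>
    (L l).toLinearMap.toAffineMap - AffineMap.const ℝ ℝ^d (L l a)
  have hF : ∀ l x, F l x = L l (x - a) := fun l x => by simp [F]
  have hFl : ∀ l v, (F l).linear v = L l v := fun l v => by simp [F]
  have key : ∀ v, v ∈ W ↔ ∀ l, L l v = 0 := fun v => by
    rw [← W.orthogonal_orthogonal, ← starProjection_apply_eq_zero_iff]
    exact ⟨fun h l => by simp [L, h], fun h => by ext l; exact h l⟩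
  refine ⟨Finset.univ.image F, fun f hf x y => ?_, fun x => by simp [key, hF], fun v => by
    simp [key, hFl]⟩
  obtain ⟨l, -, rfl⟩ := Finset.mem_image.1 hf
  rw [← affineMap_sub, hFl, dist_eq_norm]
  exact (PiLp.norm_apply_le (p := 2) (Wᗮ.starProjection (x - y)) l).trans
    (Wᗮ.norm_starProjection_apply_le _)

/-- The arrangement of a simplex: functions `B` that cut out its plane, together with the
normalized barycentric coordinates. -/
theorem OrientedSimplex.exists_arrangement {q : ℕ} (T : OrientedSimplex q d) :
    ∃ A : Arrangement d, IsLipArrangement A ∧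
      Decides A T.carrier ∧ (∀ x ∈ T.carrier, zeroDir A x ≤ T.dir) ∧
      ∀ i, lipNormalize (T.coord i) ∈ A := by
  classical
  obtain ⟨B, hB, hBx, hBv⟩ := exists_plane_functions (T.points 0) T.dir
  refine ⟨B ∪ Finset.univ.image fun i => lipNormalize (T.coord i), ?_, ?_, ?_, fun i => ?_⟩
  · intro f hf
    rcases Finset.mem_union.1 hf with hf | hf
    · exact hB f hf
    · obtain ⟨l, -, rfl⟩ := Finset.mem_image.1 hf
      exact lipNormalize_lipschitz _
  · intro x y hxy hx
    rw [T.mem_carrier_iff_coord] at hx ⊢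
    refine ⟨(hBx y).2 fun f hf => (hxy.eq_zero_iff (Finset.mem_union_left _ hf)).1
      ((hBx x).1 hx.1 f hf), fun i => ?_⟩
    have := hxy _ (Finset.mem_union_right _ (Finset.mem_image_of_mem
      (fun i => lipNormalize (T.coord i)) (Finset.mem_univ i)))
    rw [sign_lipNormalize, sign_lipNormalize] at this
    rw [← sign_nonneg_iff, ← this, sign_nonneg_iff]
    exact hx.2 i
  · intro x hx v hv
    exact (hBv v).2 fun f hf => hv f (Finset.mem_union_left _ hf)
      ((hBx x).1 (T.mem_carrier_iff_coord.1 hx).1 f hf)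
  · exact Finset.mem_union_right _ (Finset.mem_image_of_mem
      (fun i => lipNormalize (T.coord i)) (Finset.mem_univ i))

/-- By Carathéodory's theorem, a polyhedral set of dimension `n` is a finite union of simplices of
dimension at most `n`. -/
theorem IsPolyhedralSet.exists_simplices {n : ℕ} {M : Set ℝ^d} (hM : IsPolyhedralSet n M) :
    ∃ S : Set (Set ℝ^d), S.Finite ∧ M = ⋃₀ S ∧
      ∀ s ∈ S, ∃ q, q ≤ n ∧ ∃ T : OrientedSimplex q d, T.carrier = s := by
  classical
  obtain ⟨𝒦, hfin, -, hK, rfl⟩ := hM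
  choose! F hFne hFK hFn using hK
  refine ⟨⋃ K ∈ 𝒦, (fun t : Finset ℝ^d => convexHull ℝ (t : Set _)) ''
    {t | t ∈ (F K).powerset ∧ t.Nonempty ∧ AffineIndependent ℝ ((↑) : t → ℝ^d)},
    ?_, ?_, ?_⟩
  · refine hfin.biUnion fun K _ => Finite.image _ ?_
    exact (F K).powerset.finite_toSet.subset fun t ht => ht.1
  · ext x
    simp only [mem_sUnion, mem_iUnion, exists_prop, mem_image]
    constructor
    · rintro ⟨K, hKm, hx⟩
      rw [hFK K hKm, convexHull_eq_union] at hx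
      simp only [mem_iUnion] at hx
      obtain ⟨t, ht, hti, hxt⟩ := hx
      refine ⟨_, ⟨K, hKm, t, ⟨Finset.mem_powerset.2 (by exact_mod_cast ht), ?_, hti⟩, rfl⟩, hxt⟩
      rw [Finset.nonempty_iff_ne_empty]
      rintro rfl
      simp at hxt
    · rintro ⟨_, ⟨K, hKm, t, ⟨ht, -, -⟩, rfl⟩, hxt⟩
      refine ⟨K, hKm, ?_⟩
      rw [hFK K hKm]
      exact convexHull_mono (by exact_mod_cast Finset.mem_powerset.1 ht) hxt
  · intro s hs
    simp only [mem_iUnion, exists_prop, mem_image] at hs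
    obtain ⟨K, hKm, t, ⟨ht, htne, hti⟩, rfl⟩ := hs
    obtain ⟨q, hq⟩ : ∃ q, t.card = q + 1 := Nat.exists_eq_succ_of_ne_zero htne.card_pos.ne'
    let e : Fin (q + 1) ≃ t := (t.equivFinOfCardEq hq).symm
    let T : OrientedSimplex q d := ⟨fun i => (e i : ℝ^d), hti.comp_embedding e.toEmbedding⟩
    have hr : range T.points = t := by
      have : T.points = ((↑) : t → ℝ^d) ∘ e := rfl
      rw [this, e.surjective.range_comp]
      simp
    refine ⟨q, ?_, T, by rw [OrientedSimplex.carrier, hr]⟩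
    have h1 : finrank ℝ T.dir = q := T.finrank_dir
    rw [← h1, ← hFn K hKm, OrientedSimplex.dir, hr]
    exact finrank_mono (vectorSpan_mono ℝ (by exact_mod_cast Finset.mem_powerset.1 ht))

/-- Every polyhedral set has an adapted arrangement, such that each cell of top dimension of the
set is contained in a simplex of the same direction. -/
theorem IsPolyhedralSet.exists_isAdapted {n : ℕ} {M : Set ℝ^d} (hM : IsPolyhedralSet n M) :
    ∃ A : Arrangement d, IsAdapted A n M ∧ ∀ x ∈ M, finrank ℝ (zeroDir A x) = n →
        ∃ T : OrientedSimplex n d, T.dir = zeroDir A x ∧ ∀ y, SameCell A x y → y ∈ T.carrier := by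
  classical
  obtain ⟨S, hfin, rfl, hS⟩ := hM.exists_simplices
  have hex : ∀ s ∈ S, ∃ A : Arrangement d, IsLipArrangement A ∧
      Decides A s ∧ ∃ q, q ≤ n ∧ ∃ T : OrientedSimplex q d, T.carrier = s ∧
        ∀ x ∈ s, zeroDir A x ≤ T.dir := fun s hs => by
    obtain ⟨q, hq, T, rfl⟩ := hS s hs
    obtain ⟨A, h1, h2, h3, -⟩ := T.exists_arrangement
    exact ⟨A, h1, h2, q, hq, T, rfl, h3⟩
  choose! A hA1 hA2 hA3 using hex
  have hsub : ∀ s ∈ S, A s ⊆ hfin.toFinset.biUnion A := fun s hs =>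
    Finset.subset_biUnion_of_mem A (hfin.mem_toFinset.2 hs)
  have hmono : ∀ s ∈ S, ∀ x, zeroDir (hfin.toFinset.biUnion A) x ≤ zeroDir (A s) x :=
    fun s hs x v hv f hf h0 => hv f (hsub s hs hf) h0
  refine ⟨hfin.toFinset.biUnion A, ⟨?_, ?_, ?_⟩, ?_⟩
  · intro f hf
    obtain ⟨s, hs, hf⟩ := Finset.mem_biUnion.1 hf
    exact hA1 s (hfin.mem_toFinset.1 hs) f hf
  · rintro x y hxy ⟨s, hs, hx⟩
    exact ⟨s, hs, (hA2 s hs).mono (hsub s hs) x y hxy hx⟩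
  · rintro x ⟨s, hs, hx⟩
    obtain ⟨q, hq, T, -, hdir⟩ := hA3 s hs
    exact (finrank_mono ((hmono s hs x).trans (hdir x hx))).trans
      (T.finrank_dir.le.trans hq)
  · rintro x ⟨s, hs, hx⟩ hxn
    obtain ⟨q, hq, T, hTs, hdir⟩ := hA3 s hs
    have hle := (hmono s hs x).trans (hdir x hx)
    have h1 := (finrank_mono hle)
    rw [hxn, T.finrank_dir] at h1
    obtain rfl : q = n := le_antisymm hq h1
    refine ⟨T, (Submodule.eq_of_le_of_finrank_eq hle (by rw [hxn, T.finrank_dir])).symm,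
      fun y hy => ?_⟩
    rw [hTs]
    exact (hA2 s hs).mono (hsub s hs) x y hy hx

theorem IsPolyhedralSet.isCompact {n : ℕ} {M : Set ℝ^d}
    (hM : IsPolyhedralSet n M) : IsCompact M := by
  obtain ⟨𝒦, hfin, -, hK, rfl⟩ := hM
  refine hfin.isCompact_sUnion fun K hKm => ?_
  obtain ⟨F, -, rfl, -⟩ := hK K hKm
  exact F.finite_toSet.isCompact_convexHull ℝ

theorem IsPolyhedralSet.nonempty {n : ℕ} {M : Set ℝ^d} (hM : IsPolyhedralSet n M) : M.Nonempty := by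
  obtain ⟨𝒦, -, ⟨K, hKm⟩, hK, rfl⟩ := hM
  obtain ⟨F, ⟨a, ha⟩, rfl, -⟩ := hK K hKm
  exact ⟨a, _, hKm, subset_convexHull ℝ _ ha⟩

theorem IsPolyhedralSet.coveredByPlanes {n : ℕ} {M : Set ℝ^d}
    (hM : IsPolyhedralSet n M) : CoveredByPlanes n M := by
  classical
  obtain ⟨𝒦, hfin, -, hK, rfl⟩ := hM
  have hex : ∀ K ∈ 𝒦, ∃ P : ℝ^d × Submodule ℝ ℝ^d,
      finrank ℝ P.2 = n ∧ ∀ x ∈ K, x - P.1 ∈ P.2 := fun K hKm => by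
    obtain ⟨F, ⟨a, ha⟩, rfl, hn⟩ := hK K hKm
    refine ⟨(a, vectorSpan ℝ (F : Set ℝ^d)), hn, fun x hx => ?_⟩
    have h1 := convexHull_subset_affineSpan (𝕜 := ℝ) _ hx
    rw [← direction_affineSpan]
    exact AffineSubspace.vsub_mem_direction h1 (mem_affineSpan ℝ ha)
  choose! P hP1 hP2 using hex
  refine ⟨hfin.toFinset.image P, fun Q hQ => ?_, ?_⟩
  · obtain ⟨K, hKm, rfl⟩ := Finset.mem_image.1 hQ
    exact hP1 K (hfin.mem_toFinset.1 hKm)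
  · rintro x ⟨K, hKm, hx⟩
    exact ⟨P K, Finset.mem_image_of_mem P (hfin.mem_toFinset.2 hKm), hP2 K hKm x hx⟩

theorem IsPolyhedralSet.union {n : ℕ} {M M' : Set ℝ^d}
    (hM : IsPolyhedralSet n M) (hM' : IsPolyhedralSet n M') : IsPolyhedralSet n (M ∪ M') := by
  obtain ⟨𝒦, hfin, hne, hK, rfl⟩ := hM
  obtain ⟨𝒦', hfin', -, hK', rfl⟩ := hM'
  exact ⟨𝒦 ∪ 𝒦', hfin.union hfin', hne.inl, fun K h => h.elim (hK K) (hK' K),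
    sUnion_union _ _ |>.symm⟩

/-- Compact, convex unions of cells of an arrangement are polytopes: their extreme points are
points whose cells have dimension zero, and there are only finitely many of those. -/
theorem Decides.exists_convexHull {A : Arrangement d}
    {K : Set ℝ^d} (hA : IsLipArrangement A) (hK : Decides A K)
    (hc : IsCompact K) (hconv : Convex ℝ K) :
    ∃ F : Finset ℝ^d, K = convexHull ℝ (F : Set _) := by
  have hsub : K.extremePoints ℝ ⊆ range (cellPoint A) := by
    intro x hx
    have hz : zeroDir A x = ⊥ := by
      rw [Submodule.eq_bot_iff]
      intro v hv
      by_contra hv0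
      obtain ⟨ρ, hρ, -, hρA⟩ := eventually_dist_lt A x
      have hvn : 0 < ‖v‖ := norm_pos_iff.2 hv0
      let w : ℝ^d := (ρ / (2 * ‖v‖)) • v
      have hwn : ‖w‖ < ρ := by
        simp only [w]
        rw [norm_smul, norm_eq_abs, abs_of_pos (by positivity)]
        field_simp
        linarith
      have hw0 : w ≠ 0 := smul_ne_zero (by positivity) hv0
      have hw : w ∈ zeroDir A x := smul_mem _ _ hv
      have h1 : x + w ∈ K := hK x _ (sameCell_of_mem_zeroDir hA (by simpa using hw)
        fun f hf h0 => by rw [dist_self_add_right]; exact hwn.trans_le (hρA f hf h0)) hx.1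
      have h2 : x - w ∈ K := hK x _ (sameCell_of_mem_zeroDir hA (by simpa using hw)
        fun f hf h0 => by rw [dist_eq_norm]; simpa using hwn.trans_le (hρA f hf h0)) hx.1
      have h3 := hx.2 h1 h2 ⟨1 / 2, 1 / 2, by norm_num, by norm_num, by norm_num, by module⟩
      exact hw0 (by simpa using h3)
    have h := (sameCell_cellPoint A x)
    have h1 := h.symm.sub_mem_zeroDir
    rw [hz, Submodule.mem_bot, sub_eq_zero] at h1
    exact ⟨x, h1⟩
  have hfin := (finite_range_cellPoint A).subset hsub
  refine ⟨hfin.toFinset, ?_⟩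
  rw [hfin.coe_toFinset]
  exact (closure_convexHull_extremePoints hc hconv).symm.trans
    (hfin.isClosed_convexHull ℝ).closure_eq

theorem finrank_inf_ker {n : ℕ} (W : Submodule ℝ ℝ^d) (hW : finrank ℝ W = n + 1) (φ : ℝ^d →ₗ[ℝ] ℝ)
    (hφ : ∃ v ∈ W, φ v ≠ 0) : finrank ℝ (W ⊓ ker φ : Submodule ℝ _) = n := by
  obtain ⟨v, hv, hv0⟩ := hφ
  have h1 := LinearMap.finrank_range_add_finrank_ker (φ.domRestrict W)
  rw [LinearMap.range_eq_top.2 (LinearMap.surjective fun h => hv0 (DFunLike.congr_fun h ⟨v, hv⟩)),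
    finrank_top, finrank_self, hW] at h1
  rw [← Submodule.map_comap_subtype, Submodule.finrank_map_subtype_eq]
  exact Nat.add_left_cancel (h1.trans (add_comm n 1))

/-- The points of a simplex at which some function in `A`, which does not vanish on the whole
simplex, has a zero. -/
def cutSet {q : ℕ} (A : Arrangement d) (T : OrientedSimplex q d) : Set ℝ^d :=
  {z | z ∈ T.carrier ∧ ∃ f ∈ A, (∃ i, f (T.points i) ≠ 0) ∧ f z = 0}

theorem affineMap_sum {ι : Type*} [Fintype ι] (f : ℝ^d →ᵃ[ℝ] ℝ) {w : ι → ℝ}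
    (hw : ∑ i, w i = 1) (p : ι → ℝ^d) :
    f (∑ i, w i • p i) = ∑ i, w i * f (p i) := by
  rw [← affineCombination_eq_linear_combination _ _ _ hw,
    Finset.map_affineCombination _ _ _ hw f,
    affineCombination_eq_linear_combination _ _ _ hw]
  simp

theorem decides_cutSet {q : ℕ} {A : Arrangement d}
    {T : OrientedSimplex q d} (hT : Decides A T.carrier) : Decides A (cutSet A T) := by
  rintro x y hxy ⟨hx, f, hf, hfi, h0⟩
  exact ⟨hT x y hxy hx, f, hf, hfi, (hxy.eq_zero_iff hf).1 h0⟩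

theorem exists_mem_dir_linear_ne {q : ℕ} {T : OrientedSimplex q d}
    {f : ℝ^d →ᵃ[ℝ] ℝ} {i : Fin (q + 1)} (hi : f (T.points i) ≠ 0)
    {z : ℝ^d} (hz : z ∈ T.carrier) (h0 : f z = 0) :
    ∃ v ∈ T.dir, f.linear v ≠ 0 :=
  ⟨z - T.points i, T.sub_mem_dir hz i, by rw [affineMap_sub, h0, zero_sub]; exact neg_ne_zero.2 hi⟩

theorem finrank_le_of_mem_cutSet {n : ℕ} {A : Arrangement d}
    {T : OrientedSimplex (n + 1) d} (hT : ∀ x ∈ T.carrier, zeroDir A x ≤ T.dir)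
    {z : ℝ^d} (hz : z ∈ cutSet A T) :
    finrank ℝ (zeroDir A z) ≤ n := by
  obtain ⟨hz, f, hf, ⟨i, hi⟩, h0⟩ := hz
  rw [← finrank_inf_ker T.dir T.finrank_dir f.linear (exists_mem_dir_linear_ne hi hz h0)]
  exact finrank_mono (le_inf (hT z hz) fun v hv => hv f hf h0)

theorem OrientedSimplex.isConvexPolyhedron {q : ℕ} (T : OrientedSimplex q d) :
    IsConvexPolyhedron q T.carrier := by
  classical
  refine ⟨Finset.univ.image T.points, by simp, by simp [OrientedSimplex.carrier], ?_⟩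
  rw [Finset.coe_image, Finset.coe_univ, image_univ]
  exact T.finrank_dir

theorem OrientedSimplex.mem_oppositeFace_iff {q : ℕ} (T : OrientedSimplex (q + 1) d)
    {i : Fin (q + 2)} {x : ℝ^d} :
    x ∈ (T.oppositeFace i).carrier ↔ x ∈ T.carrier ∧ T.coord i x = 0 := by
  rw [OrientedSimplex.mem_carrier_iff]
  constructor
  · rintro ⟨w, h0, hw, rfl⟩
    have e1 : ∑ j, (i.insertNth 0 w : Fin (q + 2) → ℝ) j = 1 := by
      rw [Fin.sum_univ_succAbove _ i]; simpa using hw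
    have e2 : ∑ j, w j • (T.oppositeFace i).points j =
        ∑ j, (i.insertNth 0 w : Fin (q + 2) → ℝ) j • T.points j := by
      rw [Fin.sum_univ_succAbove _ i]
      simp [OrientedSimplex.oppositeFace]
    rw [e2]
    refine ⟨T.mem_carrier_iff.2 ⟨_, fun j => ?_, e1, rfl⟩, ?_⟩
    · rcases Fin.eq_self_or_eq_succAbove i j with rfl | ⟨j', rfl⟩
      · simp
      · simpa using h0 j'
    · rw [T.coord_sum e1]; simp
  · rintro ⟨hx, h0⟩
    obtain ⟨w, hw0, hw, rfl⟩ := T.mem_carrier_iff.1 hx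
    rw [T.coord_sum hw] at h0
    refine ⟨fun j => w (i.succAbove j), fun j => hw0 _, ?_, ?_⟩
    · rw [Fin.sum_univ_succAbove _ i, h0] at hw; simpa using hw
    · rw [Fin.sum_univ_succAbove _ i, h0]
      simp [OrientedSimplex.oppositeFace]

/-- If an affine function changes its sign on a simplex, then its zero set in the simplex is a
polytope of codimension one in the simplex. -/
theorem isConvexPolyhedron_zeroSet {n : ℕ} {A : Arrangement d}
    (hA : IsLipArrangement A) {T : OrientedSimplex (n + 1) d} (hT : Decides A T.carrier)
    {f : ℝ^d →ᵃ[ℝ] ℝ} (hf : f ∈ A) {i j : Fin (n + 2)}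
    (hi : 0 < f (T.points i)) (hj : f (T.points j) < 0) :
    IsConvexPolyhedron n {z | z ∈ T.carrier ∧ f z = 0} := by
  have hset : {z | z ∈ T.carrier ∧ f z = 0} = T.carrier ∩ f ⁻¹' {0} := rfl
  have hfc : Continuous f := f.continuous_of_finiteDimensional
  have hdec : Decides A {z | z ∈ T.carrier ∧ f z = 0} := fun x y hxy hx =>
    ⟨hT x y hxy hx.1, (hxy.eq_zero_iff hf).1 hx.2⟩
  have hcpt : IsCompact {z | z ∈ T.carrier ∧ f z = 0} := by
    rw [hset]
    exact T.isCompact_carrier.inter_right (isClosed_singleton.preimage hfc)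
  have hconv : Convex ℝ {z | z ∈ T.carrier ∧ f z = 0} := by
    rw [hset]
    exact (convex_convexHull ℝ _).inter ((convex_singleton 0).affine_preimage f)
  obtain ⟨F, hF⟩ := hdec.exists_convexHull hA hcpt hconv
  -- an interior point of the simplex at which `f` vanishes
  obtain ⟨w, hw0, hw1, hwf⟩ : ∃ w : Fin (n + 2) → ℝ, (∀ l, 0 < w l) ∧ ∑ l, w l = 1 ∧
      f (∑ l, w l • T.points l) = 0 := by
    -- the barycentre, after its weight at a vertex `b` is increased
    obtain ⟨b, hb, hSb⟩ : ∃ b, f (T.points b) ≠ 0 ∧ (∑ l, f (T.points l)) / f (T.points b) ≤ 0 := by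
      rcases le_total 0 (∑ l, f (T.points l)) with h | h
      exacts [⟨j, hj.ne, div_nonpos_of_nonneg_of_nonpos h hj.le⟩,
        ⟨i, hi.ne', div_nonpos_of_nonpos_of_nonneg h hi.le⟩]
    set τ := (∑ l, f (T.points l)) / f (T.points b)
    have hW : 0 < (n + 2 : ℝ) - τ := by linarith [(n.cast_nonneg : (0 : ℝ) ≤ n)]
    have hsum : ∑ l : Fin (n + 2), (1 - if l = b then τ else 0) / ((n + 2 : ℝ) - τ) = 1 := by
      rw [← sum_div, sum_sub_distrib]
      simp [hW.ne']
    refine ⟨_, fun l => div_pos ?_ hW, hsum, ?_⟩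
    · split_ifs <;> linarith
    · rw [affineMap_sum f hsum]
      simp only [div_mul_eq_mul_div, ← sum_div, sub_mul, sum_sub_distrib]
      simp [τ, hb]
  set x := ∑ l, w l • T.points l with hx
  have hxT : x ∈ T.carrier := T.mem_carrier_iff.2 ⟨w, fun l => (hw0 l).le, hw1, rfl⟩
  refine ⟨F, ?_, hF, ?_⟩
  · rw [Finset.nonempty_iff_ne_empty]
    rintro rfl
    have : x ∈ {z | z ∈ T.carrier ∧ f z = 0} := ⟨hxT, hwf⟩
    rw [hF] at this
    simp at this
  · have hspan : vectorSpan ℝ (F : Set ℝ^d) = vectorSpan ℝ {z | z ∈ T.carrier ∧ f z = 0} := by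
      rw [hF, ← direction_affineSpan, ← direction_affineSpan, affineSpan_convexHull]
    suffices h : vectorSpan ℝ {z | z ∈ T.carrier ∧ f z = 0} = T.dir ⊓ ker f.linear by
      rw [hspan, h]
      exact finrank_inf_ker T.dir T.finrank_dir f.linear (exists_mem_dir_linear_ne hi.ne' hxT hwf)
    apply le_antisymm
    · rw [vectorSpan, span_le]
      rintro _ ⟨a, ha, b, hb, rfl⟩
      refine ⟨?_, ?_⟩
      · have := T.dir.sub_mem (T.sub_mem_dir ha.1 0) (T.sub_mem_dir hb.1 0)
        simpa using this
      · show f.linear (a -ᵥ b) = 0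
        rw [f.linearMap_vsub, ha.2, hb.2]; simp
    · rintro v ⟨hv1, hv2⟩
      have hopen : ∀ᶠ t : ℝ in 𝓝 0, ∀ l, 0 < T.coord l (x + t • v) := by
        rw [eventually_all]
        intro l
        have hc : Continuous fun t : ℝ => T.coord l (x + t • v) :=
          (T.coord l).continuous_of_finiteDimensional.comp (by fun_prop)
        refine hc.continuousAt.eventually (lt_mem_nhds ?_)
        simp only [zero_smul, add_zero, hx, T.coord_sum hw1]
        exact hw0 l
      obtain ⟨t, ht, ht0⟩ := ((hopen.filter_mono nhdsWithin_le_nhds).and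
        (self_mem_nhdsWithin (s := Ioi (0 : ℝ)))).exists
      have ht0 : 0 < t := ht0
      have hmem : x + t • v ∈ {z | z ∈ T.carrier ∧ f z = 0} := by
        refine ⟨T.mem_carrier_iff_coord.2 ⟨?_, fun l => (ht l).le⟩, ?_⟩
        · rw [add_sub_right_comm]
          exact T.dir.add_mem (T.sub_mem_dir hxT 0) (T.dir.smul_mem t hv1)
        · have := affineMap_sub f x (x + t • v)
          rw [hwf, sub_zero, add_sub_cancel_left, map_smul, show f.linear v = 0 from hv2,
            smul_zero] at this
          exact this.symm
      have h1 := vsub_mem_vectorSpan ℝ hmem (show x ∈ {z | z ∈ T.carrier ∧ f z = 0} from ⟨hxT, hwf⟩)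
      have h2 := smul_mem _ t⁻¹ h1
      have h3 : t⁻¹ • (x + t • v -ᵥ x) = v := by
        rw [vsub_eq_sub, add_sub_cancel_left, inv_smul_smul₀ ht0.ne']
      rwa [h3] at h2

/-- The zero sets of functions that change their sign on the simplex are polyhedra of dimension `n`;
those of the others lie in faces of the simplex. -/
theorem isPolyhedralSet_cutSet {n : ℕ} {A : Arrangement d}
    (hA : IsLipArrangement A) {T : OrientedSimplex (n + 1) d} (hT : Decides A T.carrier)
    (hTA : ∀ i, lipNormalize (T.coord i) ∈ A) : IsPolyhedralSet n (cutSet A T) := by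
  classical
  have hface : ∀ i z, z ∈ (T.oppositeFace i).carrier → z ∈ cutSet A T := by
    intro i z hz
    obtain ⟨h1, h2⟩ := T.mem_oppositeFace_iff.1 hz
    obtain ⟨c, hc, h, -⟩ := lipNormalize_eq (T.coord i)
    refine ⟨h1, _, hTA i, ⟨i, ?_⟩, by rw [h, h2, mul_zero]⟩
    rw [h, T.coord_point, if_pos rfl, mul_one]
    exact hc.ne'
  refine ⟨range (fun i => (T.oppositeFace i).carrier) ∪
    (fun f : ℝ^d →ᵃ[ℝ] ℝ => {z | z ∈ T.carrier ∧ f z = 0}) ''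
      {f | f ∈ A ∧ (∃ i, 0 < f (T.points i)) ∧ ∃ j, f (T.points j) < 0}, ?_, ?_, ?_, ?_⟩
  · exact (finite_range _).union ((A.finite_toSet.subset fun f hf => hf.1).image _)
  · exact (range_nonempty _).inl
  · rintro K (⟨i, rfl⟩ | ⟨f, ⟨hf, ⟨i, hi⟩, ⟨j, hj⟩⟩, rfl⟩)
    · exact (T.oppositeFace i).isConvexPolyhedron
    · exact isConvexPolyhedron_zeroSet hA hT hf hi hj
  · ext z
    simp only [mem_sUnion]
    constructor
    · rintro ⟨hz, f, hf, ⟨i, hi⟩, h0⟩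
      -- if `f` does not change its sign, its zeros lie in the faces opposite to the other vertices
      have hsame : (∀ l, 0 ≤ f (T.points l) * f (T.points i)) → z ∈ (T.oppositeFace i).carrier := by
        intro hall
        obtain ⟨w, hw0, hw1, rfl⟩ := T.mem_carrier_iff.1 hz
        refine T.mem_oppositeFace_iff.2 ⟨hz, ?_⟩
        rw [T.coord_sum hw1]
        rw [affineMap_sum f hw1] at h0
        have h2 : ∑ l, w l * (f (T.points l) * f (T.points i)) = 0 := by
          simp only [← mul_assoc, ← sum_mul, h0, zero_mul]
        have h3 := (Finset.sum_eq_zero_iff_of_nonneg fun l _ =>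
          mul_nonneg (hw0 l) (hall l)).1 h2 i (Finset.mem_univ i)
        exact (mul_eq_zero.1 h3).resolve_right (mul_self_ne_zero.2 hi)
      by_cases hall : ∀ l, 0 ≤ f (T.points l) * f (T.points i)
      · exact ⟨_, Or.inl ⟨i, rfl⟩, hsame hall⟩
      · push Not at hall
        obtain ⟨l, hl⟩ := hall
        refine ⟨_, Or.inr ⟨f, ⟨hf, ?_⟩, rfl⟩, hz, h0⟩
        rcases lt_or_gt_of_ne hi with h | h
        · exact ⟨⟨l, by nlinarith⟩, ⟨i, h⟩⟩
        · exact ⟨⟨i, h⟩, ⟨l, by nlinarith⟩⟩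
    · rintro ⟨K, ⟨i, rfl⟩ | ⟨f, ⟨hf, ⟨i, hi⟩, -⟩, rfl⟩, hz⟩
      · exact hface i z hz
      · exact ⟨hz.1, f, hf, ⟨i, hi.ne'⟩, hz.2⟩

end Adapted

/-! ### Orientations of simplices -/

section Signs

variable {d q : ℕ}

/-- The determinant of the vertices of a simplex in homogeneous coordinates, in the coordinates
given by the frame `e`. -/
noncomputable def OrientedSimplex.homDet (T : OrientedSimplex q d) (e : Fin q → ℝ^d) : ℝ :=
  (of fun i j : Fin (q + 1) =>
    (Fin.cons 1 (fun l => inner ℝ (e l) (T.points j)) : Fin (q + 1) → ℝ) i).det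

theorem OrientedSimplex.edgeDet_eq_homDet (T : OrientedSimplex q d) (e : Fin q → ℝ^d) :
    (of fun i j : Fin q => inner ℝ (e i) (T.points j.succ - T.points 0)).det = T.homDet e := by
  -- subtract the first column from the others
  have h1 : T.homDet e = (of fun i j : Fin (q + 1) =>
      (Fin.cons (Fin.cons 1 fun l => inner ℝ (e l) (T.points 0))
        (fun j' : Fin q => Fin.cons 0 fun l => inner ℝ (e l) (T.points j'.succ - T.points 0)) :
        Fin (q + 1) → Fin (q + 1) → ℝ) j i).det := by
    rw [OrientedSimplex.homDet, ← det_transpose, ← det_transpose (of _)]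
    refine Matrix.det_eq_of_forall_row_eq_smul_add_const (fun j => if j = 0 then 0 else 1) 0
      (by simp) fun j i => ?_
    refine Fin.cases ?_ (fun j => ?_) j
    · refine Fin.cases ?_ (fun i => ?_) i <;> simp
    · refine Fin.cases ?_ (fun i => ?_) i <;> simp [inner_sub_right]
  rw [h1, Matrix.det_succ_row_zero, Fin.sum_univ_succ]
  simp only [of_apply, Fin.cons_zero, Fin.cons_succ, Fin.val_zero, pow_zero, mul_one, one_mul,
    mul_zero, zero_mul, Finset.sum_const_zero, add_zero]
  congr 1

theorem OrientedSimplex.sign_of_dir_ne (T : OrientedSimplex q d)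
    {e : Fin q → ℝ^d} (h : T.dir ≠ span ℝ (range e)) :
    T.sign e = 0 := by
  rw [OrientedSimplex.sign, if_neg h]

theorem OrientedSimplex.sign_of_dir_eq (T : OrientedSimplex q d)
    {e : Fin q → ℝ^d} (h : T.dir = span ℝ (range e)) :
    T.sign e = (SignType.sign (T.homDet e) : ℤ) := by
  rw [OrientedSimplex.sign, T.edgeDet_eq_homDet, if_pos h]

theorem OrientedSimplex.homDet_ne_zero (T : OrientedSimplex q d)
    {e : Fin q → ℝ^d} (h : T.dir = span ℝ (range e)) :
    T.homDet e ≠ 0 := by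
  intro h0
  obtain ⟨c, hc, hM⟩ := Matrix.exists_mulVec_eq_zero_iff.2 h0
  apply hc
  have hsum : ∑ j, c j = 0 := by
    have := congrFun hM 0
    simpa [mulVec, dotProduct] using this
  have hin : ∀ l, inner ℝ (e l) (∑ j, c j • T.points j) = 0 := fun l => by
    have := congrFun hM l.succ
    simp only [mulVec, dotProduct, of_apply, Fin.cons_succ, Pi.zero_apply] at this
    rw [inner_sum]
    simpa [inner_smul_right, mul_comm] using this
  have hmem : ∑ j, c j • T.points j ∈ span ℝ (range e) := by
    rw [← h]
    have : ∑ j, c j • T.points j = ∑ j, c j • (T.points j - T.points 0) := by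
      simp only [smul_sub, sum_sub_distrib, ← sum_smul, hsum, zero_smul, sub_zero]
    rw [this]
    exact Submodule.sum_mem _ fun i _ => smul_mem _ _
      (vsub_mem_vectorSpan ℝ (mem_range_self i) (mem_range_self 0))
  have hz : ∑ j, c j • T.points j = 0 := by
    obtain ⟨c', hc'⟩ := (Submodule.mem_span_range_iff_exists_fun ℝ).1 hmem
    refine inner_self_eq_zero (𝕜 := ℝ).1 ?_
    nth_rw 1 [← hc']
    simp [sum_inner, inner_smul_left, hin]
  funext j
  exact (affineIndependent_iff.1 T.independent) Finset.univ c hsum hz j (Finset.mem_univ j)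

theorem OrientedSimplex.sign_mul_self (T : OrientedSimplex q d)
    {e : Fin q → ℝ^d} (h : T.dir = span ℝ (range e)) :
    T.sign e * T.sign e = 1 := by
  rw [T.sign_of_dir_eq h, sign_mul_sign_self (T.homDet_ne_zero h)]

theorem inner_eq_sum_of_mem_span {b : Fin q → ℝ^d} (hb : Orthonormal ℝ b)
    {v : ℝ^d} (hv : v ∈ span ℝ (range b))
    (w : ℝ^d) : inner ℝ w v = ∑ j, inner ℝ w (b j) * inner ℝ (b j) v := by
  obtain ⟨c, rfl⟩ := (Submodule.mem_span_range_iff_exists_fun ℝ).1 hv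
  simp [inner_sum, inner_smul_right, hb.inner_right_fintype, mul_comm]

/-- Comparison of the orientations of a simplex with respect to two frames. -/
theorem OrientedSimplex.sign_eq_mul_sign (T : OrientedSimplex q d)
    {e b : Fin q → ℝ^d} (he : T.dir = span ℝ (range e))
    (hb : Orthonormal ℝ b) (hb' : T.dir = span ℝ (range b)) :
    T.sign e = (SignType.sign (of fun i j : Fin q => inner ℝ (e i) (b j)).det : ℤ) * T.sign b := by
  rw [T.sign_of_dir_eq he, T.sign_of_dir_eq hb', ← T.edgeDet_eq_homDet, ← T.edgeDet_eq_homDet]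
  have h1 : (of fun i j : Fin q => inner ℝ (e i) (T.points j.succ - T.points 0)) =
      (of fun i j : Fin q => inner ℝ (e i) (b j)) *
        (of fun i j : Fin q => inner ℝ (b i) (T.points j.succ - T.points 0)) := by
    ext i j
    rw [Matrix.mul_apply]
    refine inner_eq_sum_of_mem_span hb ?_ (e i)
    rw [← hb']
    exact vsub_mem_vectorSpan ℝ (mem_range_self j.succ) (mem_range_self 0)
  rw [h1, det_mul, sign_mul, SignType.coe_mul]

end Signs

/-! ### Cutting chains along hyperplanes -/

section Cutting

variable {d q : ℕ}

/-- A plane through a point of a simplex that does not contain the simplex meets it in a null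
set. -/
theorem OrientedSimplex.ae_sub_notMem (T : OrientedSimplex q d) {z : ℝ^d} (hz : z ∈ T.carrier)
    {W : Submodule ℝ ℝ^d} (hW : ¬ T.dir ≤ W) :
    ∀ᵐ x ∂(μH[(q : ℝ)] : Measure ℝ^d), x ∈ T.carrier → x - z ∉ W := by
  have hrank := Submodule.finrank_lt_finrank_of_lt (inf_lt_left.2 hW)
  rw [T.finrank_dir] at hrank
  filter_upwards [measure_eq_zero_iff_ae_notMem.1 (hausdorffMeasure_plane_eq_zero z _ hrank)]
    with x hx hxT hxW
  exact hx ⟨by simpa using T.dir.sub_mem (T.sub_mem_dir hxT 0) (T.sub_mem_dir hz 0), hxW⟩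

/-- The zero set of an affine function that does not vanish identically on a simplex is a null
set in this simplex. -/
theorem OrientedSimplex.ae_ne_zero (T : OrientedSimplex q d)
    (f : ℝ^d →ᵃ[ℝ] ℝ) {i : Fin (q + 1)} (hi : f (T.points i) ≠ 0) :
    ∀ᵐ x ∂(μH[(q : ℝ)] : Measure ℝ^d), x ∈ T.carrier → f x ≠ 0 := by
  by_cases hz : ∃ z ∈ T.carrier, f z = 0
  · obtain ⟨z, hz, h0⟩ := hz
    obtain ⟨v, hv, hv0⟩ := exists_mem_dir_linear_ne hi hz h0
    filter_upwards [T.ae_sub_notMem hz (W := ker f.linear) fun h => hv0 (h hv)]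
      with x hx hxT hx0
    exact hx hxT (by rw [LinearMap.mem_ker, affineMap_sub, hx0, h0, sub_zero])
  · push Not at hz
    exact Eventually.of_forall hz

/-- Barycentric coordinates with respect to a simplex whose vertex `a` has been moved by the
fraction `t` towards the vertex `b`, expressed in those of the original simplex. -/
def shearCoord (a b : Fin (q + 1)) (t : ℝ) (w : Fin (q + 1) → ℝ) : Fin (q + 1) → ℝ :=
  w + Pi.single b (t * w a) - Pi.single a (t * w a)

theorem sum_shearCoord (a b : Fin (q + 1)) (t : ℝ) (w : Fin (q + 1) → ℝ) :
    ∑ i, shearCoord a b t w i = ∑ i, w i := by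
  simp [shearCoord, sum_add_distrib, sum_sub_distrib]

theorem sum_shearCoord_smul (a b : Fin (q + 1)) (t : ℝ) (w : Fin (q + 1) → ℝ)
    (p : Fin (q + 1) → ℝ^d) :
    ∑ i, w i • update p a ((1 - t) • p a + t • p b) i = ∑ i, shearCoord a b t w i • p i := by
  have h1 : ∀ i, w i • update p a ((1 - t) • p a + t • p b) i =
      w i • p i + (if i = a then (t * w a) • (p b - p a) else 0) := by
    intro i
    by_cases h : i = a
    · subst h
      simp only [update_self, if_true]
      module
    · simp [h]
  rw [sum_congr rfl fun i _ => h1 i]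
  simp only [sum_add_distrib, shearCoord, Pi.add_apply, Pi.sub_apply, add_smul, sub_smul,
    sum_sub_distrib, Pi.single_apply, ite_smul, zero_smul]
  simp [smul_sub]
  module

theorem shearCoord_left {a b : Fin (q + 1)} (hab : a ≠ b) (t : ℝ) (w : Fin (q + 1) → ℝ) :
    shearCoord a b t w a = (1 - t) * w a := by
  simp [shearCoord, Pi.single_eq_of_ne hab]; ring

theorem shearCoord_right {a b : Fin (q + 1)} (hab : a ≠ b) (t : ℝ) (w : Fin (q + 1) → ℝ) :
    shearCoord a b t w b = w b + t * w a := by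
  simp [shearCoord, Pi.single_eq_of_ne hab.symm]

theorem shearCoord_of_ne {a b i : Fin (q + 1)} (ha : i ≠ a) (hb : i ≠ b) (t : ℝ)
    (w : Fin (q + 1) → ℝ) : shearCoord a b t w i = w i := by
  simp [shearCoord, Pi.single_eq_of_ne ha, Pi.single_eq_of_ne hb]

theorem OrientedSimplex.exists_move_vertex (T : OrientedSimplex q d) {a b : Fin (q + 1)}
    (hab : a ≠ b) {t : ℝ} (ht : t < 1) :
    ∃ T' : OrientedSimplex q d,
      T'.points = update T.points a ((1 - t) • T.points a + t • T.points b) := by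
  refine ⟨⟨update T.points a ((1 - t) • T.points a + t • T.points b), ?_⟩, rfl⟩
  convert T.independent.units_lineMap b (update 1 a (Units.mk0 (1 - t) (by linarith))) using 1
  funext i
  by_cases h : i = a
  · subst h
    simp [AffineMap.lineMap_apply_module, add_comm]
  · simp [h]

section MoveVertex

variable {T T' : OrientedSimplex q d} {a b : Fin (q + 1)} {t : ℝ}

theorem OrientedSimplex.dir_of_move_vertex (hab : a ≠ b) 
    (hT' : T'.points = update T.points a ((1 - t) • T.points a + t • T.points b)) :
    T'.dir = T.dir := by
  refine Submodule.eq_of_le_of_finrank_eq ?_ (by rw [T'.finrank_dir, T.finrank_dir])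
  have h1 : ∀ i, T'.points i - T.points b ∈ T.dir := by
    intro i
    have h2 : ∀ j, T.points j - T.points b ∈ T.dir := fun j =>
      vsub_mem_vectorSpan ℝ (mem_range_self j) (mem_range_self b)
    rw [hT']
    by_cases h : i = a
    · subst h
      rw [update_self]
      have : (1 - t) • T.points i + t • T.points b - T.points b =
        (1 - t) • (T.points i - T.points b) := by module
      rw [this]
      exact smul_mem _ _ (h2 i)
    · rw [update_of_ne h]; exact h2 i
  rw [OrientedSimplex.dir, vectorSpan, span_le]
  rintro _ ⟨_, ⟨i, rfl⟩, _, ⟨j, rfl⟩, rfl⟩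
  have := T.dir.sub_mem (h1 i) (h1 j)
  simpa using this

theorem OrientedSimplex.sign_of_move_vertex (hab : a ≠ b) (ht : t < 1)
    (hT' : T'.points = update T.points a ((1 - t) • T.points a + t • T.points b))
    (e : Fin q → ℝ^d) : T'.sign e = T.sign e := by
  by_cases h : T.dir = span ℝ (range e)
  · have h' : T'.dir = span ℝ (range e) := by rw [dir_of_move_vertex hab hT', h]
    rw [T.sign_of_dir_eq h, T'.sign_of_dir_eq h']
    have hdet : T'.homDet e = (1 - t) * T.homDet e := by
      rw [OrientedSimplex.homDet, OrientedSimplex.homDet]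
      set M := (of fun i j : Fin (q + 1) =>
        (Fin.cons 1 (fun l => inner ℝ (e l) (T.points j)) : Fin (q + 1) → ℝ) i) with hM
      have h1 : (of fun i j : Fin (q + 1) =>
          (Fin.cons 1 (fun l => inner ℝ (e l) (T'.points j)) : Fin (q + 1) → ℝ) i) =
          M.updateCol a ((1 - t) • (fun i => M i a) + t • fun i => M i b) := by
        ext i j
        rw [hT']
        by_cases hj : j = a
        · subst hj
          rw [Matrix.updateCol_self]
          refine Fin.cases ?_ (fun i => ?_) i
          · simp [hM]
          · simp [hM, update_self, inner_add_right, inner_smul_right]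
        · rw [updateCol_ne hj]
          simp [hM, update_of_ne hj]
      rw [h1, Matrix.det_updateCol_add, Matrix.det_updateCol_smul, Matrix.det_updateCol_smul]
      have h2 : (M.updateCol a fun i => M i a) = M := by
        ext i j
        by_cases hj : j = a
        · subst hj; simp
        · rw [updateCol_ne hj]
      have h3 : (M.updateCol a fun i => M i b).det = 0 := by
        refine Matrix.det_zero_of_column_eq hab fun i => ?_
        rw [Matrix.updateCol_self, updateCol_ne hab.symm]
      rw [h2, h3, mul_zero, add_zero]
    rw [hdet, sign_mul, sign_pos (by linarith : 0 < 1 - t), one_mul]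
  · have h' : T'.dir ≠ span ℝ (range e) := by rwa [dir_of_move_vertex hab hT']
    rw [T.sign_of_dir_ne h, T'.sign_of_dir_ne h']

/-- The vertex of number `a` moves along the edge from `a` to `b`. -/
theorem OrientedSimplex.mem_carrier_of_move_vertex (hab : a ≠ b) (ht0 : 0 ≤ t) (ht : t < 1)
    (hT' : T'.points = update T.points a ((1 - t) • T.points a + t • T.points b))
    {x : ℝ^d} : x ∈ T'.carrier ↔ x ∈ T.carrier ∧ t * T.coord a x ≤ (1 - t) * T.coord b x := by
  have h1t : 0 < 1 - t := by linarith
  rw [T'.mem_carrier_iff, hT']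
  constructor
  · rintro ⟨w, hw0, hw1, rfl⟩
    rw [sum_shearCoord_smul]
    rw [← sum_shearCoord a b t] at hw1
    refine ⟨T.mem_carrier_iff.2 ⟨_, fun i => ?_, hw1, rfl⟩, ?_⟩
    · by_cases hia : i = a
      · rw [hia, shearCoord_left hab]; exact mul_nonneg h1t.le (hw0 a)
      by_cases hib : i = b
      · rw [hib, shearCoord_right hab]; exact add_nonneg (hw0 b) (mul_nonneg ht0 (hw0 a))
      · rw [shearCoord_of_ne hia hib]; exact hw0 i
    · rw [T.coord_sum hw1, T.coord_sum hw1, shearCoord_left hab, shearCoord_right hab]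
      nlinarith [mul_nonneg h1t.le (hw0 b)]
  · rintro ⟨hx, hle⟩
    obtain ⟨w, hw0, hw1, rfl⟩ := T.mem_carrier_iff.1 hx
    rw [T.coord_sum hw1, T.coord_sum hw1] at hle
    let w' : Fin (q + 1) → ℝ := fun i =>
      if i = a then w a / (1 - t) else if i = b then w b - t * (w a / (1 - t)) else w i
    have hw' : shearCoord a b t w' = w := by
      funext i
      by_cases hia : i = a
      · rw [hia, shearCoord_left hab]
        simp only [w', if_true]
        field_simp
      by_cases hib : i = b
      · rw [hib, shearCoord_right hab]
        simp [w', hab.symm]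
      · rw [shearCoord_of_ne hia hib]
        simp [w', hia, hib]
    refine ⟨w', fun i => ?_, by rw [← sum_shearCoord a b t, hw', hw1], by
      rw [sum_shearCoord_smul, hw']⟩
    simp only [w']
    split_ifs with h1 h2
    · exact div_nonneg (hw0 a) h1t.le
    · rw [sub_nonneg, ← mul_div_assoc, div_le_iff₀ h1t]; linarith
    · exact hw0 i

end MoveVertex

variable {G : Type} [AddCommGroup G]

open Classical in
theorem chainMultiplicity_single (T : OrientedSimplex q d) (g : G) (x : ℝ^d) (e : Fin q → ℝ^d) :
    chainMultiplicity (Finsupp.single T g) x e = if x ∈ T.carrier then T.sign e • g else 0 := by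
  rw [chainMultiplicity, Finsupp.sum_single_index]
  split_ifs <;> simp

theorem chainMultiplicity_sub (c c' : OrientedSimplex q d →₀ G) (x : ℝ^d) (e : Fin q → ℝ^d) :
    chainMultiplicity (c - c') x e = chainMultiplicity c x e - chainMultiplicity c' x e := by
  rw [sub_eq_add_neg, chainMultiplicity_add, chainMultiplicity_neg, sub_eq_add_neg]

theorem chainMultiplicity_finset_sum {ι : Type*} (s : Finset ι) (c : ι → OrientedSimplex q d →₀ G)
    (x : ℝ^d) (e : Fin q → ℝ^d) :
    chainMultiplicity (∑ i ∈ s, c i) x e = ∑ i ∈ s, chainMultiplicity (c i) x e := by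
  classical
  induction s using Finset.induction_on with
  | empty => simp [chainMultiplicity_zero]
  | insert a s ha ih => rw [Finset.sum_insert ha, Finset.sum_insert ha, chainMultiplicity_add, ih]

/-- A simplex splits into the two parts on both sides of a point on one of its edges. -/
theorem chainMultiplicity_bisect {T T₁ T₂ : OrientedSimplex q d} {a b : Fin (q + 1)} {t : ℝ}
    (hab : a ≠ b) (ht0 : 0 < t) (ht : t < 1)
    (h₁ : T₁.points = update T.points a ((1 - t) • T.points a + t • T.points b))
    (h₂ : T₂.points = update T.points b ((1 - t) • T.points a + t • T.points b)) (g : G) :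
    ∀ᵐ x ∂(μH[(q : ℝ)] : Measure ℝ^d), ∀ e, chainMultiplicity (Finsupp.single T g) x e =
        chainMultiplicity (Finsupp.single T₁ g) x e +
          chainMultiplicity (Finsupp.single T₂ g) x e := by
  have h₂' : T₂.points = update T.points b
      ((1 - (1 - t)) • T.points b + (1 - t) • T.points a) := by
    rw [h₂]; congr 1; module
  have hne := T.ae_ne_zero (t • T.coord a - (1 - t) • T.coord b) (i := a) (by
    simp [T.coord_point, hab.symm, ht0.ne'])
  filter_upwards [hne] with x hx e
  simp only [chainMultiplicity_single]
  rw [OrientedSimplex.sign_of_move_vertex hab ht h₁,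
    OrientedSimplex.sign_of_move_vertex hab.symm (by linarith) h₂',
    OrientedSimplex.mem_carrier_of_move_vertex hab ht0.le ht h₁,
    OrientedSimplex.mem_carrier_of_move_vertex hab.symm (by linarith) (by linarith) h₂']
  by_cases hxT : x ∈ T.carrier
  · have h0 : t * T.coord a x - (1 - t) * T.coord b x ≠ 0 := by simpa using hx hxT
    rcases lt_or_gt_of_ne h0 with h | h
    · rw [if_pos hxT, if_pos ⟨hxT, by linarith⟩, if_neg (by rintro ⟨-, h'⟩; linarith), add_zero]
    · rw [if_pos hxT, if_neg (by rintro ⟨-, h'⟩; linarith), if_pos ⟨hxT, by linarith⟩, zero_add]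
  · rw [if_neg hxT, if_neg fun h => hxT h.1, if_neg fun h => hxT h.1, add_zero]

open Classical in
/-- The part of a simplex in an open half space is a chain: the simplex is bisected along the
boundary of the half space until each piece lies on one side. -/
theorem exists_cut_single (f : ℝ^d →ᵃ[ℝ] ℝ) (g : G) (T : OrientedSimplex q d) :
    ∃ c' : OrientedSimplex q d →₀ G, ∀ᵐ x ∂(μH[(q : ℝ)] : Measure ℝ^d), ∀ e,
        chainMultiplicity c' x e =
          if 0 < f x then chainMultiplicity (Finsupp.single T g) x e else 0 := by
  induction hN : (Finset.univ.filter fun i => f (T.points i) ≠ 0).card using Nat.strong_induction_on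
    generalizing T with | _ N ih
  by_cases hle : ∀ i, f (T.points i) ≤ 0
  · refine ⟨0, Eventually.of_forall fun x e => ?_⟩
    rw [chainMultiplicity_zero, chainMultiplicity_single]
    split_ifs with h1 h2
    · exact absurd (convexHull_min (range_subset_iff.2 hle) ((convex_Iic 0).affine_preimage f) h2)
        (not_le.2 h1)
    · rfl
    · rfl
  push Not at hle
  obtain ⟨a, ha⟩ := hle
  by_cases hge : ∀ i, 0 ≤ f (T.points i)
  · refine ⟨Finsupp.single T g, ?_⟩
    filter_upwards [T.ae_ne_zero f ha.ne'] with x hx e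
    rw [chainMultiplicity_single]
    by_cases hxT : x ∈ T.carrier
    · have h0 := convexHull_min (t := f ⁻¹' Ici 0) (range_subset_iff.2 hge)
        ((convex_Ici 0).affine_preimage f) hxT
      rw [if_pos (lt_of_le_of_ne h0 (hx hxT).symm)]
    · simp [hxT]
  push Not at hge
  obtain ⟨b, hb⟩ := hge
  have hab : a ≠ b := by rintro rfl; linarith
  have hden : 0 < f (T.points a) - f (T.points b) := by linarith
  set t := f (T.points a) / (f (T.points a) - f (T.points b)) with ht
  have ht0 : 0 < t := div_pos ha hden
  have ht1 : t < 1 := by rw [ht, div_lt_one hden]; linarith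
  have hft : f ((1 - t) • T.points a + t • T.points b) = 0 := by
    rw [affineMap_segment, ht]; field_simp; ring
  obtain ⟨T₁, h₁⟩ := T.exists_move_vertex hab ht1
  obtain ⟨T₂, h₂⟩ := T.exists_move_vertex hab.symm (t := 1 - t) (by linarith)
  have h₂' : T₂.points = update T.points b ((1 - t) • T.points a + t • T.points b) := by
    rw [h₂]; congr 1; module
  have hcard : ∀ (T' : OrientedSimplex q d) (j : Fin (q + 1)), f (T.points j) ≠ 0 →
      T'.points = update T.points j ((1 - t) • T.points a + t • T.points b) →
      (Finset.univ.filter fun i => f (T'.points i) ≠ 0).card < N := by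
    intro T' j hj hT'
    rw [← hN]
    refine Finset.card_lt_card (Finset.ssubset_iff_of_subset ?_ |>.2
      ⟨j, by simp [hj], by simp [hT', hft]⟩)
    intro i hi
    simp only [mem_filter, Finset.mem_univ, true_and, hT'] at hi ⊢
    by_cases hij : i = j
    · rwa [hij]
    · rwa [update_of_ne hij] at hi
  obtain ⟨c₁, hc₁⟩ := ih _ (hcard T₁ a ha.ne' h₁) T₁ rfl
  obtain ⟨c₂, hc₂⟩ := ih _ (hcard T₂ b hb.ne h₂') T₂ rfl
  refine ⟨c₁ + c₂, ?_⟩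
  filter_upwards [hc₁, hc₂, chainMultiplicity_bisect hab ht0 ht1 h₁ h₂' g] with x h1 h2 h3 e
  rw [chainMultiplicity_add, h1, h2, h3]
  split_ifs <;> simp

open Classical in
/-- The restriction of a chain to an open half space is a chain. -/
theorem exists_cut (c : OrientedSimplex q d →₀ G) (f : ℝ^d →ᵃ[ℝ] ℝ) :
    ∃ c' : OrientedSimplex q d →₀ G, ∀ᵐ x ∂(μH[(q : ℝ)] : Measure ℝ^d), ∀ e,
        chainMultiplicity c' x e = if 0 < f x then chainMultiplicity c x e else 0 := by
  induction c using Finsupp.induction_linear with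
  | zero =>
    exact ⟨0, Eventually.of_forall fun x e => by simp [chainMultiplicity_zero]⟩
  | add c₁ c₂ h₁ h₂ =>
    obtain ⟨c₁', h₁⟩ := h₁
    obtain ⟨c₂', h₂⟩ := h₂
    refine ⟨c₁' + c₂', ?_⟩
    filter_upwards [h₁, h₂] with x h1 h2 e
    rw [chainMultiplicity_add, h1, h2, chainMultiplicity_add]
    split_ifs <;> simp
  | single T g => exact exists_cut_single f g T

open Classical in
/-- The restriction of a chain to a cell of an arrangement is a chain. -/
theorem exists_restrict_cell (A : Arrangement d) (s : ℝ^d) (c : OrientedSimplex q d →₀ G) :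
    ∃ c' : OrientedSimplex q d →₀ G, ∀ᵐ x ∂(μH[(q : ℝ)] : Measure ℝ^d), ∀ e,
        chainMultiplicity c' x e = if SameCell A s x then chainMultiplicity c x e else 0 := by
  induction A using Finset.induction_on with
  | empty =>
    refine ⟨c, Eventually.of_forall fun x e => ?_⟩
    have h0 : SameCell ∅ s x := fun f hf => absurd hf (Finset.notMem_empty f)
    rw [if_pos h0]
  | insert f A hf ih =>
    obtain ⟨c₀, h₀⟩ := ih
    have hsplit : ∀ x, SameCell (insert f A) s x ↔
        SignType.sign (f s) = SignType.sign (f x) ∧ SameCell A s x := fun x => by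
      simp [SameCell]
    obtain ⟨c₁, h₁⟩ := exists_cut c₀ f
    obtain ⟨c₂, h₂⟩ := exists_cut c₀ (-f)
    rcases lt_trichotomy (f s) 0 with h | h | h
    · refine ⟨c₂, ?_⟩
      filter_upwards [h₀, h₂] with x h0 h2 e
      rw [h2, h0, hsplit, sign_neg h, eq_comm (a := -1), sign_eq_neg_one_iff]
      by_cases hx : f x < 0 <;> simp [hx]
    · refine ⟨c₀ - c₁ - c₂, ?_⟩
      filter_upwards [h₀, h₁, h₂] with x h0 h1 h2 e
      rw [chainMultiplicity_sub, chainMultiplicity_sub, h1, h2, h0, hsplit, h, sign_zero,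
        eq_comm (a := 0), sign_eq_zero_iff]
      rcases lt_trichotomy (f x) 0 with h' | h' | h'
      · simp [h', h'.ne, h'.le]
      · simp [h']
      · simp [h', h'.ne', h'.le]
    · refine ⟨c₁, ?_⟩
      filter_upwards [h₀, h₁] with x h0 h1 e
      rw [h1, h0, hsplit, sign_pos h, eq_comm (a := 1), sign_eq_one_iff]
      by_cases hx : 0 < f x <;> simp [hx]

/-- Almost every point of a simplex, with respect to the Hausdorff measure of its dimension, that
lies in an adapted set is in a cell of the same direction as the simplex. -/
theorem IsAdapted.ae_dir_eq {A : Arrangement d}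
    {M : Set ℝ^d} (hA : IsAdapted A q M) (T : OrientedSimplex q d) :
    ∀ᵐ x ∂(μH[(q : ℝ)] : Measure ℝ^d), x ∈ T.carrier → x ∈ M → T.dir = zeroDir A x := by
  have key : ∀ s ∈ range (cellPoint A) ∩ M, T.dir ≠ zeroDir A s → ∀ᵐ x ∂(μH[(q : ℝ)] : Measure ℝ^d),
        ¬ (x ∈ T.carrier ∧ SameCell A s x) := by
    intro s hs hne
    by_cases hz : ∃ z, z ∈ T.carrier ∧ SameCell A s z
    · obtain ⟨z, hzT, hz⟩ := hz
      filter_upwards [T.ae_sub_notMem hzT (W := zeroDir A z) fun h => hne <| by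
        rw [← hz.zeroDir_eq] at h
        exact eq_of_le_of_finrank_le h (T.finrank_dir.symm ▸ hA.finrank_le s hs.2)]
        with x hx hxs
      exact hx hxs.1 (hz.symm.trans hxs.2).sub_mem_zeroDir
    · push Not at hz
      exact Eventually.of_forall fun x hx => hz x hx.1 hx.2
  have hfin : (range (cellPoint A) ∩ M).Finite := (finite_range_cellPoint A).inter_of_left _
  have hall : ∀ᵐ x ∂(μH[(q : ℝ)] : Measure ℝ^d),
      ∀ s ∈ range (cellPoint A) ∩ M, T.dir ≠ zeroDir A s → ¬ (x ∈ T.carrier ∧ SameCell A s x) := by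
    rw [ae_ball_iff hfin.countable]
    intro s hs
    by_cases h : T.dir = zeroDir A s
    · exact Eventually.of_forall fun x hx => absurd h hx
    · filter_upwards [key s hs h] with x hx _ using hx
  filter_upwards [hall] with x hx hxT hxM
  by_contra hne
  have h := sameCell_cellPoint A x
  rw [← h.zeroDir_eq] at hne
  exact hx _ ⟨⟨x, rfl⟩, hA.decides _ _ h.symm hxM⟩ hne ⟨hxT, h⟩

end Cutting

/-! ### Orthonormal frames -/

/-- The orthonormal bases of `ℝ^d`. -/
abbrev Frame (d : ℕ) := OrthonormalBasis (Fin d) ℝ ℝ^d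

/-- The span of the first `n` vectors of an orthonormal basis of `ℝ^(n + k)`. -/
notation "tangentSpan" b:max => span ℝ (Set.range (tangentFrame b))

section Frames

variable {n k : ℕ}

theorem castAdd_ne_natAdd (i : Fin n) (j : Fin k) : castAdd k i ≠ natAdd n j := fun h => by
  simpa using finSumFinEquiv.injective (a₁ := Sum.inl i) (a₂ := Sum.inr j) h

/-- The vector of the plane spanned by the last `k` vectors of `b` with coordinates `w`. -/
noncomputable def normalVec (b : Frame (n + k)) (w : ℝ^k) : ℝ^(n + k) :=
  ∑ j : Fin k, w j • b (natAdd n j)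

theorem mem_span_range_comp_iff {d : ℕ} {κ : Type*} (b : Frame d) (φ : κ → Fin d) {v : ℝ^d} :
    v ∈ span ℝ (range (b ∘ φ)) ↔ ∀ l ∉ range φ, inner ℝ (b l) v = (0 : ℝ) := by
  rw [range_comp, ← b.coe_toBasis, b.toBasis.mem_span_image]
  simp only [Set.subset_def, Finset.mem_coe, Finsupp.mem_support_iff, b.coe_toBasis_repr_apply,
    b.repr_apply_apply, not_imp_comm, b.coe_toBasis]

variable (b b' : Frame (n + k))

theorem inner_castAdd_normalVec (i : Fin n) (w : ℝ^k) :
    inner ℝ (b (castAdd k i)) (normalVec b w) = 0 := by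
  simp [normalVec, inner_sum, inner_smul_right, b.inner_eq_ite, castAdd_ne_natAdd]

theorem inner_natAdd_normalVec (i : Fin k) (w : ℝ^k) :
    inner ℝ (b (natAdd n i)) (normalVec b w) = w i := by
  simp [normalVec, inner_sum, inner_smul_right, b.inner_eq_ite]

theorem norm_normalVec (w : ℝ^k) : ‖normalVec b w‖ = ‖w‖ := by
  have h1 : ‖normalVec b w‖ ^ 2 = ‖w‖ ^ 2 := by
    rw [← real_inner_self_eq_norm_sq]
    nth_rewrite 1 [normalVec]
    rw [sum_inner, EuclideanSpace.norm_sq_eq]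
    refine sum_congr rfl fun j _ => ?_
    rw [inner_smul_left, inner_natAdd_normalVec, norm_eq_abs, sq_abs, sq]
    rfl
  exact (sq_eq_sq₀ (norm_nonneg _) (norm_nonneg _)).1 h1

theorem continuous_normalVec : Continuous (normalVec b) := by
  unfold normalVec; fun_prop

theorem normalVec_smul (c : ℝ) (w : ℝ^k) : normalVec b (c • w) = c • normalVec b w := by
  simp [normalVec, Finset.smul_sum, mul_smul]

theorem normalVec_add (v w : ℝ^k) : normalVec b (v + w) = normalVec b v + normalVec b w := by
  simp [normalVec, add_smul, sum_add_distrib]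

theorem linkMap_eq {m : ℕ} {N : Set ℝ^m} (u : ℝ^(n + k) → N) (x : ℝ^(n + k)) (r : ℝ)
    (w : ℝ^k) : linkMap u x b r w = u (x + r • normalVec b w) := rfl

theorem mem_span_tangentFrame_iff {v : ℝ^(n + k)} :
    v ∈ tangentSpan b ↔ ∀ j, inner ℝ (b (natAdd n j)) v = 0 := by
  refine (mem_span_range_comp_iff b (castAdd k)).trans
    ⟨fun h j => h _ fun ⟨i, hi⟩ => castAdd_ne_natAdd i j hi, fun h l hl => ?_⟩
  induction l using Fin.addCases with
  | left i => exact absurd ⟨i, rfl⟩ hl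
  | right j => exact h j

theorem normalVec_mem_span_iff {w : ℝ^k} :
    normalVec b w ∈ tangentSpan b ↔ w = 0 := by
  rw [mem_span_tangentFrame_iff]
  simp only [inner_natAdd_normalVec]
  constructor
  · intro h; ext j; exact h j
  · rintro rfl j; rfl

theorem orthonormal_tangentFrame : Orthonormal ℝ (tangentFrame b) :=
  b.orthonormal.comp _ (Fin.castAdd_injective n k)

/-- The matrix whose rows are the vectors of the basis. -/
noncomputable def frameMatrix {d : ℕ} (b : Frame d) :
    Matrix (Fin d) (Fin d) ℝ := of fun i j => b i j

theorem frameMatrix_mul_transpose {d : ℕ} (b b' : Frame d) :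
    frameMatrix b * (frameMatrix b').transpose = of fun i j => inner ℝ (b i) (b' j) := by
  ext i j
  rw [Matrix.mul_apply, of_apply, PiLp.inner_apply]
  refine sum_congr rfl fun l _ => ?_
  simp [frameMatrix, mul_comm]

theorem det_frameMatrix_ne_zero {d : ℕ} (b : Frame d) : (frameMatrix b).det ≠ 0 := by
  have h := congrArg Matrix.det (frameMatrix_mul_transpose b b)
  have h1 : (of fun i j => inner ℝ (b i) (b j) : Matrix (Fin d) (Fin d) ℝ) = 1 := by
    ext i j
    rw [of_apply, b.inner_eq_ite, Matrix.one_apply]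
  rw [h1, det_one, det_mul] at h
  intro h0
  rw [h0, zero_mul] at h
  exact zero_ne_one h

theorem isPositivelyOriented_iff : IsPositivelyOriented b ↔ 0 < (frameMatrix b).det := Iff.rfl

/-- The determinant of the change between two orthonormal bases, when the second vectors of the
one are orthogonal to the first vectors of the other. -/
theorem det_mul_det_eq {d : ℕ} {κ ι : Type*} [Fintype κ] [Fintype ι] [DecidableEq κ] [DecidableEq ι]
    (e : κ ⊕ ι ≃ Fin d) (b b' : Frame d)
    (h : ∀ i j, inner ℝ (b (e (Sum.inr i))) (b' (e (Sum.inl j))) = (0 : ℝ)) :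
    (of fun i j => inner ℝ (b (e (Sum.inl i))) (b' (e (Sum.inl j)))).det *
      (of fun i j => inner ℝ (b (e (Sum.inr i))) (b' (e (Sum.inr j)))).det =
    (frameMatrix b).det * (frameMatrix b').det := by
  rw [← det_transpose (frameMatrix b'), ← det_mul, frameMatrix_mul_transpose,
    ← Matrix.det_fromBlocks_zero₂₁ _ (of fun i j =>
      inner ℝ (b (e (Sum.inl i))) (b' (e (Sum.inr j)))) _, ← Matrix.det_submatrix_equiv_self e]
  congr 1
  ext (i | i) (j | j) <;> simp [h]

/-- The determinants of the change of basis between the tangent and normal parts of two frames with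
the same tangent space. -/
theorem det_tangent_mul_det_normal (h : tangentSpan b = tangentSpan b') :
    (of fun i j : Fin n => inner ℝ (tangentFrame b i) (tangentFrame b' j)).det *
      (of fun i j : Fin k =>
        inner ℝ (b (natAdd n i)) (b' (natAdd n j))).det =
    (frameMatrix b).det * (frameMatrix b').det :=
  det_mul_det_eq finSumFinEquiv b b' fun i j =>
    (mem_span_tangentFrame_iff b).1 (h ▸ subset_span ⟨j, rfl⟩) i

/-- Reversing one vector of a frame reverses its orientation. -/
theorem exists_flip {d : ℕ} (b : Frame d) (j : Fin d) :
    ∃ b' : Frame d,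
      b' j = -b j ∧ (∀ i, i ≠ j → b' i = b i) ∧ (frameMatrix b').det = -(frameMatrix b).det := by
  let v : Fin d → ℝ^d := update b j (-b j)
  have hv : Orthonormal ℝ v := by
    rw [orthonormal_iff_ite]
    intro i i'
    by_cases hi : i = j <;> by_cases hi' : i' = j
    · simp [v, hi, hi']
    · have : j ≠ i' := fun h => hi' h.symm
      simp [v, hi, hi', b.inner_eq_ite, this]
    · simp [v, hi, hi', b.inner_eq_ite]
    · simp [v, hi, hi', b.inner_eq_ite]
  obtain ⟨b', hb'⟩ := Orthonormal.exists_orthonormalBasis_extension_of_card_eq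
    (ι := Fin d) (𝕜 := ℝ) (by simp) (v := v) (s := univ) (hv.comp _ Subtype.val_injective)
  have hb'' : ∀ i, b' i = v i := fun i => hb' i (mem_univ i)
  refine ⟨b', by simp [hb'', v], fun i hi => by simp [hb'', v, hi], ?_⟩
  have hM : frameMatrix b' = (frameMatrix b).updateRow j ((-1 : ℝ) • (frameMatrix b) j) := by
    ext i l
    by_cases hi : i = j
    · subst hi
      simp [frameMatrix, hb'', v]
    · simp [frameMatrix, hb'', v, hi]
  rw [hM, Matrix.det_updateRow_smul, Matrix.updateRow_eq_self, neg_one_mul]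

/-- A positively oriented orthonormal basis extending an orthonormal family that misses at least
one vector. -/
theorem exists_positive_extension {d : ℕ} (v : Fin d → ℝ^d) (s : Set (Fin d))
    (hv : Orthonormal ℝ (s.domRestrict v)) {j : Fin d} (hj : j ∉ s) :
    ∃ b : Frame d, (∀ i ∈ s, b i = v i) ∧ 0 < (frameMatrix b).det := by
  obtain ⟨b, hb⟩ := Orthonormal.exists_orthonormalBasis_extension_of_card_eq
    (ι := Fin d) (𝕜 := ℝ) (by simp) hv
  rcases lt_or_gt_of_ne (det_frameMatrix_ne_zero b) with h | h
  · obtain ⟨b', -, hb', hdet⟩ := exists_flip b j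
    exact ⟨b', fun i hi => by rw [hb' i fun h => hj (h ▸ hi), hb i hi], by linarith⟩
  · exact ⟨b, hb, h⟩

theorem exists_positive_comp_eq {d : ℕ} {κ : Type*} {φ : κ → Fin d} (hφ : Function.Injective φ)
    {j : Fin d} (hj : j ∉ range φ) {e : κ → ℝ^d} (he : Orthonormal ℝ e) :
    ∃ b : Frame d, b ∘ φ = e ∧ 0 < (frameMatrix b).det := by
  classical
  have h1 : Orthonormal ℝ ((range φ).domRestrict (Function.extend φ e 0)) := by
    rw [orthonormal_iff_ite] at he ⊢
    rintro ⟨x, hx⟩ ⟨y, hy⟩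
    obtain ⟨i, rfl⟩ := id hx
    obtain ⟨j, rfl⟩ := id hy
    simp [hφ.extend_apply, he, hφ.eq_iff]
  obtain ⟨b, hb, hpos⟩ := exists_positive_extension _ _ h1 hj
  exact ⟨b, funext fun i => (hb _ ⟨i, rfl⟩).trans (hφ.extend_apply _ _ _), hpos⟩

theorem exists_positive_span_eq {d q : ℕ} {φ : Fin q → Fin d} (hφ : Function.Injective φ)
    {j : Fin d} (hj : j ∉ range φ) {W : Submodule ℝ ℝ^d} (hW : finrank ℝ W = q) :
    ∃ b : Frame d, span ℝ (range (b ∘ φ)) = W ∧ 0 < (frameMatrix b).det := by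
  let w := (stdOrthonormalBasis ℝ W).reindex (finCongr hW)
  obtain ⟨b, hb, hpos⟩ := exists_positive_comp_eq hφ hj
    (w.orthonormal.comp_linearIsometry W.subtypeₗᵢ)
  refine ⟨b, ?_, hpos⟩
  rw [hb, range_comp, show ⇑W.subtypeₗᵢ = ⇑W.subtype from rfl, ← Submodule.map_span,
    ← w.coe_toBasis, w.toBasis.span_eq, Submodule.map_top, Submodule.range_subtype]

theorem natAdd_notMem_range_castAdd (j : Fin k) : natAdd n j ∉ range (castAdd k) :=
  fun ⟨i, h⟩ => castAdd_ne_natAdd i j h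

theorem exists_positive_tangentFrame [NeZero k] {e : Fin n → ℝ^(n + k)} (he : Orthonormal ℝ e) :
    ∃ b : Frame (n + k),
      tangentFrame b = e ∧ IsPositivelyOriented b :=
  exists_positive_comp_eq (Fin.castAdd_injective n k) (natAdd_notMem_range_castAdd 0) he

theorem exists_positive_span [NeZero k] (W : Submodule ℝ ℝ^(n + k)) (hW : finrank ℝ W = n) :
    ∃ b : Frame (n + k),
      tangentSpan b = W ∧ IsPositivelyOriented b :=
  exists_positive_span_eq (Fin.castAdd_injective n k) (natAdd_notMem_range_castAdd 0) hW

end Frames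

/-! ### Homotopy classes on small spheres -/

/-- The map `u` has the class `g` on the small spheres around `x` that are orthogonal to the first
`n` vectors of `b`. -/
abbrev HasLinkClass {n k m : ℕ} [k.AtLeastTwo] {N : Set ℝ^m} {p : N}
    (u : ℝ^(n + k) → N) (x : ℝ^(n + k)) (b : Frame (n + k)) (g : CoeffGroup k N p) : Prop :=
  ∀ᶠ r in 𝓝[>] (0 : ℝ), HasHomotopyClass k N p (linkMap u x b r) g

section Links

variable {n k m : ℕ} [k.AtLeastTwo] {N : Set ℝ^m} [IsAdmissibleTarget k N]
  {p : N} {u : ℝ^(n + k) → N} {b b' : Frame (n + k)} {x y : ℝ^(n + k)}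

/-- The class on a small sphere with respect to another frame with the same tangent space. -/
theorem HasHomotopyClass.linkMap_change_frame {r : ℝ} {g : CoeffGroup k N p}
    (h : HasHomotopyClass k N p (linkMap u x b r) g)
    (hc : ContinuousOn (linkMap u x b r) (sphere 0 1)) (hspan : tangentSpan b = tangentSpan b') :
    HasHomotopyClass k N p (linkMap u x b' r) ((SignType.sign (of fun i j : Fin k =>
        inner ℝ (b (natAdd n i)) (b' (natAdd n j))).det : ℤ) • g) := by
  set Q := of fun i j : Fin k =>
    inner ℝ (b (natAdd n i)) (b' (natAdd n j)) with hQ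
  have hdet : Q.det ≠ 0 := by
    intro h0
    have := det_tangent_mul_det_normal b b' hspan
    rw [← hQ, h0, mul_zero, eq_comm] at this
    exact mul_ne_zero (det_frameMatrix_ne_zero b) (det_frameMatrix_ne_zero b') this
  have hvec : ∀ w, normalVec b' w = normalVec b (toEuclideanLin Q w) := fun w => by
    refine b.repr.injective (PiLp.ext fun l => ?_)
    rw [b.repr_apply_apply, b.repr_apply_apply]
    induction l using Fin.addCases with
    | left i =>
      have h4 : b (castAdd k i) ∈ tangentSpan b' :=
        hspan ▸ subset_span ⟨i, rfl⟩
      rw [inner_castAdd_normalVec, real_inner_comm, normalVec, sum_inner]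
      exact sum_eq_zero fun j _ => by
        rw [inner_smul_left, (mem_span_tangentFrame_iff b').1 h4 j, mul_zero]
    | right i =>
      rw [inner_natAdd_normalVec, normalVec, inner_sum]
      simp [toLpLin_apply, mulVec, dotProduct, hQ, inner_smul_right, mul_comm]
  refine (actsBySign_of_det_ne_zero hdet _ _ hc h).congr fun w hw => ?_
  have hw1 : ‖w‖ = 1 := by simpa using hw
  have h1 : ‖toEuclideanLin Q w‖ = 1 := by
    rw [← norm_normalVec b, ← hvec, norm_normalVec, hw1]
  rw [unitVec_of_norm_eq_one h1, linkMap_eq, linkMap_eq, hvec]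

variable {A : Arrangement (n + k)} {D M : Set ℝ^(n + k)}

/-- Near a point of a cell of top dimension, an adapted set is the affine plane of the cell. -/
theorem IsAdapted.mem_iff_of_dist_lt {d q : ℕ} {A : Arrangement d}
    {M : Set ℝ^d} (hA : IsAdapted A q M) {z y : ℝ^d}
    (hz : z ∈ M) (hzq : finrank ℝ (zeroDir A z) = q)
    (hy : ∀ f ∈ A, f z ≠ 0 → dist z y < |f z|) : y ∈ M ↔ y - z ∈ zeroDir A z := by
  constructor
  · intro hyM
    have hle := zeroDir_le_of_dist_lt hA.lip hy
    have heq : zeroDir A z = zeroDir A y :=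
      eq_of_le_of_finrank_le hle (by rw [hzq]; exact hA.finrank_le y hyM)
    rw [heq]
    intro f hf hfy
    have hfz : f z = 0 := by
      by_contra hne
      have := (hA.lip f hf z y).trans_lt (hy f hf hne)
      rw [hfy, sub_zero] at this
      exact lt_irrefl _ this
    rw [affineMap_sub, hfy, hfz, sub_zero]
  · intro h
    exact hA.decides z y (sameCell_of_mem_zeroDir hA.lip h hy) hz

theorem IsAdapted.eventually_mem_iff {d q : ℕ} {A : Arrangement d}
    {M : Set ℝ^d} (hA : IsAdapted A q M) {z : ℝ^d}
    (hz : z ∈ M) (hzq : finrank ℝ (zeroDir A z) = q) :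
    ∀ᶠ y in 𝓝 z, y ∈ M ↔ y - z ∈ zeroDir A z := by
  obtain ⟨ρ, hρ, -, h⟩ := eventually_dist_lt A z
  filter_upwards [ball_mem_nhds z hρ] with y hy
  refine hA.mem_iff_of_dist_lt hz hzq fun f hf h0 => ?_
  rw [dist_comm]
  exact (mem_ball.1 hy).trans_le (h f hf h0)

theorem submodule_eq_of_eventually_iff {d : ℕ} {V W : Submodule ℝ ℝ^d}
    {z : ℝ^d} (h : ∀ᶠ y in 𝓝 z, y - z ∈ V ↔ y - z ∈ W) : V = W := by
  ext v
  have hc : Tendsto (fun t : ℝ => z + t • v) (𝓝[>] 0) (𝓝 z) := by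
    have : Continuous fun t : ℝ => z + t • v := by fun_prop
    have h := this.tendsto 0
    rw [zero_smul, add_zero] at h
    exact h.mono_left nhdsWithin_le_nhds
  obtain ⟨t, ht, ht0⟩ := ((hc.eventually h).and self_mem_nhdsWithin).exists
  have ht0 : 0 < t := ht0
  rw [add_sub_cancel_left, smul_mem_iff _ ht0.ne', smul_mem_iff _ ht0.ne'] at ht
  exact ht

omit [k.AtLeastTwo] [IsAdmissibleTarget k N] in
/-- Continuity of the link maps for points moving along a segment in a cell of top dimension. -/
theorem IsAdapted.linkMap_homotopy (hA : IsAdapted A n M) (hMD : M ⊆ D) (hDo : IsOpen D)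
    (hu : ContinuousOn u (D \ M)) (hx : x ∈ M) (hxn : finrank ℝ (zeroDir A x) = n)
    (hspan : tangentSpan b = zeroDir A x) (hxy : SameCell A x y) :
    ∃ ρ > 0, ∀ r ∈ Ioo 0 ρ, ∀ r' ∈ Ioo 0 ρ, ContinuousOn (fun q : ℝ × ℝ^k =>
      u ((1 - q.1) • x + q.1 • y + ((1 - q.1) * r + q.1 * r') • normalVec b q.2))
        (Icc 0 1 ×ˢ sphere 0 1) := by
  have hcell : ∀ t ∈ Icc (0 : ℝ) 1, SameCell A x ((1 - t) • x + t • y) := fun t ht =>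
    hxy.segment ht
  have hK : IsCompact ((fun t : ℝ => (1 - t) • x + t • y) '' Icc 0 1) :=
    isCompact_Icc.image (by fun_prop)
  obtain ⟨δ, hδ, hδD⟩ := hK.exists_thickening_subset_open hDo (by
    rintro _ ⟨t, ht, rfl⟩
    exact hMD (hA.decides x _ (hcell t ht) hx))
  obtain ⟨ρx, hρx, -, hx'⟩ := eventually_dist_lt A x
  obtain ⟨ρy, hρy, -, hy'⟩ := eventually_dist_lt A y
  refine ⟨min δ (min ρx ρy), lt_min hδ (lt_min hρx hρy), fun r hr r' hr' => hu.comp ?_ ?_⟩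
  · have := continuous_normalVec b
    exact Continuous.continuousOn (by fun_prop)
  rintro ⟨t, w⟩ ⟨ht, hw⟩
  have hw1 : ‖w‖ = 1 := by simpa using hw
  have ht1 : 0 ≤ 1 - t := by linarith [ht.2]
  simp only
  set z := (1 - t) • x + t • y with hz
  set s := (1 - t) * r + t * r' with hs
  obtain ⟨hs0, hsρ⟩ : s ∈ Ioo 0 (min δ (min ρx ρy)) :=
    convex_Ioo 0 _ hr hr' ht1 ht.1 (sub_add_cancel 1 t)
  have hdist : dist z (z + s • normalVec b w) = s := by
    rw [dist_self_add_right, norm_smul, norm_normalVec, hw1, mul_one, norm_eq_abs,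
      abs_of_pos hs0]
  have hzx := hcell t ht
  refine ⟨hδD (mem_thickening_iff.2 ⟨z, ⟨t, ht, rfl⟩, by
    rw [dist_comm, hdist]; exact hsρ.trans_le (min_le_left _ _)⟩), ?_⟩
  rw [hA.mem_iff_of_dist_lt (hA.decides x _ hzx hx) (by rw [← hzx.zeroDir_eq, hxn]),
    add_sub_cancel_left, ← hzx.zeroDir_eq, ← hspan, smul_mem_iff _ hs0.ne',
    normalVec_mem_span_iff]
  · rintro rfl; simp at hw1
  intro f hf hfz
  rw [hdist]
  refine (hsρ.trans_le (min_le_right _ _)).trans_le ?_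
  have hfx : f x ≠ 0 := fun h => hfz ((hzx.eq_zero_iff hf).1 h)
  have h1 := (min_le_left ρx ρy).trans (hx' f hf hfx)
  have h2 := (min_le_right ρx ρy).trans (hy' f hf fun h => hfx ((hxy.eq_zero_iff hf).2 h))
  have hsgn := hxy f hf
  rw [affineMap_segment]
  rcases lt_or_gt_of_ne hfx with h | h
  · have h3 : f y < 0 := by rwa [sign_neg h, eq_comm, sign_eq_neg_one_iff] at hsgn
    rw [abs_of_neg h] at h1
    rw [abs_of_neg h3] at h2
    exact le_abs.2 (Or.inr (by nlinarith [ht.1]))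
  · have h3 : 0 < f y := by rwa [sign_pos h, eq_comm, sign_eq_one_iff] at hsgn
    rw [abs_of_pos h] at h1
    rw [abs_of_pos h3] at h2
    exact le_abs.2 (Or.inl (by nlinarith [ht.1]))

omit [IsAdmissibleTarget k N] in
theorem IsAdapted.exists_linkMap_class_imp (hA : IsAdapted A n M) (hMD : M ⊆ D) (hDo : IsOpen D)
    (hu : ContinuousOn u (D \ M)) (hx : x ∈ M) (hxn : finrank ℝ (zeroDir A x) = n)
    (hspan : tangentSpan b = zeroDir A x) (hxy : SameCell A x y) :
    ∃ ρ > 0, ∀ r ∈ Ioo 0 ρ, ∀ r' ∈ Ioo 0 ρ, ∀ g : CoeffGroup k N p,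
      HasHomotopyClass k N p (linkMap u x b r) g → HasHomotopyClass k N p (linkMap u y b r') g := by
  obtain ⟨ρ, hρ, h⟩ := hA.linkMap_homotopy hMD hDo hu hx hxn hspan hxy
  refine ⟨ρ, hρ, fun r hr r' hr' g hg => hg.of_homotopy
    (fun s w => u ((1 - s) • x + s • y + ((1 - s) * r + s * r') • normalVec b w))
    (h r hr r' hr') (fun w _ => ?_) (fun w _ => ?_)⟩ <;> simp [linkMap_eq]

omit [IsAdmissibleTarget k N] in
theorem IsAdapted.linkMap_class_sameCell (hA : IsAdapted A n M) (hMD : M ⊆ D) (hDo : IsOpen D)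
    (hu : ContinuousOn u (D \ M)) (hx : x ∈ M) (hxn : finrank ℝ (zeroDir A x) = n)
    (hspan : tangentSpan b = zeroDir A x) (hxy : SameCell A x y) {g : CoeffGroup k N p}
    (hg : ∃ᶠ r in 𝓝[>] (0 : ℝ), HasHomotopyClass k N p (linkMap u x b r) g) :
    HasLinkClass u y b g := by
  obtain ⟨ρ, hρ, h⟩ := hA.exists_linkMap_class_imp hMD hDo hu hx hxn hspan hxy
  obtain ⟨r, hr, hrρ⟩ := (hg.and_eventually (Ioo_mem_nhdsGT hρ)).exists
  filter_upwards [Ioo_mem_nhdsGT hρ] with r' hr' using h r hrρ r' hr' g hr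

omit [k.AtLeastTwo] [IsAdmissibleTarget k N] in
theorem IsAdapted.eventually_continuousOn_linkMap (hA : IsAdapted A n M) (hMD : M ⊆ D)
    (hDo : IsOpen D) (hu : ContinuousOn u (D \ M)) (hx : x ∈ M) (hxn : finrank ℝ (zeroDir A x) = n)
    (hspan : tangentSpan b = zeroDir A x) :
    ∀ᶠ r in 𝓝[>] (0 : ℝ), ContinuousOn (linkMap u x b r) (sphere 0 1) := by
  obtain ⟨ρ, hρ, h⟩ := hA.linkMap_homotopy hMD hDo hu hx hxn hspan (SameCell.refl x)
  filter_upwards [Ioo_mem_nhdsGT hρ] with r hr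
  have h1 := (h r hr r hr).comp (f := fun w : ℝ^k => ((0 : ℝ), w))
    (s := sphere 0 1) (by fun_prop) fun w hw => ⟨by simp, hw⟩
  refine h1.congr fun w _ => ?_
  simp [linkMap_eq]

theorem IsAdapted.exists_linkMap_class (hA : IsAdapted A n M) (hMD : M ⊆ D)
    (hDo : IsOpen D) (hu : ContinuousOn u (D \ M)) (hx : x ∈ M) (hxn : finrank ℝ (zeroDir A x) = n)
    (hspan : tangentSpan b = zeroDir A x) (p : N) :
    ∃ g : CoeffGroup k N p, HasLinkClass u x b g := by
  have h := hA.eventually_continuousOn_linkMap hMD hDo hu hx hxn hspan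
  obtain ⟨ρ, hρ, hh⟩ := hA.exists_linkMap_class_imp hMD hDo hu hx hxn hspan (SameCell.refl x)
  obtain ⟨r, hr, hrρ⟩ := (h.and (Ioo_mem_nhdsGT hρ)).exists
  obtain ⟨g, hg⟩ := exists_hasHomotopyClass p hr
  refine ⟨g, ?_⟩
  filter_upwards [Ioo_mem_nhdsGT hρ] with r' hr' using hh r hrρ r' hr' g hg

end Links

/-! ### Existence and uniqueness of the topological singular set -/

theorem sign_eq_sign_of_mul_pos {a b : ℝ} (h : 0 < a * b) :
    (SignType.sign a : ℤ) = (SignType.sign b : ℤ) := by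
  rcases pos_and_pos_or_neg_and_neg_of_mul_pos h with ⟨ha, hb⟩ | ⟨ha, hb⟩
  · rw [sign_pos ha, sign_pos hb]
  · rw [sign_neg ha, sign_neg hb]

section SingularSetExistence

variable {n k m : ℕ} [hk : k.AtLeastTwo] {N : Set ℝ^m}
  [IsAdmissibleTarget k N] {p : N} {u : ℝ^(n + k) → N} {A : Arrangement (n + k)}
  {D M : Set ℝ^(n + k)}

/-- The class on small spheres around the points of a single cell is described by a chain carried
by that cell. -/
theorem IsAdapted.exists_cell_chain (hA : IsAdapted A n M) (hMD : M ⊆ D) (hDo : IsOpen D)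
    (hu : ContinuousOn u (D \ M)) {s : ℝ^(n + k)} (hs : s ∈ M) (hsn : finrank ℝ (zeroDir A s) = n)
    (hT : ∃ T : OrientedSimplex n (n + k), T.dir = zeroDir A s ∧
      ∀ y, SameCell A s y → y ∈ T.carrier) (p : N) :
    ∃ c : OrientedSimplex n (n + k) →₀ CoeffGroup k N p, ∀ᵐ x ∂(μH[(n : ℝ)] : Measure ℝ^(n + k)),
        (¬ SameCell A s x → ∀ e, chainMultiplicity c x e = 0) ∧
        (SameCell A s x → ∀ b : Frame (n + k), IsPositivelyOriented b →
          tangentSpan b = zeroDir A s →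
          HasLinkClass u x b (chainMultiplicity c x (tangentFrame b))) := by
  classical
  obtain ⟨T, hTdir, hTcell⟩ := hT
  have : NeZero k := ⟨by have := hk.prop; omega⟩
  obtain ⟨b₀, hb₀, hpos₀⟩ := exists_positive_span (k := k) _ hsn
  obtain ⟨g, hg⟩ := hA.exists_linkMap_class hMD hDo hu hs hsn hb₀ p
  obtain ⟨c, hc⟩ := exists_restrict_cell A s
    (Finsupp.single T (T.sign (tangentFrame b₀) • g) : OrientedSimplex n
      (n + k) →₀ CoeffGroup k N p)
  refine ⟨c, ?_⟩
  filter_upwards [hc] with x hx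
  refine ⟨fun h e => by rw [hx e, if_neg h], fun h b hb hspan => ?_⟩
  rw [hx, if_pos h, chainMultiplicity_single, if_pos (hTcell x h), smul_smul]
  have hspan' : tangentSpan b₀ = tangentSpan b := by rw [hb₀, hspan]
  have hsb : T.sign (tangentFrame b) * T.sign (tangentFrame b₀) =
      (SignType.sign (of fun i j : Fin k =>
        inner ℝ (b₀ (natAdd n i)) (b (natAdd n j))).det : ℤ) := by
    have h1 := det_tangent_mul_det_normal b₀ b hspan'
    have hdir : T.dir = tangentSpan b := by rw [hTdir, hspan]
    have hdir₀ : T.dir = tangentSpan b₀ := by rw [hTdir, hb₀]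
    have h2 := T.sign_eq_mul_sign hdir₀ (orthonormal_tangentFrame b) hdir
    rw [h2, mul_left_comm, T.sign_mul_self hdir, mul_one]
    refine sign_eq_sign_of_mul_pos ?_
    rw [h1]
    exact mul_pos ((isPositivelyOriented_iff b₀).1 hpos₀) ((isPositivelyOriented_iff b).1 hb)
  rw [hsb]
  have hxM : x ∈ M := hA.decides s x h hs
  have hxn : finrank ℝ (zeroDir A x) = n := by rw [← h.zeroDir_eq, hsn]
  filter_upwards [hA.linkMap_class_sameCell hMD hDo hu hs hsn hb₀ h hg.frequently,
    hA.eventually_continuousOn_linkMap hMD hDo hu hxM hxn (by rw [hb₀, h.zeroDir_eq])]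
    with r h1 h2
  exact h1.linkMap_change_frame h2 hspan'

/-- The chain is the sum of the chains of the finitely many `n`-dimensional cells of an adapted
arrangement in `M`. -/
theorem IsPolyhedralSet.exists_isTopologicalSingularSet (hM : IsPolyhedralSet n M) (hMD : M ⊆ D)
    (hDo : IsOpen D) (hu : ContinuousOn u (D \ M)) (p : N) :
    ∃ S : PolyhedralChain (CoeffGroup k N p) n (n + k), IsTopologicalSingularSet u M S := by
  classical
  obtain ⟨A, hA, hAT⟩ := hM.exists_isAdapted
  have hex := fun s (hs : s ∈ M) (hsn : finrank ℝ (zeroDir A s) = n) =>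
    hA.exists_cell_chain hMD hDo hu hs hsn (hAT s hs hsn) p
  choose! c hc using hex
  have hfin : (range (cellPoint A) ∩ {s | s ∈ M ∧ finrank ℝ (zeroDir A s) = n}).Finite :=
    (finite_range_cellPoint A).inter_of_left _
  have hF : ∀ s ∈ hfin.toFinset, s ∈ range (cellPoint A) ∧ s ∈ M ∧
      finrank ℝ (zeroDir A s) = n := fun s hs => hfin.mem_toFinset.1 hs
  have hae : ∀ᵐ x ∂(μH[(n : ℝ)] : Measure ℝ^(n + k)),
      ∀ s ∈ hfin.toFinset, (¬ SameCell A s x → ∀ e, chainMultiplicity (c s) x e = 0) ∧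
        (SameCell A s x → ∀ b : Frame (n + k), IsPositivelyOriented b →
          tangentSpan b = zeroDir A s → HasLinkClass u x b
            (chainMultiplicity (c s) x (tangentFrame b))) := by
    rw [Finset.eventually_all]
    intro s hs
    obtain ⟨-, hsM, hsn⟩ := hF s hs
    exact hc s hsM hsn
  refine ⟨_, ∑ s ∈ hfin.toFinset, c s, rfl, fun e _ => ?_, fun b hb => ?_⟩
  · filter_upwards [hae] with x hx hxM
    rw [chainMultiplicity_finset_sum]
    refine sum_eq_zero fun s hs => (hx s hs).1 (fun h => hxM ?_) e
    exact hA.decides s x h (hF s hs).2.1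
  · filter_upwards [hae, ae_le_finrank_zeroDir A n] with x hx hxn hxM hflat
    have hxn : finrank ℝ (zeroDir A x) = n := le_antisymm (hA.finrank_le x hxM) hxn
    have hspan : tangentSpan b = zeroDir A x := by
      refine submodule_eq_of_eventually_iff (z := x) ?_
      filter_upwards [hflat, hA.eventually_mem_iff hxM hxn] with y h1 h2
      rw [← h1, h2]
    have hs := sameCell_cellPoint A x
    have hsF : cellPoint A x ∈ hfin.toFinset := hfin.mem_toFinset.2
      ⟨⟨x, rfl⟩, hA.decides _ _ hs.symm hxM, by rw [hs.zeroDir_eq, hxn]⟩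
    rw [chainMultiplicity_finset_sum, Finset.sum_eq_single_of_mem _ hsF]
    · exact (hx _ hsF).2 hs b hb (by rw [hspan, hs.zeroDir_eq])
    · intro s' hs' hne
      refine (hx s' hs').1 (fun h => hne ?_) _
      obtain ⟨y, rfl⟩ := (hF s' hs').1
      exact ((sameCell_cellPoint A y).symm.trans h).cellPoint_eq

/-- Two chains that represent the topological singular set of a map agree almost everywhere. -/
theorem IsPolyhedralSet.isTopologicalSingularSet_unique (hM : IsPolyhedralSet n M)
    {S S' : PolyhedralChain (CoeffGroup k N p) n (n + k)}
    (hS : IsTopologicalSingularSet u M S) (hS' : IsTopologicalSingularSet u M S') : S = S' := by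
  classical
  obtain ⟨A, hA, -⟩ := hM.exists_isAdapted
  obtain ⟨c, rfl, hc1, hc2⟩ := hS
  obtain ⟨c', rfl, hc1', hc2'⟩ := hS'
  refine QuotientAddGroup.eq.2 fun e he => ?_
  have : NeZero k := ⟨by have := hk.prop; omega⟩
  obtain ⟨b, rfl, hb⟩ := exists_positive_tangentFrame (k := k) he
  have hdir : ∀ c : OrientedSimplex n (n + k) →₀ CoeffGroup k N p,
      ∀ᵐ x ∂(μH[(n : ℝ)] : Measure ℝ^(n + k)), x ∈ M → zeroDir A x ≠ tangentSpan b →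
        chainMultiplicity c x (tangentFrame b) = 0 := by
    intro c
    have h1 : ∀ᵐ x ∂(μH[(n : ℝ)] : Measure ℝ^(n + k)),
        ∀ T ∈ c.support, x ∈ T.carrier → x ∈ M → T.dir = zeroDir A x := by
      rw [Finset.eventually_all]
      exact fun T _ => hA.ae_dir_eq T
    filter_upwards [h1] with x hx hxM hne
    refine sum_eq_zero fun T hT => ?_
    simp only
    split_ifs with hxT
    · rw [T.sign_of_dir_ne (by rwa [hx T hT hxT hxM]), zero_smul]
    · rfl
  filter_upwards [hc1 _ he, hc1' _ he, hc2 b hb, hc2' b hb, hdir c, hdir c',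
    ae_le_finrank_zeroDir A n] with x h1 h1' h2 h2' h3 h3' hxn
  have key : chainMultiplicity c x (tangentFrame b) = chainMultiplicity c' x (tangentFrame b) := by
    by_cases hxM : x ∈ M
    · have hxn : finrank ℝ (zeroDir A x) = n := le_antisymm (hA.finrank_le x hxM) hxn
      by_cases hspan : zeroDir A x = tangentSpan b
      · have hflat := hA.eventually_mem_iff hxM hxn
        rw [hspan] at hflat
        obtain ⟨r, hr, hr'⟩ := ((h2 hxM hflat).and (h2' hxM hflat)).exists
        exact hr.unique hr'
      · rw [h3 hxM hspan, h3' hxM hspan]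
    · rw [h1 hxM, h1' hxM]
  rw [chainMultiplicity_add, chainMultiplicity_neg, key, neg_add_cancel]

theorem IsPolyhedralSet.existsUnique_isTopologicalSingularSet (hM : IsPolyhedralSet n M)
    (hMD : M ⊆ D) (hDo : IsOpen D) (hu : ContinuousOn u (D \ M)) (p : N) :
    ∃! S : PolyhedralChain (CoeffGroup k N p) n (n + k), IsTopologicalSingularSet u M S := by
  obtain ⟨S, hS⟩ := hM.exists_isTopologicalSingularSet hMD hDo hu p
  exact ⟨S, hS, fun S' hS' => hM.isTopologicalSingularSet_unique hS' hS⟩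

theorem IsPolyhedralSet.topologicalSingularSet_eq (hM : IsPolyhedralSet n M)
    {S : PolyhedralChain (CoeffGroup k N p) n (n + k)} (hS : IsTopologicalSingularSet u M S) :
    topologicalSingularSet p u M = S :=
  hM.isTopologicalSingularSet_unique
    (Classical.epsilon_spec (p := IsTopologicalSingularSet u M) ⟨S, hS⟩) hS

/-- A map with a nice singularity at a closed set is continuous away from that set. -/
theorem HasNiceSingularity.continuousOn {d : ℕ} {D M : Set ℝ^d}
    {u : ℝ^d → N} (h : HasNiceSingularity D M u) :
    ContinuousOn u (D \ M) := by
  intro x hx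
  obtain ⟨L, V, hV, hL⟩ := h.1 x ⟨subset_closure hx.1, hx.2⟩
  have h1 := hL.continuousOn x ⟨mem_of_mem_nhds hV, hx⟩
  exact h1.mono_of_mem_nhdsWithin (inter_comm V _ ▸ inter_mem_nhdsWithin _ hV)

end SingularSetExistence

/-! ### Projections onto affine planes -/

section PlaneProjection

variable {d : ℕ} {a : ℝ^d} {W : Submodule ℝ ℝ^d} {x y z : ℝ^d}

/-- The orthogonal projection onto the affine plane `a + W`. -/
noncomputable def planeProj (a : ℝ^d) (W : Submodule ℝ ℝ^d) (x : ℝ^d) : ℝ^d :=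
  a + W.starProjection (x - a)

/-- The projection onto the affine plane through `a` on which those functions of the arrangement
`A` vanish that vanish at `a`. -/
notation "proj[" A ", " a "]" => planeProj a (zeroDir A a)

theorem planeProj_sub_mem : planeProj a W x - a ∈ W := by
  rw [planeProj, add_sub_cancel_left]
  exact Submodule.starProjection_apply_mem _ _

theorem planeProj_sub_planeProj : planeProj a W x - planeProj a W y = W.starProjection (x - y) := by
  rw [planeProj, planeProj, add_sub_add_left_eq_sub, ← map_sub, sub_sub_sub_cancel_right]

theorem dist_planeProj_le : dist (planeProj a W x) (planeProj a W y) ≤ dist x y := by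
  rw [dist_eq_norm, dist_eq_norm, planeProj_sub_planeProj]
  exact W.norm_starProjection_apply_le _

theorem norm_sub_planeProj_sub_le : ‖(x - planeProj a W x) - (y - planeProj a W y)‖ ≤ dist x y := by
  have h1 : (x - planeProj a W x) - (y - planeProj a W y) = Wᗮ.starProjection (x - y) := by
    rw [Submodule.starProjection_orthogonal_val, ← planeProj_sub_planeProj (a := a)]
    abel
  rw [h1, dist_eq_norm]
  exact Wᗮ.norm_starProjection_apply_le _

theorem planeProj_eq_self (hx : x - a ∈ W) : planeProj a W x = x := by
  rw [planeProj, Submodule.starProjection_eq_self_iff.2 hx, add_sub_cancel]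

theorem sub_planeProj_mem : x - planeProj a W x ∈ Wᗮ := by
  have : x - planeProj a W x = (x - a) - W.starProjection (x - a) := by rw [planeProj]; abel
  rw [this]
  exact Submodule.sub_starProjection_mem_orthogonal _

theorem planeProj_add (hz : z ∈ Wᗮ) : planeProj a W (planeProj a W x + z) = planeProj a W x := by
  have h1 : planeProj a W x + z - a = (planeProj a W x - a) + z := by abel
  rw [planeProj, h1, map_add, Submodule.starProjection_eq_self_iff.2 planeProj_sub_mem,
    (starProjection_apply_eq_zero_iff _).2 hz, add_zero, add_sub_cancel]

theorem dist_planeProj_le_of_mem (hz : z - a ∈ W) : dist z (planeProj a W x) ≤ dist z x := by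
  conv_lhs => rw [← planeProj_eq_self hz]
  exact dist_planeProj_le

theorem norm_sub_planeProj_le (hz : z - a ∈ W) : ‖x - planeProj a W x‖ ≤ dist x z := by
  have := norm_sub_planeProj_sub_le (a := a) (W := W) (x := x) (y := z)
  rwa [planeProj_eq_self hz, sub_self, sub_zero] at this

theorem continuous_planeProj : Continuous (planeProj a W) := by
  unfold planeProj; fun_prop

end PlaneProjection

/-! ### Pushing points away from a polyhedral set -/

section Push

variable {d : ℕ} {A Z : Arrangement d} {P M : Set ℝ^d} {x y z : ℝ^d} {ε : ℝ}

open Classical in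
/-- A function on the common zero set of the functions in `Z ⊆ A` that is supported in `P`:
the distance from the zeros of the other functions in `A`, multiplied by `ε`. -/
noncomputable def bumpRadius (A Z : Arrangement d) (P : Set ℝ^d) (ε : ℝ) (x : ℝ^d) : ℝ :=
  if x ∈ P then ε * gap (A.filter fun f => f ∉ Z) x else 0

theorem bumpRadius_of_mem (hx : x ∈ P) : ∃ B : Arrangement d, (∀ f, f ∈ B ↔ f ∈ A ∧ f ∉ Z) ∧
      bumpRadius A Z P ε x = ε * gap B x := by
  classical
  exact ⟨A.filter fun f => f ∉ Z, fun f => mem_filter, if_pos hx⟩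

theorem bumpRadius_of_notMem (hx : x ∉ P) : bumpRadius A Z P ε x = 0 := if_neg hx

theorem bumpRadius_nonneg (hε : 0 ≤ ε) : 0 ≤ bumpRadius A Z P ε x := by
  rw [bumpRadius]
  split_ifs
  · exact mul_nonneg hε gap_nonneg
  · exact le_rfl

theorem bumpRadius_le (hε : 0 ≤ ε) : bumpRadius A Z P ε x ≤ ε := by
  rw [bumpRadius]
  split_ifs
  · exact mul_le_of_le_one_right hε gap_le_one
  · exact hε

theorem bumpRadius_le_abs (hε : 0 ≤ ε) {f : ℝ^d →ᵃ[ℝ] ℝ} (hf : f ∈ A)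
    (hfZ : f ∉ Z) : bumpRadius A Z P ε x ≤ ε * |f x| := by
  rw [bumpRadius]
  split_ifs
  · classical
    exact mul_le_mul_of_nonneg_left (gap_le_abs (mem_filter.2 ⟨hf, hfZ⟩)) hε
  · positivity

theorem bumpRadius_pos_iff (hε : 0 < ε) :
    0 < bumpRadius A Z P ε x ↔ x ∈ P ∧ ∀ f ∈ A, f ∉ Z → f x ≠ 0 := by
  rw [bumpRadius]
  split_ifs with h
  · rw [mul_pos_iff_of_pos_left hε, gap_pos_iff]
    simp [h]
  · simp [h]

/-- Points that are close to each other in the zero set of `Z` lie in the same cell. -/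
theorem sameCell_of_dist_lt (hA : IsLipArrangement A) (hy : ∀ f ∈ Z, f y = 0)
    (hz : ∀ f ∈ Z, f z = 0) (h : ∀ f ∈ A, f ∉ Z → dist y z < |f y|) : SameCell A y z := by
  intro f hf
  by_cases hfZ : f ∈ Z
  · rw [hy f hfZ, hz f hfZ]
  · exact (sign_eq_of_abs_sub_lt ((hA f hf y z).trans_lt (h f hf hfZ))).symm

theorem bumpRadius_le_add (hA : IsLipArrangement A) (hP : Decides A P) (hε : 0 ≤ ε)
    (hy : ∀ f ∈ Z, f y = 0) (hz : ∀ f ∈ Z, f z = 0) :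
    bumpRadius A Z P ε y ≤ bumpRadius A Z P ε z + ε * dist y z := by
  classical
  by_cases hyP : y ∈ P
  · by_cases hzP : z ∈ P
    · rw [bumpRadius, bumpRadius, if_pos hyP, if_pos hzP, ← mul_add]
      refine mul_le_mul_of_nonneg_left (gap_le_add_dist fun f hf => ?_) hε
      exact hA f (mem_filter.1 hf).1
    · rw [bumpRadius_of_notMem hzP, zero_add, bumpRadius, if_pos hyP]
      refine mul_le_mul_of_nonneg_left ?_ hε
      by_contra hlt
      push Not at hlt
      refine hzP (hP y z (sameCell_of_dist_lt hA hy hz fun f hf hfZ => ?_) hyP)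
      exact hlt.trans_le (gap_le_abs (mem_filter.2 ⟨hf, hfZ⟩))
  · rw [bumpRadius_of_notMem hyP]
    exact add_nonneg (bumpRadius_nonneg hε) (mul_nonneg hε dist_nonneg)

/-- The functions in `A` that vanish at `x`. -/
noncomputable def zeroSet (A : Arrangement d) (x : ℝ^d) : Arrangement d :=
  haveI := Classical.decPred fun f : ℝ^d →ᵃ[ℝ] ℝ => f x = 0
  A.filter fun f => f x = 0

theorem mem_zeroSet {f : ℝ^d →ᵃ[ℝ] ℝ} : f ∈ zeroSet A x ↔ f ∈ A ∧ f x = 0 := by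
  classical
  unfold zeroSet
  exact mem_filter

theorem sub_mem_zeroDir_iff : y - x ∈ zeroDir A x ↔ ∀ f ∈ zeroSet A x, f y = 0 := by
  constructor
  · intro h f hf
    obtain ⟨hf, hx⟩ := mem_zeroSet.1 hf
    have := h f hf hx
    rwa [affineMap_sub, hx, sub_zero] at this
  · intro h f hf hx
    rw [affineMap_sub, hx, h f (mem_zeroSet.2 ⟨hf, hx⟩), sub_zero]

/-- The map that pushes points away from the cells of `M` that are contained in the plane `F` of
the cell of `a`: near such a cell, it moves points away from `F` in the normal direction, to
distance at least `bumpRadius`. -/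
noncomputable def pushMap (A : Arrangement d) (M : Set ℝ^d) (ε : ℝ) (a x : ℝ^d) : ℝ^d :=
  proj[A, a] x + max 1 (bumpRadius A (zeroSet A a) M ε (proj[A, a] x) /
      ‖x - proj[A, a] x‖) • (x - proj[A, a] x)

variable {a : ℝ^d}

theorem planeProj_zero {f : ℝ^d →ᵃ[ℝ] ℝ} (hf : f ∈ zeroSet A a) (x : ℝ^d) : f (proj[A, a] x) = 0 :=
  sub_mem_zeroDir_iff.1 planeProj_sub_mem f hf

theorem pushMap_eq_self (h : bumpRadius A (zeroSet A a) M ε (proj[A, a] x) ≤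
    ‖x - proj[A, a] x‖) : pushMap A M ε a x = x := by
  rw [pushMap, max_eq_left (div_le_one_of_le₀ h (norm_nonneg _)), one_smul, add_sub_cancel]

/-- Data of a point that is moved by the push map. -/
theorem pushMap_of_lt (hε : 0 < ε) (h : ‖x - proj[A, a] x‖ <
      bumpRadius A (zeroSet A a) M ε (proj[A, a] x)) :
    proj[A, a] x ∈ M ∧ ∀ f ∈ A, f ∉ zeroSet A a → f (proj[A, a] x) ≠ 0 :=
  (bumpRadius_pos_iff hε).1 ((norm_nonneg _).trans_lt h)

/-- If `x` is moved, then `pushMap` is, near the base point of `x`, a dilation from that point. -/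
theorem pushMap_sub (x : ℝ^d) : ∃ l : ℝ, 1 ≤ l ∧
    l = max 1 (bumpRadius A (zeroSet A a) M ε (proj[A, a] x) /
      ‖x - proj[A, a] x‖) ∧ pushMap A M ε a x = proj[A, a] x + l • (x - proj[A, a] x) :=
  ⟨_, le_max_left _ _, rfl, rfl⟩

theorem dist_pushMap_le_sub (hε : 0 ≤ ε) : dist (pushMap A M ε a x) x ≤
      max 0 (bumpRadius A (zeroSet A a) M ε (proj[A, a] x) -
        ‖x - proj[A, a] x‖) := by
  rcases le_or_gt (bumpRadius A (zeroSet A a) M ε (proj[A, a] x))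
    ‖x - proj[A, a] x‖ with h | h
  · rw [pushMap_eq_self h, dist_self]; exact le_max_left _ _
  · refine le_trans ?_ (le_max_right _ _)
    set θ := bumpRadius A (zeroSet A a) M ε (proj[A, a] x) with hθ
    set v := x - proj[A, a] x with hv
    rcases eq_or_lt_of_le (norm_nonneg v) with h0 | h0
    · have hv0 : v = 0 := norm_eq_zero.1 h0.symm
      rw [pushMap, ← hv, hv0, smul_zero, add_zero]
      have : x = proj[A, a] x := sub_eq_zero.1 hv0
      rw [← this, dist_self, norm_zero, sub_zero]
      exact bumpRadius_nonneg hε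
    · have h1 : 1 ≤ θ / ‖v‖ := (one_le_div h0).2 h.le
      have h2 : pushMap A M ε a x - x = (θ / ‖v‖ - 1) • v := by
        have e : x = proj[A, a] x + v := by rw [hv]; abel
        rw [pushMap, ← hθ, ← hv, max_eq_right h1]
        nth_rewrite 2 [e]
        rw [sub_smul, one_smul]
        abel
      rw [dist_eq_norm, h2, norm_smul, norm_eq_abs, abs_of_nonneg (by linarith), sub_mul,
        div_mul_cancel₀ _ h0.ne', one_mul]

theorem dist_pushMap_le_bumpRadius (hε : 0 ≤ ε) : dist (pushMap A M ε a x) x ≤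
    bumpRadius A (zeroSet A a) M ε (proj[A, a] x) :=
  (dist_pushMap_le_sub hε).trans (max_le (bumpRadius_nonneg hε) (sub_le_self _ (norm_nonneg _)))

/-- Pushing multiplies the functions that vanish on the stratum by a positive factor, and changes
the others by less than their absolute values. -/
theorem sameCell_pushMap (hA : IsLipArrangement A) (hε : 0 < ε) (hε1 : ε < 1) :
    SameCell A x (pushMap A M ε a x) := by
  rcases le_or_gt (bumpRadius A (zeroSet A a) M ε (proj[A, a] x))
    ‖x - proj[A, a] x‖ with h | h
  · rw [pushMap_eq_self h]; exact SameCell.refl x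
  · intro f hf
    by_cases hfZ : f ∈ zeroSet A a
    · obtain ⟨l, hl, -, hx⟩ := pushMap_sub (A := A) (M := M) (ε := ε) (a := a) x
      have h0 := planeProj_zero hfZ x
      have h1 : f (pushMap A M ε a x) = l * f x := by
        have h2 := affineMap_sub f (proj[A, a] x) (pushMap A M ε a x)
        have h3 := affineMap_sub f (proj[A, a] x) x
        rw [h0, sub_zero] at h2 h3
        rw [← h2, ← h3, hx, add_sub_cancel_left, map_smul, smul_eq_mul]
      rw [h1, sign_mul, sign_pos (by linarith : 0 < l), one_mul]
    · refine (sign_eq_of_abs_sub_lt ((hA f hf _ _).trans_lt ?_)).symm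
      rw [dist_comm]
      have h1 := dist_pushMap_le_sub (A := A) (M := M) (x := x) (a := a) hε.le
      rw [max_eq_right (by linarith)] at h1
      have h2 := bumpRadius_le_abs (P := M) (x := proj[A, a] x) hε.le hf hfZ
      have h3 := hA f hf (proj[A, a] x) x
      rw [dist_eq_norm, norm_sub_rev] at h3
      have h4 := abs_sub_abs_le_abs_sub (f (proj[A, a] x)) (f x)
      have h5 : 0 < |f (proj[A, a] x)| := abs_pos.2 ((pushMap_of_lt hε h).2 f hf hfZ)
      nlinarith

theorem planeProj_pushMap : proj[A, a] (pushMap A M ε a x) = proj[A, a] x := by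
  rw [pushMap]
  exact planeProj_add (smul_mem _ _ sub_planeProj_mem)

/-- Distances from points of `M` grow at least by the dilation factor. -/
theorem mul_infDist_le_infDist_pushMap (hA : IsLipArrangement A) (hM : Decides A M)
    (hMne : M.Nonempty) (hε : 0 < ε) (hε1 : 2 * ε ≤ 1) {l : ℝ} (hl1 : 1 ≤ l)
    (hl : l = max 1 (bumpRadius A (zeroSet A a) M ε (proj[A, a] x) /
      ‖x - proj[A, a] x‖)) :
    l * infDist x M ≤ infDist (pushMap A M ε a x) M := by
  rcases le_or_gt (bumpRadius A (zeroSet A a) M ε (proj[A, a] x))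
    ‖x - proj[A, a] x‖ with h | h
  · rw [pushMap_eq_self h, hl, max_eq_left (div_le_one_of_le₀ h (norm_nonneg _)), one_mul]
  have hdist := dist_pushMap_le_bumpRadius (A := A) (M := M) (x := x) (a := a) hε.le
  obtain ⟨hzM, hz⟩ := pushMap_of_lt hε h
  have hpx : pushMap A M ε a x = proj[A, a] x + l • (x - proj[A, a] x) := by rw [pushMap, ← hl]
  have hdx := infDist_le_dist_of_mem (x := x) hzM
  have hzf : ∀ f ∈ zeroSet A a, f (proj[A, a] x) = 0 :=
    fun f hf => planeProj_zero hf x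
  have hq : l * ‖x - proj[A, a] x‖ ≤ bumpRadius A (zeroSet A a) M ε (proj[A, a] x) := by
    rcases eq_or_lt_of_le (norm_nonneg (x - proj[A, a] x)) with h0 | h0
    · rw [← h0, mul_zero]; exact bumpRadius_nonneg hε.le
    · rw [hl, max_eq_right ((one_le_div h0).2 h.le), div_mul_cancel₀ _ h0.ne']
  obtain ⟨B, hB, hθ⟩ := bumpRadius_of_mem (A := A) (Z := zeroSet A a) (ε := ε) hzM
  generalize proj[A, a] x = z at *
  generalize bumpRadius A (zeroSet A a) M ε z = θ at *
  refine (le_infDist hMne).2 fun m hm => ?_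
  have hl0 : 0 < l := by linarith
  have hpz : dist (pushMap A M ε a x) z ≤ θ := by
    rw [hpx, dist_eq_norm, add_sub_cancel_left, norm_smul, norm_eq_abs, abs_of_pos hl0]
    exact hq
  rcases lt_or_ge (dist z m) (gap B z) with hlt | hge
  · -- shrink `m` towards `z`: it stays in `M`
    set m' := z + l⁻¹ • (m - z) with hm'
    have hl1' : l⁻¹ ≤ 1 := inv_le_one_of_one_le₀ hl1
    have hmm' : SameCell A m m' := by
      intro f hf
      by_cases hfZ : f ∈ zeroSet A a
      · have h2 := affineMap_sub f z m'
        have h3 := affineMap_sub f z m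
        rw [hzf f hfZ, sub_zero] at h2 h3
        rw [← h2, ← h3, hm', add_sub_cancel_left, map_smul, smul_eq_mul, sign_mul,
          sign_pos (inv_pos.2 hl0), one_mul]
      · have h4 : ∀ w, dist z w ≤ dist z m → SignType.sign (f w) = SignType.sign (f z) := by
          intro w hw
          exact sign_eq_of_abs_sub_lt ((hA f hf z w).trans_lt (hw.trans_lt
            (hlt.trans_le (gap_le_abs ((hB f).2 ⟨hf, hfZ⟩)))))
        rw [h4 m le_rfl, h4 m' ?_]
        rw [hm', dist_self_add_right, norm_smul, norm_eq_abs, abs_of_pos (inv_pos.2 hl0),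
          dist_comm, dist_eq_norm]
        exact mul_le_of_le_one_left (norm_nonneg _) hl1'
    have hm'M : m' ∈ M := hM m m' hmm' hm
    have h5 : dist (pushMap A M ε a x) m = l * dist x m' := by
      rw [dist_eq_norm, dist_eq_norm]
      have : pushMap A M ε a x - m = l • (x - m') := by
        have e : l • (l⁻¹ • (m - z)) = m - z := smul_inv_smul₀ hl0.ne' _
        rw [hpx, hm', ← sub_sub, smul_sub l (x - z), e]
        abel
      rw [this, norm_smul, norm_eq_abs, abs_of_pos hl0]
    rw [h5]
    exact mul_le_mul_of_nonneg_left (infDist_le_dist_of_mem hm'M) hl0.le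
  · have h6 : l * infDist x M ≤ θ := by
      rw [dist_eq_norm] at hdx
      exact (mul_le_mul_of_nonneg_left hdx hl0.le).trans hq
    have h7 := dist_triangle_left z m (pushMap A M ε a x)
    have h8 : 0 ≤ gap B z := gap_nonneg
    nlinarith

/-- Distances from the points of `M` at which some function vanishes that does not vanish on the
plane of `a` decrease at most by a constant factor. -/
theorem dist_le_dist_pushMap (hA : IsLipArrangement A) (hε : 0 < ε) (hε1 : 2 * ε ≤ 1)
    {m : ℝ^d} {f : ℝ^d →ᵃ[ℝ] ℝ} (hf : f ∈ A)
    (hfZ : f ∉ zeroSet A a) (hm : f m = 0) : dist x m ≤ 3 * dist (pushMap A M ε a x) m := by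
  rcases le_or_gt (bumpRadius A (zeroSet A a) M ε (proj[A, a] x))
    ‖x - proj[A, a] x‖ with h | h
  · rw [pushMap_eq_self h]; linarith [dist_nonneg (x := x) (y := m)]
  have h1 := dist_pushMap_le_bumpRadius (A := A) (M := M) (x := x) (a := a) hε.le
  have h2 := bumpRadius_le_abs (P := M) (x := proj[A, a] x) hε.le hf hfZ
  have h1' := dist_pushMap_le_sub (A := A) (M := M) (x := x) (a := a) hε.le
  rw [max_eq_right (by linarith)] at h1'
  have h3 := hA f hf (proj[A, a] x) m
  rw [hm, sub_zero] at h3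
  set z := proj[A, a] x
  have h4 := dist_triangle x z m
  have h5 := dist_triangle4 z x (pushMap A M ε a x) m
  have h6 : ‖x - z‖ = dist x z := (dist_eq_norm _ _).symm
  rw [h6] at h h1'
  rw [dist_comm (pushMap A M ε a x) x] at h1'
  rw [dist_comm z x] at h5
  have h7 : ε * |f z| ≤ ε * dist z m := mul_le_mul_of_nonneg_left h3 hε.le
  have h8 : 2 * ε * dist z m ≤ 1 * dist z m := mul_le_mul_of_nonneg_right hε1 dist_nonneg
  linarith

end Push

/-! ### Pushing the strata one after the other -/

section PushIteration

variable {d : ℕ} {A Z : Arrangement d} {M : Set ℝ^d} {x : ℝ^d} {ε : ℝ}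

/-- The distance of two vectors with prescribed norms `|s|` and `s'`. -/
theorem norm_smul_sub_smul_le {E : Type*} [NormedAddCommGroup E] [NormedSpace ℝ E] {v v' : E}
    (hv : v ≠ 0) (hv' : v' ≠ 0) (s : ℝ) {s' : ℝ} (hs' : 0 ≤ s') :
    ‖(s / ‖v‖) • v - (s' / ‖v'‖) • v'‖ ≤ |s - s'| + 2 * (s' / ‖v‖) * ‖v - v'‖ := by
  have h0 : 0 < ‖v‖ := norm_pos_iff.2 hv
  have h0' : 0 < ‖v'‖ := norm_pos_iff.2 hv'
  have h1 : (s / ‖v‖) • v - (s' / ‖v'‖) • v' = ((s - s') / ‖v‖) • v + (s' / ‖v‖) • (v - v') +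
      (s' / ‖v‖ * (‖v'‖ - ‖v‖) / ‖v'‖) • v' := by
    have e : s' / ‖v‖ * (‖v'‖ - ‖v‖) / ‖v'‖ = s' / ‖v‖ - s' / ‖v'‖ := by field_simp
    rw [e, sub_div]; module
  rw [h1]
  refine (norm_add_le _ _).trans ((add_le_add_left (norm_add_le _ _) _).trans ?_)
  have e1 : ‖((s - s') / ‖v‖) • v‖ = |s - s'| := by
    rw [norm_smul, norm_div, norm_norm, div_mul_cancel₀ _ h0.ne', norm_eq_abs]
  have e2 : ‖(s' / ‖v‖) • (v - v')‖ = s' / ‖v‖ * ‖v - v'‖ := by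
    rw [norm_smul, norm_of_nonneg (by positivity)]
  have e3 : ‖(s' / ‖v‖ * (‖v'‖ - ‖v‖) / ‖v'‖) • v'‖ ≤ s' / ‖v‖ * ‖v - v'‖ := by
    rw [norm_smul, norm_div, norm_norm, div_mul_cancel₀ _ h0'.ne', norm_mul,
      norm_of_nonneg (by positivity : 0 ≤ s' / ‖v‖)]
    refine mul_le_mul_of_nonneg_left ?_ (by positivity)
    rw [norm_sub_rev v v']
    exact abs_norm_sub_norm_le v' v
  rw [e1, e2]
  linarith

/-- The local Lipschitz constant of a map that dilates the distance from a plane. -/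
theorem lipNear_dilate {π : ℝ^d → ℝ^d} {t : ℝ^d → ℝ} (hπ : ∀ y z, dist (π y) (π z) ≤ dist y z)
    (hv : ∀ y z, ‖(y - π y) - (z - π z)‖ ≤ dist y z) (ht : ∀ y z, |t y - t z| ≤ dist y z)
    (hx : 0 < ‖x - π x‖) :
    LipNear (6 * max 1 (t x / ‖x - π x‖))
      (fun y => π y + max 1 (t y / ‖y - π y‖) • (y - π y)) x := by
  set l := max 1 (t x / ‖x - π x‖) with hl
  have hqabs : ∀ y z, |‖y - π y‖ - ‖z - π z‖| ≤ dist y z := fun y z =>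
    (abs_norm_sub_norm_le _ _).trans (hv y z)
  have hmabs : ∀ y z, |max ‖y - π y‖ (t y) - max ‖z - π z‖ (t z)| ≤ dist y z := fun y z =>
    (abs_max_sub_max_le_max _ _ _ _).trans (max_le (hqabs y z) (ht y z))
  have hcont : ∀ f : ℝ^d → ℝ, (∀ y z, |f y - f z| ≤ dist y z) →
      Continuous f := fun f hf => (LipschitzWith.of_dist_le_mul (K := 1) fun y z => by
        rw [NNReal.coe_one, one_mul]; exact hf y z).continuous
  have hm0 : ‖x - π x‖ ≤ max ‖x - π x‖ (t x) := le_max_left _ _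
  have hlm : l = max ‖x - π x‖ (t x) / ‖x - π x‖ := by
    rw [hl, ← div_self hx.ne', max_div_div_right hx.le]
  have e1 : ∀ᶠ y in 𝓝 x, 2 / 3 * ‖x - π x‖ < ‖y - π y‖ :=
    (hcont _ hqabs).continuousAt.eventually (lt_mem_nhds (by linarith))
  have e2 : ∀ᶠ y in 𝓝 x, max ‖y - π y‖ (t y) < 4 / 3 * max ‖x - π x‖ (t x) :=
    (hcont _ hmabs).continuousAt.eventually (gt_mem_nhds (by linarith))
  refine ⟨_, e1.and e2, ?_⟩
  rintro y ⟨hy1, hy2⟩ z ⟨hz1, hz2⟩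
  have hy0 : 0 < ‖y - π y‖ := lt_trans (by positivity) hy1
  have hz0 : 0 < ‖z - π z‖ := lt_trans (by positivity) hz1
  have hrew : ∀ w, 0 < ‖w - π w‖ →
      max 1 (t w / ‖w - π w‖) = max ‖w - π w‖ (t w) / ‖w - π w‖ := fun w hw => by
    rw [← div_self hw.ne', max_div_div_right hw.le]
  have h1 := norm_smul_sub_smul_le (norm_pos_iff.1 hy0) (norm_pos_iff.1 hz0)
    (max ‖y - π y‖ (t y)) (hz0.le.trans (le_max_left ‖z - π z‖ (t z)))
  have h2 : max ‖z - π z‖ (t z) / ‖y - π y‖ ≤ 2 * l := by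
    rw [div_le_iff₀ hy0]
    have : l * ‖x - π x‖ = max ‖x - π x‖ (t x) := by rw [hlm, div_mul_cancel₀ _ hx.ne']
    have hl1 : 1 ≤ l := le_max_left _ _
    nlinarith
  have hl1 : 1 ≤ l := le_max_left _ _
  have h3 := hmabs y z
  have h4 := hv y z
  have h5 := hπ y z
  dsimp only
  rw [dist_eq_norm, hrew y hy0, hrew z hz0, add_sub_add_comm]
  refine (norm_add_le _ _).trans ?_
  rw [dist_eq_norm (π y)] at h5
  have h6 : 2 * (max ‖z - π z‖ (t z) / ‖y - π y‖) * ‖(y - π y) - (z - π z)‖ ≤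
      2 * (2 * l) * dist y z :=
    mul_le_mul (by linarith) h4 (norm_nonneg _) (by linarith)
  nlinarith [dist_nonneg (x := y) (y := z)]

theorem lipNear_pushMap (hA : IsLipArrangement A) (hM : Decides A M) (hMc : IsClosed M)
    (hε : 0 ≤ ε) (hε1 : ε ≤ 1) {a : ℝ^d} (hx : x ∉ M) :
    LipNear (6 * max 1 (bumpRadius A (zeroSet A a) M ε (proj[A, a] x) /
      ‖x - proj[A, a] x‖)) (pushMap A M ε a) x := by
  rcases eq_or_lt_of_le (norm_nonneg (x - proj[A, a] x)) with h0 | h0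
  · have hxa : x = proj[A, a] x := sub_eq_zero.1 (norm_eq_zero.1 h0.symm)
    have hev : ∀ᶠ y in 𝓝 x, proj[A, a] y ∈ Mᶜ :=
      continuous_planeProj.continuousAt.eventually_mem (hMc.isOpen_compl.mem_nhds (by rwa [← hxa]))
    have hid : (fun y => y) =ᶠ[𝓝 x] pushMap A M ε a := by
      filter_upwards [hev] with y hy
      exact (pushMap_eq_self (by rw [bumpRadius_of_notMem hy]; exact norm_nonneg _)).symm
    refine LipNear.mono (LipNear.congr ⟨univ, univ_mem, fun y _ z _ => ?_⟩ hid) (K := 1) ?_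
    · rw [one_mul]
    · linarith [le_max_left 1 (bumpRadius A (zeroSet A a) M ε (proj[A, a] x) /
        ‖x - proj[A, a] x‖)]
  · have h1 : ∀ y z, bumpRadius A (zeroSet A a) M ε (proj[A, a] y) -
        bumpRadius A (zeroSet A a) M ε (proj[A, a] z) ≤ dist y z := fun y z => by
      have e1 := bumpRadius_le_add (P := M) hA hM hε (fun f hf => planeProj_zero (A := A) (a :=
        a) hf y)
        (fun f hf => planeProj_zero (A := A) (a := a) hf z)
      have e2 := dist_planeProj_le (a := a) (W := zeroDir A a) (x := y) (y := z)
      nlinarith [dist_nonneg (x := proj[A, a] y) (y := proj[A, a] z)]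
    refine lipNear_dilate (fun y z => dist_planeProj_le) (fun y z => norm_sub_planeProj_sub_le)
      (t := fun y => bumpRadius A (zeroSet A a) M ε (proj[A, a] y))
      (fun y z => abs_le.2 ⟨?_, h1 y z⟩) h0
    have := h1 z y
    rw [dist_comm] at this
    linarith

/-- `Φ` pushes points away from the points of `M` whose zero sets belong to `S`; it is close to the
identity, preserves the cells of `A`, and its local Lipschitz constants are controlled by the
distances from `M`. -/
structure IsPush (A : Arrangement d) (M : Set ℝ^d)
    (S : Set (Arrangement d)) (η L c : ℝ) (Φ : ℝ^d → ℝ^d) : Prop where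
  nonneg : 0 ≤ L
  pos : 0 < c
  sameCell : ∀ x, SameCell A x (Φ x)
  lipNear : ∀ x, x ∉ M → LipNear (L * (infDist (Φ x) M / infDist x M)) Φ x
  le_dist : ∀ x, x ∉ M → ∀ m ∈ M, zeroSet A m ∈ S → c ≤ dist (Φ x) m
  dist_le : ∀ x, dist (Φ x) x ≤ η
  eq_self : ∀ x, η ≤ infDist x M → Φ x = x

/-- One more stratum can be pushed away, provided that the smaller strata have been treated. -/
theorem exists_isPush_insert (hA : IsLipArrangement A) (hM : Decides A M) (hMc : IsCompact M)
    (hMne : M.Nonempty) {S : Set (Arrangement d)}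
    (hS : ∀ Z' ∈ S, ¬ Z' ⊆ Z) (hZ : ∀ m ∈ M, Z ⊂ zeroSet A m → zeroSet A m ∈ S)
    (h : ∀ η : ℝ, 0 < η → ∃ L c Φ, IsPush A M S η L c Φ) {η : ℝ} (hη : 0 < η) :
    ∃ L c Φ, IsPush A M (insert Z S) η L c Φ := by
  by_cases hex : ∃ a ∈ M, zeroSet A a = Z
  swap
  · obtain ⟨L, c, Φ, hΦ⟩ := h η hη
    refine ⟨L, c, Φ, hΦ.nonneg, hΦ.pos, hΦ.sameCell, hΦ.lipNear, ?_, hΦ.dist_le, hΦ.eq_self⟩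
    rintro x hx m hm (hmZ | hmS)
    · exact absurd ⟨m, hm, hmZ⟩ hex
    · exact hΦ.le_dist x hx m hm hmS
  obtain ⟨a, haM, rfl⟩ := hex
  obtain ⟨L, c, Φ, hΦ⟩ := h (η / 2) (by positivity)
  set ε := min (1 / 2) (η / 2) with hεdef
  have hε : 0 < ε := lt_min (by norm_num) (by positivity)
  have hε1 : ε ≤ 1 / 2 := min_le_left _ _
  have hεη : ε ≤ η / 2 := min_le_right _ _
  set π := proj[A, a] with hπ
  have hdec : ∀ x, x ∉ M → Φ x ∉ M := fun x hx h => hx ((hM.iff (hΦ.sameCell x)).2 h)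
  have hpos : ∀ x, x ∉ M → 0 < infDist x M := fun x hx =>
    (hMc.isClosed.notMem_iff_infDist_pos hMne).1 hx
  -- distances from the stratum, as long as its points are away from smaller strata
  have hstratum : ∀ x, x ∉ M → ∀ m ∈ M, zeroSet A m = zeroSet A a →
      bumpRadius A (zeroSet A a) M ε m ≤ 2 * dist (pushMap A M ε a (Φ x)) m := by
    intro x hx m hm hmZ
    have hmF : ∀ f ∈ zeroSet A a, f m = 0 := fun f hf => (mem_zeroSet.1 (hmZ ▸ hf)).2
    have e1 := bumpRadius_le_add (P := M) hA hM hε.le hmF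
      fun f hf => planeProj_zero (A := A) hf (Φ x)
    have hmW : m - a ∈ zeroDir A a := sub_mem_zeroDir_iff.2 hmF
    have e2 := dist_planeProj_le_of_mem (x := pushMap A M ε a (Φ x)) hmW
    have e3 := norm_sub_planeProj_le (x := pushMap A M ε a (Φ x)) hmW
    rw [planeProj_pushMap] at e2 e3
    have e4 : bumpRadius A (zeroSet A a) M ε (π (Φ x)) ≤ ‖pushMap A M ε a (Φ x) - π (Φ x)‖ := by
      rcases le_or_gt (bumpRadius A (zeroSet A a) M ε (π (Φ x))) ‖Φ x - π (Φ x)‖ with h' | h'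
      · rwa [pushMap_eq_self h']
      · have hne : 0 < ‖Φ x - π (Φ x)‖ := by
          refine lt_of_le_of_ne (norm_nonneg _) fun h0 => hdec x hx ?_
          rw [sub_eq_zero.1 (norm_eq_zero.1 h0.symm)]
          exact (pushMap_of_lt hε h').1
        rw [pushMap, ← hπ, add_sub_cancel_left, norm_smul, norm_of_nonneg (by positivity),
          ← div_le_iff₀ hne]
        exact le_max_right _ _
    have e5 : ε * dist m (proj[A, a] (Φ x)) ≤ 1 * dist m (proj[A, a] (Φ x)) :=
      mul_le_mul_of_nonneg_right (by linarith) dist_nonneg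
    rw [dist_comm _ m] at e3 ⊢
    rw [hπ] at e4
    linarith
  have hsmall : ∀ x, x ∉ M → ∀ m ∈ M, zeroSet A m ∈ S → c / 3 ≤ dist (pushMap A M ε a (Φ x)) m := by
    intro x hx m hm hmS
    obtain ⟨f, hf, hfZ⟩ := Finset.not_subset.1 (hS _ hmS)
    obtain ⟨hfA, hfm⟩ := mem_zeroSet.1 hf
    have := dist_le_dist_pushMap (M := M) (x := Φ x) hA hε (by linarith) hfA hfZ hfm
    have := hΦ.le_dist x hx m hm hmS
    linarith
  obtain ⟨c', hc', hdist⟩ : ∃ c' > 0, ∀ m ∈ M, m ∈ M → (∀ f ∈ zeroSet A a, f m = 0) →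
      ∀ x, x ∉ M → c' ≤ dist (pushMap A M ε a (Φ x)) m := by
    refine hMc.induction_on (p := fun s => ∃ c' > 0, ∀ m ∈ s, m ∈ M →
      (∀ f ∈ zeroSet A a, f m = 0) → ∀ x, x ∉ M → c' ≤ dist (pushMap A M ε a (Φ x)) m)
      ⟨1, one_pos, by simp⟩ ?_ ?_ ?_
    · rintro s t hst ⟨c', hc', h'⟩
      exact ⟨c', hc', fun m hm => h' m (hst hm)⟩
    · rintro s t ⟨c₁, hc₁, h₁⟩ ⟨c₂, hc₂, h₂⟩
      refine ⟨min c₁ c₂, lt_min hc₁ hc₂, ?_⟩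
      rintro m (hm | hm) hmM hmf x hx
      · exact (min_le_left _ _).trans (h₁ m hm hmM hmf x hx)
      · exact (min_le_right _ _).trans (h₂ m hm hmM hmf x hx)
    · intro m hm
      by_cases hmf : ∀ f ∈ zeroSet A a, f m = 0
      swap
      · push Not at hmf
        obtain ⟨f, hf, hfm⟩ := hmf
        have hc : ContinuousAt f m := f.continuous_of_finiteDimensional.continuousAt
        exact ⟨_, mem_nhdsWithin_of_mem_nhds (hc.eventually_ne hfm), 1, one_pos,
          fun m' hm' _ hf' => absurd (hf' f hf) hm'⟩
      have hsub : zeroSet A a ⊆ zeroSet A m := fun f hf =>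
        mem_zeroSet.2 ⟨(mem_zeroSet.1 hf).1, hmf f hf⟩
      by_cases heq : zeroSet A m = zeroSet A a
      · obtain ⟨B, hB, hθ⟩ := bumpRadius_of_mem (A := A) (Z := zeroSet A a) (ε := ε) hm
        have hBlip : IsLipArrangement B := fun f hf => hA f ((hB f).1 hf).1
        have hg : 0 < gap B m := gap_pos_iff.2 fun f hf h0 =>
          ((hB f).1 hf).2 (heq ▸ mem_zeroSet.2 ⟨((hB f).1 hf).1, h0⟩)
        refine ⟨_, mem_nhdsWithin_of_mem_nhds ((continuous_gap hBlip).continuousAt.eventually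
          (lt_mem_nhds (half_lt_self hg))), ε * (gap B m / 2) / 2, by positivity, ?_⟩
        intro m' hm' hm'M hm'f x hx
        have hm' : gap B m / 2 < gap B m' := hm'
        have hm'Z : zeroSet A m' = zeroSet A a := by
          ext f
          refine ⟨fun hf => ?_, fun hf => mem_zeroSet.2 ⟨(mem_zeroSet.1 hf).1, hm'f f hf⟩⟩
          by_contra hfa
          obtain ⟨hfA, hf0⟩ := mem_zeroSet.1 hf
          exact gap_pos_iff.1 ((half_pos hg).trans hm') f ((hB f).2 ⟨hfA, hfa⟩) hf0
        have e := hstratum x hx m' hm'M hm'Z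
        obtain ⟨B', hB', hθ'⟩ := bumpRadius_of_mem (A := A) (Z := zeroSet A a) (ε := ε) hm'M
        obtain rfl : B' = B := by ext f; rw [hB', hB]
        rw [hθ'] at e
        nlinarith
      · have hmS := hZ m hm (lt_of_le_of_ne hsub (Ne.symm heq))
        refine ⟨_, mem_nhdsWithin_of_mem_nhds (ball_mem_nhds m (ε := c / 6)
          (by linarith [hΦ.pos])), c / 6, by linarith [hΦ.pos], fun m' hm' _ _ x hx => ?_⟩
        have e1 := hsmall x hx m hm hmS
        have e2 := dist_triangle_right (pushMap A M ε a (Φ x)) m m'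
        have e3 := mem_ball.1 hm'
        rw [dist_comm m' m] at e3
        linarith [dist_comm m m']
  refine ⟨6 * L, min (c / 3) c', fun x => pushMap A M ε a (Φ x), by linarith [hΦ.nonneg],
    lt_min (by linarith [hΦ.pos]) hc', fun x => (hΦ.sameCell x).trans
      (sameCell_pushMap hA hε (by linarith)), ?_, ?_, ?_, ?_⟩
  · intro x hx
    have h1 := hpos x hx
    have h2 := hpos _ (hdec x hx)
    refine ((lipNear_pushMap hA hM hMc.isClosed hε.le (by linarith) (hdec x hx)).comp
      (by positivity) (hΦ.lipNear x hx)).mono ?_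
    have h3 := mul_infDist_le_infDist_pushMap (a := a) (x := Φ x) hA hM hMne hε (by linarith)
      (le_max_left _ _) rfl
    set l := max 1 (bumpRadius A (zeroSet A a) M ε (proj[A, a] (Φ x)) /
      ‖Φ x - proj[A, a] (Φ x)‖)
    calc 6 * l * (L * (infDist (Φ x) M / infDist x M))
        = 6 * L * ((l * infDist (Φ x) M) / infDist x M) := by ring
      _ ≤ _ := by have := hΦ.nonneg; gcongr
  · rintro x hx m hm (hmZ | hmS)
    · exact (min_le_right _ _).trans (hdist m hm hm (fun f hf => (mem_zeroSet.1 (hmZ ▸ hf)).2) x hx)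
    · exact (min_le_left _ _).trans (hsmall x hx m hm hmS)
  · intro x
    have h1 := dist_triangle (pushMap A M ε a (Φ x)) (Φ x) x
    have h2 := dist_pushMap_le_bumpRadius (A := A) (M := M) (x := Φ x) (a := a) hε.le
    have h3 := bumpRadius_le (A := A) (Z := zeroSet A a) (P := M) (x := π (Φ x)) hε.le
    linarith [hΦ.dist_le x]
  · intro x hx
    have hx' : Φ x = x := hΦ.eq_self x (by linarith)
    rw [hx']
    refine pushMap_eq_self ?_
    by_contra hlt
    push Not at hlt
    have h1 := infDist_le_dist_of_mem (x := x) (pushMap_of_lt hε hlt).1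
    rw [dist_eq_norm] at h1
    have h2 := bumpRadius_le (A := A) (Z := zeroSet A a) (P := M) (x := π x) hε.le
    linarith

theorem IsPush.mono {S S' : Set (Arrangement d)} {η L c : ℝ}
    {Φ : ℝ^d → ℝ^d} (h : IsPush A M S η L c Φ)
    (hS : ∀ m ∈ M, zeroSet A m ∈ S' → zeroSet A m ∈ S) : IsPush A M S' η L c Φ :=
  ⟨h.nonneg, h.pos, h.sameCell, h.lipNear, fun x hx m hm hmS => h.le_dist x hx m hm (hS m hm hmS),
    h.dist_le, h.eq_self⟩

/-- All strata of `M` can be pushed away, the smallest ones first. -/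
theorem exists_isPush (hA : IsLipArrangement A) (hM : Decides A M) (hMc : IsCompact M)
    (hMne : M.Nonempty) {η : ℝ} (hη : 0 < η) : ∃ L c Φ, IsPush A M univ η L c Φ := by
  classical
  have hmain : ∀ Q : Finset (Arrangement d),
      (∀ Z ∈ Q, ∀ m ∈ M, Z ⊂ zeroSet A m → zeroSet A m ∈ Q) →
        ∀ η : ℝ, 0 < η → ∃ L c Φ, IsPush A M (Q : Set (Arrangement d)) η L c Φ := by
    refine fun Q => Finset.induction_on_min_value Finset.card Q ?_ ?_
    · intro _ η hη
      refine ⟨1, 1, fun x => x, zero_le_one, one_pos, SameCell.refl, fun x hx => ?_,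
        fun x _ m _ hm => absurd hm (by simp), fun x => by rw [dist_self]; exact hη.le,
        fun x _ => rfl⟩
      rw [one_mul, div_self ((hMc.isClosed.notMem_iff_infDist_pos hMne).1 hx).ne']
      exact ⟨univ, univ_mem, fun y _ z _ => by rw [one_mul]⟩
    · intro Z Q hZ hmin ih hQ η hη
      rw [Finset.coe_insert]
      refine exists_isPush_insert hA hM hMc hMne
        (fun Z' hZ' hsub => hZ (Finset.eq_of_subset_of_card_le hsub (hmin Z' hZ') ▸ hZ'))
        (fun m hm hlt => ?_) (ih fun Z' hZ' m hm hlt => ?_) hη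
      · exact Finset.mem_of_mem_insert_of_ne (hQ Z (Finset.mem_insert_self Z Q) m hm hlt) hlt.ne'
      · refine Finset.mem_of_mem_insert_of_ne
          (hQ Z' (Finset.mem_insert_of_mem hZ') m hm hlt) fun e => ?_
        exact ((hmin Z' hZ').trans_lt (Finset.card_lt_card hlt)).ne (by rw [e])
  have hmem : ∀ m, zeroSet A m ∈ A.powerset := fun m =>
    Finset.mem_powerset.2 fun f hf => (mem_zeroSet.1 hf).1
  obtain ⟨L, c, Φ, hΦ⟩ := hmain A.powerset (fun _ _ m _ _ => hmem m) η hη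
  exact ⟨L, c, Φ, hΦ.mono fun m _ _ => hmem m⟩

theorem IsPush.le_infDist {η L c : ℝ} {Φ : ℝ^d → ℝ^d}
    (h : IsPush A M univ η L c Φ) (hMne : M.Nonempty) (hx : x ∉ M) :
    c ≤ infDist (Φ x) M :=
  (Metric.le_infDist hMne).2 fun m hm => h.le_dist x hx m hm (mem_univ _)

end PushIteration

/-! ### Gluing locally Lipschitz maps -/

section Gluing

/-- Two locally Lipschitz maps that agree on a level set of a continuous function can be glued along
it without increasing the Lipschitz constant. -/
theorem LipNear.ite {E Y : Type*} [NormedAddCommGroup E] [NormedSpace ℝ E] [PseudoMetricSpace Y]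
    {F G : E → Y} {h : E → ℝ} {K c : ℝ} {x : E} (hh : ∀ᶠ y in 𝓝 x, ContinuousAt h y)
    (hF : c ≤ h x → LipNear K F x) (hG : h x ≤ c → LipNear K G x)
    (he : ∀ᶠ y in 𝓝 x, h y = c → F y = G y) :
    LipNear K (fun y => if c ≤ h y then F y else G y) x := by
  rcases lt_trichotomy (h x) c with hlt | heq | hlt
  · refine (hG hlt.le).congr ?_
    filter_upwards [hh.self_of_nhds.eventually (gt_mem_nhds hlt)] with y hy
    exact (if_neg (not_le.2 hy)).symm
  · obtain ⟨V, hV, hVF⟩ := hF heq.ge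
    obtain ⟨W, hW, hWG⟩ := hG heq.le
    obtain ⟨r, hr, hball⟩ := Metric.mem_nhds_iff.1 (inter_mem (inter_mem hV hW) (inter_mem hh he))
    have hcross : ∀ y ∈ ball x r, ∀ z ∈ ball x r, c ≤ h y → h z ≤ c →
        dist (F y) (G z) ≤ K * dist y z := by
      intro y hy z hz hyc hzc
      have hseg : segment ℝ z y ⊆ ball x r := (convex_ball x r).segment_subset hz hy
      have hcont : ContinuousOn h (segment ℝ z y) := fun w hw =>
        (hball (hseg hw)).2.1.continuousWithinAt
      obtain ⟨w, hw, hwc⟩ := (convex_segment z y).isPreconnected.intermediate_value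
        (left_mem_segment ℝ z y) (right_mem_segment ℝ z y) hcont ⟨hzc, hyc⟩
      have e := (hball (hseg hw)).2.2 hwc
      have h1 := hVF y (hball hy).1.1 w (hball (hseg hw)).1.1
      have h2 := hWG w (hball (hseg hw)).1.2 z (hball hz).1.2
      rw [segment_symm] at hw
      have h3 := dist_add_dist_of_mem_segment hw
      calc dist (F y) (G z) ≤ dist (F y) (F w) + dist (F w) (G z) := dist_triangle _ _ _
        _ ≤ K * dist y w + K * dist w z := by rw [e] at *; exact add_le_add h1 h2
        _ = _ := by rw [← mul_add, h3]
    refine ⟨ball x r, ball_mem_nhds x hr, fun y hy z hz => ?_⟩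
    dsimp only
    split_ifs with hy1 hz1 hz1
    · exact hVF y (hball hy).1.1 z (hball hz).1.1
    · exact hcross y hy z hz hy1 (not_le.1 hz1).le
    · rw [dist_comm, dist_comm y]
      exact hcross z hz y hy hz1 (not_le.1 hy1).le
    · exact hWG y (hball hy).1.2 z (hball hz).1.2
  · refine (hF hlt.le).congr ?_
    filter_upwards [hh.self_of_nhds.eventually (lt_mem_nhds hlt)] with y hy
    exact (if_pos (le_of_lt hy)).symm

theorem LipNear.interpolate {X E : Type*} [PseudoMetricSpace X] [NormedAddCommGroup E]
    [NormedSpace ℝ E] {F : X → E} {s : X → ℝ} {c : E} {K K' R : ℝ} {x : X}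
    (hK' : 0 ≤ K') (hF : LipNear K F x) (hs : LipNear K' s x) (h01 : ∀ y, s y ∈ Icc (0 : ℝ) 1)
    (hR : dist (F x) c < R) : LipNear (K + K' * R) (fun y => (1 - s y) • F y + s y • c) x := by
  have hev := (hF.continuousAt.dist continuousAt_const).eventually (gt_mem_nhds hR)
  obtain ⟨V, hV, hVF⟩ := hF
  obtain ⟨W, hW, hWs⟩ := hs
  refine ⟨_, inter_mem (inter_mem hV hW) hev, fun y hy z hz => ?_⟩
  have h1 := hVF y hy.1.1 z hz.1.1
  have h2 := hWs y hy.1.2 z hz.1.2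
  have h3 : dist (F z) c < R := hz.2
  rw [dist_eq_norm] at h1 h3
  rw [Real.dist_eq, abs_sub_comm] at h2
  have e : ((1 - s y) • F y + s y • c) - ((1 - s z) • F z + s z • c) =
      (1 - s y) • (F y - F z) + (s z - s y) • (F z - c) := by module
  rw [dist_eq_norm, e]
  refine (norm_add_le _ _).trans ?_
  rw [norm_smul, norm_smul, norm_eq_abs, norm_eq_abs,
    abs_of_nonneg (sub_nonneg.2 (h01 y).2), add_mul, mul_right_comm]
  refine add_le_add ?_ (mul_le_mul h2 h3.le (norm_nonneg _) (by positivity))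
  exact (mul_le_of_le_one_left (norm_nonneg _) (by linarith [(h01 y).1])).trans h1

end Gluing

/-! ### Inserting bubbles along a simplex -/

section Insertion

variable {d q : ℕ}

/-- The functions in `A` that vanish on the plane of `T`. -/
noncomputable def planeFunctions (A : Arrangement d) (T : OrientedSimplex q d) : Arrangement d :=
  open Classical in A.filter fun f => ∀ i, f (T.points i) = 0

/-- The projection to the plane of `T`. -/
noncomputable abbrev OrientedSimplex.proj (T : OrientedSimplex q d) (x : ℝ^d) :
    ℝ^d := planeProj (T.points 0) T.dir x

/-- The radius at `x` of the lens-shaped neighbourhood of `T` in which bubbles are inserted. -/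
noncomputable def lensRadius (A : Arrangement d) (T : OrientedSimplex q d) (ε : ℝ) (x : ℝ^d) : ℝ :=
  bumpRadius A (planeFunctions A T) T.carrier ε (T.proj x)

/-- The normal component of `x` with respect to `T`, rescaled so that the lens has radius `3`. -/
noncomputable def lensVec (A : Arrangement d) (T : OrientedSimplex q d) (ε : ℝ) (x : ℝ^d) : ℝ^d :=
  (3 / lensRadius A T ε x) • (x - T.proj x)

/-- The time of the slide of `Φ x` at `x`. -/
noncomputable def slideTime (A : Arrangement d) (T : OrientedSimplex q d) (ε : ℝ) (x : ℝ^d) : ℝ :=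
  clampI (3 - ‖lensVec A T ε x‖)

open Classical in
/-- The map `u` with a bubble `f` inserted along the simplex `T`. Away from `T`, this is `u ∘ Φ`. In
the normal planes of `T`, from the outside to the inside of the lens, the point `Φ x` first slides
to the point `c` chosen in the cell of the projection of `x`, then the value moves from `u c` to the
base point along the path `γ c`, and then `f` is inserted. -/
noncomputable def insertMap {k m : ℕ} {N : Set ℝ^m} (A : Arrangement d) (T : OrientedSimplex q d)
    (ε : ℝ) (Φ : ℝ^d → ℝ^d) (u : ℝ^d → N) (γ : ℝ^d → ℝ → N) (f : ℝ^k → N) (R : ℝ^d →L[ℝ] ℝ^k)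
    (x : ℝ^d) : N :=
  if lensRadius A T ε x = 0 then u (Φ x) else
    if 2 ≤ ‖lensVec A T ε x‖ then
      u ((1 - slideTime A T ε x) • Φ x + slideTime A T ε x • cellPoint A (T.proj x))
    else if 1 ≤ ‖lensVec A T ε x‖ then γ (cellPoint A (T.proj x)) ‖lensVec A T ε x‖
    else f (R (lensVec A T ε x))

variable {A : Arrangement d} {T : OrientedSimplex q d} {ε : ℝ} {x y z : ℝ^d}

theorem mem_planeFunctions {f : ℝ^d →ᵃ[ℝ] ℝ} :
    f ∈ planeFunctions A T ↔ f ∈ A ∧ ∀ i, f (T.points i) = 0 := by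
  unfold planeFunctions
  exact @mem_filter _ _ (_) _ _

theorem OrientedSimplex.proj_sub_mem : T.proj x - T.points 0 ∈ T.dir := planeProj_sub_mem

theorem apply_eq_zero_of_mem_planeFunctions {f : ℝ^d →ᵃ[ℝ] ℝ}
    (hf : f ∈ planeFunctions A T) (hx : x - T.points 0 ∈ T.dir) : f x = 0 := by
  obtain ⟨h1, h2⟩ := T.eq_sum_coord hx
  rw [h2, affineMap_sum f h1]
  exact sum_eq_zero fun i _ => by rw [(mem_planeFunctions.1 hf).2 i, mul_zero]

theorem linear_eq_zero_of_mem_planeFunctions {f : ℝ^d →ᵃ[ℝ] ℝ}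
    (hf : f ∈ planeFunctions A T) {v : ℝ^d} (hv : v ∈ T.dir) :
    f.linear v = 0 := by
  have h := affineMap_sub f (T.points 0) (T.points 0 + v)
  rwa [add_sub_cancel_left, apply_eq_zero_of_mem_planeFunctions hf (by rwa [add_sub_cancel_left]),
    apply_eq_zero_of_mem_planeFunctions hf (by rw [sub_self]; exact T.dir.zero_mem), sub_zero] at h

theorem lensRadius_nonneg (hε : 0 ≤ ε) : 0 ≤ lensRadius A T ε x := bumpRadius_nonneg hε

theorem lensRadius_pos_iff (hε : 0 < ε) : 0 < lensRadius A T ε x ↔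
    T.proj x ∈ T.carrier ∧ T.proj x ∉ cutSet A T := by
  rw [lensRadius, bumpRadius_pos_iff hε]
  refine and_congr_right fun h => ⟨fun h1 h2 => ?_, fun h1 f hf hfZ h0 => h1 ⟨h, f, hf, ?_, h0⟩⟩
  · obtain ⟨-, f, hf, ⟨i, hi⟩, h0⟩ := h2
    exact h1 f hf (fun h => hi ((mem_planeFunctions.1 h).2 i)) h0
  · by_contra hall
    push Not at hall
    exact hfZ (mem_planeFunctions.2 ⟨hf, hall⟩)

theorem abs_lensRadius_sub_le (hA : IsLipArrangement A) (hT : Decides A T.carrier) (hε : 0 ≤ ε)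
    (hε1 : ε ≤ 1) (x y : ℝ^d) :
    |lensRadius A T ε x - lensRadius A T ε y| ≤ dist x y := by
  have h : ∀ x y, lensRadius A T ε x ≤ lensRadius A T ε y + dist x y := fun x y => by
    refine (bumpRadius_le_add hA hT hε
      (fun f hf => apply_eq_zero_of_mem_planeFunctions hf OrientedSimplex.proj_sub_mem)
      (fun f hf => apply_eq_zero_of_mem_planeFunctions hf OrientedSimplex.proj_sub_mem)).trans
      (add_le_add_right ?_ _)
    exact (mul_le_of_le_one_left dist_nonneg hε1).trans dist_planeProj_le
  rw [abs_le]
  exact ⟨by linarith [h y x, dist_comm x y], by linarith [h x y]⟩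

theorem continuous_lensRadius (hA : IsLipArrangement A) (hT : Decides A T.carrier) (hε : 0 ≤ ε)
    (hε1 : ε ≤ 1) : Continuous (lensRadius A T ε) :=
  (LipschitzWith.of_dist_le_mul (K := 1) fun x y => by
    rw [NNReal.coe_one, one_mul]; exact abs_lensRadius_sub_le hA hT hε hε1 x y).continuous

theorem norm_lensVec (hε : 0 ≤ ε) :
    ‖lensVec A T ε x‖ = 3 * ‖x - T.proj x‖ / lensRadius A T ε x := by
  rw [lensVec, norm_smul, norm_eq_abs, abs_of_nonneg
    (div_nonneg zero_le_three (lensRadius_nonneg hε)), div_mul_eq_mul_div]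

theorem lensVec_mem : lensVec A T ε x ∈ T.dirᗮ := smul_mem _ _ sub_planeProj_mem

/-- In the lens, the rescaled normal component is Lipschitz. -/
theorem lipNear_lensVec (hA : IsLipArrangement A) (hT : Decides A T.carrier) (hε : 0 ≤ ε)
    (hε1 : ε ≤ 1) (h0 : 0 < lensRadius A T ε x) (hx : ‖x - T.proj x‖ ≤ lensRadius A T ε x) :
    LipNear (30 / lensRadius A T ε x) (lensVec A T ε) x := by
  set θ := lensRadius A T ε x with hθ
  have hc := continuous_lensRadius hA hT hε hε1
  have hv : Continuous fun y => ‖y - T.proj y‖ := (continuous_id.sub continuous_planeProj).norm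
  refine ⟨_, inter_mem (hc.continuousAt.eventually (lt_mem_nhds (half_lt_self h0)))
    (hv.continuousAt.eventually (gt_mem_nhds (show ‖x - T.proj x‖ < 2 * θ by linarith))), ?_⟩
  rintro y ⟨hy1, hy2⟩ z ⟨hz1, hz2⟩
  have hy1 : θ / 2 < lensRadius A T ε y := hy1
  have hy2 : ‖y - T.proj y‖ < 2 * θ := hy2
  have hz1 : θ / 2 < lensRadius A T ε z := hz1
  have h1 := abs_lensRadius_sub_le hA hT hε hε1 z y
  have h2 := norm_sub_planeProj_sub_le (a := T.points 0) (W := T.dir) (x := y) (y := z)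
  rw [dist_comm] at h1
  have e : lensVec A T ε y - lensVec A T ε z = (3 * (lensRadius A T ε z - lensRadius A T ε y) /
        (lensRadius A T ε y * lensRadius A T ε z)) • (y - T.proj y) +
      (3 / lensRadius A T ε z) • ((y - T.proj y) - (z - T.proj z)) := by
    have e1 : 3 * (lensRadius A T ε z - lensRadius A T ε y) /
        (lensRadius A T ε y * lensRadius A T ε z) =
        3 / lensRadius A T ε y - 3 / lensRadius A T ε z := by
      have := (half_pos h0).trans hy1
      have := (half_pos h0).trans hz1
      field_simp
    rw [e1, lensVec, lensVec]
    module
  generalize lensRadius A T ε y = s at *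
  generalize lensRadius A T ε z = t at *
  have hs : 0 < s := (half_pos h0).trans hy1
  have ht : 0 < t := (half_pos h0).trans hz1
  rw [dist_eq_norm, e]
  refine (norm_add_le _ _).trans ?_
  rw [norm_smul, norm_smul, norm_eq_abs, norm_eq_abs, abs_div, abs_mul,
    abs_of_pos (by positivity : (0 : ℝ) < 3), abs_of_pos (mul_pos hs ht),
    abs_of_pos (div_pos zero_lt_three ht)]
  have h3 : 3 * |t - s| / (s * t) * ‖y - T.proj y‖ ≤
      3 * dist y z / (θ / 2 * (θ / 2)) * (2 * θ) := by gcongr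
  have h4 : 3 / t * ‖(y - T.proj y) - (z - T.proj z)‖ ≤ 3 / (θ / 2) * dist y z := by gcongr
  refine (add_le_add h3 h4).trans (le_of_eq ?_)
  field_simp
  ring

section Values

variable {k m : ℕ} {N : Set ℝ^m} {Φ : ℝ^d → ℝ^d} {u : ℝ^d → N} {γ : ℝ^d → ℝ → N} {f : ℝ^k → N}
  {R : ℝ^d →L[ℝ] ℝ^k}

theorem insertMap_of_le (hε : 0 ≤ ε) (h : lensRadius A T ε x ≤ ‖x - T.proj x‖) :
    insertMap A T ε Φ u γ f R x = u (Φ x) := by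
  by_cases h0 : lensRadius A T ε x = 0
  · rw [insertMap, if_pos h0]
  · have h1 : 3 ≤ ‖lensVec A T ε x‖ := by
      rw [norm_lensVec hε, le_div_iff₀ (lt_of_le_of_ne (lensRadius_nonneg hε) (Ne.symm h0))]
      linarith
    rw [insertMap, if_neg h0, if_pos (by linarith), slideTime,
      clampI_of_le (by linarith), Icc.coe_zero, sub_zero, one_smul, zero_smul, add_zero]

end Values

/-- On a simplex, a non-negative affine function is bounded below by the distance from its zeros. -/
theorem OrientedSimplex.exists_infDist_le (T : OrientedSimplex q d) (f : ℝ^d →ᵃ[ℝ] ℝ) {M : Set ℝ^d}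
    (hM : ∀ z ∈ T.carrier, f z = 0 → z ∈ M) :
    ∃ C ≥ 0, ∀ z ∈ T.carrier, 0 ≤ f z → infDist z M ≤ C * f z := by
  obtain ⟨κ, hκ, hκ0⟩ : ∃ κ : ℝ, (∀ i, 0 < f (T.points i) → κ ≤ f (T.points i)) ∧ 0 < κ := by
    refine ((eventually_all.2 fun i => ?_).and self_mem_nhdsWithin).exists (f := 𝓝[>] (0 : ℝ))
    by_cases h : 0 < f (T.points i)
    · filter_upwards [mem_nhdsWithin_of_mem_nhds (gt_mem_nhds h)] with κ hκ _ using le_of_lt hκ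
    · exact Eventually.of_forall fun κ h' => absurd h' h
  have hconv : Convex ℝ T.carrier := convex_convexHull ℝ _
  set Q := diam T.carrier
  have hQ : ∀ y ∈ T.carrier, ∀ z ∈ T.carrier, dist y z ≤ Q := fun y hy z hz =>
    dist_le_diam_of_mem T.isCompact_carrier.isBounded hy hz
  have hQ0 : 0 ≤ Q := diam_nonneg
  by_cases hneg : ∃ j, f (T.points j) < 0
  · -- the segment from `z` to a vertex with a negative value contains a zero
    obtain ⟨j, hj⟩ := hneg
    have hTj := T.points_mem_carrier j
    refine ⟨Q / -f (T.points j), div_nonneg hQ0 (by linarith), fun z hz hfz => ?_⟩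
    have hpos : 0 < f z - f (T.points j) := by linarith
    set t := f z / (f z - f (T.points j)) with ht
    have ht0 : 0 ≤ t := div_nonneg hfz hpos.le
    have ht1 : t ≤ 1 := div_le_one_of_le₀ (by linarith) hpos.le
    have hy := hM _ (hconv hz hTj (by linarith) ht0 (by ring : 1 - t + t = 1)) (by
      rw [affineMap_segment, ht]
      field_simp
      ring)
    refine (infDist_le_dist_of_mem hy).trans ?_
    have e : z - ((1 - t) • z + t • T.points j) = t • (z - T.points j) := by module
    rw [dist_eq_norm, e, norm_smul, norm_of_nonneg ht0, ← dist_eq_norm, div_mul_eq_mul_div Q,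
      mul_comm Q, mul_div_right_comm]
    exact mul_le_mul (div_le_div_of_nonneg_left hfz (by linarith) (by linarith)) (hQ _ hz _ hTj)
      dist_nonneg (div_nonneg hfz (by linarith))
  push Not at hneg
  by_cases hj : ∃ j, f (T.points j) = 0
  · -- the mass of the vertices with positive values moves to a vertex where `f` vanishes
    obtain ⟨j, hj⟩ := hj
    refine ⟨Q / κ, by positivity, fun z hz _ => ?_⟩
    obtain ⟨w, hw0, hw1, rfl⟩ := T.mem_carrier_iff.1 hz
    have hp : ∀ i, ∃ y ∈ T.carrier, f y = 0 ∧ dist (T.points i) y ≤ Q / κ * f (T.points i) := by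
      intro i
      rcases (hneg i).eq_or_lt with h | h
      · exact ⟨_, T.points_mem_carrier i, h.symm, by rw [dist_self, ← h, mul_zero]⟩
      · refine ⟨_, T.points_mem_carrier j, hj, ?_⟩
        rw [div_mul_eq_mul_div, le_div_iff₀ hκ0]
        exact mul_le_mul (hQ _ (T.points_mem_carrier i) _ (T.points_mem_carrier j)) (hκ i h)
          hκ0.le hQ0
    choose y hy hy0 hyd using hp
    refine (infDist_le_dist_of_mem (hM (∑ i, w i • y i)
      (hconv.sum_mem (fun i _ => hw0 i) hw1 fun i _ => hy i) ?_)).trans ?_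
    · rw [affineMap_sum f hw1, sum_eq_zero fun i _ => by rw [hy0, mul_zero]]
    · rw [affineMap_sum f hw1, Finset.mul_sum]
      refine (dist_sum_sum_le _ _ _).trans (sum_le_sum fun i _ => ?_)
      rw [dist_smul₀, norm_of_nonneg (hw0 i), mul_left_comm]
      exact mul_le_mul_of_nonneg_left (hyd i) (hw0 i)
  · obtain ⟨Q', hQ'⟩ := T.isCompact_carrier.bddAbove_image (continuous_infDist_pt M).continuousOn
    have hQ' : ∀ z ∈ T.carrier, infDist z M ≤ Q' := fun z hz => hQ' (mem_image_of_mem _ hz)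
    have hQ'0 := infDist_nonneg.trans (hQ' _ (T.points_mem_carrier 0))
    refine ⟨Q' / κ, by positivity, fun z hz _ => ?_⟩
    obtain ⟨w, hw0, hw1, rfl⟩ := T.mem_carrier_iff.1 hz
    rw [div_mul_eq_mul_div, le_div_iff₀ hκ0]
    refine mul_le_mul (hQ' _ hz) ?_ hκ0.le hQ'0
    rw [affineMap_sum f hw1, ← one_mul κ, ← hw1, sum_mul]
    exact sum_le_sum fun i _ => mul_le_mul_of_nonneg_left
      (hκ i ((hneg i).lt_of_ne' fun h => hj ⟨i, h⟩)) (hw0 i)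

/-- On the simplex, the lens radius controls the distance from the set where it vanishes. -/
theorem exists_infDist_le_lensRadius (hε : 0 < ε) {M : Set ℝ^d} (hcut : cutSet A T ⊆ M) :
    ∃ C ≥ 0, ∀ z ∈ T.carrier, infDist z M ≤ C * lensRadius A T ε z := by
  obtain ⟨Q, hQ⟩ := (T.isCompact_carrier.bddAbove_image (continuous_infDist_pt M).continuousOn)
  have hQ : ∀ z ∈ T.carrier, infDist z M ≤ Q := fun z hz => hQ (mem_image_of_mem _ hz)
  have hQ0 : 0 ≤ Q := infDist_nonneg.trans (hQ _ (T.points_mem_carrier 0))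
  have hf : ∀ f ∈ A, f ∉ planeFunctions A T →
      ∃ C ≥ 0, ∀ z ∈ T.carrier, infDist z M ≤ C * |f z| := by
    intro f hfA hfZ
    have hi : ∃ i, f (T.points i) ≠ 0 := by
      by_contra h
      push Not at h
      exact hfZ (mem_planeFunctions.2 ⟨hfA, h⟩)
    have hM : ∀ z ∈ T.carrier, f z = 0 → z ∈ M := fun z hz h0 => hcut ⟨hz, f, hfA, hi, h0⟩
    obtain ⟨C, hC, h⟩ := T.exists_infDist_le f hM
    obtain ⟨C', hC', h'⟩ := T.exists_infDist_le (-f) fun z hz h0 => hM z hz (neg_eq_zero.1 h0)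
    refine ⟨C + C', by positivity, fun z hz => ?_⟩
    rw [add_mul]
    rcases le_total 0 (f z) with h0 | h0
    · rw [abs_of_nonneg h0]
      linarith [h z hz h0, mul_nonneg hC' h0]
    · rw [abs_of_nonpos h0]
      have e : (-f) z = -f z := rfl
      have := h' z hz (by rw [e]; linarith)
      rw [e] at this
      linarith [mul_nonneg hC (neg_nonneg.2 h0)]
  choose! Cf hCf0 hCf using hf
  classical
  set B := A.filter fun f => f ∉ planeFunctions A T with hB
  have hBm : ∀ f ∈ B, f ∈ A ∧ f ∉ planeFunctions A T := fun f hf => mem_filter.1 hf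
  set C := 1 + Q + ∑ f ∈ B, Cf f with hC
  have hsum : 0 ≤ ∑ f ∈ B, Cf f := sum_nonneg fun f hf => hCf0 f (hBm f hf).1 (hBm f hf).2
  have hC0 : 0 < C := by linarith
  refine ⟨C / ε, by positivity, fun z hz => ?_⟩
  have hproj : T.proj z = z := planeProj_eq_self (T.sub_mem_dir hz 0)
  obtain ⟨B', hB', h⟩ := bumpRadius_of_mem (A := A) (Z := planeFunctions A T) (ε := ε) hz
  obtain rfl : B' = B := by ext f; rw [hB', hB, mem_filter]
  rw [lensRadius, hproj, h, ← mul_assoc, div_mul_cancel₀ _ hε.ne', ← div_le_iff₀' hC0, le_gap_iff]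
  refine ⟨(div_le_one hC0).2 (by linarith [hQ z hz]), fun f hf => ?_⟩
  rw [div_le_iff₀' hC0]
  have h1 := single_le_sum (f := Cf) (fun f hf => hCf0 f (hBm f hf).1 (hBm f hf).2) hf
  exact (hCf f (hBm f hf).1 (hBm f hf).2 z hz).trans
    (mul_le_mul_of_nonneg_right (by linarith) (abs_nonneg _))

end Insertion

/-! ### The gradient of the new map -/

section InsertionEstimates

variable {n k m : ℕ}

/-- The geometric setting in which a bubble is inserted along `T` into a map with a nice singularity
at `Sig`: the arrangement `A` describes both `Sig` and `T`, and `Φ` pushes points away from the new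
singular set. -/
structure IsInsertionSetting (D Sig : Set ℝ^(n + k))
    (T : OrientedSimplex (n + 1) (n + k)) (A : Arrangement (n + k))
    (ε η L c : ℝ) (Φ : ℝ^(n + k) → ℝ^(n + k)) :
    Prop where
  adapted : IsAdapted A n Sig
  polyhedral : IsPolyhedralSet n Sig
  polyhedral_union : IsPolyhedralSet n (Sig ∪ cutSet A T)
  decides : Decides A T.carrier
  zeroDir_le : ∀ x ∈ T.carrier, zeroDir A x ≤ T.dir
  coord_mem : ∀ i, lipNormalize (T.coord i) ∈ A
  eps_pos : 0 < ε
  eps_le : ε ≤ 1 / 4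
  eta_pos : 0 < η
  push : IsPush A (Sig ∪ cutSet A T) univ η L c Φ
  ball_subset : ∀ z ∈ Sig ∪ T.carrier, ball z (2 * (η + ε)) ⊆ D

/-- The bubble `f`, which has the value `p` far away from the axis, and the paths `γ c` that connect
the value of `u` at `c` to `p`. -/
structure IsBubble [k.AtLeastTwo] {N : Set ℝ^m}
    (A : Arrangement (n + k)) (T : OrientedSimplex (n + 1) (n + k)) (u : ℝ^(n + k) → N) (p : N)
    (γ : ℝ^(n + k) → ℝ → N) (f : ℝ^k → N) (R : ℝ^(n + k) →L[ℝ] ℝ^k) (K : ℝ) : Prop where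
  nonneg : 0 ≤ K
  lip_path : ∀ x t, LipNear K (γ (cellPoint A x)) t
  path_left : ∀ c, ∀ t ≤ 1, γ c t = p
  path_right : ∀ c t, 2 ≤ t → γ c t = u c
  lip_bubble : ∀ ζ, LipNear K f ζ
  bubble_eq : ∀ ζ, 1 ≤ ‖tailVec ζ‖ → f ζ = p
  norm_le : ∀ v, ‖R v‖ ≤ ‖v‖
  norm_tail : ∀ v ∈ T.dirᗮ, ‖tailVec (R v)‖ = ‖v‖

/-- Segments that start away from `M ⊇ S` and end at one of finitely many points `a` in convex
components `C` of the complement of a union of hyperplanes containing `S` keep a positive distance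
from `S`, provided that they start in the closures of these components. -/
theorem exists_le_infDist_segment {d : ℕ} {A Z : Arrangement d}
    {M S C₀ : Set ℝ^d} (hC₀ : C₀.Finite) (hS : IsClosed S) (hSne : S.Nonempty) (hSM : S ⊆ M)
    (hnot : ∀ y, (∀ f ∈ A, f ∉ Z → f y ≠ 0) → y ∉ S) {c : ℝ} (hc : 0 < c) (r : ℝ) :
    ∃ c₁ > 0, ∀ a ∈ C₀, (∀ f ∈ A, f ∉ Z → f a ≠ 0) → ∀ y ∈ closedBall 0 r,
      c ≤ infDist y M → (∀ f ∈ A, f ∉ Z → 0 ≤ f y * f a) →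
        ∀ t ∈ Icc (0 : ℝ) 1, c₁ ≤ infDist ((1 - t) • y + t • a) S := by
  have hcf : ∀ f : ℝ^d →ᵃ[ℝ] ℝ, Continuous f := fun f =>
    f.continuous_of_finiteDimensional
  have hone : ∀ a ∈ C₀, ∃ c₁ > 0, (∀ f ∈ A, f ∉ Z → f a ≠ 0) → ∀ y ∈ closedBall 0 r,
      c ≤ infDist y M → (∀ f ∈ A, f ∉ Z → 0 ≤ f y * f a) →
        ∀ t ∈ Icc (0 : ℝ) 1, c₁ ≤ infDist ((1 - t) • y + t • a) S := by
    intro a _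
    by_cases ha : ∀ f ∈ A, f ∉ Z → f a ≠ 0
    swap
    · exact ⟨1, one_pos, fun h => absurd h ha⟩
    have hF1 : IsClosed {y | c ≤ infDist y M} :=
      isClosed_le continuous_const (continuous_infDist_pt M)
    have hF2 : IsClosed (⋂ f ∈ A, ⋂ (_ : f ∉ Z), {y | 0 ≤ f y * f a}) :=
      isClosed_biInter fun f _ => isClosed_iInter fun _ =>
        isClosed_le continuous_const ((hcf f).mul continuous_const)
    have hK := (isCompact_Icc (a := (0 : ℝ)) (b := 1)).prod
      (((isCompact_closedBall (0 : ℝ^d) r).inter_right hF1).inter_right hF2)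
    have hcont : Continuous fun q : ℝ × ℝ^d =>
        infDist ((1 - q.1) • q.2 + q.1 • a) S :=
      (continuous_infDist_pt S).comp (by fun_prop)
    obtain ⟨c₁, hc₁, hle⟩ := hK.exists_forall_le' (a := 0) hcont.continuousOn (by
      rintro ⟨t, y⟩ ⟨ht, ⟨-, hy⟩, hs⟩
      refine (hS.notMem_iff_infDist_pos hSne).1 ?_
      dsimp only at ht hy hs ⊢
      rcases eq_or_lt_of_le ht.1 with h0 | h0
      · rw [← h0, sub_zero, one_smul, zero_smul, add_zero]
        intro hyS
        have := infDist_zero_of_mem (hSM hyS)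
        linarith [show c ≤ infDist y M from hy]
      · refine hnot _ fun f hf hfZ => ?_
        rw [affineMap_segment]
        intro h1
        have h2 : 0 ≤ f y * f a := mem_iInter.1 (mem_iInter₂.1 hs f hf) hfZ
        have h3 : 0 < f a * f a := mul_self_pos.2 (ha f hf hfZ)
        have h4 := mul_nonneg (sub_nonneg.2 ht.2) h2
        have h5 := mul_pos h0 h3
        have h6 : ((1 - t) * f y + t * f a) * f a = 0 := by rw [h1, zero_mul]
        linarith [show ((1 - t) * f y + t * f a) * f a =
          (1 - t) * (f y * f a) + t * (f a * f a) by ring])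
    exact ⟨c₁, hc₁, fun _ y hy hyM hs t ht => hle (t, y) ⟨ht, ⟨hy, hyM⟩,
      mem_iInter₂.2 fun f hf => mem_iInter.2 fun hfZ => hs f hf hfZ⟩⟩
  choose! C hC hC' using hone
  have hmin : ∀ᶠ c₁ in 𝓝[>] (0 : ℝ), ∀ a ∈ C₀, c₁ ≤ C a := by
    refine (eventually_all_finite hC₀).2 fun a ha => ?_
    filter_upwards [mem_nhdsWithin_of_mem_nhds (gt_mem_nhds (hC a ha))] with c₁ h using le_of_lt h
  obtain ⟨c₁, h1, h2⟩ := (hmin.and self_mem_nhdsWithin).exists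
  exact ⟨c₁, h2, fun a ha hne y hy hyM hs t ht =>
    (h1 a ha).trans (hC' a ha hne y hy hyM hs t ht)⟩

namespace IsInsertionSetting

variable {D Sig : Set ℝ^(n + k)} {T : OrientedSimplex (n + 1) (n + k)}
  {A : Arrangement (n + k)} {ε η L c : ℝ} {Φ : ℝ^(n + k) → ℝ^(n + k)}
  {x y z : ℝ^(n + k)} (h : IsInsertionSetting D Sig T A ε η L c Φ)

include h

theorem notMem_sig (hy : ∀ f ∈ A, f ∉ planeFunctions A T → f y ≠ 0) : y ∉ Sig := fun hyS => by
  have h1 : T.dir ≤ zeroDir A y := fun v hv f hf h0 => by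
    by_contra hne
    exact hy f hf (fun hZ => hne (linear_eq_zero_of_mem_planeFunctions hZ hv)) h0
  have h2 := finrank_mono h1
  rw [T.finrank_dir] at h2
  have := h.adapted.finrank_le y hyS
  omega

theorem carrier_subset : T.carrier ⊆ D := fun z hz =>
  h.ball_subset z (Or.inr hz) (mem_ball_self (by linarith [h.eps_pos, h.eta_pos]))

theorem union_subset : Sig ∪ cutSet A T ⊆ D := by
  rintro z (hz | hz)
  · exact h.ball_subset z (Or.inl hz) (mem_ball_self (by linarith [h.eps_pos, h.eta_pos]))
  · exact h.carrier_subset hz.1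

theorem ne_zero_of_lensRadius_pos (hx : 0 < lensRadius A T ε x) :
    ∀ f ∈ A, f ∉ planeFunctions A T → f (T.proj x) ≠ 0 :=
  ((bumpRadius_pos_iff h.eps_pos).1 hx).2

theorem proj_mem (hx : 0 < lensRadius A T ε x) :
    T.proj x ∈ T.carrier ∧ T.proj x ∉ Sig ∪ cutSet A T := by
  have h1 := (lensRadius_pos_iff h.eps_pos).1 hx
  exact ⟨h1.1, fun h2 => h2.elim (h.notMem_sig (h.ne_zero_of_lensRadius_pos hx)) h1.2⟩

/-- A point of the simplex that does not belong to the new singular set lies in the lens. -/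
theorem lensRadius_pos (hx : x ∈ T.carrier)
    (hxM : x ∉ Sig ∪ cutSet A T) : 0 < lensRadius A T ε x := by
  rw [lensRadius_pos_iff h.eps_pos, OrientedSimplex.proj, planeProj_eq_self (T.sub_mem_dir hx 0)]
  exact ⟨hx, fun h' => hxM (Or.inr h')⟩

theorem sign_eq_of_lens (hx : ‖x - T.proj x‖ ≤ lensRadius A T ε x) (h0 : 0 < lensRadius A T ε x)
    {f : ℝ^(n + k) →ᵃ[ℝ] ℝ} (hf : f ∈ A) (hfZ : f ∉ planeFunctions A T) :
    SignType.sign (f x) = SignType.sign (f (cellPoint A (T.proj x))) ∧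
      f (cellPoint A (T.proj x)) ≠ 0 := by
  have hc := sameCell_cellPoint A (T.proj x)
  have hne := h.ne_zero_of_lensRadius_pos h0 f hf hfZ
  refine ⟨(sign_eq_of_abs_sub_lt ?_).trans (hc f hf).symm, fun h' => hne ((hc.eq_zero_iff hf).1 h')⟩
  refine (h.adapted.lip f hf (T.proj x) x).trans_lt ?_
  rw [dist_comm, dist_eq_norm]
  refine (hx.trans (bumpRadius_le_abs h.eps_pos.le hf hfZ)).trans_lt ?_
  have := abs_pos.2 hne
  nlinarith [h.eps_le]

/-- The points used in the construction of the bubbles stay in the domain. -/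
theorem segment_mem (hx : ‖x - T.proj x‖ ≤ lensRadius A T ε x) (h0 : 0 < lensRadius A T ε x) {t : ℝ}
    (ht : t ∈ Icc (0 : ℝ) 1) : (1 - t) • Φ x + t • cellPoint A (T.proj x) ∈ D := by
  have hp := (h.proj_mem h0).1
  have hc : cellPoint A (T.proj x) ∈ T.carrier :=
    (h.decides.iff (sameCell_cellPoint A (T.proj x))).2 hp
  have hconv : Convex ℝ T.carrier := convex_convexHull ℝ _
  refine h.ball_subset _ (Or.inr (hconv hp hc (sub_nonneg.2 ht.2) ht.1 (by ring))) ?_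
  have e : (1 - t) • Φ x + t • cellPoint A (T.proj x) -
      ((1 - t) • T.proj x + t • cellPoint A (T.proj x)) = (1 - t) • (Φ x - T.proj x) := by module
  rw [mem_ball, dist_eq_norm, e, norm_smul, norm_eq_abs, abs_of_nonneg (sub_nonneg.2 ht.2)]
  have h1 := dist_triangle (Φ x) x (T.proj x)
  rw [dist_eq_norm, dist_eq_norm x] at h1
  have h2 := h.push.dist_le x
  have h3 : lensRadius A T ε x ≤ ε := bumpRadius_le h.eps_pos.le
  have h4 := mul_le_of_le_one_left (norm_nonneg (Φ x - T.proj x)) (by linarith [ht.1] : 1 - t ≤ 1)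
  linarith [h.eps_pos, h.eta_pos]

theorem push_mem (hx : x ∈ D) : Φ x ∈ D := by
  rcases le_or_gt η (infDist x (Sig ∪ cutSet A T)) with h1 | h1
  · rwa [h.push.eq_self x h1]
  · obtain ⟨z, hz, hxz⟩ := (infDist_lt_iff h.polyhedral_union.nonempty).1 h1
    refine h.ball_subset z (hz.imp_right fun h => h.1) (mem_ball.2 ?_)
    linarith [dist_triangle (Φ x) x z, h.push.dist_le x, h.eps_pos]

/-- The slides inside the lens keep a positive distance from the old singular set. -/
theorem exists_le_infDist (hD : IsBounded D) : ∃ c₁ > 0, ∀ x ∈ D, x ∉ Sig ∪ cutSet A T →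
      ‖x - T.proj x‖ ≤ lensRadius A T ε x → 0 < lensRadius A T ε x → ∀ t ∈ Icc (0 : ℝ) 1,
        c₁ ≤ infDist ((1 - t) • Φ x + t • cellPoint A (T.proj x)) Sig := by
  obtain ⟨r, hr⟩ := hD.subset_closedBall 0
  obtain ⟨c₁, hc₁, hle⟩ := exists_le_infDist_segment (finite_range_cellPoint A)
    h.polyhedral.isCompact.isClosed h.polyhedral.nonempty subset_union_left
    (fun y hy => h.notMem_sig hy) h.push.pos r
  refine ⟨c₁, hc₁, fun x hxD hxM hxl hx0 t ht => hle _ (mem_range_self _)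
    (fun f hf hfZ => (h.sign_eq_of_lens hxl hx0 hf hfZ).2) _ (hr (h.push_mem hxD))
    (h.push.le_infDist h.polyhedral_union.nonempty hxM) (fun f hf hfZ => ?_) t ht⟩
  have h1 := (h.sign_eq_of_lens hxl hx0 hf hfZ).1
  rw [h.push.sameCell x f hf] at h1
  rw [← sign_nonneg_iff, sign_mul, h1, ← sign_mul, sign_nonneg_iff]
  exact mul_self_nonneg _

theorem eventually_cellPoint_eq (h0 : 0 < lensRadius A T ε x) :
    ∀ᶠ y in 𝓝 x, cellPoint A (T.proj y) = cellPoint A (T.proj x) := by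
  have hev : ∀ᶠ y in 𝓝 x, dist x y < lensRadius A T ε x := by
    filter_upwards [ball_mem_nhds x h0] with y hy
    rwa [dist_comm]
  filter_upwards [hev] with y hy
  refine (SameCell.cellPoint_eq (sameCell_of_dist_lt (Z := planeFunctions A T) h.adapted.lip
    (fun f hf => apply_eq_zero_of_mem_planeFunctions hf OrientedSimplex.proj_sub_mem)
    (fun f hf => apply_eq_zero_of_mem_planeFunctions hf OrientedSimplex.proj_sub_mem)
    fun f hf hfZ => ?_)).symm
  refine (dist_planeProj_le.trans_lt hy).trans_le ((bumpRadius_le_abs h.eps_pos.le hf hfZ).trans ?_)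
  exact mul_le_of_le_one_left (abs_nonneg _) (by linarith [h.eps_le])

variable [hk : k.AtLeastTwo] {N : Set ℝ^m} {p : N} {u : ℝ^(n + k) → N} {γ : ℝ^(n + k) → ℝ → N}
  {f : ℝ^k → N} {R : ℝ^(n + k) →L[ℝ] ℝ^k} {K : ℝ}

omit hk in
theorem eventually_insertMap_eq (hx : lensRadius A T ε x < ‖x - T.proj x‖ ∨ T.proj x ∉ T.carrier) :
    ∀ᶠ y in 𝓝 x, insertMap A T ε Φ u γ f R y = u (Φ y) := by
  rcases hx with hx | hx
  · have h1 := continuous_lensRadius h.adapted.lip h.decides h.eps_pos.le (by linarith [h.eps_le])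
    have h2 : Continuous fun y => ‖y - T.proj y‖ := (continuous_id.sub continuous_planeProj).norm
    filter_upwards [h1.continuousAt.eventually_lt h2.continuousAt hx] with y hy
    exact insertMap_of_le h.eps_pos.le hy.le
  · filter_upwards [continuous_planeProj.continuousAt.eventually
      (T.isCompact_carrier.isClosed.isOpen_compl.mem_nhds hx)] with y hy
    refine insertMap_of_le h.eps_pos.le ?_
    rw [lensRadius, bumpRadius_of_notMem hy]
    exact norm_nonneg _

omit hk in
theorem lens_or (hx : x ∉ T.carrier ∨ x ∉ Sig ∪ cutSet A T) :
    (lensRadius A T ε x < ‖x - T.proj x‖ ∨ T.proj x ∉ T.carrier) ∨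
      (0 < lensRadius A T ε x ∧ ‖x - T.proj x‖ ≤ lensRadius A T ε x) := by
  rcases lt_or_ge (lensRadius A T ε x) ‖x - T.proj x‖ with h1 | h1
  · exact Or.inl (Or.inl h1)
  · rcases eq_or_lt_of_le (lensRadius_nonneg (A := A) (T := T) (x := x) h.eps_pos.le) with h2 | h2
    · rw [← h2] at h1
      have h3 := sub_eq_zero.1 (norm_eq_zero.1 (le_antisymm h1 (norm_nonneg _)))
      refine Or.inl (Or.inr ?_)
      rw [← h3]
      rcases hx with hx | hx
      · exact hx
      · exact fun h4 => (h.lensRadius_pos h4 hx).ne h2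
    · exact Or.inr ⟨h2, h1⟩

omit hk in
theorem lipNear_comp_push {C : ℝ} (hC : 0 ≤ C) (hu : ∀ x ∈ D \ Sig, LipNear (C / infDist x Sig) u x)
    (hx : x ∈ D \ (Sig ∪ cutSet A T)) :
    LipNear (C * L / infDist x (Sig ∪ cutSet A T)) (fun y => u (Φ y)) x := by
  have hMne := h.polyhedral_union.nonempty
  have hpos := h.push.pos.trans_le (h.push.le_infDist hMne hx.2)
  have hle := infDist_le_infDist_of_subset (x := Φ x)
    (subset_union_left : Sig ⊆ Sig ∪ cutSet A T) h.polyhedral.nonempty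
  have hΦ : Φ x ∈ D \ Sig := ⟨h.push_mem hx.1, fun h' => by
    rw [infDist_zero_of_mem (show Φ x ∈ Sig ∪ cutSet A T from Or.inl h')] at hpos
    exact lt_irrefl _ hpos⟩
  refine (((hu _ hΦ).mono (div_le_div_of_nonneg_left hC hpos hle)).comp
    (by positivity) (h.push.lipNear x hx.2)).mono (le_of_eq ?_)
  field_simp

/-- The modified map has the growth of its local Lipschitz constants that is required for a nice
singularity. In the lens, the width of the lens at `x` is comparable to the distance from the new
singular set. -/
theorem exists_lipNear_insertMap
    (hD : IsBounded D) (hb : IsBubble A T u p γ f R K) {C : ℝ} (hC : 0 ≤ C)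
    (hu : ∀ x ∈ D \ Sig, LipNear (C / infDist x Sig) u x) :
    ∃ C' ≥ 0, ∀ x ∈ D \ (Sig ∪ cutSet A T),
      LipNear (C' / infDist x (Sig ∪ cutSet A T)) (insertMap A T ε Φ u γ f R) x := by
  obtain ⟨c₁, hc₁, hc₁'⟩ := h.exists_le_infDist hD
  have hMne := h.polyhedral_union.nonempty
  obtain ⟨Q, hQ0, hQ⟩ := exists_infDist_le_lensRadius (A := A) (T := T) h.eps_pos
    (subset_union_right (s := Sig))
  obtain ⟨r, hr⟩ : ∃ r : ℝ, ∀ x ∈ D, ∀ y ∈ D, dist x y < r := by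
    obtain ⟨r, hr⟩ := isBounded_iff.1 hD
    exact ⟨r + 1, fun x hx y hy => (hr hx hy).trans_lt (lt_add_one r)⟩
  have hMpos : ∀ x ∉ Sig ∪ cutSet A T, 0 < infDist x (Sig ∪ cutSet A T) := fun x hx =>
    (h.polyhedral_union.isCompact.isClosed.notMem_iff_infDist_pos hMne).1 hx
  obtain ⟨m₀, hm₀⟩ := hMne
  have hr0 : 0 ≤ r := by
    have := hr m₀ (h.union_subset hm₀) m₀ (h.union_subset hm₀)
    rw [dist_self] at this
    exact this.le
  have hL := h.push.nonneg
  have hK := hb.nonneg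
  have hε1 : ε ≤ 1 := by linarith [h.eps_le]
  refine ⟨C * L + (C / c₁ * (L * r + 30 * (1 + Q) * r) + K * (30 * (1 + Q))), by positivity,
    fun x hx => ?_⟩
  have hpos := hMpos x hx.2
  rcases h.lens_or (Or.inr hx.2) with hx1 | ⟨hx0, hx1⟩
  · refine ((h.lipNear_comp_push hC hu hx).congr ?_).mono (div_le_div_of_nonneg_right
      (le_add_of_nonneg_right (by positivity)) hpos.le)
    filter_upwards [h.eventually_insertMap_eq (u := u) (γ := γ) (f := f) (R := R) hx1] with y hy
    exact hy.symm
  -- the width of the lens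
  have hwidth : infDist x (Sig ∪ cutSet A T) ≤ (1 + Q) * lensRadius A T ε x := by
    have e1 := infDist_le_infDist_add_dist (s := Sig ∪ cutSet A T) (x := x) (y := T.proj x)
    have e2 := hQ _ (h.proj_mem hx0).1
    have e3 : lensRadius A T ε (T.proj x) = lensRadius A T ε x := by
      rw [lensRadius, lensRadius, OrientedSimplex.proj, OrientedSimplex.proj,
        planeProj_eq_self planeProj_sub_mem]
    rw [e3] at e2
    rw [dist_eq_norm] at e1
    linarith
  have hinv : 30 / lensRadius A T ε x ≤ 30 * (1 + Q) / infDist x (Sig ∪ cutSet A T) := by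
    rw [div_le_div_iff₀ hx0 hpos]
    linarith
  have hζ : LipNear (30 * (1 + Q) / infDist x (Sig ∪ cutSet A T)) (lensVec A T ε) x :=
    (lipNear_lensVec h.adapted.lip h.decides h.eps_pos.le hε1 hx0 hx1).mono hinv
  set θ' := 30 * (1 + Q) / infDist x (Sig ∪ cutSet A T) with hθ'
  have hθ'0 : 0 ≤ θ' := by positivity
  have hnorm : LipNear θ' (fun y => ‖lensVec A T ε y‖) x := by
    have := (lipschitzWith_one_norm.lipNear (lensVec A T ε x)).comp (by simp) hζ
    simpa using this
  have hc := h.eventually_cellPoint_eq hx0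
  have hctn : ∀ᶠ y in 𝓝 x, ContinuousAt (fun y => ‖lensVec A T ε y‖) y := by
    filter_upwards [hnorm.eventually] with y hy using hy.continuousAt
  have hlens : ∀ᶠ y in 𝓝 x, 0 < lensRadius A T ε y :=
    (continuous_lensRadius h.adapted.lip h.decides h.eps_pos.le hε1).continuousAt.eventually
      (lt_mem_nhds hx0)
  have hcD : cellPoint A (T.proj x) ∈ D := h.carrier_subset
    ((h.decides.iff (sameCell_cellPoint A (T.proj x))).2 (h.proj_mem hx0).1)
  set a := cellPoint A (T.proj x) with ha
  -- the three parts of the map in the lens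
  have h1 : LipNear (C / c₁ * (L * r + 30 * (1 + Q) * r) / infDist x (Sig ∪ cutSet A T))
      (fun y => u ((1 - slideTime A T ε y) • Φ y + slideTime A T ε y • a)) x := by
    have hs : LipNear θ' (slideTime A T ε) x := by
      obtain ⟨V, hV, hV'⟩ := hnorm
      refine ⟨V, hV, fun y hy z hz => (abs_projIcc_sub_projIcc zero_le_one).trans ?_⟩
      rw [sub_sub_sub_cancel_left, abs_sub_comm]
      exact hV' y hy z hz
    have hΦ : LipNear (L * r / infDist x (Sig ∪ cutSet A T)) Φ x := by
      refine (h.push.lipNear x hx.2).mono ?_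
      rw [← mul_div_assoc]
      gcongr
      exact (infDist_le_dist_of_mem hm₀).trans (hr _ (h.push_mem hx.1) _ (h.union_subset hm₀)).le
    have hseg := hΦ.interpolate hθ'0 hs (fun y => (clampI _).2) (hr _ (h.push_mem hx.1) a hcD)
    have hm : slideTime A T ε x ∈ I := (clampI _).2
    have hd := hc₁' x hx.1 hx.2 hx1 hx0 _ hm
    have hmem := h.segment_mem hx1 hx0 hm
    have hSig : (1 - slideTime A T ε x) • Φ x + slideTime A T ε x • a ∉ Sig := fun h' => by
      rw [infDist_zero_of_mem h'] at hd
      linarith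
    have hux := (hu _ ⟨hmem, hSig⟩).mono (div_le_div_of_nonneg_left hC hc₁ hd)
    refine (LipNear.comp (f := fun y => (1 - slideTime A T ε y) • Φ y + slideTime A T ε y • a)
      (by positivity) hux hseg).mono (le_of_eq ?_)
    rw [hθ']
    field_simp
  have h2 : LipNear (K * (30 * (1 + Q)) / infDist x (Sig ∪ cutSet A T))
      (fun y => γ a ‖lensVec A T ε y‖) x := by
    rw [mul_div_assoc]
    exact (hb.lip_path _ _).comp hK hnorm
  have h3 : LipNear (K * (30 * (1 + Q)) / infDist x (Sig ∪ cutSet A T))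
      (fun y => f (R (lensVec A T ε y))) x := by
    rw [mul_div_assoc]
    refine (hb.lip_bubble _).comp hK ?_
    obtain ⟨V, hV, hV'⟩ := hζ
    refine ⟨V, hV, fun y hy z hz => le_trans ?_ (hV' y hy z hz)⟩
    rw [dist_eq_norm, dist_eq_norm, ← map_sub]
    exact hb.norm_le _
  have h12 : C / c₁ * (L * r + 30 * (1 + Q) * r) / infDist x (Sig ∪ cutSet A T) ≤
      (C / c₁ * (L * r + 30 * (1 + Q) * r) + K * (30 * (1 + Q))) / infDist x (Sig ∪ cutSet A T) :=
    div_le_div_of_nonneg_right (le_add_of_nonneg_right (by positivity)) hpos.le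
  have h23 : K * (30 * (1 + Q)) / infDist x (Sig ∪ cutSet A T) ≤
      (C / c₁ * (L * r + 30 * (1 + Q) * r) + K * (30 * (1 + Q))) / infDist x (Sig ∪ cutSet A T) :=
    div_le_div_of_nonneg_right (le_add_of_nonneg_left (by positivity)) hpos.le
  refine LipNear.mono (LipNear.congr (LipNear.ite (c := 2) hctn (fun _ => h1.mono h12) (fun _ =>
    LipNear.ite (c := 1) hctn (fun _ => h2.mono h23) (fun _ => h3.mono h23) ?_) ?_) ?_) ?_
  · refine Eventually.of_forall fun y hy => ?_
    rw [hb.path_left _ _ hy.le, hb.bubble_eq]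
    rw [hb.norm_tail _ lensVec_mem, hy]
  · refine Eventually.of_forall fun y hy => ?_
    rw [if_pos (by rw [hy]; norm_num), hy, hb.path_right _ _ le_rfl,
      slideTime, hy, clampI_of_ge (by norm_num), Icc.coe_one, sub_self, zero_smul, one_smul,
        zero_add]
  · filter_upwards [hc, hlens] with y hy hy0
    rw [insertMap, if_neg hy0.ne', hy]
  · exact div_le_div_of_nonneg_right (le_add_of_nonneg_left (by positivity)) hpos.le

end IsInsertionSetting

end InsertionEstimates

/-! ### Existence of insertions, and their regularity -/

section InsertionExistence

variable {n k m : ℕ} {D Sig : Set ℝ^(n + k)} {T : OrientedSimplex (n + 1) (n + k)}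

theorem IsAdapted.mono {A A' : Arrangement (n + k)} {M : Set ℝ^(n + k)} (h : IsAdapted A n M)
    (hA : A ⊆ A') (hA' : IsLipArrangement A') : IsAdapted A' n M :=
  ⟨hA', h.decides.mono hA, fun x hx =>
    (finrank_mono (show zeroDir A' x ≤ zeroDir A x from
      fun _ hv f hf h0 => hv f (hA hf) h0)).trans (h.finrank_le x hx)⟩

/-- The arrangement is the union of one adapted to the old singular set and one that decides the
simplex and contains multiples of its barycentric coordinates. -/
theorem exists_isInsertionSetting (hD : IsOpen D) (hSig : IsPolyhedralSet n Sig) (hSigD : Sig ⊆ D)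
    (hT : T.carrier ⊆ D) : ∃ A ε η L c Φ, IsInsertionSetting D Sig T A ε η L c Φ := by
  classical
  obtain ⟨A₁, hA₁, -⟩ := hSig.exists_isAdapted
  obtain ⟨A₂, hA₂, hdec, hdir, hcoord⟩ := T.exists_arrangement
  have hA : IsLipArrangement (A₁ ∪ A₂) := fun f hf =>
    (Finset.mem_union.1 hf).elim (hA₁.lip f) (hA₂ f)
  have hdec' := hdec.mono (Finset.subset_union_right (s₁ := A₁))
  have hcoord' : ∀ i, lipNormalize (T.coord i) ∈ A₁ ∪ A₂ := fun i =>
    Finset.mem_union_right _ (hcoord i)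
  have hadapt := hA₁.mono Finset.subset_union_left hA
  have hM := hSig.union (isPolyhedralSet_cutSet hA hdec' hcoord')
  obtain ⟨δ, hδ, hsub⟩ := (hSig.isCompact.union T.isCompact_carrier).exists_thickening_subset_open
    hD (union_subset hSigD hT)
  have hη : 0 < δ / 4 := by positivity
  obtain ⟨L, c, Φ, hΦ⟩ := exists_isPush hA (hadapt.decides.union (decides_cutSet hdec'))
    hM.isCompact hM.nonempty hη
  refine ⟨A₁ ∪ A₂, min (δ / 4) (1 / 4), δ / 4, L, c, Φ, hadapt, hSig, hM, hdec', fun x hx v hv =>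
    hdir x hx fun f hf h0 => hv f (Finset.mem_union_right _ hf) h0, hcoord',
    lt_min hη (by norm_num), min_le_right _ _, hη, hΦ, fun z hz => ?_⟩
  refine ((ball_subset_ball ?_).trans (ball_subset_thickening hz δ)).trans hsub
  linarith [min_le_left (δ / 4) (1 / 4 : ℝ)]

variable [hk : k.AtLeastTwo]

/-- The first `n + 1` vectors of an orthonormal basis. -/
noncomputable def extFrame (b : Frame (n + k)) : Fin (n + 1) → ℝ^(n + k) :=
  b ∘ Fin.castLE (Nat.add_le_add_left (le_of_lt hk.prop) n)

theorem extFrame_eq_snoc (b : Frame (n + k)) : extFrame b =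
    Fin.snoc (α := fun _ => ℝ^(n + k)) (tangentFrame b) (b (natAdd n 0)) := by
  funext i
  refine Fin.lastCases ?_ (fun i => ?_) i
  · rw [Fin.snoc_last]; rfl
  · rw [Fin.snoc_castSucc]; rfl

theorem orthonormal_extFrame (B : Frame (n + k)) :
    Orthonormal ℝ (extFrame B) := B.orthonormal.comp _ (Fin.castLE_injective _)

theorem mem_span_extFrame_iff {b : Frame (n + k)} {v : ℝ^(n + k)} :
    v ∈ span ℝ (range (extFrame b)) ↔
      ∀ j : Fin k, j ≠ 0 → inner ℝ (b (natAdd n j)) v = (0 : ℝ) := by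
  refine (mem_span_range_comp_iff b _).trans
    ⟨fun h j hj => h _ fun ⟨i, hi⟩ => hj ?_, fun h l hl => ?_⟩
  · have h1 : (i : ℕ) = n + j := congrArg Fin.val hi
    exact Fin.val_eq_zero_iff.1 (by omega)
  · induction l using Fin.addCases with
    | left i => exact absurd ⟨i.castSucc, rfl⟩ hl
    | right j => exact h j fun hj => hl ⟨Fin.last n, by rw [hj]; rfl⟩

theorem exists_positive_extFrame (W : Submodule ℝ ℝ^(n + k)) (hW : finrank ℝ W = n + 1) :
    ∃ B : Frame (n + k),
      span ℝ (range (extFrame B)) = W ∧ 0 < (frameMatrix B).det := by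
  have h2 := hk.prop
  refine exists_positive_span_eq (Fin.castLE_injective _) (j := ⟨n + 1, by omega⟩) ?_ hW
  rintro ⟨i, hi⟩
  exact i.2.ne (congrArg Fin.val hi)

/-- The last `k - 1` coordinates with respect to `B`, as a vector of `ℝ^k` with vanishing first
coordinate. -/
noncomputable def normalTail (B : Frame (n + k)) : ℝ^(n + k) →L[ℝ] ℝ^k :=
  toContinuousLinearMap
    { toFun := fun v => WithLp.toLp 2 fun j => if j = 0 then 0 else inner ℝ (B (natAdd n j)) v
      map_add' := fun v w => by
        ext j
        simp only [PiLp.add_apply, inner_add_right]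
        split_ifs <;> simp
      map_smul' := fun c v => by
        ext j
        simp only [PiLp.smul_apply, inner_smul_right, RingHom.id_apply, smul_eq_mul]
        split_ifs <;> simp }

theorem normalTail_apply (B : Frame (n + k)) (v : ℝ^(n + k)) (j : Fin k) :
    normalTail B v j = if j = 0 then 0 else inner ℝ (B (natAdd n j)) v := rfl

theorem tailVec_normalTail (B : Frame (n + k)) (v : ℝ^(n + k)) :
    tailVec (normalTail B v) = normalTail B v := by
  rw [tailVec, normalTail_apply, if_pos rfl, zero_smul, sub_zero]

theorem norm_sq_eq_sum_add_normalTail (B : Frame (n + k)) (v : ℝ^(n + k)) :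
    ‖v‖ ^ 2 = ∑ i, inner ℝ (extFrame B i) v ^ 2 + ‖normalTail B v‖ ^ 2 := by
  have h1 := B.sum_sq_norm_inner_right v
  rw [← h1, extFrame_eq_snoc, Fin.sum_univ_add, EuclideanSpace.norm_sq_eq, Fin.sum_univ_castSucc,
    add_assoc]
  congr 1
  · refine sum_congr rfl fun i _ => ?_
    rw [Fin.snoc_castSucc, norm_eq_abs, sq_abs]
    rfl
  · rw [Fin.snoc_last, ← add_sum_erase _ _ (Finset.mem_univ (0 : Fin k)),
      ← add_sum_erase (Finset.univ : Finset (Fin k)) (fun i => ‖normalTail B v i‖ ^ 2)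
        (Finset.mem_univ 0), normalTail_apply, if_pos rfl, norm_zero, zero_pow two_ne_zero,
          zero_add, norm_eq_abs, sq_abs]
    congr 1
    refine sum_congr rfl fun j hj => ?_
    rw [normalTail_apply, if_neg (Finset.ne_of_mem_erase hj)]

variable {N : Set ℝ^m} [hN : IsAdmissibleTarget k N] {p : N} {u : ℝ^(n + k) → N}

/-- The normal part of a bubble is a Lipschitz map of the given class; one Lipschitz path for each
of the finitely many cells joins it to the values of `u`. -/
theorem exists_isBubble (A : Arrangement (n + k)) {B : Frame (n + k)}
    (hB : span ℝ (range (extFrame B)) = T.dir) (g : CoeffGroup k N p) :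
    ∃ γ f K, IsBubble A T u p γ f (normalTail B) K ∧ HasHomotopyClass k N p (capFill p f) g := by
  obtain ⟨f, K, hK, hf, hfp, hg⟩ := exists_lipschitz_bubble g
  choose γ Kγ hKγ hγ hγp hγq using fun c => exists_lipschitz_path (k := k) p (u c)
  obtain ⟨K', hK'⟩ := ((finite_range_cellPoint A).image Kγ).bddAbove
  refine ⟨γ, f, max K K', ⟨hK.trans (le_max_left _ _), fun x t => (hγ _ t).mono
    ((hK' (mem_image_of_mem _ (mem_range_self x))).trans (le_max_right _ _)), hγp, hγq,
    fun ζ => (hf ζ).mono (le_max_left _ _), hfp, fun v => ?_, fun v hv => ?_⟩, hg⟩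
  · rw [← sq_le_sq₀ (norm_nonneg _) (norm_nonneg _), norm_sq_eq_sum_add_normalTail B v]
    exact le_add_of_nonneg_left (sum_nonneg fun i _ => sq_nonneg _)
  · rw [tailVec_normalTail, ← sq_eq_sq₀ (norm_nonneg _) (norm_nonneg _),
      norm_sq_eq_sum_add_normalTail B v, sum_eq_zero, zero_add]
    intro i _
    rw [(Submodule.mem_orthogonal _ _).1 hv _ (hB ▸ subset_span (mem_range_self i)),
      zero_pow two_ne_zero]

variable {A : Arrangement (n + k)} {ε η L c : ℝ} {Φ : ℝ^(n + k) → ℝ^(n + k)}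
  {γ : ℝ^(n + k) → ℝ → N} {f : ℝ^k → N} {R : ℝ^(n + k) →L[ℝ] ℝ^k} {K : ℝ}

omit hk hN in
/-- Far away from the old singular set and the simplex, the map is not changed. -/
theorem IsInsertionSetting.insertMap_eq (h : IsInsertionSetting D Sig T A ε η L c Φ)
    {x : ℝ^(n + k)} (hx : η + ε < infDist x (Sig ∪ T.carrier)) :
    insertMap A T ε Φ u γ f R x = u x := by
  have hne : (Sig ∪ cutSet A T).Nonempty := h.polyhedral_union.nonempty
  have h1 : Φ x = x := by
    refine h.push.eq_self x ?_
    have := infDist_le_infDist_of_subset (x := x)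
      (union_subset_union_right Sig (fun z (hz : z ∈ cutSet A T) => hz.1)) hne
    linarith [h.eps_pos]
  rw [insertMap_of_le h.eps_pos.le, h1]
  by_contra hlt
  push Not at hlt
  have h2 := (h.proj_mem ((norm_nonneg _).trans_lt hlt)).1
  have h3 := infDist_le_dist_of_mem (x := x) (show T.proj x ∈ Sig ∪ T.carrier from Or.inr h2)
  have h4 : lensRadius A T ε x ≤ ε := bumpRadius_le h.eps_pos.le
  rw [dist_eq_norm] at h3
  linarith [h.eta_pos]

omit hk hN in
theorem IsInsertionSetting.exists_nhds_frontier (h : IsInsertionSetting D Sig T A ε η L c Φ)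
    (hD : IsOpen D) : ∃ V, IsOpen V ∧ frontier D ⊆ V ∧
      ∀ x ∈ V, insertMap A T ε Φ u γ f R x = u x := by
  refine ⟨{x | η + ε < infDist x (Sig ∪ T.carrier)},
    isOpen_lt continuous_const (continuous_infDist_pt _), fun x hx => ?_,
    fun x hx => h.insertMap_eq hx⟩
  rw [hD.frontier_eq] at hx
  have h1 : 2 * (η + ε) ≤ infDist x (Sig ∪ T.carrier) := by
    refine (le_infDist (h.polyhedral.nonempty.mono subset_union_left)).2 fun z hz => ?_
    by_contra hlt
    push Not at hlt
    exact hx.2 (h.ball_subset z hz hlt)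
  show η + ε < _
  linarith [h.eps_pos, h.eta_pos]

theorem IsInsertionSetting.memSobolev_and_hasNiceSingularity
    (h : IsInsertionSetting D Sig T A ε η L c Φ) (hD : IsOpen D) (hDb : IsBounded D)
    (hb : IsBubble A T u p γ f R K) (hu : HasNiceSingularity D Sig u) :
    MemSobolev D ((k - 1 : ℕ) : ENNReal) (insertMap A T ε Φ u γ f R) ∧
      HasNiceSingularity D (Sig ∪ cutSet A T) (insertMap A T ε Φ u γ f R) := by
  have hM := h.polyhedral_union
  obtain ⟨C, hC, hCu⟩ := hu.exists_lipNear hD h.polyhedral.isCompact.isClosed h.polyhedral.nonempty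
  obtain ⟨C', hC', hC'u⟩ := h.exists_lipNear_insertMap hDb hb hC hCu
  refine ⟨memSobolev_of_lipNear hk.prop hN.isCompact hD hDb hM.isCompact hM.nonempty
    hM.coveredByPlanes hC' hC'u, .of_lipNear hD hM.isCompact.isClosed hC' hC'u fun x hx => ?_⟩
  obtain ⟨V, hV, hDV, hVu⟩ := h.exists_nhds_frontier (u := u) (γ := γ) (f := f) (R := R) hD
  have hxD : x ∈ closure D \ Sig := ⟨frontier_subset_closure hx, fun hxS => by
    rw [hD.frontier_eq] at hx
    exact hx.2 (h.union_subset (Or.inl hxS))⟩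
  obtain ⟨L', W, hW, hL'⟩ := hu.1 x hxD
  refine ⟨L', _, inter_mem hW (hV.mem_nhds (hDV hx)), fun y hy z hz => ?_⟩
  rw [hVu y hy.1.2, hVu z hz.1.2]
  exact hL' ⟨hy.1.1, hy.2.1, fun hS => hy.2.2 (Or.inl hS)⟩
    ⟨hz.1.1, hz.2.1, fun hS => hz.2.2 (Or.inl hS)⟩

end InsertionExistence

/-! ### Orientations of faces and of frames -/

section Orientation

variable {n k d : ℕ}

/-- The orientation of a simplex with respect to a frame that extends a frame `e` of a face by a
vector `ν` pointing inwards. -/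
theorem OrientedSimplex.sign_snoc (T : OrientedSimplex (n + 1) d) (i : Fin (n + 2))
    {e : Fin n → ℝ^d} {ν : ℝ^d} (hF : (T.oppositeFace i).dir = span ℝ (range e))
    (hT : T.dir = span ℝ (range (Fin.snoc (α := fun _ => ℝ^d) e ν)))
    (hν : ∀ j, inner ℝ ν (e j) = (0 : ℝ)) (hν1 : ‖ν‖ = 1) (hpos : 0 < (T.coord i).linear ν) :
    T.sign (Fin.snoc (α := fun _ => ℝ^d) e ν) =
      (-1) ^ (n + 1 + (i : ℕ)) * (T.oppositeFace i).sign e := by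
  set e' := Fin.snoc (α := fun _ => ℝ^d) e ν with he'
  set l := (T.coord i).linear ν with hl
  -- on the direction of `T`, the coordinate number `i` is a multiple of the product with `ν`
  have hlin : ∀ v ∈ T.dir, (T.coord i).linear v = inner ℝ ν v * l := by
    intro v hv
    rw [hT] at hv
    induction hv using Submodule.span_induction with
    | mem v hv =>
      obtain ⟨j, rfl⟩ := hv
      refine Fin.lastCases ?_ (fun j => ?_) j
      · rw [he', Fin.snoc_last, real_inner_self_eq_norm_sq, hν1, one_pow, one_mul]
      · rw [he', Fin.snoc_castSucc, hν, zero_mul]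
        have hej : e j ∈ (T.oppositeFace i).dir := hF ▸ subset_span (mem_range_self j)
        refine (show (T.oppositeFace i).dir ≤ ker (T.coord i).linear from ?_) hej
        rw [OrientedSimplex.dir, vectorSpan_def, span_le]
        rintro _ ⟨_, ⟨a, rfl⟩, _, ⟨b, rfl⟩, rfl⟩
        show (T.coord i).linear (T.points (i.succAbove a) - T.points (i.succAbove b)) = 0
        rw [affineMap_sub, T.coord_point, T.coord_point, if_neg (Fin.succAbove_ne i a).symm,
          if_neg (Fin.succAbove_ne i b).symm, sub_zero]
    | zero => simp
    | add v w _ _ hv hw => rw [map_add, hv, hw, inner_add_right, add_mul]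
    | smul c v _ hv => rw [map_smul, hv, inner_smul_right, smul_eq_mul, mul_assoc]
  set h := inner ℝ ν (T.points (i.succAbove 0)) with hh
  have hrow : ∀ j, inner ℝ ν (T.points j) = h + l⁻¹ * if i = j then 1 else 0 := by
    intro j
    have h1 := hlin _ (vsub_mem_vectorSpan ℝ (mem_range_self j)
      (mem_range_self (i.succAbove (0 : Fin (n + 1)))))
    rw [vsub_eq_sub, affineMap_sub, T.coord_point, T.coord_point,
      if_neg (Fin.succAbove_ne i 0).symm, sub_zero, inner_sub_right] at h1
    rw [h1, hh]
    field_simp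
    ring
  have hdet : T.homDet e' = l⁻¹ * ((-1) ^ (n + 1 + (i : ℕ)) * (T.oppositeFace i).homDet e) := by
    set M : Matrix (Fin (n + 2)) (Fin (n + 2)) ℝ := of fun a j =>
      (Fin.cons 1 fun a => inner ℝ (e' a) (T.points j) : Fin (n + 2) → ℝ) a with hM
    have hlast : ∀ j, M (Fin.last (n + 1)) j = h * M 0 j + l⁻¹ * if i = j then 1 else 0 := by
      intro j
      have : Fin.last (n + 1) = Fin.succ (Fin.last n) := rfl
      rw [hM, of_apply, of_apply, this, Fin.cons_succ, Fin.cons_zero, mul_one, he',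
        Fin.snoc_last, hrow]
    have hMdet : T.homDet e' = M.det := rfl
    have hupd : M = M.updateRow (Fin.last (n + 1)) (h • M 0 + l⁻¹ • Pi.single i 1) := by
      ext a j
      by_cases ha : a = Fin.last (n + 1)
      · subst ha
        rw [updateRow_self, hlast]
        simp [Pi.single_apply, eq_comm]
      · rw [updateRow_ne ha]
    have hzero : (M.updateRow (Fin.last (n + 1)) (M 0)).det = 0 := by
      refine Matrix.det_zero_of_row_eq (i := 0) (j := Fin.last (n + 1))
        (Fin.ne_of_lt (Fin.last_pos)) ?_
      rw [updateRow_self, updateRow_ne (Fin.ne_of_lt (Fin.last_pos))]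
    rw [hMdet, hupd, Matrix.det_updateRow_add, Matrix.det_updateRow_smul, Matrix.det_updateRow_smul,
      hzero, mul_zero, zero_add, Matrix.det_succ_row _ (Fin.last (n + 1)),
      sum_eq_single i]
    · rw [updateRow_self, Pi.single_eq_same, mul_one, Fin.val_last]
      congr 2
      rw [OrientedSimplex.homDet]
      congr 1
      ext a j
      rw [Matrix.submatrix_apply, Fin.succAbove_last, updateRow_ne
        (Fin.castSucc_lt_last a).ne, hM, of_apply, of_apply]
      refine Fin.cases ?_ (fun a => ?_) a
      · rfl
      · rw [← Fin.succ_castSucc, Fin.cons_succ, Fin.cons_succ, he', Fin.snoc_castSucc]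
        rfl
    · intro j _ hj
      rw [updateRow_self, Pi.single_eq_of_ne hj, mul_zero, zero_mul]
    · simp
  rw [T.sign_of_dir_eq hT, (T.oppositeFace i).sign_of_dir_eq hF, hdet, sign_mul,
    sign_pos (inv_pos.2 hpos), one_mul, sign_mul, sign_pow, Left.sign_neg, sign_one]
  push_cast
  rfl

variable [hk : k.AtLeastTwo]

/-- If two orthonormal bases agree in their last `k - 1` vectors, then their orientations are
compared by their first `n + 1` vectors. -/
theorem det_extFrame {b B : Frame (n + k)}
    (h : ∀ j : Fin k, j ≠ 0 → b (natAdd n j) = B (natAdd n j)) :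
    (of fun i j => inner ℝ (extFrame b i) (extFrame B j)).det =
      (frameMatrix b).det * (frameMatrix B).det := by
  have h2 := hk.prop
  let e : Fin (n + 1) ⊕ Fin (k - 1) ≃ Fin (n + k) := finSumFinEquiv.trans (finCongr (by omega))
  have hb2 : ∀ j, b (e (Sum.inr j)) = B (e (Sum.inr j)) := fun j => by
    have e1 : e (Sum.inr j) = natAdd n ⟨j + 1, by omega⟩ := Fin.ext (by simp [e]; ring)
    rw [e1]
    exact h _ fun h0 => by simpa using congrArg Fin.val h0
  rw [← det_mul_det_eq e b B fun i j => by
    rw [hb2, B.inner_eq_zero fun h => by simpa using e.injective h]]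
  have h1 : (of fun i j => inner ℝ (b (e (Sum.inr i))) (B (e (Sum.inr j)))) = 1 := by
    ext i j
    simp [hb2, B.inner_eq_ite, Matrix.one_apply]
  have hb1 : ∀ (b : Frame (n + k)) i, b (e (Sum.inl i)) = extFrame b i :=
    fun b i => congrArg b (Fin.ext rfl)
  simp only [h1, hb1, det_one, mul_one]

end Orientation

/-! ### Small spheres around the new singular set -/

section LinkEventually

variable {n k m : ℕ} {N : Set ℝ^m} {b : Frame (n + k)} {x ν : ℝ^(n + k)}

theorem eventually_link {P : ℝ^(n + k) → Prop} (h : ∀ᶠ y in 𝓝 x, P y) :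
    ∀ᶠ r in 𝓝[>] (0 : ℝ), ∀ w ∈ sphere (0 : ℝ^k) 1, P (x + r • normalVec b w) := by
  obtain ⟨δ, hδ, hball⟩ := eventually_nhds_iff_ball.1 h
  filter_upwards [Ioo_mem_nhdsGT hδ] with r hr w hw
  refine hball _ ?_
  rw [mem_ball, dist_self_add_left, norm_smul, norm_normalVec, mem_sphere_zero_iff_norm.1 hw,
    norm_eq_abs, abs_of_pos hr.1, mul_one]
  exact hr.2

/-- Small normal spheres around a generic point of an adapted set do not meet the set. -/
theorem IsAdapted.eventually_link_notMem {A : Arrangement (n + k)}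
    {M : Set ℝ^(n + k)} (hA : IsAdapted A n M) (hx : x ∈ M) (hxn : finrank ℝ (zeroDir A x) = n)
    (hspan : tangentSpan b = zeroDir A x) :
    ∀ᶠ r in 𝓝[>] (0 : ℝ), ∀ w ∈ sphere (0 : ℝ^k) 1, x + r • normalVec b w ∉ M := by
  filter_upwards [eventually_link (b := b) (hA.eventually_mem_iff hx hxn), self_mem_nhdsWithin]
    with r hr (hr0 : 0 < r) w hw hmem
  rw [hr w hw, add_sub_cancel_left, ← hspan, ← normalVec_smul, normalVec_mem_span_iff] at hmem
  rcases smul_eq_zero.1 hmem with h | h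
  · exact hr0.ne' h
  · exact ne_zero_of_mem_unit_sphere' hw h

theorem affineMap_add_smul (f : ℝ^(n + k) →ᵃ[ℝ] ℝ) (t : ℝ) :
    f (x + t • ν) = f x + t * f.linear ν := by
  have := affineMap_sub f x (x + t • ν)
  rw [add_sub_cancel_left, map_smul, smul_eq_mul] at this
  linarith

/-- The points of a ray close to its initial point belong to one cell. -/
theorem eventually_sameCell (A : Arrangement (n + k)) (x ν : ℝ^(n + k)) :
    ∃ t₁ > (0 : ℝ), ∀ t ∈ Ioo 0 t₁, ∀ t' ∈ Ioo 0 t₁, SameCell A (x + t • ν) (x + t' • ν) := by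
  have hev : ∀ᶠ t in 𝓝[>] (0 : ℝ), ∀ f ∈ A, SignType.sign (f (x + t • ν)) =
      if f x = 0 then SignType.sign (f.linear ν) else SignType.sign (f x) := by
    refine (Finset.eventually_all A).2 fun f _ => ?_
    by_cases h0 : f x = 0
    · filter_upwards [self_mem_nhdsWithin] with t (ht : 0 < t)
      rw [if_pos h0, affineMap_add_smul, h0, zero_add, sign_mul, sign_pos ht, one_mul]
    · have hc : Tendsto (fun t : ℝ => |f x - f (x + t • ν)|) (𝓝[>] 0) (𝓝 0) := by
        have : Continuous fun t : ℝ => |f x - f (x + t • ν)| :=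
          (continuous_const.sub (f.continuous_of_finiteDimensional.comp (by fun_prop))).abs
        have h1 := this.tendsto 0
        rw [zero_smul, add_zero, sub_self, abs_zero] at h1
        exact h1.mono_left nhdsWithin_le_nhds
      filter_upwards [hc.eventually (gt_mem_nhds (abs_pos.2 h0))] with t ht
      rw [if_neg h0]
      exact sign_eq_of_abs_sub_lt ht
  obtain ⟨t₁, ht₁, hsub⟩ := mem_nhdsGT_iff_exists_Ioo_subset.1 hev
  exact ⟨t₁, ht₁, fun t ht t' ht' f hf => (hsub ht f hf).trans (hsub ht' f hf).symm⟩

end LinkEventually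

namespace IsInsertionSetting

variable {n k m : ℕ} {D Sig : Set ℝ^(n + k)}
  {T : OrientedSimplex (n + 1) (n + k)} {A : Arrangement (n + k)}
  {ε η L c : ℝ} {Φ : ℝ^(n + k) → ℝ^(n + k)}
  {x ν : ℝ^(n + k)} (h : IsInsertionSetting D Sig T A ε η L c Φ)

include h

theorem adapted_union : IsAdapted A n (Sig ∪ cutSet A T) :=
  ⟨h.adapted.lip, h.adapted.decides.union (decides_cutSet h.decides), fun z hz =>
    hz.elim (h.adapted.finrank_le z) fun hz => finrank_le_of_mem_cutSet h.zeroDir_le hz⟩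

/-- The functions in `A` that vanish at a generic point of `T`, but not on `T`, have non-zero
derivatives in a direction of `T` transversal to their zero sets. -/
theorem linear_ne_zero (hx : x ∈ T.carrier)
    (hxn : finrank ℝ (zeroDir A x) = n) (hν : ν ∈ T.dir) (hν' : ν ∉ zeroDir A x)
    {f : ℝ^(n + k) →ᵃ[ℝ] ℝ} (hf : f ∈ A) (hfZ : f ∉ planeFunctions A T)
    (h0 : f x = 0) : f.linear ν ≠ 0 := by
  intro hfν
  have hW := h.zeroDir_le x hx
  have hker : T.dir ≤ ker f.linear := by
    have h1 : zeroDir A x ≤ T.dir ⊓ ker f.linear := le_inf hW fun v hv => hv f hf h0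
    have h2 : zeroDir A x < T.dir ⊓ ker f.linear :=
      lt_of_le_of_ne h1 fun e => hν' (e ▸ ⟨hν, hfν⟩)
    have h3 := Submodule.finrank_lt_finrank_of_lt h2
    have h4 : T.dir ⊓ ker f.linear = T.dir :=
      eq_of_le_of_finrank_le inf_le_left (by rw [T.finrank_dir]; omega)
    exact inf_eq_left.1 h4
  refine hfZ (mem_planeFunctions.2 ⟨hf, fun i => ?_⟩)
  have h5 : T.points i - x ∈ T.dir := by
    rw [← neg_sub]
    exact T.dir.neg_mem (T.sub_mem_dir hx i)
  have h6 : f.linear (T.points i - x) = 0 := hker h5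
  rwa [affineMap_sub, h0, sub_zero] at h6

/-- Near a generic point of `T`, the lens radius grows linearly in transversal directions. -/
theorem exists_bumpRadius_eq (hx : x ∈ T.carrier)
    (hxM : x ∈ Sig ∪ cutSet A T) (hxn : finrank ℝ (zeroDir A x) = n) (hν : ν ∈ T.dir)
    (hν' : ν ∉ zeroDir A x) (hν1 : ‖ν‖ = 1) (hin : ∀ᶠ t in 𝓝[>] (0 : ℝ), x + t • ν ∈ T.carrier) :
    ∃ κ > 0, ∀ᶠ t in 𝓝[>] (0 : ℝ),
      bumpRadius A (planeFunctions A T) T.carrier ε (x + t • ν) = κ * t := by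
  classical
  let B₀ := A.filter fun f => f ∉ planeFunctions A T ∧ f x = 0
  have hB₀ : ∀ f, f ∈ B₀ ↔ f ∈ A ∧ f ∉ planeFunctions A T ∧ f x = 0 := fun f => mem_filter
  have hne : B₀.Nonempty := by
    by_contra hemp
    have h1 : bumpRadius A (planeFunctions A T) T.carrier ε (T.proj x) > 0 := by
      rw [OrientedSimplex.proj, planeProj_eq_self (T.sub_mem_dir hx 0)]
      refine (bumpRadius_pos_iff h.eps_pos).2 ⟨hx, fun f hf hfZ h0 => hemp ⟨f, ?_⟩⟩
      exact (hB₀ f).2 ⟨hf, hfZ, h0⟩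
    have h2 := (h.proj_mem h1).2
    rw [OrientedSimplex.proj, planeProj_eq_self (T.sub_mem_dir hx 0)] at h2
    exact h2 hxM
  obtain ⟨f₀, hf₀, hmin⟩ := B₀.exists_min_image (fun f => |f.linear ν|) hne
  have hf₀' := (hB₀ f₀).1 hf₀
  have hκ : 0 < |f₀.linear ν| := abs_pos.2 (h.linear_ne_zero hx hxn hν hν' hf₀'.1 hf₀'.2.1 hf₀'.2.2)
  have hlip : |f₀.linear ν| ≤ 1 := by
    have := h.adapted.lip f₀ hf₀'.1 (x + (1 : ℝ) • ν) x
    rw [affineMap_add_smul, one_mul, add_sub_cancel_left, one_smul, dist_self_add_left, hν1] at this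
    exact this
  obtain ⟨ρ, hρ, hρ1, hρA⟩ := eventually_dist_lt A x
  refine ⟨ε * |f₀.linear ν|, mul_pos h.eps_pos hκ, ?_⟩
  filter_upwards [hin, Ioo_mem_nhdsGT (half_pos hρ)] with t htT ht
  obtain ⟨B, hB, hθ⟩ := bumpRadius_of_mem (A := A) (Z := planeFunctions A T) (ε := ε) htT
  rw [hθ, mul_assoc]
  congr 1
  have habs : ∀ f : ℝ^(n + k) →ᵃ[ℝ] ℝ, f x = 0 →
      |f (x + t • ν)| = |f.linear ν| * t := fun f hf => by
    rw [affineMap_add_smul, hf, zero_add, abs_mul, abs_of_pos ht.1, mul_comm]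
  have hle : |f₀.linear ν| * t ≤ t := mul_le_of_le_one_left ht.1.le hlip
  refine le_antisymm ?_ (le_gap_iff.2 ⟨by linarith [ht.2], fun f hf => ?_⟩)
  · exact (gap_le_abs ((hB f₀).2 ⟨hf₀'.1, hf₀'.2.1⟩)).trans (habs f₀ hf₀'.2.2).le
  · obtain ⟨hfA, hfZ⟩ := (hB f).1 hf
    by_cases h0 : f x = 0
    · rw [habs f h0]
      exact mul_le_mul_of_nonneg_right (hmin f ((hB₀ f).2 ⟨hfA, hfZ, h0⟩)) ht.1.le
    · have h1 := hρA f hfA h0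
      have h2 := h.adapted.lip f hfA x (x + t • ν)
      rw [dist_self_add_right, norm_smul, hν1, mul_one, norm_eq_abs, abs_of_pos ht.1] at h2
      have h3 := abs_sub_abs_le_abs_sub (f x) (f (x + t • ν))
      linarith [ht.2]

variable [hk : k.AtLeastTwo] {N : Set ℝ^m} [hN : IsAdmissibleTarget k N] {p : N} {u : ℝ^(n + k) → N}
  {b B : Frame (n + k)} {γ : ℝ^(n + k) → ℝ → N} {f : ℝ^k → N} {K : ℝ}

omit hN in
/-- The push map does not change the homotopy classes on small spheres. -/
theorem linkMap_comp_push (hDo : IsOpen D)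
    (hu : ContinuousOn u (D \ Sig)) (hx : x ∈ Sig ∪ cutSet A T) (hxn : finrank ℝ (zeroDir A x) = n)
    (hspan : tangentSpan b = zeroDir A x) {a : CoeffGroup k N p} (ha : HasLinkClass u x b a) :
    HasLinkClass (fun y => u (Φ y)) x b a := by
  have hM := h.adapted_union
  have hopen : IsOpen (D \ Sig) := hDo.sdiff h.polyhedral.isCompact.isClosed
  filter_upwards [ha, hM.eventually_link_notMem hx hxn hspan,
    eventually_link (b := b) (ball_mem_nhds x h.eta_pos)] with r hr hrM hrx
  refine hr.of_homotopy (fun s w => u ((1 - s) • (x + r • normalVec b w) +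
    s • Φ (x + r • normalVec b w))) ?_ (fun w _ => ?_) (fun w _ => ?_)
  · rintro ⟨s, w⟩ ⟨hs, hw⟩
    have hyM := hrM w hw
    have hcell := (h.push.sameCell (x + r • normalVec b w)).segment hs
    have hzM : (1 - s) • (x + r • normalVec b w) + s • Φ (x + r • normalVec b w) ∉
        Sig ∪ cutSet A T := fun h' => hyM ((hM.decides.iff hcell).2 h')
    have hzD : (1 - s) • (x + r • normalVec b w) + s • Φ (x + r • normalVec b w) ∈ D := by
      refine h.ball_subset x (hx.imp_right fun h => h.1) ?_
      have h1 := mem_ball.1 (hrx w hw)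
      have h2 := h.push.dist_le (x + r • normalVec b w)
      have h3 : dist ((1 - s) • (x + r • normalVec b w) + s • Φ (x + r • normalVec b w))
          (x + r • normalVec b w) ≤ η := by
        have e : (1 - s) • (x + r • normalVec b w) + s • Φ (x + r • normalVec b w) -
            (x + r • normalVec b w) =
            s • (Φ (x + r • normalVec b w) - (x + r • normalVec b w)) := by module
        rw [dist_eq_norm, e, norm_smul, ← dist_eq_norm, norm_eq_abs, abs_of_nonneg hs.1]
        exact (mul_le_of_le_one_left dist_nonneg hs.2).trans h2
      refine mem_ball.2 ((dist_triangle _ (x + r • normalVec b w) _).trans_lt ?_)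
      linarith [h.eps_pos]
    have hcu := hu.continuousAt (hopen.mem_nhds ⟨hzD, fun h' => hzM (Or.inl h')⟩)
    have hcΦ := (h.push.lipNear _ hyM).continuousAt
    have hcy : Continuous fun q : ℝ × ℝ^k => x + r • normalVec b q.2 :=
      continuous_const.add (((continuous_normalVec b).comp continuous_snd).const_smul r)
    have hcy' : ContinuousAt (fun q : ℝ × ℝ^k =>
        Φ (x + r • normalVec b q.2)) (s, w) :=
      ContinuousAt.comp (g := Φ) (f := fun q : ℝ × ℝ^k =>
        x + r • normalVec b q.2) hcΦ hcy.continuousAt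
    have hinner : ContinuousAt (fun q : ℝ × ℝ^k =>
        (1 - q.1) • (x + r • normalVec b q.2) + q.1 • Φ (x + r • normalVec b q.2)) (s, w) :=
      (((continuous_const.sub continuous_fst).smul hcy).continuousAt).add
        (continuousAt_fst.smul hcy')
    exact (ContinuousAt.comp (g := u) (f := fun q : ℝ × ℝ^k =>
      (1 - q.1) • (x + r • normalVec b q.2) + q.1 • Φ (x + r • normalVec b q.2)) hcu
        hinner).continuousWithinAt
  · rw [sub_zero, one_smul, zero_smul, add_zero, linkMap_eq]
  · rw [sub_self, zero_smul, one_smul, zero_add, linkMap_eq]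

omit hN in
/-- At the points of the singular set outside `T`, the class on small spheres is not changed. -/
theorem linkMap_insertMap_of_notMem (hDo : IsOpen D) {R : ℝ^(n + k) →L[ℝ] ℝ^k}
    (hu : ContinuousOn u (D \ Sig)) (hx : x ∈ Sig ∪ cutSet A T) (hxT : x ∉ T.carrier)
    (hxn : finrank ℝ (zeroDir A x) = n) (hspan : tangentSpan b = zeroDir A x) {a : CoeffGroup k N p}
    (ha : HasLinkClass u x b a) :
    HasLinkClass (insertMap A T ε Φ u γ f R) x b a := by
  rcases h.lens_or (Or.inl hxT) with h1 | ⟨h1, h2⟩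
  · filter_upwards [h.linkMap_comp_push hDo hu hx hxn hspan ha, eventually_link (b := b)
      (h.eventually_insertMap_eq (u := u) (γ := γ) (f := f) (R := R) h1)] with r hr hr'
    exact hr.congr fun w hw => (hr' w hw).symm
  · refine absurd hx (not_or.2 ⟨h.notMem_sig fun f hf hfZ h0 => ?_, fun h' => hxT h'.1⟩)
    have h3 := h.sign_eq_of_lens h2 h1 hf hfZ
    rw [h0, sign_zero] at h3
    exact h3.2 (sign_eq_zero_iff.1 h3.1.symm)

end IsInsertionSetting

/-! ### The class on small spheres that meet one bubble -/

/-- Continuity of a homotopy that slides the points `Ψ x` to `a` and then follows a path. -/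
theorem continuousOn_slide {X E Y : Type*} [TopologicalSpace X] [NormedAddCommGroup E]
    [NormedSpace ℝ E] [TopologicalSpace Y] {S : Set X} {Ψ : X → E} {a : E} {u : E → Y} {γ : ℝ → Y}
    (hu : ∀ x ∈ S, ∀ t ∈ Icc (0 : ℝ) 1, ContinuousAt u ((1 - t) • Ψ x + t • a))
    (hΨ : ∀ x ∈ S, ContinuousAt Ψ x) (hγ : Continuous γ) (h2 : γ 2 = u a) :
    ContinuousOn (fun q : X × ℝ =>
      if q.2 ≤ 1 then u ((1 - (clampI q.2 : ℝ)) • Ψ q.1 + (clampI q.2 : ℝ) • a) else γ (3 - q.2))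
      (S ×ˢ Icc 0 2) := by
  rw [continuousOn_iff_continuous_domRestrict]
  refine Continuous.if_le (f := fun q : (S ×ˢ Icc (0 : ℝ) 2 : Set (X × ℝ)) => q.1.2)
    (g := fun _ => 1) ?_ (hγ.comp (by fun_prop)) (by fun_prop) continuous_const ?_
  · refine continuous_iff_continuousAt.2 fun q => ?_
    have hcs : Continuous fun q : X × ℝ => (clampI q.2 : ℝ) :=
      continuous_subtype_val.comp (continuous_clampI.comp continuous_snd)
    have hinner : ContinuousAt (fun q : X × ℝ =>
        (1 - (clampI q.2 : ℝ)) • Ψ q.1 + (clampI q.2 : ℝ) • a) q.1 :=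
      ((continuous_const.sub hcs).continuousAt.smul
        ((hΨ _ q.2.1).comp continuousAt_fst)).add (hcs.smul continuous_const).continuousAt
    have hout := ContinuousAt.comp (g := u) (f := fun q : X × ℝ =>
      (1 - (clampI q.2 : ℝ)) • Ψ q.1 + (clampI q.2 : ℝ) • a) (hu _ q.2.1 _ (clampI _).2) hinner
    exact ContinuousAt.comp (f := Subtype.val) (x := q) hout continuous_subtype_val.continuousAt
  · rintro ⟨⟨x, s⟩, hx⟩ (hs : s = 1)
    dsimp only
    rw [hs, clampI_of_ge le_rfl, Icc.coe_one, sub_self, zero_smul, one_smul, zero_add, ← h2]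
    norm_num

namespace IsInsertionSetting

variable {n k m : ℕ} {D Sig : Set ℝ^(n + k)}
  {T : OrientedSimplex (n + 1) (n + k)} {A : Arrangement (n + k)}
  {ε η L c : ℝ} {Φ : ℝ^(n + k) → ℝ^(n + k)} {x : ℝ^(n + k)} [hk : k.AtLeastTwo] {N : Set ℝ^m}
  [hN : IsAdmissibleTarget k N] {p : N} {u : ℝ^(n + k) → N} {b B : Frame (n + k)}
  {γ : ℝ^(n + k) → ℝ → N} {f : ℝ^k → N} {K : ℝ} {g : CoeffGroup k N p}

theorem natAdd_mem_orthogonal (hB : span ℝ (range (extFrame B)) = T.dir) {j : Fin k}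
    (hj : j ≠ 0) : B (natAdd n j) ∈ T.dirᗮ := by
  rw [← hB, Submodule.mem_orthogonal]
  exact fun v hv => (real_inner_comm _ _).trans (mem_span_extFrame_iff.1 hv j hj)

theorem normalVec_eq (w : ℝ^k) :
    normalVec b w = w 0 • b (natAdd n 0) + normalVec b (tailVec w) := by
  have h1 : normalVec b (poleVec k) = b (natAdd n 0) := by
    rw [normalVec, sum_eq_single 0, poleVec_zero, one_smul]
    · intro j _ hj
      rw [poleVec_of_ne hj, zero_smul]
    · simp
  rw [← h1, ← normalVec_smul, ← normalVec_add, tailVec, add_sub_cancel]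

section Frame

variable (hB : span ℝ (range (extFrame B)) = T.dir) (hxT : x ∈ T.carrier)
  (hb0 : b (natAdd n 0) ∈ T.dir) (hbj : ∀ j : Fin k, j ≠ 0 → b (natAdd n j) = B (natAdd n j))

include hB hbj

theorem normalVec_tailVec_mem (w : ℝ^k) : normalVec b (tailVec w) ∈ T.dirᗮ := by
  rw [normalVec]
  refine Submodule.sum_mem _ fun j _ => ?_
  by_cases hj : j = 0
  · rw [hj, tailVec_zero, zero_smul]
    exact Submodule.zero_mem _
  · rw [hbj j hj]
    exact smul_mem _ _ (natAdd_mem_orthogonal hB hj)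

include hxT hb0 in
theorem proj_link (r : ℝ) (w : ℝ^k) :
    T.proj (x + r • normalVec b w) = x + (r * w 0) • b (natAdd n 0) := by
  have h1 : T.proj (x + (r * w 0) • b (natAdd n 0)) = x + (r * w 0) • b (natAdd n 0) := by
    refine planeProj_eq_self ?_
    rw [add_sub_right_comm]
    exact T.dir.add_mem (T.sub_mem_dir hxT 0) (T.dir.smul_mem _ hb0)
  have h2 : x + r • normalVec b w = T.proj (x + (r * w 0) • b (natAdd n 0)) +
      r • normalVec b (tailVec w) := by
    rw [h1, normalVec_eq w, smul_add, smul_smul, add_assoc]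
  rw [h2, OrientedSimplex.proj, planeProj_add (smul_mem _ _
    (normalVec_tailVec_mem hB hbj w))]
  exact h1

include hxT hb0 in
theorem sub_proj_link (r : ℝ) (w : ℝ^k) :
    x + r • normalVec b w - T.proj (x + r • normalVec b w) = r • normalVec b (tailVec w) := by
  rw [proj_link hB hxT hb0 hbj, normalVec_eq w]
  module

omit hB in
theorem normalTail_normalVec (w : ℝ^k) : normalTail B (normalVec b (tailVec w)) = tailVec w := by
  ext j
  rw [normalTail_apply]
  split_ifs with hj
  · rw [hj, tailVec_zero]
  · rw [← hbj j hj, inner_natAdd_normalVec]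

end Frame

/-- The bubble inserted on the side of `T` to which the first normal vector points changes the
homotopy class by the class of the bubble. -/
theorem linkMap_insert (h : IsInsertionSetting D Sig T A ε η L c Φ) (hDo : IsOpen D)
    (hDb : IsBounded D) (hu : ContinuousOn u (D \ Sig))
    (hb : IsBubble A T u p γ f (normalTail B) K) (hg : HasHomotopyClass k N p (capFill p f) g)
    (hB : span ℝ (range (extFrame B)) = T.dir) (hxT : x ∈ T.carrier)
    (hxM : x ∈ Sig ∪ cutSet A T) (hxn : finrank ℝ (zeroDir A x) = n)
    (hspan : tangentSpan b = zeroDir A x) (hb0 : b (natAdd n 0) ∈ T.dir)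
    (hbj : ∀ j : Fin k, j ≠ 0 → b (natAdd n j) = B (natAdd n j))
    (hin : ∀ᶠ t in 𝓝[>] (0 : ℝ), x + t • b (natAdd n 0) ∈ T.carrier) :
    ∀ᶠ r in 𝓝[>] (0 : ℝ), ∀ U U' : ℝ^(n + k) → N, ContinuousOn (linkMap U x b r) (sphere 0 1) →
      ContinuousOn (linkMap U' x b r) (sphere 0 1) →
      (∀ w ∈ sphere (0 : ℝ^k) 1, 0 < w 0 → linkMap U x b r w = u (Φ (x + r • normalVec b w)) ∧
        linkMap U' x b r w = insertMap A T ε Φ u γ f (normalTail B) (x + r • normalVec b w)) →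
      (∀ w ∈ sphere (0 : ℝ^k) 1, w 0 ≤ 0 → linkMap U' x b r w = linkMap U x b r w) →
      ∀ a, HasHomotopyClass k N p (linkMap U x b r) a →
        HasHomotopyClass k N p (linkMap U' x b r) (a + g) := by
  have hM := h.adapted_union
  have hopen : IsOpen (D \ Sig) := hDo.sdiff h.polyhedral.isCompact.isClosed
  have hν : b (natAdd n 0) ∉ zeroDir A x := fun hmem => by
    rw [← hspan, mem_span_tangentFrame_iff] at hmem
    have := hmem 0
    rw [b.inner_eq_ite, if_pos rfl] at this
    exact one_ne_zero this
  obtain ⟨κ, hκ, hev⟩ := h.exists_bumpRadius_eq hxT hxM hxn hb0 hν (b.orthonormal.1 _) hin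
  obtain ⟨t₁, ht₁, hcell⟩ := eventually_sameCell A x (b (natAdd n 0))
  obtain ⟨t₂, ht₂, hκt⟩ := mem_nhdsGT_iff_exists_Ioo_subset.1 hev
  have ht₂ : 0 < t₂ := ht₂
  obtain ⟨c₁, hc₁, hc₁'⟩ := h.exists_le_infDist hDb
  set a₀ := cellPoint A (x + (t₁ / 2) • b (natAdd n 0)) with ha₀
  have hmemD : ∀ᶠ y in 𝓝 x, y ∈ D := hDo.mem_nhds (h.union_subset hxM)
  filter_upwards [Ioo_mem_nhdsGT (lt_min ht₁ ht₂), hM.eventually_link_notMem hxM hxn hspan,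
    eventually_link (b := b) hmemD] with r hr hrM hrD U U' hU hU' hpos hneg a ha
  have hr0 : 0 < r := hr.1
  have hw1 : ∀ w ∈ sphere (0 : ℝ^k) 1, w 0 ≤ 1 := fun w hw => by
    have h1 := norm_sq_eq_pole_add_tail w
    rw [mem_sphere_zero_iff_norm.1 hw] at h1
    nlinarith [sq_nonneg ‖tailVec w‖]
  -- the lens on the side of `T`
  have hlens : ∀ w ∈ sphere (0 : ℝ^k) 1, 0 < w 0 →
      lensRadius A T ε (x + r • normalVec b w) = κ * (r * w 0) ∧
        cellPoint A (T.proj (x + r • normalVec b w)) = a₀ := by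
    intro w hw hw0
    have h1 : r * w 0 < min t₁ t₂ := (mul_le_of_le_one_right hr0.le (hw1 w hw)).trans_lt hr.2
    have h2 : 0 < r * w 0 := mul_pos hr0 hw0
    rw [lensRadius, proj_link hB hxT hb0 hbj]
    exact ⟨hκt ⟨h2, h1.trans_le (min_le_right _ _)⟩, (hcell _ ⟨h2, h1.trans_le (min_le_left _ _)⟩ _
      ⟨half_pos ht₁, half_lt_self ht₁⟩).cellPoint_eq⟩
  have hsub : ∀ w, ‖x + r • normalVec b w - T.proj (x + r • normalVec b w)‖ = r * ‖tailVec w‖ :=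
    fun w => by
      rw [sub_proj_link hB hxT hb0 hbj, norm_smul, norm_normalVec, norm_eq_abs, abs_of_pos hr0]
  have hnorm : ∀ w ∈ sphere (0 : ℝ^k) 1, 0 < w 0 →
      ‖lensVec A T ε (x + r • normalVec b w)‖ = 3 / κ * ‖tailVec w‖ / w 0 := by
    intro w hw hw0
    rw [norm_lensVec h.eps_pos.le, hsub, (hlens w hw hw0).1]
    field_simp
  have hcap : ∀ w ∈ sphere (0 : ℝ^k) 1, 3 / κ * ‖tailVec w‖ ≤ 3 * w 0 → 0 < w 0 := by
    intro w hw h1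
    have h2 : 0 ≤ 3 / κ * ‖tailVec w‖ := by positivity
    refine lt_of_le_of_ne (by linarith) fun h0 => ?_
    rw [← h0, mul_zero] at h1
    have h3 : ‖tailVec w‖ = 0 := by
      have := le_antisymm h1 h2
      rcases mul_eq_zero.1 this with h4 | h4
      · exact absurd h4 (by positivity)
      · exact h4
    have h4 := norm_sq_eq_pole_add_tail w
    rw [mem_sphere_zero_iff_norm.1 hw, h3, ← h0] at h4
    norm_num at h4
  have hcap' : ∀ w ∈ sphere (0 : ℝ^k) 1, 3 / κ * ‖tailVec w‖ ≤ 3 * w 0 →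
        ‖x + r • normalVec b w - T.proj (x + r • normalVec b w)‖ ≤
          lensRadius A T ε (x + r • normalVec b w) ∧
        0 < lensRadius A T ε (x + r • normalVec b w) := by
    intro w hw h1
    have h0 := hcap w hw h1
    rw [hsub, (hlens w hw h0).1]
    refine ⟨?_, by positivity⟩
    rw [div_mul_eq_mul_div, div_le_iff₀ hκ] at h1
    have := mul_le_mul_of_nonneg_left h1 hr0.le
    linarith
  classical
  -- the slide from the map `u ∘ Φ` to the base point
  let Γ : ℝ^k → ℝ → N := fun w s =>
    if s ≤ 1 then u ((1 - (clampI s : ℝ)) • Φ (x + r • normalVec b w) + (clampI s : ℝ) • a₀)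
    else γ a₀ (3 - s)
  have hΓ : ContinuousOn (fun q : ℝ^k × ℝ => Γ q.1 q.2)
      ((sphere 0 1 ∩ {w | 3 / κ * ‖tailVec w‖ ≤ 3 * w 0}) ×ˢ Icc 0 2) := by
    have hγ : Continuous (γ a₀) := continuous_iff_continuousAt.2 fun t =>
      (hb.lip_path _ t).continuousAt
    refine continuousOn_slide (Ψ := fun w => Φ (x + r • normalVec b w)) ?_ ?_ hγ
      (hb.path_right _ _ le_rfl)
    · rintro w ⟨hw, hwc⟩ s hs
      obtain ⟨hl, hl0⟩ := hcap' w hw hwc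
      have hd := hc₁' _ (hrD w hw) (hrM w hw) hl hl0 _ hs
      have hmem := h.segment_mem hl hl0 hs
      rw [(hlens w hw (hcap w hw hwc)).2] at hd hmem
      exact hu.continuousAt (hopen.mem_nhds ⟨hmem, fun hS => by
        rw [infDist_zero_of_mem hS] at hd
        linarith⟩)
    · rintro w ⟨hw, -⟩
      have hcy : Continuous fun w => x + r • normalVec b w :=
        continuous_const.add ((continuous_normalVec b).const_smul r)
      exact ContinuousAt.comp (g := Φ) (f := fun w => x + r • normalVec b w)
        (h.push.lipNear _ (hrM w hw)).continuousAt hcy.continuousAt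
  have hfc : Continuous f := continuous_iff_continuousAt.2 fun ζ => (hb.lip_bubble ζ).continuousAt
  refine HasHomotopyClass.insert_bubble (c := 3 / κ) (by positivity) hU hU' hfc hb.bubble_eq hg Γ hΓ
    (fun w hw hwc => ?_) (fun w hw hwc => ?_) (fun w hw hwc => ?_) (fun w hw hwc hw2 => ?_)
    (fun w hw hwc => ?_) ha
  · simp only [Γ]
    rw [if_pos zero_le_one, clampI_of_le le_rfl, Icc.coe_zero, sub_zero, one_smul, zero_smul,
      add_zero, (hpos w hw (hcap w hw hwc)).1]
  · simp only [Γ]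
    rw [if_neg (by norm_num), hb.path_left _ _ (by norm_num)]
  · rcases lt_or_ge 0 (w 0) with h0 | h0
    · rw [(hpos w hw h0).1, (hpos w hw h0).2]
      refine insertMap_of_le h.eps_pos.le ?_
      rw [hsub, (hlens w hw h0).1]
      rw [div_mul_eq_mul_div, lt_div_iff₀ hκ] at hwc
      have := mul_lt_mul_of_pos_left hwc hr0
      linarith
    · exact hneg w hw h0
  · have h0 := hcap w hw hwc
    have hn := hnorm w hw h0
    have h3 : 3 / κ * ‖tailVec w‖ / w 0 ≤ 3 := (div_le_iff₀ h0).2 hwc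
    have h1 : 1 ≤ 3 / κ * ‖tailVec w‖ / w 0 := (one_le_div h0).2 hw2
    rw [(hpos w hw h0).2, insertMap, if_neg (hcap' w hw hwc).2.ne', hn, (hlens w hw h0).2,
      min_eq_right (by linarith)]
    simp only [Γ, slideTime, hn]
    by_cases h2 : 2 ≤ 3 / κ * ‖tailVec w‖ / w 0
    · rw [if_pos h2, if_pos (by linarith)]
    · rw [if_neg h2, if_pos h1, if_neg (by linarith), sub_sub_cancel]
  · have h0 : 0 < w 0 := by
      refine hcap w hw (hwc.trans ?_)
      have : 0 ≤ 3 / κ * ‖tailVec w‖ := by positivity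
      linarith
    have hn := hnorm w hw h0
    have h1 : 3 / κ * ‖tailVec w‖ / w 0 ≤ 1 := (div_le_one h0).2 hwc
    have hθ := (hlens w hw h0).1
    have hθ0 : 0 < κ * (r * w 0) := by positivity
    have hR : normalTail B (lensVec A T ε (x + r • normalVec b w)) = (3 / κ / w 0) • tailVec w := by
      rw [lensVec, hθ, sub_proj_link hB hxT hb0 hbj, map_smul, map_smul, normalTail_normalVec hbj,
        smul_smul]
      congr 1
      field_simp
    rw [(hpos w hw h0).2, insertMap, if_neg (hθ ▸ hθ0.ne'), hn, if_neg (by linarith), hR]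
    split_ifs with h2
    · rw [hb.path_left _ _ h1, hb.bubble_eq]
      rw [tailVec_smul, norm_smul, norm_eq_abs, abs_of_pos (by positivity)]
      have e : tailVec (tailVec w) = tailVec w := by
        rw [tailVec, tailVec_zero, zero_smul, sub_zero]
      rw [e]
      calc (1 : ℝ) ≤ 3 / κ * ‖tailVec w‖ / w 0 := h2
        _ = _ := by ring
    · rfl

end IsInsertionSetting

/-! ### Frames adapted to the simplex -/

section Frames

variable {n k : ℕ} [hk : k.AtLeastTwo] {b B : Frame (n + k)}

/-- A frame of `ℝ^{n+k}` adapted to an `n`-plane and an `(n+1)`-plane containing it. -/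
theorem exists_frame (b B : Frame (n + k)) (h : tangentSpan b ≤ span ℝ (range (extFrame B))) :
    ∃ b' : Frame (n + k), tangentFrame b' = tangentFrame b ∧
        ∀ j : Fin k, j ≠ 0 → b' (natAdd n j) = B (natAdd n j) := by
  have hbB : ∀ (i : Fin n) (j : Fin k), j ≠ 0 →
      inner ℝ (B (natAdd n j)) (b (castAdd k i)) = (0 : ℝ) := fun i j hj =>
    mem_span_extFrame_iff.1 (h (subset_span ⟨i, rfl⟩)) j hj
  let v : Fin (n + k) → ℝ^(n + k) := Fin.append (tangentFrame b) fun j => B (natAdd n j)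
  have hv : Orthonormal ℝ (({natAdd n 0}ᶜ : Set (Fin (n + k))).domRestrict v) := by
    rw [orthonormal_iff_ite]
    rintro ⟨i, hi⟩ ⟨i', hi'⟩
    simp only [Set.domRestrict_apply, v, Subtype.mk.injEq]
    induction i using Fin.addCases with
    | left i =>
      induction i' using Fin.addCases with
      | left i' => simp [tangentFrame, b.inner_eq_ite]
      | right j' =>
        rw [Fin.append_left, Fin.append_right, real_inner_comm, tangentFrame,
          hbB _ _ fun h => hi' (by rw [h]; rfl), if_neg (castAdd_ne_natAdd _ _)]
    | right j =>
      induction i' using Fin.addCases with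
      | left i' =>
        rw [Fin.append_left, Fin.append_right, tangentFrame,
          hbB _ _ fun h => hi (by rw [h]; rfl), if_neg (castAdd_ne_natAdd _ _).symm]
      | right j' => simp [B.inner_eq_ite]
  obtain ⟨b', hb'⟩ := Orthonormal.exists_orthonormalBasis_extension_of_card_eq
    (ι := Fin (n + k)) (𝕜 := ℝ) (by simp) hv
  refine ⟨b', funext fun i => ?_, fun j hj => ?_⟩
  · exact (hb' _ (castAdd_ne_natAdd _ _)).trans (Fin.append_left _ _ i)
  · exact (hb' _ fun h => hj (by simpa using h)).trans (Fin.append_right _ _ j)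

theorem span_extFrame_eq (h : ∀ j : Fin k, j ≠ 0 → b (natAdd n j) = B (natAdd n j)) :
    span ℝ (range (extFrame b)) = span ℝ (range (extFrame B)) := by
  ext v
  rw [mem_span_extFrame_iff, mem_span_extFrame_iff]
  exact forall₂_congr fun j hj => by rw [h j hj]

omit hk in
theorem det_normal_of_tangentFrame_eq {b' : Frame (n + k)}
    (htan : tangentFrame b' = tangentFrame b) :
    (of fun i j : Fin k => inner ℝ (b (natAdd n i)) (b' (natAdd n j))).det =
      (frameMatrix b).det * (frameMatrix b').det := by
  rw [← det_tangent_mul_det_normal b b' (by rw [htan]), htan,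
    show (of fun i j : Fin n => inner ℝ (tangentFrame b i) (tangentFrame b j)) = 1 from
      Matrix.ext fun i j => orthonormal_iff_ite.1 (orthonormal_tangentFrame b) i j,
    det_one, one_mul]

/-- A change of the normal vectors of the frame multiplies the class by the sign of its
determinant. -/
theorem IsAdapted.linkMap_reframe {m : ℕ} {N : Set ℝ^m}
    [IsAdmissibleTarget k N] {p : N} {b' : Frame (n + k)} {A : Arrangement (n + k)}
    {D M : Set ℝ^(n + k)} {u : ℝ^(n + k) → N} {x : ℝ^(n + k)} (hA : IsAdapted A n M)
    (hMD : M ⊆ D) (hDo : IsOpen D) (hu : ContinuousOn u (D \ M)) (hx : x ∈ M)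
    (hxn : finrank ℝ (zeroDir A x) = n) (hspan : tangentSpan b = zeroDir A x)
    (htan : tangentFrame b' = tangentFrame b) {a : CoeffGroup k N p} (ha : HasLinkClass u x b a) :
    HasLinkClass u x b'
      ((SignType.sign ((frameMatrix b).det * (frameMatrix b').det) : ℤ) • a) := by
  rw [← det_normal_of_tangentFrame_eq htan]
  filter_upwards [ha, hA.eventually_continuousOn_linkMap hMD hDo hu hx hxn hspan] with r hr hc
  exact hr.linkMap_change_frame hc (by rw [htan])

end Frames

/-! ### The class around the points of the simplex -/

namespace IsInsertionSetting

variable {n k m : ℕ} {D Sig : Set ℝ^(n + k)}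
  {T : OrientedSimplex (n + 1) (n + k)} {A : Arrangement (n + k)}
  {ε η L c : ℝ} {Φ : ℝ^(n + k) → ℝ^(n + k)} {x ν : ℝ^(n + k)}

theorem eventually_mem_carrier (hx : x ∈ T.carrier) (hν : ν ∈ T.dir)
    (h : ∀ i, T.coord i x = 0 → 0 < (T.coord i).linear ν) :
    ∀ᶠ t in 𝓝[>] (0 : ℝ), x + t • ν ∈ T.carrier := by
  have h1 : ∀ i, ∀ᶠ t in 𝓝[>] (0 : ℝ), 0 ≤ T.coord i (x + t • ν) := by
    intro i
    rcases (T.mem_carrier_iff_coord.1 hx).2 i |>.eq_or_lt with h0 | h0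
    · filter_upwards [self_mem_nhdsWithin] with t (ht : 0 < t)
      rw [affineMap_add_smul, ← h0, zero_add]
      exact mul_nonneg ht.le (h i h0.symm).le
    · have hc : ContinuousAt (fun t : ℝ => T.coord i x + t * (T.coord i).linear ν) 0 := by fun_prop
      have h2 := hc.eventually (lt_mem_nhds (a := 0) (by simpa using h0))
      filter_upwards [nhdsWithin_le_nhds h2] with t ht
      rw [affineMap_add_smul]
      exact le_of_lt ht
  filter_upwards [eventually_all.2 h1] with t ht
  refine T.mem_carrier_iff_coord.2 ⟨?_, ht⟩
  rw [add_sub_right_comm]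
  exact T.dir.add_mem (T.sub_mem_dir hx 0) (T.dir.smul_mem _ hν)

variable [hk : k.AtLeastTwo] {N : Set ℝ^m} [hN : IsAdmissibleTarget k N] {p : N} {u : ℝ^(n + k) → N}
  {b b' B : Frame (n + k)} {γ : ℝ^(n + k) → ℝ → N} {f : ℝ^k → N} {K : ℝ} {g a : CoeffGroup k N p}

omit hN in
theorem natAdd_zero_mem_dir (hB : span ℝ (range (extFrame B)) = T.dir)
    (hbj : ∀ j : Fin k, j ≠ 0 → b (natAdd n j) = B (natAdd n j)) :
    b (natAdd n 0) ∈ T.dir := by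
  rw [← hB, ← span_extFrame_eq hbj, mem_span_extFrame_iff]
  exact fun j hj => by rw [b.inner_eq_ite, if_neg (by simpa using hj)]

/-- At a generic point, at most one barycentric coordinate vanishes. -/
theorem coord_pos (h : IsInsertionSetting D Sig T A ε η L c Φ) (hxT : x ∈ T.carrier)
    (hB : span ℝ (range (extFrame B)) = T.dir) (hspan : tangentSpan b = zeroDir A x)
    (hbj : ∀ j : Fin k, j ≠ 0 → b (natAdd n j) = B (natAdd n j))
    {i : Fin (n + 2)} (hi : T.coord i x = 0) :
    (T.coord i).linear (b (natAdd n 0)) ≠ 0 ∧ ∀ j ≠ i, 0 < T.coord j x := by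
  have hb : span ℝ (range (extFrame b)) = T.dir := (span_extFrame_eq hbj).trans hB
  have hz : ∀ l, T.coord l x = 0 → ∀ v ∈ zeroDir A x, (T.coord l).linear v = 0 := by
    intro l hl v hv
    obtain ⟨s, hs, hs1, hs2⟩ := lipNormalize_eq (T.coord l)
    have := hv _ (h.coord_mem l) (by rw [hs1, hl, mul_zero])
    rw [hs2] at this
    exact (mul_eq_zero.1 this).resolve_left hs.ne'
  -- every direction of `T` is the sum of one along the cell of `x` and a multiple of `b_n`
  have hdec : ∀ l, T.coord l x = 0 → ∀ v ∈ T.dir, (T.coord l).linear v =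
      inner ℝ (b (natAdd n 0)) v * (T.coord l).linear (b (natAdd n 0)) := by
    intro l hl v hv
    have hmem : v - inner ℝ (b (natAdd n 0)) v • b (natAdd n 0) ∈ zeroDir A x := by
      rw [← hspan, mem_span_tangentFrame_iff]
      intro j
      rw [inner_sub_right, inner_smul_right, b.inner_eq_ite]
      by_cases hj : j = 0
      · simp [hj]
      · rw [if_neg (by simpa using hj), mul_zero, sub_zero]
        exact mem_span_extFrame_iff.1 (hb ▸ hv) j hj
    have := hz l hl _ hmem
    rwa [map_sub, map_smul, smul_eq_mul, sub_eq_zero] at this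
  have hne : ∀ l, T.coord l x = 0 → (T.coord l).linear (b (natAdd n 0)) ≠ 0 := by
    intro l hl h0
    have := hdec l hl (T.points l - x) (by
      rw [← neg_sub]; exact T.dir.neg_mem (T.sub_mem_dir hxT l))
    rw [h0, mul_zero, affineMap_sub, T.coord_point, if_pos rfl, hl] at this
    norm_num at this
  refine ⟨hne i hi, fun j hj => lt_of_le_of_ne ((T.mem_carrier_iff_coord.1 hxT).2 j) fun hj0 => ?_⟩
  have hm : T.points j - x ∈ T.dir := by
    rw [← neg_sub]; exact T.dir.neg_mem (T.sub_mem_dir hxT j)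
  have h1 := hdec i hi _ hm
  have h2 := hdec j hj0.symm _ hm
  rw [affineMap_sub, T.coord_point, if_neg hj.symm, hi, sub_zero, eq_comm, mul_eq_zero] at h1
  rw [h1.resolve_right (hne i hi), zero_mul, affineMap_sub, T.coord_point, if_pos rfl, ← hj0] at h2
  norm_num at h2

section LocalClass

variable (h : IsInsertionSetting D Sig T A ε η L c Φ) (hDo : IsOpen D)
  (hDb : IsBounded D) (hu : ContinuousOn u (D \ Sig))
  (hcΦ : ContinuousOn (fun y => u (Φ y)) (D \ (Sig ∪ cutSet A T)))
  (hcI : ContinuousOn (insertMap A T ε Φ u γ f (normalTail B)) (D \ (Sig ∪ cutSet A T)))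
  (hb : IsBubble A T u p γ f (normalTail B) K) (hg : HasHomotopyClass k N p (capFill p f) g)
  (hB : span ℝ (range (extFrame B)) = T.dir) (hxT : x ∈ T.carrier)
  (hxM : x ∈ Sig ∪ cutSet A T) (hxn : finrank ℝ (zeroDir A x) = n)
  (hspan : tangentSpan b = zeroDir A x) (hbj : ∀ j : Fin k, j ≠ 0 → b (natAdd n j) = B (natAdd n j))

include h hB hxT hxM hbj in
omit hN in
/-- On the part of a small sphere that projects outside `T`, the bubble is not seen. -/
theorem insertMap_link_of_notMem {r : ℝ} {w : ℝ^k}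
    (hw : r * w 0 = 0 ∨ x + (r * w 0) • b (natAdd n 0) ∉ T.carrier) :
    insertMap A T ε Φ u γ f (normalTail B) (x + r • normalVec b w) =
      u (Φ (x + r • normalVec b w)) := by
  have hb0 := natAdd_zero_mem_dir hB hbj
  refine insertMap_of_le h.eps_pos.le ((not_lt.1 fun h0 => ?_).trans (norm_nonneg _))
  have h1 := h.proj_mem h0
  rw [proj_link hB hxT hb0 hbj] at h1
  rcases hw with hw | hw
  · rw [hw, zero_smul, add_zero] at h1
    exact h1.2 hxM
  · exact hw h1.1

include h hDo hDb hu hcΦ hcI hb hg hB hxT hxM hxn hspan hbj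

/-- At a generic point of a face of `T`, only the side of the face in `T` carries a bubble. -/
theorem linkMap_insertMap_of_coord_eq_zero {i : Fin (n + 2)} (hi : T.coord i x = 0)
    (hpos : 0 < (T.coord i).linear (b (natAdd n 0))) (ha : HasLinkClass (fun y => u (Φ y)) x b a) :
    HasLinkClass (insertMap A T ε Φ u γ f (normalTail B)) x b (a + g) := by
  have hb0 := natAdd_zero_mem_dir hB hbj
  have hcp := (h.coord_pos hxT hB hspan hbj hi).2
  have hin := eventually_mem_carrier hxT hb0 fun j hj => by
    by_cases hij : j = i
    · rwa [hij]
    · exact absurd hj (hcp j hij).ne'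
  filter_upwards [ha, h.linkMap_insert hDo hDb hu hb hg hB hxT hxM hxn hspan hb0 hbj hin,
    h.adapted_union.eventually_continuousOn_linkMap h.union_subset hDo hcΦ hxM hxn hspan,
    h.adapted_union.eventually_continuousOn_linkMap h.union_subset hDo hcI hxM hxn hspan,
    self_mem_nhdsWithin] with r hr hins hc1 hc2 (hr0 : 0 < r)
  refine hins _ _ hc1 hc2 (fun w _ _ => ⟨rfl, rfl⟩) (fun w _ hw0 => ?_) a hr
  refine h.insertMap_link_of_notMem hB hxT hxM hbj ?_
  rcases hw0.eq_or_lt with h0 | h0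
  · exact Or.inl (by rw [h0, mul_zero])
  · refine Or.inr fun hT => ?_
    have h1 := (T.mem_carrier_iff_coord.1 hT).2 i
    rw [affineMap_add_smul, hi, zero_add] at h1
    have := mul_neg_of_neg_of_pos (mul_neg_of_pos_of_neg hr0 h0) hpos
    linarith

/-- At the interior points of `T` that belong to the singular set, two bubbles of opposite
orientation are inserted, on both sides of the singular set. -/
theorem linkMap_insertMap_of_coord_pos (hpos : ∀ i, 0 < T.coord i x)
    (ha : HasLinkClass (fun y => u (Φ y)) x b a) :
    HasLinkClass (insertMap A T ε Φ u γ f (normalTail B)) x b a := by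
  have hb0 := natAdd_zero_mem_dir hB hbj
  obtain ⟨b', hb'0, hb'i, hdet⟩ := exists_flip b (natAdd n 0)
  have hb'j : ∀ j : Fin k, j ≠ 0 → b' (natAdd n j) = B (natAdd n j) := fun j hj => by
    rw [hb'i _ (by simpa using hj), hbj j hj]
  have htan : tangentFrame b' = tangentFrame b := funext fun i => hb'i _ (castAdd_ne_natAdd _ _)
  have hspan' : tangentSpan b' = zeroDir A x := by rw [htan, hspan]
  have hin : ∀ ν ∈ T.dir, ∀ᶠ t in 𝓝[>] (0 : ℝ), x + t • ν ∈ T.carrier := fun ν hν =>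
    eventually_mem_carrier hxT hν fun i hi => absurd hi (hpos i).ne'
  have hb'0T : b' (natAdd n 0) ∈ T.dir := hb'0 ▸ T.dir.neg_mem hb0
  have hc := fun (b : Frame (n + k))
    (hs : tangentSpan b = zeroDir A x) =>
    (h.adapted_union.eventually_continuousOn_linkMap h.union_subset hDo hcΦ hxM hxn hs).and
    (h.adapted_union.eventually_continuousOn_linkMap h.union_subset hDo hcI hxM hxn hs)
  set u' := insertMap A T ε Φ u γ f (normalTail B) with hu'
  -- the bubble is inserted on one side only
  let U : ℝ^(n + k) → N := fun y =>
    if inner ℝ (b (natAdd n 0)) (y - x) ≤ (0 : ℝ) then u (Φ y) else u' y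
  have hU : ∀ r w, linkMap U x b r w = if r * w 0 ≤ 0 then u (Φ (x + r • normalVec b w)) else
      u' (x + r • normalVec b w) := fun r w => by
    rw [linkMap_eq]
    simp only [U]
    rw [add_sub_cancel_left, inner_smul_right, inner_natAdd_normalVec]
  have hU' : ∀ r w, linkMap U x b' r w = if 0 ≤ r * w 0 then u (Φ (x + r • normalVec b' w)) else
      u' (x + r • normalVec b' w) := fun r w => by
    rw [linkMap_eq]
    simp only [U]
    rw [add_sub_cancel_left, ← neg_neg (b (natAdd n 0)), ← hb'0, inner_neg_left,
      inner_smul_right, inner_natAdd_normalVec]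
    simp only [neg_nonpos]
  have hw0 : ∀ r, Continuous fun w : ℝ^k => r * w 0 := fun r => by fun_prop
  filter_upwards [ha, h.linkMap_insert hDo hDb hu hb hg hB hxT hxM hxn hspan hb0 hbj (hin _ hb0),
    h.linkMap_insert hDo hDb hu hb hg hB hxT hxM hxn hspan' hb'0T hb'j (hin _ hb'0T),
    hc b hspan, hc b' hspan', self_mem_nhdsWithin] with r hr h1 h2 ⟨hc1, hc2⟩ ⟨hc1', hc2'⟩
      (hr0 : 0 < r)
  have hcU : ContinuousOn (linkMap U x b r) (sphere 0 1) := by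
    refine (continuousOn_if_le' (hw0 r) continuous_const (hc1.mono inter_subset_left)
      (hc2.mono inter_subset_left) fun w _ hw => ?_).congr fun w _ => hU r w
    exact (h.insertMap_link_of_notMem hB hxT hxM hbj (Or.inl hw)).symm
  have hcU' : ContinuousOn (linkMap U x b' r) (sphere 0 1) := by
    refine (continuousOn_if_le' continuous_const (hw0 r) (hc1'.mono inter_subset_left)
      (hc2'.mono inter_subset_left) fun w _ hw => ?_).congr fun w _ => hU' r w
    exact (h.insertMap_link_of_notMem hB hxT hxM hb'j (Or.inl hw.symm)).symm
  have s1 := h1 _ U hc1 hcU (fun w _ hw => ⟨rfl, by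
    rw [hU, if_neg (by have := mul_pos hr0 hw; linarith)]⟩) (fun w _ hw => by
    rw [hU, if_pos (mul_nonpos_of_nonneg_of_nonpos hr0.le hw)]; rfl) a hr
  have s2 := s1.linkMap_change_frame hcU (b' := b') (by rw [htan])
  have hsgn := fun (b b' : Frame (n + k))
    (e : tangentFrame b' = tangentFrame b) => det_normal_of_tangentFrame_eq e
  have hneg : (frameMatrix b).det * (frameMatrix b').det < 0 := by
    rw [hdet, mul_neg]
    exact neg_neg_of_pos (mul_self_pos.2 (det_frameMatrix_ne_zero b))
  rw [hsgn b b' htan, sign_neg hneg] at s2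
  have s3 := h2 U u' hcU' hc2' (fun w _ hw => ⟨by
    rw [hU', if_pos (mul_pos hr0 hw).le], rfl⟩) (fun w _ hw => by
    rw [hU']
    rcases hw.eq_or_lt with hw | hw
    · rw [hw, mul_zero, if_pos le_rfl]
      exact h.insertMap_link_of_notMem hB hxT hxM hb'j (Or.inl (by rw [hw, mul_zero]))
    · rw [if_neg (by have := mul_neg_of_pos_of_neg hr0 hw; linarith)]; rfl) _ s2
  have s4 := s3.linkMap_change_frame hc2' (b' := b) (by rw [htan])
  rw [hsgn b' b htan.symm, mul_comm, sign_neg hneg] at s4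
  simpa using s4

end LocalClass

/-- At almost every point of the singular set that lies in `T`, inserting bubbles changes the class
on small spheres by the multiplicity of the boundary of `T`. -/
theorem linkMap_insertMap (h : IsInsertionSetting D Sig T A ε η L c Φ) (hDo : IsOpen D)
    (hDb : IsBounded D) (hu : ContinuousOn u (D \ Sig))
    (hcΦ : ContinuousOn (fun y => u (Φ y)) (D \ (Sig ∪ cutSet A T)))
    (hcI : ContinuousOn (insertMap A T ε Φ u γ f (normalTail B)) (D \ (Sig ∪ cutSet A T)))
    (hb : IsBubble A T u p γ f (normalTail B) K)
    (hg : HasHomotopyClass k N p (capFill p f) (((-1) ^ (n + 1) * T.sign (extFrame B)) • g))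
    (hB : span ℝ (range (extFrame B)) = T.dir) (hBpos : 0 < (frameMatrix B).det)
    (hxT : x ∈ T.carrier) (hxM : x ∈ Sig ∪ cutSet A T) (hxn : finrank ℝ (zeroDir A x) = n)
    (hspan : tangentSpan b = zeroDir A x) (hbpos : IsPositivelyOriented b)
    (hF : ∀ i, x ∈ (T.oppositeFace i).carrier → (T.oppositeFace i).dir = zeroDir A x)
    (ha : HasLinkClass u x b a) :
    HasLinkClass (insertMap A T ε Φ u γ f (normalTail B)) x b
      (a + chainMultiplicity (∑ i, Finsupp.single (T.oppositeFace i) ((-1 : ℤ) ^ (i : ℕ) • g)) x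
        (tangentFrame b)) := by
  have ha := h.linkMap_comp_push hDo hu hxM hxn hspan ha
  have hle : tangentSpan b ≤ span ℝ (range (extFrame B)) := by
    rw [hspan, hB]; exact h.zeroDir_le x hxT
  obtain ⟨b₁, htan₁, hb₁j⟩ := exists_frame b B hle
  rw [chainMultiplicity_finset_sum]
  simp only [chainMultiplicity_single, T.mem_oppositeFace_iff, hxT, true_and] at hF ⊢
  have hcoord := (T.mem_carrier_iff_coord.1 hxT).2
  have hre := fun (b b' : Frame (n + k))
    (v : ℝ^(n + k) → N) (a' : CoeffGroup k N p) =>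
    h.adapted_union.linkMap_reframe (b := b) (b' := b') (u := v) (a := a') h.union_subset hDo
      (hx := hxM) (hxn := hxn)
  by_cases hi : ∃ i, T.coord i x = 0
  · obtain ⟨i, hi⟩ := hi
    obtain ⟨b₂, htan, hbj, hpos⟩ : ∃ b₂ : Frame (n + k),
        tangentFrame b₂ = tangentFrame b ∧ (∀ j : Fin k, j ≠ 0 → b₂ (natAdd n j) = B (natAdd n j)) ∧
        0 < (T.coord i).linear (b₂ (natAdd n 0)) := by
      rcases lt_or_gt_of_ne (h.coord_pos hxT hB (htan₁ ▸ hspan) hb₁j hi).1 with hlt | hgt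
      · obtain ⟨b₂, h0, hne, -⟩ := exists_flip b₁ (natAdd n 0)
        refine ⟨b₂, htan₁ ▸ funext fun i => hne _ (castAdd_ne_natAdd _ _), fun j hj => ?_, ?_⟩
        · rw [hne _ (by simpa using hj), hb₁j j hj]
        · rw [h0, map_neg]; linarith
      · exact ⟨b₁, htan₁, hb₁j, hgt⟩
    have hspan₂ : tangentSpan b₂ = zeroDir A x := htan ▸ hspan
    have s1 := h.linkMap_insertMap_of_coord_eq_zero hDo hDb hu hcΦ hcI hb hg hB hxT hxM hxn hspan₂
      hbj hi hpos (hre b b₂ _ _ hcΦ hspan htan ha)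
    have s2 := hre b₂ b _ _ hcI hspan₂ htan.symm s1
    rw [sum_eq_single i (fun j _ hj => if_neg
      ((h.coord_pos hxT hB hspan₂ hbj hi).2 j hj).ne') (by simp), if_pos hi]
    rw [isPositivelyOriented_iff] at hbpos
    have hsgn : ∀ s : ℝ, SignType.sign (s * (frameMatrix b).det) = SignType.sign s := fun s => by
      rw [sign_mul, sign_pos hbpos, mul_one]
    rw [hsgn, mul_comm, hsgn, smul_add, smul_smul,
      sign_mul_sign_self (det_frameMatrix_ne_zero b₂), one_smul, smul_smul] at s2
    rw [smul_smul]
    have hdir : T.dir = span ℝ (range (extFrame b₂)) := by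
      rw [span_extFrame_eq hbj, hB]
    have e1 := T.sign_eq_mul_sign hdir (orthonormal_extFrame B) hB.symm
    rw [det_extFrame hbj, sign_mul, sign_pos hBpos, mul_one] at e1
    have e2 := T.sign_snoc i (e := tangentFrame b) (ν := b₂ (natAdd n 0))
      (by rw [hF i hi, hspan]) (htan ▸ extFrame_eq_snoc b₂ ▸ hdir) (fun j => by
        rw [← htan]; exact b₂.inner_eq_zero (castAdd_ne_natAdd _ _).symm) (b₂.orthonormal.1 _) hpos
    have e3 : T.sign (extFrame b₂) = (-1) ^ (n + 1 + (i : ℕ)) *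
        (T.oppositeFace i).sign (tangentFrame b) := by rw [← e2, ← htan, extFrame_eq_snoc]
    convert s2 using 3
    have e4 : ((-1 : ℤ) ^ (n + 1)) * (-1) ^ (n + 1) = 1 := by
      rw [← mul_pow]; simp
    rw [mul_left_comm, ← e1, e3, pow_add _ (n + 1), ← mul_assoc, ← mul_assoc, e4, one_mul, mul_comm]
  · push Not at hi
    have s1 := h.linkMap_insertMap_of_coord_pos hDo hDb hu hcΦ hcI hb hg hB hxT hxM hxn
      (htan₁ ▸ hspan) hb₁j (fun i => lt_of_le_of_ne (hcoord i) (hi i).symm)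
      (hre b b₁ _ _ hcΦ hspan htan₁ ha)
    have s2 := hre b₁ b _ _ hcI (htan₁ ▸ hspan) htan₁.symm s1
    rw [smul_smul, mul_comm (frameMatrix b₁).det, sign_mul_sign_self (mul_ne_zero
      (det_frameMatrix_ne_zero b) (det_frameMatrix_ne_zero b₁)), one_smul] at s2
    rwa [sum_eq_zero fun i _ => if_neg (hi i), add_zero]

end IsInsertionSetting

/-! ### The topological singular set of the new map -/

section Final

variable {n k m : ℕ} [hk : k.AtLeastTwo] {N : Set ℝ^m}
  [hN : IsAdmissibleTarget k N] {p : N} {u : ℝ^(n + k) → N}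

/-- A constant is freely homotopic to the constant base point, as the target is path connected. -/
theorem hasHomotopyClass_const (q : N) : HasHomotopyClass k N p (fun _ => q) 0 := by
  obtain ⟨γ⟩ := hN.joined q p
  have h := GenLoop.hasHomotopyClass (φ := fun _ : ℝ^k => p)
    (GenLoop.const : Ω^ (Fin (k - 1)) N p) fun t => rfl
  refine h.of_homotopy (fun t _ => γ.extend t) ?_ (fun w _ => γ.extend_zero) fun w _ => γ.extend_one
  exact (γ.continuous_extend.comp continuous_fst).continuousOn

/-- Around a point where `u` is continuous, the class of `u` on small spheres is trivial. -/
theorem eventually_linkMap_class_zero {O : Set ℝ^(n + k)} (hO : IsOpen O)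
    (hu : ContinuousOn u O) {x : ℝ^(n + k)} (hx : x ∈ O) (b : Frame (n + k)) :
    HasLinkClass u x b (0 : CoeffGroup k N p) := by
  obtain ⟨δ, hδ, hball⟩ := isOpen_iff.1 hO x hx
  filter_upwards [Ioo_mem_nhdsGT hδ] with r hr
  refine (hasHomotopyClass_const (u x)).of_homotopy (fun t w => u (x + (t * r) • normalVec b w))
    ?_ (fun w _ => by rw [zero_mul, zero_smul, add_zero])
    fun w _ => by rw [one_mul, linkMap_eq]
  have hc : Continuous fun q : ℝ × ℝ^k => x + (q.1 * r) • normalVec b q.2 :=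
    continuous_const.add ((continuous_fst.mul continuous_const).smul
      ((continuous_normalVec b).comp continuous_snd))
  refine hu.comp hc.continuousOn ?_
  rintro ⟨t, w⟩ ⟨ht, hw⟩
  refine hball ?_
  rw [mem_ball, dist_self_add_left, norm_smul, norm_normalVec, mem_sphere_zero_iff_norm.1 hw,
    mul_one, norm_eq_abs, abs_of_nonneg (mul_nonneg ht.1 hr.1.le)]
  exact (mul_le_of_le_one_left hr.1.le ht.2).trans_lt hr.2

variable {D Sig : Set ℝ^(n + k)} {T : OrientedSimplex (n + 1) (n + k)} {A : Arrangement (n + k)}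
  {ε η L c : ℝ} {Φ : ℝ^(n + k) → ℝ^(n + k)} {B : Frame (n + k)}
  {γ : ℝ^(n + k) → ℝ → N} {f : ℝ^k → N} {K : ℝ} {g : CoeffGroup k N p}

omit hk in
/-- A barycentric coordinate vanishes on its face and does not vanish identically on `T`. -/
theorem IsInsertionSetting.oppositeFace_subset (h : IsInsertionSetting D Sig T A ε η L c Φ)
    (i : Fin (n + 2)) : (T.oppositeFace i).carrier ⊆ cutSet A T := by
  intro x hx
  rw [T.mem_oppositeFace_iff] at hx
  obtain ⟨s, hs, hs1, -⟩ := lipNormalize_eq (T.coord i)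
  refine ⟨hx.1, _, h.coord_mem i, ⟨i, ?_⟩, by rw [hs1, hx.2, mul_zero]⟩
  rw [hs1, T.coord_point, if_pos rfl, mul_one]
  exact hs.ne'

/-- The chain `g ∂⟦T⟧` is the change of the topological singular set under the insertion of
bubbles. -/
theorem IsInsertionSetting.isTopologicalSingularSet (h : IsInsertionSetting D Sig T A ε η L c Φ)
    (hDo : IsOpen D) (hDb : IsBounded D) (hu : HasNiceSingularity D Sig u)
    (hb : IsBubble A T u p γ f (normalTail B) K)
    (hg : HasHomotopyClass k N p (capFill p f) (((-1) ^ (n + 1) * T.sign (extFrame B)) • g))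
    (hB : span ℝ (range (extFrame B)) = T.dir) (hBpos : 0 < (frameMatrix B).det)
    {S : PolyhedralChain (CoeffGroup k N p) n (n + k)} (hS : IsTopologicalSingularSet u Sig S) :
    IsTopologicalSingularSet (insertMap A T ε Φ u γ f (normalTail B)) (Sig ∪ cutSet A T)
      (S + simplexBoundary g T) := by
  obtain ⟨s, rfl, hs1, hs2⟩ := hS
  obtain ⟨C, hC, hlip⟩ := hu.exists_lipNear hDo h.polyhedral.isCompact.isClosed
    h.polyhedral.nonempty
  have huc := hu.continuousOn
  have hcΦ : ContinuousOn (fun y => u (Φ y)) (D \ (Sig ∪ cutSet A T)) := fun x hx =>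
    (h.lipNear_comp_push hC hlip hx).continuousAt.continuousWithinAt
  have hcI := (h.memSobolev_and_hasNiceSingularity hDo hDb hb hu).2.continuousOn
  refine ⟨s + ∑ i, Finsupp.single (T.oppositeFace i) ((-1 : ℤ) ^ (i : ℕ) • g), ?_,
    fun e he => ?_, fun b hbpos => ?_⟩
  · rw [simplexBoundary, QuotientAddGroup.mk_add]
    congr 1
    rw [← QuotientAddGroup.mk'_apply, map_sum]
    refine sum_congr rfl fun i _ => ?_
    rw [simplexChain, ← Finsupp.smul_single]
    rfl
  · filter_upwards [hs1 e he] with x hx hxM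
    rw [chainMultiplicity_add, hx fun h' => hxM (Or.inl h'), zero_add, chainMultiplicity_finset_sum]
    refine sum_eq_zero fun i _ => ?_
    rw [chainMultiplicity_single, if_neg fun h' => hxM (Or.inr (h.oppositeFace_subset i h'))]
  · filter_upwards [hs1 _ (orthonormal_tangentFrame b), hs2 b hbpos, ae_le_finrank_zeroDir A n,
      eventually_all.2 fun i => h.adapted_union.ae_dir_eq (T.oppositeFace i)]
      with x h1 h2 hxn hdir hxM hflat
    have hxn := le_antisymm (h.adapted_union.finrank_le x hxM) hxn
    have hspan : tangentSpan b = zeroDir A x := by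
      refine submodule_eq_of_eventually_iff (z := x) ?_
      filter_upwards [hflat, h.adapted_union.eventually_mem_iff hxM hxn] with y h1 h2
      rw [← h1, h2]
    have ha : HasLinkClass u x b (chainMultiplicity s x (tangentFrame b)) := by
      by_cases hxS : x ∈ Sig
      · exact h2 hxS (hspan ▸ h.adapted.eventually_mem_iff hxS hxn)
      · rw [h1 hxS]
        exact eventually_linkMap_class_zero (hDo.sdiff h.polyhedral.isCompact.isClosed) huc
          ⟨h.union_subset hxM, hxS⟩ b
    rw [chainMultiplicity_add]
    by_cases hxT : x ∈ T.carrier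
    · exact h.linkMap_insertMap hDo hDb huc hcΦ hcI hb hg hB hBpos hxT hxM hxn hspan hbpos
        (fun i hi => hdir i hi hxM) ha
    · rw [chainMultiplicity_finset_sum, sum_eq_zero fun i _ => ?_, add_zero]
      · exact h.linkMap_insertMap_of_notMem hDo huc hxM hxT hxn hspan ha
      · rw [chainMultiplicity_single, if_neg fun h' => hxT (h.oppositeFace_subset i h').1]

end Final

theorem mainTheorem7 (n k m : ℕ) [k.AtLeastTwo]
    (N : Set (EuclideanSpace ℝ (Fin m))) [IsAdmissibleTarget k N] (p : N)
    (D : Set (EuclideanSpace ℝ (Fin (n + k))))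
    (hD_open : IsOpen D) (hD_conn : IsConnected D) (hD_bdd : Bornology.IsBounded D)
    (Sig : Set (EuclideanSpace ℝ (Fin (n + k)))) (hSig : IsPolyhedralSet n Sig) (hSigD : Sig ⊆ D)
    (u : EuclideanSpace ℝ (Fin (n + k)) → N)
    (hu_sob : MemSobolev D ((k - 1 : ℕ) : ENNReal) u) (hu_nice : HasNiceSingularity D Sig u)
    (T : OrientedSimplex (n + 1) (n + k)) (hT : T.carrier ⊆ D) (g : CoeffGroup k N p) :
    (∃! S : PolyhedralChain (CoeffGroup k N p) n (n + k), IsTopologicalSingularSet u Sig S) ∧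
    ∃ (u' : EuclideanSpace ℝ (Fin (n + k)) → N) (Sig' : Set (EuclideanSpace ℝ (Fin (n + k)))),
      MemSobolev D ((k - 1 : ℕ) : ENNReal) u' ∧
      IsPolyhedralSet n Sig' ∧ Sig' ⊆ D ∧ HasNiceSingularity D Sig' u' ∧
      (∃ V : Set (EuclideanSpace ℝ (Fin (n + k))), IsOpen V ∧ frontier D ⊆ V ∧
        ∀ x ∈ V ∩ D, u' x = u x) ∧
      (∃! S : PolyhedralChain (CoeffGroup k N p) n (n + k), IsTopologicalSingularSet u' Sig' S) ∧
      topologicalSingularSet p u' Sig' = topologicalSingularSet p u Sig + simplexBoundary g T := by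
  have hex := hSig.existsUnique_isTopologicalSingularSet hSigD hD_open hu_nice.continuousOn p
  refine ⟨hex, ?_⟩
  obtain ⟨A, ε, η, L, c, Φ, h⟩ := exists_isInsertionSetting hD_open hSig hSigD hT
  obtain ⟨B, hB, hBpos⟩ := exists_positive_extFrame T.dir T.finrank_dir
  obtain ⟨γ, f, K, hb, hg⟩ := exists_isBubble (T := T) (u := u) A hB
    (((-1) ^ (n + 1) * T.sign (extFrame B)) • g)
  obtain ⟨hsob, hnice⟩ := h.memSobolev_and_hasNiceSingularity hD_open hD_bdd hb hu_nice
  obtain ⟨V, hV, hDV, hVu⟩ := h.exists_nhds_frontier (u := u) (γ := γ) (f := f)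
    (R := normalTail B) hD_open
  obtain ⟨S, hS, -⟩ := id hex
  have hS1 := h.isTopologicalSingularSet hD_open hD_bdd hu_nice hb hg hB hBpos hS
  refine ⟨insertMap A T ε Φ u γ f (normalTail B), Sig ∪ cutSet A T, hsob, h.polyhedral_union,
    h.union_subset, hnice, ⟨V, hV, hDV, fun x hx => hVu x hx.1⟩,
    h.polyhedral_union.existsUnique_isTopologicalSingularSet h.union_subset hD_open
      hnice.continuousOn p, ?_⟩
  rw [h.polyhedral_union.topologicalSingularSet_eq hS1, hSig.topologicalSingularSet_eq hS]
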